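/- **Conventions.** Let $k\ge 3$ and $n\ge 1$ be integers, $A=i\,e^{-\pi i/2k}$, so that $A^{-4}=e^{2\pi i/k}$, and $d=-A^2-A^{-2}=2\cos(\pi/k)>0$. A braid $B$ with $n$ strands and $m$ crossings is given by a word of length $m$ in the Artin generators $\sigma_1,\dots,\sigma_{n-1}$ and their inverses; $B^{tr}$ is the link diagram obtained by joining, for each position, the top end to the bottom end, all strands being oriented downwards. Its Jones polynomial at $e^{2\pi i/k}$ is $$V_{B^{tr}}(e^{2\pi i/k})=(-A)^{3w}\sum_{s}A^{s^+-s^-}d^{|s|-1},$$ where $w$ is the writhe, $\sigma_i$ and $\sigma_i^{-1}$ counting $+1$ and $-1$; $s$ runs over the $2^m$ ways to replace each crossing by a capcup or by two vertical strands; $|s|$ is the number of closed loops that arise; and $s^+$ is the number of crossings $\sigma_i$ replaced by a capcup plus the number of crossings $\sigma_i^{-1}$ replaced by vertical strands, $s^-=m-s^+$. A *quantum algorithm* is a classical random access program (integer arithmetic, with logarithmic cost) that may repeatedly prepare a list of elementary gates (Hadamard, controlled NOT, and one- or two-qubit (controlled) phase gates of angle $2\pi/2^j$, the latter charged $j+1$),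 have it applied to the all-zero state by a quantum computer, and receive the outcome of the measurement of one qubit. Its running time is the total cost of the classical operations and the gates. Its output is a complex number $(x+iy)/z$ with integers $x,y,z$. **Theorem.** Let $p,q$ be polynomials in three variables with coefficients in $\mathbb N$, and put $\epsilon=1/(1+p(n,m,k))$. (a) There are a quantum algorithm and a polynomial $T$ such that for all $n\ge1$, $k\ge3$ and all braids $B$ with $n$ strands and $m$ crossings, on the input $(n,k,m,B)$ the algorithm always stops within time $T(n,m,k)$ and, with probability at least $1-2^{-q(n,m,k)}$, outputs a complex number $r$ with $$|r-V_{B^{tr}}(e^{2\pi i/k})|<\epsilon\, d^{\,n-1}.$$ (b) There is a polynomial $M$ such that, for all such $n,k,B$, the following idealized procedure (with exact arithmetic and with $M=M(n,m,k)$) outputs a number $r$ with the same error bound with probability at least $1-2^{-q(n,m,k)}$. Let $\lambda_\ell=\sin(\pi\ell/k)$ for $1\le\ell\le k-1$ and $\lambda_\ell=0$ otherwise. A bit string of length $n$ describes a walk from the site $1$, a $1$ being a step $+1$ and a $0$ a step $-1$; it is a *path* if it stays in $\{1,\dots,k-1\}$. On the span of the paths let $\Phi_i$ act on the bits $i,i+1$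 by $|00\rangle,|11\rangle\mapsto0$, $|01\rangle\mapsto\frac{\lambda_{z-1}}{\lambda_z}|01\rangle+\frac{\sqrt{\lambda_{z+1}\lambda_{z-1}}}{\lambda_z}|10\rangle$, $|10\rangle\mapsto\frac{\lambda_{z+1}}{\lambda_z}|10\rangle+\frac{\sqrt{\lambda_{z+1}\lambda_{z-1}}}{\lambda_z}|01\rangle$, where $z$ is the site reached after the first $i-1$ bits. Let $Q(B)$ be the operator on $n$ qubits obtained from $B$ by replacing $\sigma_i^{\pm1}$ by $A^{\pm1}\Phi_i+A^{\mp1}I$ on the span of the paths and by the identity on the other basis vectors. The procedure makes $M$ independent rounds in each of which it picks a path $v$ with probability proportional to $\lambda_\ell$, where $\ell$ is the last site of $v$, and makes the Hadamard test for $\mathrm{Re}\langle v|Q(B)|v\rangle$, with outcome $x_j\in\{1,-1\}$; likewise $M$ rounds with the Hadamard test for $\mathrm{Im}\langle v|Q(B)|v\rangle$, with outcomes $y_j$; the output is $(-A)^{3w}d^{n-1}\frac1M\sum_{j=1}^{M}(x_j+iy_j)$. -/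

import Mathlib

open scoped BigOperators

noncomputable section

namespace JonesTrace

/-! ## Oriented link diagrams, Kauffman bracket, Jones polynomial -/

/-- An oriented link diagram, cut into pieces at finitely many marked points. Two marked points are
related by `arc` when a piece of strand without crossings joins them. Each crossing is drawn, after a
rotation of the plane, with both of its strands oriented downwards; its four ends are the marked
points `nw`, `ne` (incoming) and `sw`, `se` (outgoing), and `positive` is its sign. -/
structure LinkDiagram where
  Point : Type
  numCrossings : ℕ
  arc : Point → Point → Prop
  nw : Fin numCrossings → Point
  ne : Fin numCrossings → Point
  sw : Fin numCrossings → Point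
  se : Fin numCrossings → Point
  positive : Fin numCrossings → Bool

namespace LinkDiagram

variable (L : LinkDiagram)

/-- A state replaces every crossing either by a capcup (`true`: the two upper ends are joined
and the two lower ends are joined) or by two vertical strands (`false`). -/
abbrev State : Type := Fin L.numCrossings → Bool

/-- The pairs of marked points that are joined by a piece of strand in the diagram obtained
from the state `s`. -/
inductive Joined (s : L.State) : L.Point → L.Point → Prop
  | arc {a b : L.Point} (h : L.arc a b) : Joined s a b
  | cup (c : Fin L.numCrossings) (h : s c = true) : Joined s (L.nw c) (L.ne c)
  | cap (c : Fin L.numCrossings) (h : s c = true) : Joined s (L.sw c) (L.se c)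
  | left (c : Fin L.numCrossings) (h : s c = false) : Joined s (L.nw c) (L.sw c)
  | right (c : Fin L.numCrossings) (h : s c = false) : Joined s (L.ne c) (L.se c)

/-- The number of closed loops of the diagram obtained from the state `s`. (`Quot` divides by the
equivalence relation generated by `Joined`.) -/
def loops (s : L.State) : ℕ := Nat.card (Quot (L.Joined s))

/-- `σ⁺ - σ⁻`: a crossing counts `+1` if it is positive and replaced by a capcup, or negative and
replaced by two vertical strands, and `-1` otherwise. (A negative crossing is a positive one turned
by a right angle, which exchanges the two pictures.) -/
def stateExponent (s : L.State) : ℤ := ∑ c, if s c = L.positive c then 1 else -1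

/-- The writhe: the sum of the signs of the crossings. -/
def writhe : ℤ := ∑ c, if L.positive c then 1 else -1

end LinkDiagram

/-- The value `d = -A² - A⁻²` of a closed loop. -/
def loopValue (A : ℂ) : ℂ := -A ^ 2 - A⁻¹ ^ 2

/-- The Kauffman bracket, as a state sum. -/
def LinkDiagram.bracket (L : LinkDiagram) (A : ℂ) : ℂ :=
  ∑ s : L.State, A ^ L.stateExponent s * loopValue A ^ (L.loops s - 1)

/-- The Jones polynomial `V_L(A⁻⁴)`. -/
def LinkDiagram.jones (L : LinkDiagram) (A : ℂ) : ℂ :=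
  (-A) ^ (3 * L.writhe) * L.bracket A

/-! ## Braids and their trace closure -/

/-- A braid with `n` strands, given by its sequence of crossings from top to bottom. The crossing
`(i, true)` is the generator that crosses the strands at the (0-based) positions `i` and `i + 1`, and
`(i, false)` is its inverse. -/
abbrev Braid (n : ℕ) : Type := List (Fin (n - 1) × Bool)

/-- The left one of the two positions of a generator. -/
def posL {n : ℕ} (i : Fin (n - 1)) : Fin n := ⟨i, by omega⟩

/-- The right one of the two positions of a generator. -/
def posR {n : ℕ} (i : Fin (n - 1)) : Fin n := ⟨i + 1, by omega⟩

/-- The trace closure of a braid. The marked point `(p, j)` lies at position `p` between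
the crossings number `j - 1` and `j`. -/
def traceClosure {n : ℕ} (B : Braid n) : LinkDiagram where
  Point := Fin n × Fin (B.length + 1)
  numCrossings := B.length
  arc a b :=
    (∃ j : Fin B.length, a.2 = j.castSucc ∧ b.2 = j.succ ∧ a.1 = b.1 ∧
      a.1 ≠ posL (B.get j).1 ∧ a.1 ≠ posR (B.get j).1) ∨
    (a.2 = Fin.last B.length ∧ b.2 = 0 ∧ a.1 = b.1)
  nw j := (posL (B.get j).1, j.castSucc)
  ne j := (posR (B.get j).1, j.castSucc)
  sw j := (posL (B.get j).1, j.succ)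
  se j := (posR (B.get j).1, j.succ)
  positive j := (B.get j).2

/-- `A = i e^{-π i / 2k}`, a fourth root of `t⁻¹` for `t = e^{2π i / k}`. -/
def rootA (k : ℕ) : ℂ := Complex.I * Complex.exp (-(Real.pi * Complex.I) / (2 * k))

/-- The loop value at `rootA k`, as a real number. -/
def dval (k : ℕ) : ℝ := 2 * Real.cos (Real.pi / k)

theorem rootA_sq (k : ℕ) : rootA k ^ 2 = -Complex.exp (-(Real.pi / k * Complex.I)) := by
  rw [rootA, mul_pow, Complex.I_sq, ← Complex.exp_nat_mul, neg_one_mul]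
  congr 2
  rcases eq_or_ne (k : ℂ) 0 with h | h
  · simp [h]
  · push_cast; field_simp

theorem loopValue_rootA (k : ℕ) : loopValue (rootA k) = dval k := by
  rw [loopValue, inv_pow, rootA_sq, dval, inv_neg, ← Complex.exp_neg, neg_neg]
  push_cast
  rw [Complex.two_cos, neg_mul]
  ring_nf

theorem rootA_zpow_neg_four (k : ℕ) :
    rootA k ^ (-4 : ℤ) = Complex.exp (2 * Real.pi * Complex.I / k) := by
  have h : rootA k ^ (4 : ℕ) = Complex.exp (-(2 * Real.pi * Complex.I / k)) := by
    rw [show 4 = 2 * 2 from rfl, pow_mul, rootA_sq, neg_sq, ← Complex.exp_nat_mul]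
    congr 1
    push_cast
    ring
  rw [show (-4 : ℤ) = -((4 : ℕ) : ℤ) from rfl, zpow_neg, zpow_natCast, h, ← Complex.exp_neg,
    neg_neg]

/-- The value `V_{B^tr}(e^{2π i / k})`. -/
def jonesTrace {n : ℕ} (B : Braid n) (k : ℕ) : ℂ := (traceClosure B).jones (rootA k)

/-! ## Quantum circuits

The qubits are numbered by the natural numbers. A vector of the computational basis is the
finite set of those qubits that are in the state `1`, and a state assigns an amplitude to
each basis vector. -/

/-- The elementary gates, each on at most two qubits: the Hadamard gate on the qubit `i`; the
controlled NOT with control `c` and target `t` (nothing is done if `c = t`); the controlled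
phase gate, which multiplies by `e^{2π i / 2^j}` if the qubits `a` and `b` are both `1` (for `a = b`
this is the one-qubit phase gate). -/
inductive Gate
  | had (i : ℕ)
  | cnot (c t : ℕ)
  | cphase (j a b : ℕ)

abbrev QState : Type := Finset ℕ → ℂ

/-- The action of a gate on a state. -/
def Gate.apply : Gate → QState → QState
  | .had i, ψ => fun x =>
      (ψ (x.erase i) + (if i ∈ x then -1 else 1) * ψ (insert i x)) / (Real.sqrt 2 : ℂ)
  | .cnot c t, ψ => fun x => if c ≠ t ∧ c ∈ x then ψ (symmDiff x {t}) else ψ x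
  | .cphase j a b, ψ => fun x =>
      if a ∈ x ∧ b ∈ x then Complex.exp (2 * Real.pi * Complex.I / 2 ^ j) * ψ x else ψ x

/-- A number greater than all the qubits on which the gate acts. -/
def Gate.width : Gate → ℕ
  | .had i => i + 1
  | .cnot c t => max c t + 1
  | .cphase _ a b => max a b + 1

/-- The state in which all the qubits are `0`. -/
def zeroState : QState := fun x => if x = ∅ then 1 else 0

/-- The state after the gates of a circuit, listed in the order of their application, have acted
on the all-zero state. -/
def runCircuit (C : List Gate) : QState := C.foldl (fun ψ g => g.apply ψ) zeroState

/-- The size of a register that holds the qubit `0` and all the qubits of the circuit. -/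
def circuitWidth (C : List Gate) : ℕ := (C.map Gate.width).foldr max 1

/-- The probability that a measurement of the qubit `0` after the circuit yields `b`. -/
def outcomeProb (C : List Gate) (b : Bool) : ℝ :=
  ∑ x ∈ (Finset.range (circuitWidth C)).powerset with decide (0 ∈ x) = b, ‖runCircuit C x‖ ^ 2

theorem Gate.apply_norm (g : Gate) (ψ : QState) (N : ℕ) (h : g.width ≤ N) :
    ∑ x ∈ (Finset.range N).powerset, ‖g.apply ψ x‖ ^ 2 =
      ∑ x ∈ (Finset.range N).powerset, ‖ψ x‖ ^ 2 := by
  cases g with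
  | had i =>
    have hi : i ∈ Finset.range N := by
      simp only [Gate.width] at h; simp; omega
    rw [← Finset.insert_erase hi, Finset.sum_powerset_insert (Finset.notMem_erase _ _),
      Finset.sum_powerset_insert (Finset.notMem_erase _ _), ← Finset.sum_add_distrib,
      ← Finset.sum_add_distrib]
    refine Finset.sum_congr rfl fun t ht => ?_
    have hit : i ∉ t := fun h' => by
      have := Finset.mem_powerset.1 ht h'
      simp at this
    have h2 : ‖((Real.sqrt 2 : ℝ) : ℂ)‖ ^ 2 = 2 := by
      rw [Complex.norm_real, Real.norm_eq_abs, sq_abs, Real.sq_sqrt (by norm_num)]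
    have hp := parallelogram_law_with_norm ℂ (ψ t) (ψ (insert i t))
    simp only [Gate.apply, hit, if_false, Finset.erase_eq_of_notMem hit, Finset.mem_insert_self,
      if_true, Finset.erase_insert hit, Finset.insert_idem, one_mul, neg_one_mul, norm_div,
      div_pow, h2, ← sub_eq_add_neg]
    nlinarith [hp]
  | cnot c t =>
    by_cases hct : c = t
    · simp [Gate.apply, hct]
    simp only [Gate.width] at h
    let f : Finset ℕ → Finset ℕ := fun x => if c ∈ x then symmDiff x {t} else x
    have hf : ∀ x, f (f x) = x := by
      intro x
      by_cases hc : c ∈ x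
      · have : c ∈ symmDiff x {t} := by simp [Finset.mem_symmDiff, hc, hct]
        simp only [f, hc, if_true, this, symmDiff_assoc, symmDiff_self, symmDiff_bot]
      · simp [f, hc]
    have hr : ∀ x ∈ (Finset.range N).powerset, f x ∈ (Finset.range N).powerset := by
      intro x hx
      rw [Finset.mem_powerset] at hx ⊢
      by_cases hc : c ∈ x
      · intro y hy
        simp only [f, hc, if_true, Finset.mem_symmDiff, Finset.mem_singleton] at hy
        rcases hy with hy | hy
        · exact hx hy.1
        · rw [hy.1]; simp; omega
      · simpa [f, hc] using hx
    have key : ∀ x, Gate.apply (.cnot c t) ψ x = ψ (f x) := by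
      intro x
      by_cases hc : c ∈ x <;> simp [Gate.apply, f, hc, hct]
    simp only [key]
    exact Finset.sum_nbij' f f hr hr (fun x _ => hf x) (fun x _ => hf x) (fun x _ => rfl)
  | cphase j a b =>
    refine Finset.sum_congr rfl fun x _ => ?_
    simp only [Gate.apply]
    split_ifs
    · rw [norm_mul]
      have : (2 * Real.pi * Complex.I / 2 ^ j : ℂ) = ((2 * Real.pi / 2 ^ j : ℝ) : ℂ) * Complex.I := by
        push_cast; ring
      rw [this, Complex.norm_exp_ofReal_mul_I, one_mul]
    · rfl

theorem foldl_apply_norm (C : List Gate) (ψ : QState) (N : ℕ) (h : ∀ g ∈ C, g.width ≤ N) :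
    ∑ x ∈ (Finset.range N).powerset, ‖C.foldl (fun ψ g => g.apply ψ) ψ x‖ ^ 2 =
      ∑ x ∈ (Finset.range N).powerset, ‖ψ x‖ ^ 2 := by
  induction C generalizing ψ with
  | nil => rfl
  | cons g C ih =>
    rw [List.foldl_cons, ih _ fun g' hg' => h g' (List.mem_cons_of_mem _ hg')]
    exact g.apply_norm ψ N (h g List.mem_cons_self)

theorem width_le_circuitWidth (C : List Gate) : ∀ g ∈ C, g.width ≤ circuitWidth C := by
  induction C with
  | nil => simp
  | cons g C ih =>
    intro g' hg'
    simp only [circuitWidth, List.map_cons, List.foldr_cons]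
    rcases List.mem_cons.1 hg' with rfl | h
    · exact le_max_left _ _
    · exact le_trans (ih g' h) (le_max_right _ _)

theorem outcomeProb_sum (C : List Gate) : outcomeProb C true + outcomeProb C false = 1 := by
  have h := foldl_apply_norm C zeroState (circuitWidth C) (width_le_circuitWidth C)
  have h0 : ∑ x ∈ (Finset.range (circuitWidth C)).powerset, ‖zeroState x‖ ^ 2 = 1 := by
    rw [Finset.sum_eq_single ∅]
    · simp [zeroState]
    · intro x _ hx; simp [zeroState, hx]
    · simp
  rw [h0] at h
  rw [← h, ← Finset.sum_filter_add_sum_filter_not _ (fun x => 0 ∈ x)]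
  simp [outcomeProb, runCircuit]

/-- The distribution of the outcome of a measurement of the qubit `0` after the circuit. -/
def measureDist (C : List Gate) : PMF Bool :=
  PMF.ofFintype (fun b => ENNReal.ofReal (outcomeProb C b)) (by
    rw [Fintype.sum_bool, ← ENNReal.ofReal_add, outcomeProb_sum, ENNReal.ofReal_one] <;>
      exact Finset.sum_nonneg fun _ _ => by positivity)

/-! ## Classical programs with calls to a quantum computer

The classical part is a random access machine with integer cells and logarithmic cost. It can
prepare a list of gates and call a quantum computer, which starts from the all-zero state,
applies these gates and measures the qubit `0`. All loops are bounded; this only restricts the class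
of programs. -/

/-- Arithmetic expressions over the memory. -/
inductive Expr
  | lit (z : ℤ)
  | load (addr : Expr)
  | add (e f : Expr)
  | sub (e f : Expr)
  | mul (e f : Expr)
  | div (e f : Expr)
  | le (e f : Expr)

abbrev Memory : Type := ℕ → ℤ

def Expr.eval (μ : Memory) : Expr → ℤ
  | .lit z => z
  | .load a => μ (a.eval μ).toNat
  | .add e f => e.eval μ + f.eval μ
  | .sub e f => e.eval μ - f.eval μ
  | .mul e f => e.eval μ * f.eval μ
  | .div e f => e.eval μ / f.eval μ
  | .le e f => if e.eval μ ≤ f.eval μ then 1 else 0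

/-- The number of binary digits of an integer. -/
def bitLength (z : ℤ) : ℕ := z.natAbs.size

/-- The time to evaluate an expression: each node costs `1` plus the number of bits of its value. -/
def Expr.time (μ : Memory) : Expr → ℕ
  | .lit z => 1 + bitLength z
  | .load a => a.time μ + 1 + bitLength ((Expr.load a).eval μ)
  | .add e f => e.time μ + f.time μ + 1 + bitLength ((Expr.add e f).eval μ)
  | .sub e f => e.time μ + f.time μ + 1 + bitLength ((Expr.sub e f).eval μ)
  | .mul e f => e.time μ + f.time μ + 1 + bitLength ((Expr.mul e f).eval μ)
  | .div e f => e.time μ + f.time μ + 1 + bitLength ((Expr.div e f).eval μ)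
  | .le e f => e.time μ + f.time μ + 1 + bitLength ((Expr.le e f).eval μ)

/-- Programs. `store a e` writes `e` to the cell `a`; `had`, `cnot`, `cphase` append a gate to the
current circuit; `measure a` runs the current circuit on the quantum computer, writes the
outcome (`0` or `1`) to the cell `a` and discards the circuit; `ite e P Q` runs `P` if
the value of `e` is not zero, and `Q` otherwise; `loop e P` evaluates `e` and then runs `P` that many
times. -/
inductive Prog
  | store (addr val : Expr)
  | had (i : Expr)
  | cnot (c t : Expr)
  | cphase (j a b : Expr)
  | measure (addr : Expr)
  | seq (P Q : Prog)
  | ite (cond : Expr) (P Q : Prog)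
  | loop (count : Expr) (P : Prog)

/-- A configuration: the memory, the circuit prepared so far and the time used so far. -/
structure Config where
  mem : Memory
  circuit : List Gate
  time : ℕ

/-- Time passes. -/
def Config.tick (s : Config) (t : ℕ) : Config := { s with time := s.time + t }

/-- A gate is appended to the current circuit. -/
def Config.addGate (s : Config) (g : Gate) : Config := { s with circuit := s.circuit ++ [g] }

/-- The probability distribution of the configuration in which a run of the program from a given
configuration ends. The time counts the classical operations with their bit costs, and each
gate, a phase gate of angle `2π / 2^j` being charged `j + 1`. -/
def Prog.run : Prog → Config → PMF Config
  | .store a e, s =>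
      PMF.pure ({ s with mem := Function.update s.mem (a.eval s.mem).toNat (e.eval s.mem) }.tick
        (a.time s.mem + e.time s.mem + 1))
  | .had i, s =>
      PMF.pure ((s.addGate (.had (i.eval s.mem).toNat)).tick (i.time s.mem + 1))
  | .cnot c t, s =>
      PMF.pure ((s.addGate (.cnot (c.eval s.mem).toNat (t.eval s.mem).toNat)).tick
        (c.time s.mem + t.time s.mem + 1))
  | .cphase j a b, s =>
      PMF.pure ((s.addGate (.cphase (j.eval s.mem).toNat (a.eval s.mem).toNat
        (b.eval s.mem).toNat)).tick
          (j.time s.mem + a.time s.mem + b.time s.mem + (j.eval s.mem).toNat + 1))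
  | .measure a, s =>
      (measureDist s.circuit).map fun b =>
        ({ s with
            mem := Function.update s.mem (a.eval s.mem).toNat (if b then 1 else 0)
            circuit := [] }).tick (a.time s.mem + 1)
  | .seq P Q, s => (P.run s).bind Q.run
  | .ite e P Q, s =>
      if e.eval s.mem ≠ 0 then P.run (s.tick (e.time s.mem + 1))
      else Q.run (s.tick (e.time s.mem + 1))
  | .loop e P, s =>
      (fun ν : PMF Config => ν.bind P.run)^[(e.eval s.mem).toNat]
        (PMF.pure (s.tick (e.time s.mem + 1)))

/-- The input: the numbers `n`, `k` and `m`, followed by the `m` crossings, the generators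
being encoded by `1, …, n - 1` and their inverses by `-1, …, -(n - 1)`. All other cells are `0`. -/
def inputMemory {n : ℕ} (B : Braid n) (k : ℕ) : Memory
  | 0 => n
  | 1 => k
  | 2 => B.length
  | j + 3 =>
    match B[j]? with
    | some (i, true) => (i : ℤ) + 1
    | some (i, false) => -((i : ℤ) + 1)
    | none => 0

/-- The initial configuration. -/
def initial {n : ℕ} (B : Braid n) (k : ℕ) : Config := ⟨inputMemory B k, [], 0⟩

/-- The output: the complex number `(x + i y) / z`, where `x`, `y`, `z` are the contents of the
first three cells. -/
def Config.output (s : Config) : ℂ :=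
  ((s.mem 0 : ℂ) + (s.mem 1 : ℂ) * Complex.I) / (s.mem 2 : ℂ)

/-! ## The path model on qubits -/

/-- `λ_ℓ = sin(π ℓ / k)` for `ℓ = 1, …, k - 1`, and `0` otherwise. -/
def lam (k : ℕ) (l : ℤ) : ℝ := if 1 ≤ l ∧ l < k then Real.sin (Real.pi * l / k) else 0

/-- The site reached after the first `i` steps of a bit string, from the site `1`; `true` is a step
to the right, `false` a step to the left. -/
def site {n : ℕ} (p : Fin n → Bool) (i : ℕ) : ℤ :=
  1 + ∑ j ∈ Finset.univ.filter (fun j : Fin n => (j : ℕ) < i), if p j then 1 else -1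

/-- The bit string describes a path inside the line graph with the sites `1, …, k - 1`. -/
def IsPath {n : ℕ} (k : ℕ) (p : Fin n → Bool) : Prop := ∀ i ≤ n, 1 ≤ site p i ∧ site p i < k

/-- The entry `⟨q| Φ_i |p⟩` of the image of a generator of the Temperley-Lieb algebra. It acts on the
steps `i`, `i + 1` only and kills the paths on which these are equal. -/
def pathEntry {n : ℕ} (k : ℕ) (i : Fin (n - 1)) (q p : Fin n → Bool) : ℝ :=
  let z := site p i
  open Classical in
  if (∀ j, j ≠ posL i → j ≠ posR i → q j = p j) ∧
      p (posL i) ≠ p (posR i) ∧ q (posL i) ≠ q (posR i) then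
    if q (posL i) = p (posL i) then
      (if p (posL i) then lam k (z + 1) else lam k (z - 1)) / lam k z
    else Real.sqrt (lam k (z + 1) * lam k (z - 1)) / lam k z
  else 0

/-- The operator of one crossing on `n` qubits: `A Φ_i + A⁻¹` for a generator and `A⁻¹ Φ_i + A`
for its inverse on the span of the paths, the identity on the other basis vectors. -/
def crossingMatrix {n : ℕ} (k : ℕ) (c : Fin (n - 1) × Bool) :
    Matrix (Fin n → Bool) (Fin n → Bool) ℂ := fun q p =>
  let a := if c.2 then rootA k else (rootA k)⁻¹
  open Classical in
  if IsPath k p ∧ IsPath k q then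
    a * (pathEntry k c.1 q p : ℂ) + a⁻¹ * (1 : Matrix (Fin n → Bool) (Fin n → Bool) ℂ) q p
  else (1 : Matrix (Fin n → Bool) (Fin n → Bool) ℂ) q p

/-- The path-model unitary `Q(B)` of a braid on `n` qubits. -/
def braidMatrix {n : ℕ} (k : ℕ) (B : Braid n) : Matrix (Fin n → Bool) (Fin n → Bool) ℂ :=
  (B.map (crossingMatrix k)).prod

/-! ## The path sampling algorithm with exact arithmetic -/

/-- `λ_ℓ` for a path that ends at the site `ℓ`, and `0` for a bit string that is not a path. -/
def pathWeight {n : ℕ} (k : ℕ) (p : Fin n → Bool) : ℝ :=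
  open Classical in if IsPath k p then lam k (site p n) else 0

/-- The outcome of a Hadamard test as a number: `1` or `-1`. -/
def sign (b : Bool) : ℂ := if b then 1 else -1

/-- The probability of the outcome `sign b` in the Hadamard test of `Q(B)` on the path `p` that
starts from `(|0⟩ + u |1⟩)|p⟩ / √2`, namely the squared norm of `(|p⟩ + sign b · u · Q(B)|p⟩) / 2`. -/
def hadamardProb {n : ℕ} (k : ℕ) (B : Braid n) (u : ℂ) (p : Fin n → Bool) (b : Bool) : ℝ :=
  ∑ q : Fin n → Bool, ‖((1 : Matrix (Fin n → Bool) (Fin n → Bool) ℂ) q p +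
    sign b * u * braidMatrix k B q p) / 2‖ ^ 2

/-- The probability that one round picks the path `x.1`, with probability proportional to
`pathWeight`, and then obtains the outcome `sign x.2` in the Hadamard test. -/
def roundProb {n : ℕ} (k : ℕ) (B : Braid n) (u : ℂ) (x : (Fin n → Bool) × Bool) : ℝ :=
  pathWeight k x.1 / (∑ p : Fin n → Bool, pathWeight k p) * hadamardProb k B u x.1 x.2

/-- The output `(-A)^{3w} d^{n-1} r`, where `r` is the average of the outcomes of `M` rounds for
the real part and of `M` rounds for the imaginary part. -/
def samplingOutput {n M : ℕ} (k : ℕ) (B : Braid n) (xs ys : Fin M → (Fin n → Bool) × Bool) : ℂ :=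
  (-rootA k) ^ (3 * (traceClosure B).writhe) * (dval k : ℂ) ^ (n - 1) *
    ((∑ j, (sign (xs j).2 + Complex.I * sign (ys j).2)) / (M : ℂ))

/-- The probability that `M` independent rounds for the real part (`u = 1`) and `M` for the
imaginary part (`u = -i`) lead to an output that is not at distance less than `δ` from `v`. -/
def samplingFailure {n : ℕ} (k : ℕ) (B : Braid n) (M : ℕ) (v : ℂ) (δ : ℝ) : ℝ :=
  open Classical in
  ∑ s : (Fin M → (Fin n → Bool) × Bool) × (Fin M → (Fin n → Bool) × Bool)
      with ¬ ‖samplingOutput k B s.1 s.2 - v‖ < δ,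
    (∏ j, roundProb k B 1 (s.1 j)) * ∏ j, roundProb k B (-Complex.I) (s.2 j)

/-- The value of a polynomial in the number of strands, the number of crossings and `k`. -/
def polyVal (p : MvPolynomial (Fin 3) ℕ) {n : ℕ} (B : Braid n) (k : ℕ) : ℕ :=
  MvPolynomial.eval ![n, B.length, k] p

end JonesTrace

end

open scoped BigOperators

noncomputable section

namespace JonesTrace

/-! ## Temperley-Lieb matrices on walks -/

/-! The product of the operators $A^{\pm1}\Phi_i+A^{\mp1}$ over the crossings expands into a sum
over the states $s$: a power of $A$ times a word in the $\Phi_i$. Weight the diagonal entries of a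
word by $\lambda$ at the end of the path. This weighted trace is $\lambda_1 d^{|s|}$, and the total
weight of the paths is $\lambda_1 d^n$. Hence the Jones value is $(-A)^{3w}d^{n-1}$ times the mean
of $\langle v|Q(B)|v\rangle$ over paths drawn with probability proportional to $\lambda$
(`jonesTrace_eq`).

The loops are counted without planar topology. The $\Phi_i$, and the capcup matrices on labellings
of the strands by two labels, are both instances of a `StepModel`. In every such model $E_i^2=dE_i$,
$E_{i+1}E_iE_{i+1}=E_{i+1}$, and distant generators commute. By these relations alone
`word_reduction` rewrites a word so that its highest generator occurs at most once. Then
`wtr_word_succ` and `wtr_markov` remove the last strand. The recursion is the same in all models, so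
two models give $\lambda_{\rm start}d^l$ with a common $l$ (`exists_wtr_eq_pow`). In the labelling
model $d=2$ and the trace counts the labellings that are constant on the loops (`labelModel_wtr`),
so $l=|s|$.

Sampling with exact arithmetic: $d=-A^2-A^{-2}$ makes the crossing operators unitary
(`crossOp_unitary`), so a Hadamard test has the expected mean (`hadamardProb_eq`), and an elementary
Hoeffding bound controls the averages (`samplingFailure_le`).

The circuit: a path is stored with one qubit for every pair of a time and a height; the qubit 0
controls the test. In the plane of two paths that differ only in the site between the steps $i$ and
$i+1$, $\Phi_i/d$ is the projection to a vector $(\sin\varphi,\cos\varphi)$. A crossing with its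
writhe factor is therefore a phase times $1+(e^{i\psi}-1)P$, which is built from Hadamard,
controlled NOT and repeated small phase gates (`act_midGates`, `act_crossGates_pset`). The same
angle gives the step probability $\sin^2\varphi=\lambda_{z+1}/(d\lambda_z)$, and a path drawn step
by step in this way has the required law (`pathProb_snoc`). The circuit operators are exactly
unitary for every choice of the gate counts, so the errors only add up: $11\delta$ for a crossing
and $2\delta$ for a step (`abs_roundMean_sub_le`).

The angles are found by integer arithmetic. The powers of $N^2-1+2Ni$ advance by the angle
$\eta=2\arctan(1/N)$, and counting the powers that pass a sign test locates an angle up to about one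
$\eta$. The cosines of the site angles are then accurate to $O(k^3/N)$, the projections to the
square root of this, so a polynomial $N$ suffices (`calib_accurate`).

The program is analysed by the relation `RExec`, which gives the law of the final variables and a
time bound polynomial in a single size parameter $\beta$. Finally `failure_le` combines the errors
with tail bounds from exponential moments, and `exists_quantum_algorithm` fixes the polynomials. -/

/-- Walks on the integers with steps from a finite set closed under reversal, together with a
non-negative function that is an eigenfunction of the step operator on its support. -/
structure StepModel (S : Type) [Fintype S] where
  σ : S → ℤ
  bar : S → S
  lam : ℤ → ℝ
  d : ℝ
  start : ℤ
  bar_bar : ∀ s, bar (bar s) = s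
  σ_bar : ∀ s, σ (bar s) = -σ s
  lam_nonneg : ∀ z, 0 ≤ lam z
  harmonic : ∀ z, lam z ≠ 0 → ∑ s, lam (z + σ s) = d * lam z
  start_ne : lam start ≠ 0

namespace StepModel

variable {S : Type} [Fintype S] (M : StepModel S) {n : ℕ}

/-- The site reached after the first `i` steps. -/
def site (p : Fin n → S) (i : ℕ) : ℤ :=
  M.start + ∑ j ∈ Finset.univ.filter (fun j : Fin n => (j : ℕ) < i), M.σ (p j)

theorem site_zero (p : Fin n → S) : M.site p 0 = M.start := by
  simp [site]

theorem site_succ (p : Fin n → S) {i : ℕ} (h : i < n) :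
    M.site p (i + 1) = M.site p i + M.σ (p ⟨i, h⟩) := by
  have : Finset.univ.filter (fun j : Fin n => (j : ℕ) < i + 1) =
      insert ⟨i, h⟩ (Finset.univ.filter (fun j : Fin n => (j : ℕ) < i)) := by
    ext j
    simp only [Finset.mem_filter, Finset.mem_univ, true_and, Finset.mem_insert, Fin.ext_iff]
    omega
  rw [site, site, this, Finset.sum_insert (by simp)]
  ring

theorem site_congr {p q : Fin n → S} {i : ℕ} (h : ∀ j : Fin n, (j : ℕ) < i → p j = q j) :
    M.site p i = M.site q i := by
  rw [site, site]
  congr 1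
  refine Finset.sum_congr rfl fun j hj => ?_
  rw [h j (by simpa using hj)]

/-- The walk stays in the support of `lam`. -/
def Good (p : Fin n → S) : Prop := ∀ i ≤ n, M.lam (M.site p i) ≠ 0

/-- The steps `i` and `i + 1` are replaced by a step and its reversal. -/
def pair (i : ℕ) (h : i + 1 < n) (s : S) (q : Fin n → S) : Fin n → S :=
  Function.update (Function.update q ⟨i, by omega⟩ s) ⟨i + 1, h⟩ (M.bar s)

/-- The local weight of a cup and a cap between walks at the site `z`. -/
def wt (z : ℤ) (s t : S) : ℝ :=
  Real.sqrt (M.lam (z + M.σ s) * M.lam (z + M.σ t)) / M.lam z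

open Classical in
/-- The matrix of the Temperley-Lieb generator that acts on the steps `i` and `i + 1`. -/
def tl (n i : ℕ) : Matrix (Fin n → S) (Fin n → S) ℝ :=
  if h : i + 1 < n then Matrix.of fun q p => ∑ s,
    if (M.Good q ∧ q ⟨i + 1, h⟩ = M.bar (q ⟨i, by omega⟩)) ∧ p = M.pair i h s q then
      M.wt (M.site q i) (q ⟨i, by omega⟩) s else 0
  -- A default without effect: the relations and the traces below are only used for `i + 1 < n`.
  else 1

variable {i : ℕ} (h : i + 1 < n)

theorem pair_left (s : S) (q : Fin n → S) : M.pair i h s q ⟨i, by omega⟩ = s := by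
  rw [pair, Function.update_of_ne (by simp [Fin.ext_iff]), Function.update_self]

theorem pair_right (s : S) (q : Fin n → S) : M.pair i h s q ⟨i + 1, h⟩ = M.bar s := by
  rw [pair, Function.update_self]

theorem pair_of_ne (s : S) (q : Fin n → S) {j : Fin n} (h1 : (j : ℕ) ≠ i) (h2 : (j : ℕ) ≠ i + 1) :
    M.pair i h s q j = q j := by
  rw [pair, Function.update_of_ne (by simpa [Fin.ext_iff] using h2),
    Function.update_of_ne (by simpa [Fin.ext_iff] using h1)]

theorem pair_pair (s t : S) (q : Fin n → S) : M.pair i h t (M.pair i h s q) = M.pair i h t q := by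
  funext j
  by_cases h1 : (j : ℕ) = i
  · have h1 : j = ⟨i, by omega⟩ := Fin.ext h1
    rw [h1, pair_left, pair_left]
  by_cases h2 : (j : ℕ) = i + 1
  · have h2 : j = ⟨i + 1, h⟩ := Fin.ext h2
    rw [h2, pair_right, pair_right]
  simp only [pair_of_ne _ _ _ _ h1 h2]

theorem pair_self {q : Fin n → S} (hq : q ⟨i + 1, h⟩ = M.bar (q ⟨i, by omega⟩)) :
    M.pair i h (q ⟨i, by omega⟩) q = q := by
  rw [pair, Function.update_eq_self, ← hq, Function.update_eq_self]

theorem site_pair_le (s : S) (q : Fin n → S) {j : ℕ} (hj : j ≤ i) :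
    M.site (M.pair i h s q) j = M.site q j :=
  M.site_congr fun l hl => M.pair_of_ne h s q (by omega) (by omega)

theorem site_pair_mid (s : S) (q : Fin n → S) :
    M.site (M.pair i h s q) (i + 1) = M.site q i + M.σ s := by
  rw [M.site_succ _ (by omega : i < n), M.site_pair_le h s q le_rfl, pair_left]

theorem site_add_two {q : Fin n → S} (hq : q ⟨i + 1, h⟩ = M.bar (q ⟨i, by omega⟩)) :
    M.site q (i + 2) = M.site q i := by
  rw [M.site_succ _ h, M.site_succ _ (by omega : i < n), hq, M.σ_bar]
  ring

theorem site_pair_ge (s : S) {q : Fin n → S} (hq : q ⟨i + 1, h⟩ = M.bar (q ⟨i, by omega⟩))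
    {j : ℕ} (hj : i + 2 ≤ j) : M.site (M.pair i h s q) j = M.site q j := by
  induction j, hj using Nat.le_induction with
  | base =>
    rw [M.site_add_two h hq, M.site_add_two h (by rw [pair_left, pair_right]),
      M.site_pair_le h s q le_rfl]
  | succ j hj ih =>
    by_cases hn : j < n
    · rw [M.site_succ _ hn, M.site_succ _ hn, ih,
        M.pair_of_ne h s q (by simp; omega) (by simp; omega)]
    -- Beyond `n` the filter is all of `Fin n`, and the site no longer moves.
    · have key : ∀ p : Fin n → S, M.site p (j + 1) = M.site p j := by
        intro p
        rw [site, site]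
        congr 2
        ext l
        simp
        omega
      rw [key, key, ih]

theorem site_pair (s : S) {q : Fin n → S} (hq : q ⟨i + 1, h⟩ = M.bar (q ⟨i, by omega⟩))
    {j : ℕ} (hj : j ≠ i + 1) : M.site (M.pair i h s q) j = M.site q j := by
  rcases Nat.lt_or_ge i j with h' | h'
  · exact M.site_pair_ge h s hq (by omega)
  · exact M.site_pair_le h s q h'

theorem good_pair {s : S} {q : Fin n → S} (hg : M.Good q)
    (hq : q ⟨i + 1, h⟩ = M.bar (q ⟨i, by omega⟩)) (hs : M.lam (M.site q i + M.σ s) ≠ 0) :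
    M.Good (M.pair i h s q) := by
  intro j hj
  by_cases hj' : j = i + 1
  · rw [hj', site_pair_mid]; exact hs
  · rw [M.site_pair h s hq hj']; exact hg j hj

theorem wt_eq (z : ℤ) (s t : S) : M.wt z s t =
    Real.sqrt (M.lam (z + M.σ s)) * Real.sqrt (M.lam (z + M.σ t)) / M.lam z := by
  rw [wt, Real.sqrt_mul (M.lam_nonneg _)]

theorem wt_comm (z : ℤ) (s t : S) : M.wt z s t = M.wt z t s := by
  rw [wt, wt, mul_comm]

theorem wt_eq_zero {z : ℤ} {s : S} (h : M.lam (z + M.σ s) = 0) (t : S) : M.wt z t s = 0 := by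
  simp [wt, h]

open Classical in
theorem tl_apply (q p : Fin n → S) : M.tl n i q p = ∑ s,
    if (M.Good q ∧ q ⟨i + 1, h⟩ = M.bar (q ⟨i, by omega⟩)) ∧ p = M.pair i h s q then
      M.wt (M.site q i) (q ⟨i, by omega⟩) s else 0 := by
  rw [tl, dif_pos h, Matrix.of_apply]

open Classical in
theorem tl_mul_apply (X : Matrix (Fin n → S) (Fin n → S) ℝ) (q r : Fin n → S) :
    (M.tl n i * X) q r = if M.Good q ∧ q ⟨i + 1, h⟩ = M.bar (q ⟨i, by omega⟩) then
      ∑ s, M.wt (M.site q i) (q ⟨i, by omega⟩) s * X (M.pair i h s q) r else 0 := by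
  rw [Matrix.mul_apply]
  simp only [M.tl_apply h, Finset.sum_mul, ite_mul, zero_mul]
  rw [Finset.sum_comm]
  split_ifs with hc
  · simp [hc]
  · simp [hc]

/-- A new pair changes only the middle site, and the weight contains the factor $\sqrt\lambda$
there. It vanishes whenever the changed walk leaves the support, so the inner test for `Good` can be
dropped. This is what lets products of generators be expanded without tracking the support. -/
theorem wt_mul_ite_good {s : S} {q : Fin n → S} (hg : M.Good q)
    (hq : q ⟨i + 1, h⟩ = M.bar (q ⟨i, by omega⟩)) (a : S) (c : Prop) [Decidable c]
    [Decidable (M.Good (M.pair i h s q) ∧ c)] (x : ℝ) :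
    M.wt (M.site q i) a s * (if M.Good (M.pair i h s q) ∧ c then x else 0) =
      M.wt (M.site q i) a s * (if c then x else 0) := by
  by_cases hs : M.lam (M.site q i + M.σ s) = 0
  · rw [M.wt_eq_zero hs, zero_mul, zero_mul]
  · simp [M.good_pair h hg hq hs]

theorem Good.lam_ne {q : Fin n → S} {M : StepModel S} (hg : M.Good q) {j : ℕ} (hj : j ≤ n) :
    M.lam (M.site q j) ≠ 0 := hg j hj

/-- The intermediate step $s$ enters both weights through $\sqrt{\lambda(z+\sigma_s)}$. Their
product is $\lambda(z+\sigma_s)$, and the sum over $s$ is the eigenfunction equation. The right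
factor $X$ is carried along so that `tl_mul_apply` can expand every product from the left. -/
theorem tl_mul_tl_mul (h : i + 1 < n) (X : Matrix (Fin n → S) (Fin n → S) ℝ) :
    M.tl n i * (M.tl n i * X) = M.d • (M.tl n i * X) := by
  classical
  ext q r
  rw [Matrix.smul_apply, M.tl_mul_apply h, M.tl_mul_apply h]
  split_ifs with hc
  · obtain ⟨hg, hq⟩ := hc
    simp only [M.tl_mul_apply h, pair_right, pair_left, M.wt_mul_ite_good h hg hq, if_true,
      M.site_pair_le h _ _ le_rfl, pair_pair]
    simp only [smul_eq_mul, Finset.mul_sum]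
    rw [Finset.sum_comm]
    refine Finset.sum_congr rfl fun t _ => ?_
    have hz := hg.lam_ne (by omega : i ≤ n)
    set z := M.site q i
    have : ∀ s, M.wt z (q ⟨i, by omega⟩) s * (M.wt z s t * X (M.pair i h t q) r) =
        M.lam (z + M.σ s) * (M.wt z (q ⟨i, by omega⟩) t / M.lam z * X (M.pair i h t q) r) := by
      intro s
      have h2 := Real.mul_self_sqrt (M.lam_nonneg (z + M.σ s))
      rw [wt_eq, wt_eq, wt_eq]
      generalize Real.sqrt (M.lam (z + M.σ s)) = x at h2
      rw [← h2]
      ring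
    rw [Finset.sum_congr rfl fun s _ => this s, ← Finset.sum_mul, M.harmonic z hz]
    field_simp
  · simp

theorem tl_mul_self (h : i + 1 < n) : M.tl n i * M.tl n i = M.d • M.tl n i := by
  classical
  simpa using M.tl_mul_tl_mul h 1

/-- A step and its reversal cancel, so changing the pair at `i` alters neither the site before `j`
nor the steps there. Both products become the same double sum. -/
theorem tl_comm {j : ℕ} (hij : i + 2 ≤ j) (hj : j + 1 < n) :
    M.tl n i * M.tl n j = M.tl n j * M.tl n i := by
  classical
  have key : ∀ X : Matrix (Fin n → S) (Fin n → S) ℝ,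
      M.tl n i * (M.tl n j * X) = M.tl n j * (M.tl n i * X) := by
    intro X
    have hi : i + 1 < n := by omega
    ext q r
    rw [M.tl_mul_apply hi, M.tl_mul_apply hj]
    by_cases hg : M.Good q
    swap
    · simp [hg]
    by_cases h1 : q ⟨i + 1, hi⟩ = M.bar (q ⟨i, by omega⟩) <;>
    by_cases h2 : q ⟨j + 1, hj⟩ = M.bar (q ⟨j, by omega⟩)
    · simp only [hg, h1, h2, and_self, if_true]
      simp only [M.tl_mul_apply hj, M.tl_mul_apply hi, M.wt_mul_ite_good hi hg h1,
        M.wt_mul_ite_good hj hg h2]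
      have e1 : ∀ s, M.pair i hi s q ⟨j + 1, hj⟩ = q ⟨j + 1, hj⟩ :=
        fun s => M.pair_of_ne hi s q (by simp; omega) (by simp; omega)
      have e2 : ∀ s, M.pair i hi s q ⟨j, by omega⟩ = q ⟨j, by omega⟩ :=
        fun s => M.pair_of_ne hi s q (by simp; omega) (by simp; omega)
      have e3 : ∀ s, M.pair j hj s q ⟨i + 1, hi⟩ = q ⟨i + 1, hi⟩ :=
        fun s => M.pair_of_ne hj s q (by simp; omega) (by simp; omega)
      have e4 : ∀ s, M.pair j hj s q ⟨i, by omega⟩ = q ⟨i, by omega⟩ :=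
        fun s => M.pair_of_ne hj s q (by simp; omega) (by simp; omega)
      have e5 : ∀ s, M.site (M.pair i hi s q) j = M.site q j :=
        fun s => M.site_pair hi s h1 (by omega)
      have e6 : ∀ s, M.site (M.pair j hj s q) i = M.site q i :=
        fun s => M.site_pair hj s h2 (by omega)
      have e7 : ∀ s t, M.pair j hj t (M.pair i hi s q) = M.pair i hi s (M.pair j hj t q) := by
        intro s t
        simp only [pair]
        rw [Function.update_comm (a := (⟨i + 1, hi⟩ : Fin n)) (b := ⟨j, by omega⟩)
            (by simp [Fin.ext_iff]; omega),
          Function.update_comm (a := (⟨i + 1, hi⟩ : Fin n)) (b := ⟨j + 1, hj⟩)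
            (by simp [Fin.ext_iff]; omega),
          Function.update_comm (a := (⟨i, by omega⟩ : Fin n)) (b := ⟨j, by omega⟩)
            (by simp [Fin.ext_iff]; omega),
          Function.update_comm (a := (⟨i, by omega⟩ : Fin n)) (b := ⟨j + 1, hj⟩)
            (by simp [Fin.ext_iff]; omega)]
      simp only [e1, e2, e3, e4, e5, e6, e7, h1, h2, if_true, Finset.mul_sum]
      rw [Finset.sum_comm]
      refine Finset.sum_congr rfl fun t _ => Finset.sum_congr rfl fun s _ => ?_
      ring
    · simp only [hg, h1, h2, and_self, if_true, and_false, if_false]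
      refine Finset.sum_eq_zero fun s _ => ?_
      rw [M.tl_mul_apply hj, M.pair_of_ne hi s q (by simp; omega) (by simp; omega),
        M.pair_of_ne hi s q (by simp; omega) (by simp; omega)]
      simp [h2]
    · simp only [hg, h1, h2, and_self, if_true, and_false, if_false]
      symm
      refine Finset.sum_eq_zero fun s _ => ?_
      rw [M.tl_mul_apply hi, M.pair_of_ne hj s q (by simp; omega) (by simp; omega),
        M.pair_of_ne hj s q (by simp; omega) (by simp; omega)]
      simp [h1]
    · simp [h1, h2]
  simpa using key 1

/-- The middle weight is $\lambda(z)/\lambda(z+\sigma_s)$, which cancels the two factors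
$\sqrt{\lambda(z+\sigma_s)}$ and one denominator $\lambda(z)$ of the outer weights. -/
theorem wt_collapse {z : ℤ} (s a u : S) (hz : M.lam z ≠ 0) (hs : M.lam (z + M.σ s) ≠ 0) :
    M.wt z a s * (M.wt (z + M.σ s) (M.bar s) (M.bar s) * M.wt z s u) = M.wt z a u := by
  have e : z + M.σ s + M.σ (M.bar s) = z := by rw [M.σ_bar]; ring
  have h1 : M.wt (z + M.σ s) (M.bar s) (M.bar s) = M.lam z / M.lam (z + M.σ s) := by
    rw [wt_eq, e, Real.mul_self_sqrt (M.lam_nonneg _)]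
  rw [h1, wt_eq, wt_eq, wt_eq]
  have h2 := Real.mul_self_sqrt (M.lam_nonneg (z + M.σ s))
  have h3 : Real.sqrt (M.lam (z + M.σ s)) ≠ 0 := by
    rw [Real.sqrt_ne_zero (M.lam_nonneg _)]; exact hs
  rw [← h2]
  field_simp
  rw [Real.sqrt_sq (Real.sqrt_nonneg _)]

/-- A single intermediate walk survives. The middle generator demands that the inserted step be the
reversal of the preceding step `a`, and the generator to its right demands that `a` be restored.
Then `wt_collapse` evaluates the weights. The mirror relation is not needed by `word_reduction`. -/
theorem tl_braid_down (h2 : i + 2 < n) :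
    M.tl n (i + 1) * (M.tl n i * M.tl n (i + 1)) =
      M.tl n (i + 1) := by
  classical
  have key : ∀ X : Matrix (Fin n → S) (Fin n → S) ℝ,
      M.tl n (i + 1) * (M.tl n i * (M.tl n (i + 1) * X)) = M.tl n (i + 1) * X := by
    intro X
    have h : i + 1 < n := by omega
    ext q r
    rw [M.tl_mul_apply h2, M.tl_mul_apply h2]
    split_ifs with hc
    swap
    · rfl
    obtain ⟨hg, hq⟩ := hc
    set a := q ⟨i, by omega⟩ with hadef
    have hz := hg.lam_ne (by omega : i ≤ n)
    have hz' := hg.lam_ne (by omega : i + 1 ≤ n)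
    have hsite : M.site q (i + 1) = M.site q i + M.σ a := M.site_succ q _
    have hmid : ∀ s, (M.tl n i * (M.tl n (i + 1) * X)) (M.pair (i + 1) h2 s q) r =
        if M.Good (M.pair (i + 1) h2 s q) ∧ s = M.bar a then
          M.wt (M.site q i) a a * ∑ u, M.wt (M.site q (i + 1)) s u *
            X (M.pair (i + 1) h2 u q) r else 0 := by
      intro s
      have e0 : M.pair (i + 1) h2 s q ⟨i, by omega⟩ = a :=
        M.pair_of_ne h2 s q (by simp; try omega) (by simp; try omega)
      rw [M.tl_mul_apply h, pair_left, e0]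
      simp only [M.site_pair_le h2 _ _ (Nat.le_succ i)]
      split_ifs with hc'
      swap
      · rfl
      obtain ⟨hg', hcs⟩ := hc'
      have hcond : ∀ t, t ≠ a →
          (M.tl n (i + 1) * X) (M.pair i h t (M.pair (i + 1) h2 s q)) r = 0 := by
        intro t ht
        rw [M.tl_mul_apply h2, if_neg]
        rintro ⟨-, h'⟩
        rw [M.pair_right h, M.pair_of_ne h _ _ (by simp; try omega) (by simp; try omega), pair_right, M.bar_bar, hcs,
          ← M.bar_bar t, ← M.bar_bar a] at h'
        apply ht
        rw [← M.bar_bar t, ← M.bar_bar a, ← h', M.bar_bar, M.bar_bar]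
      rw [Finset.sum_eq_single a (fun t _ ht => by rw [hcond t ht, mul_zero]) (by simp)]
      have e : M.pair i h a (M.pair (i + 1) h2 s q) = M.pair (i + 1) h2 s q := by
        have := M.pair_self h (q := M.pair (i + 1) h2 s q) (by rw [pair_left, e0]; exact hcs)
        rwa [e0] at this
      rw [e, M.tl_mul_apply h2, if_pos ⟨hg', by rw [pair_left, pair_right]⟩, pair_left,
        M.site_pair_le h2 _ _ le_rfl]
      simp only [pair_pair]
    simp only [hmid, M.wt_mul_ite_good h2 hg hq]
    simp only [mul_ite, mul_zero, Finset.sum_ite_eq', Finset.mem_univ, if_true]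
    simp only [Finset.mul_sum]
    refine Finset.sum_congr rfl fun u _ => ?_
    have e : M.site q (i + 1) + M.σ (M.bar a) = M.site q i := by rw [hsite, M.σ_bar]; ring
    have hw := M.wt_collapse (M.bar a) (q ⟨i + 1, by omega⟩) u hz' (by rw [e]; exact hz)
    rw [e, M.bar_bar] at hw
    rw [← mul_assoc, ← mul_assoc, mul_assoc (M.wt _ _ _), hw]
  simpa using key 1

end StepModel

/-! ## Reduction of Temperley-Lieb words -/

/-- Jones's normal form argument. Letters are appended on the right. When a second highest letter
arrives, the part between the two is reduced by the induction on `m`: either it lacks the next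
letter and the two copies meet as a square, or it contains it once and the relation `down` absorbs
it. The monoid is arbitrary so that the lemma can be applied to pairs of matrices from two models at
once. -/
theorem word_reduction {G : Type*} [Monoid G] (E : ℕ → G) (δ : G) (N : ℕ)
    (hδ : ∀ i, Commute δ (E i)) (sq : ∀ i < N, E i * E i = δ * E i)
    (down : ∀ i, i + 1 < N → E (i + 1) * (E i * E (i + 1)) = E (i + 1))
    (comm : ∀ i j, i + 2 ≤ j → j < N → E i * E j = E j * E i) (m : ℕ) (hm : m < N) (w : List ℕ)
    (hw : ∀ i ∈ w, i ≤ m) :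
    ∃ c : ℕ, (∃ y : List ℕ, (∀ i ∈ y, i < m) ∧ (w.map E).prod = δ ^ c * (y.map E).prod) ∨
      ∃ y y' : List ℕ, (∀ i ∈ y, i < m) ∧ (∀ i ∈ y', i < m) ∧
        (w.map E).prod = δ ^ c * ((y.map E).prod * (E m * (y'.map E).prod)) := by
  have hδw : ∀ (c : ℕ) (y : List ℕ), Commute (δ ^ c) (y.map E).prod := by
    intro c y
    induction y with
    | nil => simp
    | cons i y ih => simpa using ((hδ i).pow_left c).mul_right ih
  have hcw : ∀ (j : ℕ) (y : List ℕ), j < N → (∀ i ∈ y, i + 2 ≤ j) →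
      Commute (E j) (y.map E).prod := by
    intro j y hj hy
    induction y with
    | nil => simp
    | cons i y ih =>
      simp only [List.map_cons, List.prod_cons]
      refine Commute.mul_right ?_ (ih fun i hi => hy i (List.mem_cons_of_mem _ hi))
      exact (comm i j (hy i List.mem_cons_self) hj).symm
  induction m generalizing w with
  | zero =>
    induction w using List.reverseRecOn with
    | nil => exact ⟨0, Or.inl ⟨[], by simp⟩⟩
    | append_singleton w j ih =>
      obtain rfl : j = 0 := by simpa using hw j (by simp)
      obtain ⟨c, ⟨y, hy, e⟩ | ⟨y, y', hy, hy', e⟩⟩ := ih fun i hi => hw i (by simp [hi])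
      · obtain rfl : y = [] := List.eq_nil_iff_forall_not_mem.2 fun i hi => by simpa using hy i hi
        exact ⟨c, Or.inr ⟨[], [], by simp, by simp, by simpa using by rw [e]; simp⟩⟩
      · obtain rfl : y = [] := List.eq_nil_iff_forall_not_mem.2 fun i hi => by simpa using hy i hi
        obtain rfl : y' = [] := List.eq_nil_iff_forall_not_mem.2 fun i hi => by simpa using hy' i hi
        refine ⟨c + 1, Or.inr ⟨[], [], by simp, by simp, ?_⟩⟩
        simp only [List.map_append, List.prod_append, e]
        simp [mul_assoc, sq 0 hm, pow_succ]
  | succ m ihm =>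
    induction w using List.reverseRecOn with
    | nil => exact ⟨0, Or.inl ⟨[], by simp⟩⟩
    | append_singleton w j ih =>
      have hj : j ≤ m + 1 := hw j (by simp)
      obtain ⟨c, ⟨y, hy, e⟩ | ⟨y, y', hy, hy', e⟩⟩ := ih fun i hi => hw i (by simp [hi])
      · rcases Nat.lt_or_ge j (m + 1) with hj' | hj'
        · refine ⟨c, Or.inl ⟨y ++ [j], ?_, by simp [e, mul_assoc]⟩⟩
          exact List.forall_mem_append.2 ⟨hy, by simp; omega⟩
        · obtain rfl : j = m + 1 := le_antisymm hj hj'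
          exact ⟨c, Or.inr ⟨y, [], hy, by simp, by simp [e, mul_assoc]⟩⟩
      · rcases Nat.lt_or_ge j (m + 1) with hj' | hj'
        · refine ⟨c, Or.inr ⟨y, y' ++ [j], hy, ?_, by simp [e, mul_assoc]⟩⟩
          exact List.forall_mem_append.2 ⟨hy', by simp; omega⟩
        · obtain rfl : j = m + 1 := le_antisymm hj hj'
          -- The part `y'` between the two letters `m + 1` is itself reduced; the letters of `u` and
          -- `u'` are less than `m`, so these words commute with `E (m + 1)`.
          obtain ⟨c', ⟨u, hu, e'⟩ | ⟨u, u', hu, hu', e'⟩⟩ := ihm (by omega) y' fun i hi =>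
            Nat.lt_succ_iff.1 (hy' i hi)
          · refine ⟨c + (c' + 1), Or.inr ⟨y ++ u, [], ?_, by simp, ?_⟩⟩
            · exact List.forall_mem_append.2 ⟨hy, fun i hi => Nat.lt_succ_of_lt (hu i hi)⟩
            · have h1 := (hcw (m + 1) u hm fun i hi => by have := hu i hi; omega).eq
              simp only [List.map_append, List.prod_append, List.map_cons, List.map_nil,
                List.prod_cons, List.prod_nil, mul_one, e, e']
              calc δ ^ c * ((y.map E).prod * (E (m + 1) * (δ ^ c' * (u.map E).prod))) * E (m + 1)
                  = δ ^ c * ((y.map E).prod * ((E (m + 1) * δ ^ c') * ((u.map E).prod *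
                      E (m + 1)))) := by simp only [mul_assoc]
                _ = δ ^ c * (((y.map E).prod * δ ^ c') * ((E (m + 1) * E (m + 1)) *
                      (u.map E).prod)) := by
                    rw [← ((hδ (m + 1)).pow_left c').eq, ← h1]; simp only [mul_assoc]
                _ = δ ^ c * ((δ ^ c' * ((y.map E).prod * δ)) * (E (m + 1) * (u.map E).prod)) := by
                    rw [← (hδw c' y).eq, sq _ hm]; simp only [mul_assoc]
                _ = _ := by
                    have h2 := (hδw 1 y).eq
                    rw [pow_one] at h2
                    rw [← h2, h1, pow_add, pow_succ]; simp only [mul_assoc]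
          · refine ⟨c + c', Or.inr ⟨y ++ u, u', ?_, ?_, ?_⟩⟩
            · exact List.forall_mem_append.2 ⟨hy, fun i hi => Nat.lt_succ_of_lt (hu i hi)⟩
            · exact fun i hi => Nat.lt_succ_of_lt (hu' i hi)
            · have h1 := (hcw (m + 1) u hm fun i hi => by have := hu i hi; omega).eq
              have h2 := (hcw (m + 1) u' hm fun i hi => by have := hu' i hi; omega).eq
              simp only [List.map_append, List.prod_append, List.map_cons, List.map_nil,
                List.prod_cons, List.prod_nil, mul_one, e, e']
              calc δ ^ c * ((y.map E).prod * (E (m + 1) * (δ ^ c' * ((u.map E).prod *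
                    (E m * (u'.map E).prod))))) * E (m + 1)
                  = δ ^ c * ((y.map E).prod * ((E (m + 1) * δ ^ c') * ((u.map E).prod *
                    (E m * ((u'.map E).prod * E (m + 1)))))) := by simp only [mul_assoc]
                _ = δ ^ c * (((y.map E).prod * δ ^ c') * ((E (m + 1) * (u.map E).prod) *
                    (E m * (E (m + 1) * (u'.map E).prod)))) := by
                    rw [← ((hδ (m + 1)).pow_left c').eq, ← h2]; simp only [mul_assoc]
                _ = δ ^ c * ((δ ^ c' * (y.map E).prod) * ((u.map E).prod *
                    ((E (m + 1) * (E m * E (m + 1))) * (u'.map E).prod))) := by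
                    rw [← (hδw c' y).eq, h1]; simp only [mul_assoc]
                _ = _ := by rw [down m hm, pow_add]; simp only [mul_assoc]

/-! ### Weighted traces of Temperley-Lieb words and the Markov property -/

namespace StepModel

variable {S : Type} [Fintype S] [DecidableEq S] (M : StepModel S) {n : ℕ}

/-- The matrix of a word in the generators. -/
def word (n : ℕ) (w : List ℕ) : Matrix (Fin n → S) (Fin n → S) ℝ := (w.map (M.tl n)).prod

theorem word_cons (i : ℕ) (w : List ℕ) : M.word n (i :: w) = M.tl n i * M.word n w := by
  simp [word]

theorem word_append (w w' : List ℕ) : M.word n (w ++ w') = M.word n w * M.word n w' := by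
  simp [word]

open Classical in
/-- The trace of a matrix on the good walks, weighted by `lam` at their ends. -/
def wtr (X : Matrix (Fin n → S) (Fin n → S) ℝ) : ℝ :=
  ∑ p, if M.Good p then M.lam (M.site p n) * X p p else 0

theorem tl_ne_zero {i : ℕ} (h : i + 1 < n) {q p : Fin n → S} (hne : M.tl n i q p ≠ 0) :
    M.Good q ∧ M.Good p ∧ M.site q n = M.site p n := by
  classical
  rw [M.tl_apply h] at hne
  obtain ⟨s, -, hs⟩ := Finset.exists_ne_zero_of_sum_ne_zero hne
  obtain ⟨⟨hg, hq⟩, rfl⟩ : (M.Good q ∧ q ⟨i + 1, h⟩ = M.bar (q ⟨i, by omega⟩)) ∧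
      p = M.pair i h s q := by
    by_contra hc
    exact hs (if_neg hc)
  rw [if_pos ⟨⟨hg, hq⟩, rfl⟩] at hs
  refine ⟨hg, M.good_pair h hg hq fun h0 => hs (M.wt_eq_zero h0 _), ?_⟩
  rw [M.site_pair h s hq (by omega)]

theorem word_ne_zero {w : List ℕ} (hw : ∀ i ∈ w, i + 1 < n) {q p : Fin n → S}
    (hne : M.word n w q p ≠ 0) : (M.Good q ↔ M.Good p) ∧ M.site q n = M.site p n := by
  induction w generalizing q with
  | nil =>
    have : q = p := by
      by_contra h
      exact hne (by simp [word, h])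
    simp [this]
  | cons i w ih =>
    rw [word_cons, Matrix.mul_apply] at hne
    obtain ⟨r, -, hr⟩ := Finset.exists_ne_zero_of_sum_ne_zero hne
    obtain ⟨h1, h2, h3⟩ := M.tl_ne_zero (hw i List.mem_cons_self) (left_ne_zero_of_mul hr)
    obtain ⟨h4, h5⟩ := ih (fun i hi => hw i (List.mem_cons_of_mem _ hi)) (right_ne_zero_of_mul hr)
    exact ⟨⟨fun _ => h4.1 h2, fun _ => h1⟩, h3.trans h5⟩

/-- A walk with one more step. -/
def snoc (p : Fin n → S) (t : S) : Fin (n + 1) → S := Fin.snoc (α := fun _ => S) p t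

theorem sum_snoc {R : Type*} [AddCommMonoid R] (f : (Fin (n + 1) → S) → R) :
    ∑ p, f p = ∑ p : Fin n → S, ∑ t, f (snoc p t) := by
  rw [← (Fin.snocEquiv (fun _ => S)).sum_comp, Fintype.sum_prod_type, Finset.sum_comm]
  rfl

theorem snoc_inj {p q : Fin n → S} {s t : S} : snoc p s = snoc q t ↔ p = q ∧ s = t :=
  Fin.snoc_inj

theorem snoc_of_lt (p : Fin n → S) (t : S) {j : ℕ} (h : j < n) :
    snoc p t ⟨j, by omega⟩ = p ⟨j, h⟩ := by
  have := Fin.snoc_castSucc (α := fun _ => S) t p ⟨j, h⟩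
  exact this

theorem snoc_last (p : Fin n → S) (t : S) (h : n < n + 1) : snoc p t ⟨n, h⟩ = t :=
  Fin.snoc_last (α := fun _ => S) t p

theorem site_snoc (p : Fin n → S) (t : S) {j : ℕ} (hj : j ≤ n) :
    M.site (snoc p t) j = M.site p j := by
  induction j with
  | zero => rw [site_zero, site_zero]
  | succ j ih =>
    rw [M.site_succ _ (by omega : j < n + 1), M.site_succ _ (by omega : j < n), ih (by omega),
      snoc_of_lt p t (by omega)]

theorem site_snoc_last (p : Fin n → S) (t : S) :
    M.site (snoc p t) (n + 1) = M.site p n + M.σ t := by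
  rw [M.site_succ _ (by omega : n < n + 1), M.site_snoc p t le_rfl, snoc_last]

theorem good_snoc (p : Fin n → S) (t : S) :
    M.Good (snoc p t) ↔ M.Good p ∧ M.lam (M.site p n + M.σ t) ≠ 0 := by
  constructor
  · intro h
    refine ⟨fun j hj => ?_, ?_⟩
    · rw [← M.site_snoc p t hj]; exact h j (by omega)
    · rw [← M.site_snoc_last]; exact h _ le_rfl
  · rintro ⟨h1, h2⟩ j hj
    rcases Nat.lt_or_ge n j with hj' | hj'
    · obtain rfl : j = n + 1 := by omega
      rwa [M.site_snoc_last]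
    · rw [M.site_snoc p t hj']; exact h1 j hj'

theorem pair_snoc {i : ℕ} (h : i + 1 < n) (s : S) (q : Fin n → S) (t : S) :
    M.pair i (by omega) s (snoc q t) = snoc (M.pair i h s q) t := by
  funext j
  rcases Nat.lt_or_ge (j : ℕ) n with hj | hj
  · have e := fun p : Fin n → S => snoc_of_lt p t hj
    by_cases h1 : (j : ℕ) = i
    · have e1 : j = ⟨i, by omega⟩ := Fin.ext h1
      rw [e1, pair_left, snoc_of_lt _ _ (by omega), pair_left]
    by_cases h2 : (j : ℕ) = i + 1
    · have e1 : j = ⟨i + 1, by omega⟩ := Fin.ext h2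
      rw [e1, pair_right, snoc_of_lt _ _ (by omega), pair_right]
    rw [M.pair_of_ne _ _ _ h1 h2]
    have e1 := e q
    have e2 := e (M.pair i h s q)
    rw [M.pair_of_ne h s q (j := ⟨j, hj⟩) h1 h2] at e2
    exact e1.trans e2.symm
  · have e1 : j = ⟨n, by omega⟩ := Fin.ext (by have := j.2; simp; omega)
    rw [M.pair_of_ne _ _ _ (by omega) (by omega), e1, snoc_last, snoc_last]

open Classical in
theorem tl_snoc {i : ℕ} (h : i + 1 < n) (q p : Fin n → S) (s t : S) :
    M.tl (n + 1) i (snoc q s) (snoc p t) =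
      if s = t ∧ M.lam (M.site q n + M.σ s) ≠ 0 then M.tl n i q p else 0 := by
  rw [M.tl_apply (by omega), M.tl_apply h]
  simp only [M.pair_snoc h, snoc_inj, good_snoc, M.site_snoc q s (by omega : i ≤ n),
    snoc_of_lt q s h, snoc_of_lt q s (by omega : i < n)]
  split_ifs with hc
  · obtain ⟨rfl, h2⟩ := hc
    refine Finset.sum_congr rfl fun u _ => ?_
    simp only [ne_eq, h2, not_false_eq_true, and_true]
    congr
  · refine Finset.sum_eq_zero fun u _ => if_neg ?_
    rintro ⟨⟨⟨-, h1⟩, -⟩, -, h2⟩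
    exact hc ⟨h2.symm, h1⟩

/-- No generator touches the additional step. The test whether this step stays in the support is
decided at the end of `p`: nonzero entries preserve the end site (`word_ne_zero`), so the
intermediate walks either pass the test or contribute zero. -/
theorem word_snoc {w : List ℕ} (hw : ∀ i ∈ w, i + 1 < n) (q p : Fin n → S) (s t : S)
    (ht : M.lam (M.site p n + M.σ t) ≠ 0) :
    M.word (n + 1) w (snoc q s) (snoc p t) = if s = t then M.word n w q p else 0 := by
  classical
  induction w generalizing q s with
  | nil =>
    simp only [word, List.map_nil, List.prod_nil, Matrix.one_apply, snoc_inj]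
    split_ifs <;> simp_all
  | cons i w ih =>
    have ih' := ih fun i hi => hw i (List.mem_cons_of_mem _ hi)
    rw [word_cons, word_cons, Matrix.mul_apply, Matrix.mul_apply, sum_snoc]
    simp only [ih', mul_ite, mul_zero, Finset.sum_ite_eq', Finset.mem_univ, if_true,
      M.tl_snoc (hw i List.mem_cons_self)]
    by_cases hst : s = t
    · subst hst
      simp only [true_and, if_true]
      refine Finset.sum_congr rfl fun r _ => ?_
      split_ifs with hq
      · rfl
      · rw [zero_mul]
        by_contra hne
        have hne := Ne.symm hne
        have h1 := (M.tl_ne_zero (hw i List.mem_cons_self) (left_ne_zero_of_mul hne)).2.2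
        have h2 := (M.word_ne_zero (fun i hi => hw i (List.mem_cons_of_mem _ hi))
          (right_ne_zero_of_mul hne)).2
        rw [h1, h2] at hq
        exact hq ht
    · simp [hst]

/-- A free last strand contributes one loop: the sum of $\lambda$ over the possible last steps is
the eigenfunction equation at the end of the shorter walk. -/
theorem wtr_word_succ {w : List ℕ} (hw : ∀ i ∈ w, i + 1 < n) :
    M.wtr (M.word (n + 1) w) = M.d * M.wtr (M.word n w) := by
  classical
  rw [wtr, wtr, sum_snoc, Finset.mul_sum]
  refine Finset.sum_congr rfl fun p _ => ?_
  simp only [good_snoc, site_snoc_last]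
  by_cases hg : M.Good p
  · simp only [hg, true_and, if_true]
    have : ∀ t, (if M.lam (M.site p n + M.σ t) ≠ 0 then M.lam (M.site p n + M.σ t) *
        M.word (n + 1) w (snoc p t) (snoc p t) else 0) =
        M.lam (M.site p n + M.σ t) * M.word n w p p := by
      intro t
      split_ifs with h
      · rw [M.word_snoc hw p p t t h, if_pos rfl]
      · rw [not_not.1 h, zero_mul]
    rw [Finset.sum_congr rfl fun t _ => this t, ← Finset.sum_mul,
      M.harmonic _ (hg.lam_ne le_rfl), mul_assoc]
  · simp [hg]

/-- In the trace the last step `t` is the same at the beginning and at the end, and only the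
generator `n` sees it. That generator forces `t` to be the reversal of the last step of the
intermediate walk `q`, so the long walk ends at `site q n`, while the diagonal weight is
$\lambda({\rm site}_{n+1}q)/\lambda({\rm site}_n q)$. The end weight is thus turned into the one for
the shorter walks. -/
theorem wtr_markov {y y' : List ℕ} (hy : ∀ i ∈ y, i < n) (hy' : ∀ i ∈ y', i < n) :
    M.wtr (M.word (n + 2) y * (M.tl (n + 2) n * M.word (n + 2) y')) =
      M.wtr (M.word (n + 1) y * M.word (n + 1) y') := by
  classical
  have hy1 : ∀ i ∈ y, i + 1 < n + 1 := fun i hi => by have := hy i hi; omega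
  have hy2 : ∀ i ∈ y', i + 1 < n + 1 := fun i hi => by have := hy' i hi; omega
  have hn : n + 1 < n + 2 := by omega
  have hinner : ∀ (p q : Fin (n + 1) → S) (t s : S), M.Good (snoc p t) →
      M.word (n + 2) y (snoc p t) (snoc q s) *
        (M.tl (n + 2) n * M.word (n + 2) y') (snoc q s) (snoc p t) =
      if s = t then if M.Good q ∧ t = M.bar (q (Fin.last n)) then
        M.lam (M.site q (n + 1)) / M.lam (M.site q n) * (M.word (n + 1) y p q *
          M.word (n + 1) y' q p) else 0 else 0 := by
    intro p q t s hg
    have hpt := ((M.good_snoc p t).1 hg).2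
    rw [M.tl_mul_apply hn, snoc_last, snoc_of_lt q s (by omega : n < n + 1)]
    rw [show (⟨n, by omega⟩ : Fin (n + 1)) = Fin.last n from rfl]
    have hsite : M.site q (n + 1) = M.site q n + M.σ (q (Fin.last n)) := M.site_succ q _
    by_cases hs : s = M.bar (q (Fin.last n))
    swap
    · rw [if_neg (fun h => hs h.2), mul_zero]
      split_ifs with h1 h2
      · exact absurd (h1.trans h2.2) hs
      · rfl
      · rfl
    have hz : M.site q (n + 1) + M.σ s = M.site q n := by
      rw [hsite, hs, M.σ_bar]; ring
    by_cases hq : M.Good q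
    swap
    · have : ¬ M.Good (snoc q s) := fun h => hq ((M.good_snoc q s).1 h).1
      simp [this, hq]
    have hqs : M.lam (M.site q (n + 1) + M.σ s) ≠ 0 := by rw [hz]; exact hq.lam_ne (by omega)
    rw [if_pos ⟨(M.good_snoc q s).2 ⟨hq, hqs⟩, hs⟩, M.word_snoc hy1 p q t s hqs]
    by_cases hst : s = t
    swap
    · simp [hst, Ne.symm hst]
    subst hst
    rw [if_pos rfl, if_pos rfl, if_pos ⟨hq, hs⟩]
    have hpair : ∀ u, M.pair n hn u (snoc q s) =
        snoc (Function.update q (Fin.last n) u) (M.bar u) := by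
      intro u
      funext j
      by_cases h1 : (j : ℕ) = n
      · have e1 : j = ⟨n, by omega⟩ := Fin.ext h1
        rw [e1, pair_left, snoc_of_lt _ _ (by omega : n < n + 1)]
        exact (Function.update_self (Fin.last n) u q).symm
      by_cases h2 : (j : ℕ) = n + 1
      · have e1 : j = ⟨n + 1, by omega⟩ := Fin.ext h2
        rw [e1, pair_right, snoc_last]
      rw [M.pair_of_ne hn _ _ h1 h2]
      have hj : (j : ℕ) < n + 1 := by have := j.2; omega
      have e1 := snoc_of_lt q s hj
      have e2 := snoc_of_lt (Function.update q (Fin.last n) u) (M.bar u) hj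
      rw [Function.update_of_ne (by simp [Fin.ext_iff]; omega)] at e2
      exact e1.trans e2.symm
    -- The word `y'` must return to the last step `s`, which it cannot change; hence the pair
    -- written by the generator ends in `s`.
    have hsum : ∀ u, u ≠ M.bar s → M.word (n + 2) y' (M.pair n hn u (snoc q s)) (snoc p s) = 0 := by
      intro u hu
      rw [hpair, M.word_snoc hy2 _ _ _ _ hpt, if_neg]
      intro h
      exact hu (by rw [← h, M.bar_bar])
    rw [Finset.sum_eq_single (M.bar s) (fun u _ hu => by rw [hsum u hu, mul_zero]) (by simp),
      hpair, M.word_snoc hy2 _ _ _ _ hpt, if_pos (M.bar_bar s), M.site_snoc _ _ (by omega)]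
    have hbs : M.bar s = q (Fin.last n) := by rw [hs, M.bar_bar]
    rw [hbs, Function.update_eq_self]
    change _ * (M.wt _ (q (Fin.last n)) _ * _) = _
    rw [wt_eq, ← hsite, Real.mul_self_sqrt (M.lam_nonneg _)]
    ring
  rw [wtr, wtr, sum_snoc]
  simp only [Matrix.mul_apply (M := M.word (n + 2) y), sum_snoc (n := n + 1)]
  refine Finset.sum_congr rfl fun p _ => ?_
  -- The test for `Good` on the long walk is implied by the condition on `t` as soon as the entry of
  -- `y` does not vanish, because then `q` is good and the walk ends at one of its sites.
  have h1 : ∀ t, (if M.Good (snoc p t) then M.lam (M.site (snoc p t) (n + 2)) *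
      ∑ q, ∑ s, M.word (n + 2) y (snoc p t) (snoc q s) *
        (M.tl (n + 2) n * M.word (n + 2) y') (snoc q s) (snoc p t) else 0) =
      ∑ q, if t = M.bar (q (Fin.last n)) then if M.Good p then M.lam (M.site p (n + 1)) *
        (M.word (n + 1) y p q * M.word (n + 1) y' q p) else 0 else 0 := by
    intro t
    by_cases hg : M.Good (snoc p t)
    · obtain ⟨hp, hpt⟩ := (M.good_snoc p t).1 hg
      simp only [if_pos hg, hinner p _ t _ hg, Finset.sum_ite_eq', Finset.mem_univ, if_true,
        Finset.mul_sum, if_pos hp]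
      refine Finset.sum_congr rfl fun q _ => ?_
      by_cases ht : t = M.bar (q (Fin.last n))
      swap
      · simp [ht]
      by_cases h0 : M.word (n + 1) y p q = 0
      · simp [h0]
      obtain ⟨h2, h3⟩ := M.word_ne_zero hy1 h0
      have hq := h2.1 hp
      have hz : M.site (snoc p t) (n + 2) = M.site q n := by
        rw [M.site_snoc_last, h3, M.site_succ q (by omega : n < n + 1)]
        change _ + M.σ (q (Fin.last n)) + _ = _
        rw [ht, M.σ_bar]; ring
      rw [if_pos ⟨hq, ht⟩, if_pos ht, hz, h3]
      have := hq.lam_ne (j := n) (by omega)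
      field_simp
    · rw [if_neg hg]
      symm
      refine Finset.sum_eq_zero fun q _ => ?_
      split_ifs with ht hp
      · by_cases h0 : M.word (n + 1) y p q = 0
        · simp [h0]
        obtain ⟨h2, h3⟩ := M.word_ne_zero hy1 h0
        have hq := h2.1 hp
        exfalso
        apply hg
        rw [good_snoc]
        refine ⟨hp, ?_⟩
        have hz : M.site p (n + 1) + M.σ t = M.site q n := by
          rw [h3, M.site_succ q (by omega : n < n + 1)]
          change _ + M.σ (q (Fin.last n)) + _ = _
          rw [ht, M.σ_bar]; ring
        rw [hz]
        exact hq.lam_ne (by omega)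
      · rfl
      · rfl
  simp only [h1]
  rw [Finset.sum_comm]
  simp only [Finset.sum_ite_eq', Finset.mem_univ, if_true]
  split_ifs with hp
  · rw [Matrix.mul_apply, Finset.mul_sum]
  · simp

theorem wtr_smul (c : ℝ) (X : Matrix (Fin n → S) (Fin n → S) ℝ) : M.wtr (c • X) = c * M.wtr X := by
  rw [wtr, wtr, Finset.mul_sum]
  refine Finset.sum_congr rfl fun p _ => ?_
  split_ifs
  · rw [Matrix.smul_apply, smul_eq_mul]; ring
  · simp

theorem wtr_zero_strands (w : List ℕ) (hw : ∀ i ∈ w, i + 1 < 0) :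
    M.wtr (M.word 0 w) = M.lam M.start := by
  obtain rfl : w = [] := List.eq_nil_iff_forall_not_mem.2 fun i hi => by have := hw i hi; omega
  have hg : ∀ p : Fin 0 → S, M.Good p := by
    intro p j hj
    obtain rfl : j = 0 := by omega
    rw [site_zero]; exact M.start_ne
  simp [wtr, hg, word, site_zero]

/-- The weighted traces of a word in two models are powers, with a common exponent, of their loop
values. -/
theorem exists_wtr_eq_pow {S' : Type} [Fintype S'] [DecidableEq S'] (M' : StepModel S') (n : ℕ)
    (w : List ℕ) (hw : ∀ i ∈ w, i + 1 < n) : ∃ l : ℕ,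
      M.wtr (M.word n w) = M.lam M.start * M.d ^ l ∧
      M'.wtr (M'.word n w) = M'.lam M'.start * M'.d ^ l := by
  induction n generalizing w with
  | zero => exact ⟨0, by simp [wtr_zero_strands _ w hw]⟩
  | succ n ih =>
    -- Words that leave the last strand alone: one factor of the loop value for this strand, and `c`
    -- factors from the reduction.
    have hsucc : ∀ (c : ℕ) (y : List ℕ), (∀ i ∈ y, i + 1 < n) → ∃ l : ℕ,
        M.d ^ c * M.wtr (M.word (n + 1) y) = M.lam M.start * M.d ^ l ∧
        M'.d ^ c * M'.wtr (M'.word (n + 1) y) = M'.lam M'.start * M'.d ^ l := by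
      intro c y hy
      obtain ⟨l, h1, h2⟩ := ih y hy
      refine ⟨l + 1 + c, ?_, ?_⟩
      · rw [M.wtr_word_succ hy, h1]; ring
      · rw [M'.wtr_word_succ hy, h2]; ring
    cases n with
    | zero =>
      obtain ⟨l, h⟩ := hsucc 0 w fun i hi => by have := hw i hi; omega
      exact ⟨l, by simpa using h⟩
    | succ n =>
      -- The two models are put side by side in a product monoid, so that one reduction serves both
      -- and yields the same exponent and the same words.
      let E : ℕ → Matrix (Fin (n + 2) → S) (Fin (n + 2) → S) ℝ ×
        Matrix (Fin (n + 2) → S') (Fin (n + 2) → S') ℝ := fun i => (M.tl _ i, M'.tl _ i)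
      let δ : Matrix (Fin (n + 2) → S) (Fin (n + 2) → S) ℝ ×
        Matrix (Fin (n + 2) → S') (Fin (n + 2) → S') ℝ := (M.d • 1, M'.d • 1)
      have hprod : ∀ w : List ℕ, (w.map E).prod = (M.word _ w, M'.word _ w) := by
        intro w
        induction w with
        | nil => rfl
        | cons i w ih => rw [List.map_cons, List.prod_cons, ih, word_cons, word_cons]; rfl
      have hpow : ∀ c : ℕ, δ ^ c = (M.d ^ c • 1, M'.d ^ c • 1) := by
        intro c
        simp only [δ, Prod.pow_mk, smul_pow, one_pow]
      obtain ⟨c, ⟨y, hy, e⟩ | ⟨y, y', hy, hy', e⟩⟩ := word_reduction E δ (n + 1)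
        (fun i => by
          change δ * E i = E i * δ
          simp only [E, δ, Prod.mk_mul_mk, smul_mul_assoc, mul_smul_comm, one_mul, mul_one])
        (fun i hi => by
          simp only [E, δ, Prod.mk_mul_mk, smul_mul_assoc, one_mul]
          rw [M.tl_mul_self (by omega), M'.tl_mul_self (by omega)])
        (fun i hi => by
          simp only [E, Prod.mk_mul_mk]
          rw [M.tl_braid_down (by omega), M'.tl_braid_down (by omega)])
        (fun i j hij hj => by
          simp only [E, Prod.mk_mul_mk]
          rw [M.tl_comm hij (by omega), M'.tl_comm hij (by omega)])
        n (by omega) w (fun i hi => by have := hw i hi; omega)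
      · rw [hprod, hprod, hpow, Prod.mk_mul_mk, Prod.mk.injEq] at e
        obtain ⟨l, h1, h2⟩ := hsucc c y fun i hi => by have := hy i hi; omega
        refine ⟨l, ?_, ?_⟩
        · rw [e.1, smul_mul_assoc, one_mul, wtr_smul, h1]
        · rw [e.2, smul_mul_assoc, one_mul, wtr_smul, h2]
      · rw [hprod, hprod, hprod, hpow] at e
        simp only [E, Prod.mk_mul_mk, Prod.mk.injEq] at e
        obtain ⟨l, h1, h2⟩ := ih (y ++ y') fun i hi => by
          rcases List.mem_append.1 hi with hi | hi
          · have := hy i hi; omega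
          · have := hy' i hi; omega
        rw [word_append] at h1 h2
        refine ⟨l + c, ?_, ?_⟩
        · rw [e.1, smul_mul_assoc, one_mul, wtr_smul, M.wtr_markov hy hy', h1]; ring
        · rw [e.2, smul_mul_assoc, one_mul, wtr_smul, M'.wtr_markov hy hy', h2]; ring

end StepModel

/-! ## The path model and the labelling model -/

theorem lam_eq_sin {k : ℕ} (hk : 0 < k) {l : ℤ} (h0 : 0 ≤ l) (h1 : l ≤ k) :
    lam k l = Real.sin (Real.pi * l / k) := by
  rw [lam]
  split_ifs with h
  · rfl
  · have hk' : (k : ℝ) ≠ 0 := by positivity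
    rcases (by omega : l = 0 ∨ l = k) with rfl | rfl
    · simp
    · push_cast
      rw [mul_div_assoc, div_self hk', mul_one, Real.sin_pi]

theorem lam_pos {k : ℕ} {l : ℤ} (h0 : 1 ≤ l) (h1 : l < k) : 0 < lam k l := by
  rw [lam, if_pos ⟨h0, h1⟩]
  have hk : (0 : ℝ) < k := by
    have : (0 : ℤ) < k := by omega
    exact_mod_cast this
  have h0' : (0 : ℝ) < l := by exact_mod_cast (by omega : (0 : ℤ) < l)
  have h1' : (l : ℝ) < k := by exact_mod_cast h1
  apply Real.sin_pos_of_pos_of_lt_pi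
  · positivity
  · rw [div_lt_iff₀ hk]
    exact mul_lt_mul_of_pos_left h1' Real.pi_pos

theorem lam_ne_zero_iff {k : ℕ} {l : ℤ} : lam k l ≠ 0 ↔ 1 ≤ l ∧ l < k := by
  constructor
  · intro h
    by_contra h'
    exact h (if_neg h')
  · rintro ⟨h0, h1⟩
    exact (lam_pos h0 h1).ne'

theorem lam_nonneg (k : ℕ) (l : ℤ) : 0 ≤ lam k l := by
  by_cases h : 1 ≤ l ∧ l < k
  · exact (lam_pos h.1 h.2).le
  · rw [lam, if_neg h]

/-- The addition formulas for the sine. At $z=1$ and $z=k-1$ the convention $\lambda_0=\lambda_k=0$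
agrees with the sine. -/
theorem lam_harmonic {k : ℕ} {z : ℤ} (h0 : 1 ≤ z) (h1 : z < k) :
    lam k (z + 1) + lam k (z - 1) = dval k * lam k z := by
  have hk : 0 < k := by omega
  rw [lam_eq_sin hk (by omega) (by omega), lam_eq_sin hk (by omega) (by omega),
    lam_eq_sin hk (by omega) h1.le, dval]
  have e1 : Real.pi * ((z + 1 : ℤ) : ℝ) / k = Real.pi * z / k + Real.pi / k := by
    push_cast; ring
  have e2 : Real.pi * ((z - 1 : ℤ) : ℝ) / k = Real.pi * z / k - Real.pi / k := by
    push_cast; ring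
  rw [e1, e2, Real.sin_add, Real.sin_sub]
  ring

/-- Walks on the line graph with the sites `1, …, k - 1`. -/
def pathModel (k : ℕ) (hk : 3 ≤ k) : StepModel Bool where
  σ b := if b then 1 else -1
  bar b := !b
  lam := lam k
  d := dval k
  start := 1
  bar_bar := by simp
  σ_bar := by intro s; cases s <;> simp
  lam_nonneg := lam_nonneg k
  harmonic z hz := by
    obtain ⟨h0, h1⟩ := lam_ne_zero_iff.1 hz
    simpa [sub_eq_add_neg] using lam_harmonic h0 h1
  start_ne := lam_ne_zero_iff.2 ⟨le_rfl, by omega⟩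

theorem pathModel_site {k : ℕ} (hk : 3 ≤ k) {n : ℕ} (p : Fin n → Bool) (i : ℕ) :
    (pathModel k hk).site p i = site p i := rfl

theorem pathModel_good {k : ℕ} (hk : 3 ≤ k) {n : ℕ} (p : Fin n → Bool) :
    (pathModel k hk).Good p ↔ IsPath k p :=
  forall₂_congr fun _ _ => lam_ne_zero_iff

/-- Labellings of the strands by two labels. -/
def labelModel : StepModel Bool where
  σ _ := 0
  bar b := b
  lam _ := 1
  d := 2
  start := 0
  bar_bar := by simp
  σ_bar := by simp
  lam_nonneg := by simp
  harmonic := by simp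
  start_ne := by simp

theorem labelModel_good {n : ℕ} (p : Fin n → Bool) : labelModel.Good p := by
  intro i _
  simp [labelModel]

open Classical in
theorem labelModel_tl {n i : ℕ} (h : i + 1 < n) (q p : Fin n → Bool) :
    labelModel.tl n i q p = if q ⟨i + 1, h⟩ = q ⟨i, by omega⟩ ∧ p ⟨i + 1, h⟩ = p ⟨i, by omega⟩ ∧
      ∀ j : Fin n, (j : ℕ) ≠ i → (j : ℕ) ≠ i + 1 → q j = p j then 1 else 0 := by
  rw [labelModel.tl_apply h]
  have hw : ∀ z s t, labelModel.wt z s t = 1 := by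
    intro z s t
    simp [StepModel.wt, labelModel]
  simp only [labelModel_good, true_and, hw]
  split_ifs with hc
  · rw [Finset.sum_eq_single (p ⟨i, by omega⟩)]
    · refine if_pos ⟨hc.1, ?_⟩
      funext j
      by_cases h1 : (j : ℕ) = i
      · have e1 : j = ⟨i, by omega⟩ := Fin.ext h1
        rw [e1, StepModel.pair_left]
      by_cases h2 : (j : ℕ) = i + 1
      · have e1 : j = ⟨i + 1, by omega⟩ := Fin.ext h2
        rw [e1, StepModel.pair_right]
        exact hc.2.1
      rw [labelModel.pair_of_ne h _ _ h1 h2]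
      exact (hc.2.2 j h1 h2).symm
    · intro s _ hs
      refine if_neg ?_
      rintro ⟨-, rfl⟩
      rw [StepModel.pair_left] at hs
      exact hs rfl
    · simp
  · refine Finset.sum_eq_zero fun s _ => if_neg ?_
    rintro ⟨h1, rfl⟩
    refine hc ⟨h1, ?_, fun j h1 h2 => ?_⟩
    · rw [StepModel.pair_left, StepModel.pair_right]; rfl
    · rw [labelModel.pair_of_ne h _ _ h1 h2]

/-! ## Products of matrices as sums over sequences -/

/-- A product of matrices of relations counts the chains of related indices between its two ends. In
`labelModel_wtr` a chain lists the labels of the marked points level by level. -/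
theorem prod_ofFn_apply {I : Type*} [Fintype I] [DecidableEq I] (m : ℕ) (r : Fin m → I → I → Prop)
    [∀ j x y, Decidable (r j x y)] (X : Fin m → Matrix I I ℝ) (hX : ∀ j x y, X j x y = if r j x y then 1 else 0) (a b : I) :
    (List.ofFn X).prod a b =
      ∑ x : Fin (m + 1) → I, if x 0 = a ∧ x (Fin.last m) = b ∧ ∀ j : Fin m,
        r j (x j.castSucc) (x j.succ) then 1 else 0 := by
  induction m generalizing a with
  | zero =>
    rw [← (Equiv.funUnique (Fin 1) I).symm.sum_comp]
    have : ∀ x : I, (if x = a ∧ x = b then (1 : ℝ) else 0) = if x = a then if a = b then 1 else 0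
        else 0 := by
      intro x
      split_ifs <;> simp_all
    simp [Matrix.one_apply, this]
  | succ m ih =>
    rw [List.ofFn_succ, List.prod_cons, Matrix.mul_apply]
    simp only [ih (fun j => r j.succ) (fun j => X j.succ) fun j => hX j.succ, hX]
    rw [← (Fin.consEquiv fun _ => I).sum_comp, Fintype.sum_prod_type, Finset.sum_comm]
    simp only [Fin.consEquiv_apply, Fin.cons_zero, Fin.forall_fin_succ, Fin.castSucc_zero,
      Fin.cons_succ, ← Fin.succ_last, ← Fin.succ_castSucc, Finset.mul_sum]
    rw [Finset.sum_comm]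
    refine Finset.sum_congr rfl fun x _ => ?_
    rw [Finset.sum_eq_single (x 0) (fun c _ hc => by simp [hc.symm]) (by simp),
      Finset.sum_eq_single a (fun c _ hc => by simp [hc]) (by simp)]
    by_cases h1 : r 0 a (x 0) <;> simp [h1]

/-- Distributivity over the crossings; the functions `s` are the states of the diagram. -/
theorem prod_ofFn_add {R : Type*} [Semiring R] (m : ℕ) (f : Fin m → Bool → R) :
    (List.ofFn fun j => f j true + f j false).prod =
      ∑ s : Fin m → Bool, (List.ofFn fun j => f j (s j)).prod := by
  induction m with
  | zero => simp
  | succ m ih =>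
    rw [List.ofFn_succ, List.prod_cons, ih fun j => f j.succ,
      ← (Fin.consEquiv fun _ => Bool).sum_comp, Fintype.sum_prod_type]
    simp [List.ofFn_succ, add_mul, Finset.mul_sum, Finset.sum_add_distrib]

theorem prod_ofFn_smul {R X : Type*} [CommSemiring R] [Semiring X] [Algebra R X] (m : ℕ)
    (c : Fin m → R) (f : Fin m → X) :
    (List.ofFn fun j => c j • f j).prod = (∏ j, c j) • (List.ofFn f).prod := by
  induction m with
  | zero => simp
  | succ m ih =>
    rw [List.ofFn_succ, List.prod_cons, ih (fun j => c j.succ) fun j => f j.succ,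
      List.ofFn_succ (f := f), List.prod_cons, Fin.prod_univ_succ, smul_mul_smul_comm]

/-! ## The state sum as a trace -/

section StateSum

variable {n : ℕ} (B : Braid n)

/-- The word of the generators that a state inserts. -/
def stateWord (s : Fin B.length → Bool) : List ℕ :=
  (List.ofFn fun j => if s j then [((B.get j).1 : ℕ)] else []).flatten

theorem stateWord_lt (s : Fin B.length → Bool) : ∀ i ∈ stateWord B s, i + 1 < n := by
  intro i hi
  simp only [stateWord, List.mem_flatten, List.mem_ofFn] at hi
  obtain ⟨l, ⟨j, rfl⟩, hl⟩ := hi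
  split_ifs at hl
  · rw [List.mem_singleton.1 hl]
    have := (B.get j).1.2
    omega
  · simp at hl

theorem word_stateWord {S : Type} [Fintype S] [DecidableEq S] (M : StepModel S)
    (s : Fin B.length → Bool) : M.word n (stateWord B s) =
      (List.ofFn fun j => if s j then M.tl n (B.get j).1 else 1).prod := by
  rw [stateWord, StepModel.word, List.map_flatten, List.prod_flatten, List.map_map, List.map_ofFn]
  congr 2
  funext j
  simp only [Function.comp]
  split_ifs <;> simp

/-- All weights are 1, so the trace counts closed chains of labellings, that is, labellings of the
marked points that agree on joined points. These are the functions from the set of loops to the two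
labels. -/
theorem labelModel_wtr (s : Fin B.length → Bool) :
    labelModel.wtr (labelModel.word n (stateWord B s)) = 2 ^ (traceClosure B).loops s := by
  classical
  let r : Fin B.length → (Fin n → Bool) → (Fin n → Bool) → Prop := fun j x y =>
    if s j then x (posR (B.get j).1) = x (posL (B.get j).1) ∧
      y (posR (B.get j).1) = y (posL (B.get j).1) ∧
      ∀ l : Fin n, (l : ℕ) ≠ (B.get j).1 → (l : ℕ) ≠ (B.get j).1 + 1 → x l = y l else x = y
  have hmat : ∀ j x y, (if s j then labelModel.tl n (B.get j).1 else 1 :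
      Matrix (Fin n → Bool) (Fin n → Bool) ℝ) x y = if r j x y then 1 else 0 := by
    intro j x y
    by_cases hs : s j = true
    · have hi : ((B.get j).1 : ℕ) + 1 < n := by have := (B.get j).1.2; omega
      rw [if_pos hs, labelModel_tl hi]
      by_cases hr : r j x y
      · rw [if_pos hr]
        simp only [r, if_pos hs] at hr
        exact if_pos hr
      · rw [if_neg hr]
        simp only [r, if_pos hs] at hr
        exact if_neg hr
    · simp [hs, r, Matrix.one_apply]
  have e0 : labelModel.wtr (labelModel.word n (stateWord B s)) =
      ∑ p, ∑ x : Fin (B.length + 1) → Fin n → Bool, if x 0 = p ∧ x (Fin.last _) = p ∧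
        ∀ j : Fin B.length, r j (x j.castSucc) (x j.succ) then (1 : ℝ) else 0 := by
    rw [word_stateWord, StepModel.wtr]
    refine Finset.sum_congr rfl fun p _ => ?_
    rw [if_pos (labelModel_good p)]
    rw [show labelModel.lam (labelModel.site p n) = 1 from rfl, one_mul]
    exact prod_ofFn_apply _ r _ hmat p p
  rw [e0]
  rw [Finset.sum_comm]
  have e2 : ∀ x : Fin (B.length + 1) → Fin n → Bool,
      (∑ p, if x 0 = p ∧ x (Fin.last _) = p ∧ ∀ j : Fin B.length, r j (x j.castSucc) (x j.succ)
        then (1 : ℝ) else 0) =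
      if x (Fin.last _) = x 0 ∧ ∀ j : Fin B.length, r j (x j.castSucc) (x j.succ) then 1 else 0 := by
    intro x
    rw [Finset.sum_eq_single (x 0) (fun p _ hp => by simp [hp.symm]) (by simp)]
    simp
  simp only [e2]
  rw [← Finset.sum_filter, Finset.sum_const, nsmul_eq_mul, mul_one]
  unfold LinkDiagram.loops
  have hfin : Finite (Quot ((traceClosure B).Joined s)) := by
    have : Finite (traceClosure B).Point := inferInstanceAs (Finite (Fin n × Fin (B.length + 1)))
    infer_instance
  have hcard : Nat.card (Quot ((traceClosure B).Joined s) → Bool) =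
      2 ^ Nat.card (Quot ((traceClosure B).Joined s)) := by
    rw [Nat.card_fun, Nat.card_eq_fintype_card, Fintype.card_bool]
  rw [← Nat.cast_ofNat (R := ℝ), ← Nat.cast_pow, ← hcard, Nat.cast_inj]
  rw [← Fintype.card_coe, ← Nat.card_eq_fintype_card]
  -- Labellings compatible with `Joined`. The relations between adjacent levels express the arcs,
  -- cups, caps and vertical strands; the equality of the last and the first level expresses the
  -- closing arcs.
  let Resp : (Fin n × Fin (B.length + 1) → Bool) → Prop := fun f =>
    ∀ a b, (traceClosure B).Joined s a b → f a = f b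
  have key : ∀ x : Fin (B.length + 1) → Fin n → Bool,
      (x (Fin.last _) = x 0 ∧ ∀ j : Fin B.length, r j (x j.castSucc) (x j.succ)) ↔
        Resp fun a => x a.2 a.1 := by
    intro x
    constructor
    · rintro ⟨h1, h2⟩ a b hab
      cases hab with
      | arc h =>
        rcases h with ⟨j, ha, hb, hab, hl, hr⟩ | ⟨ha, hb, hab⟩
        · simp only [ha, hb, hab]
          have hj := h2 j
          simp only [r] at hj
          split_ifs at hj with hs
          · refine hj.2.2 _ (fun h => hl ?_) (fun h => hr ?_)
            · rw [hab]; exact Fin.ext h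
            · rw [hab]; exact Fin.ext h
          · rw [hj]
        · simp only [ha, hb, hab, h1]
      | cup c h => have hj := h2 c; simp only [r, if_pos h] at hj; exact hj.1.symm
      | cap c h => have hj := h2 c; simp only [r, if_pos h] at hj; exact hj.2.1.symm
      | left c h =>
        have hj : x c.castSucc = x c.succ := by
          have hc := h2 c
          simp only [r, h, Bool.false_eq_true, if_false] at hc
          exact hc
        exact congrFun hj _
      | right c h =>
        have hj : x c.castSucc = x c.succ := by
          have hc := h2 c
          simp only [r, h, Bool.false_eq_true, if_false] at hc
          exact hc
        exact congrFun hj _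
    · intro h
      have harc : ∀ (j : Fin B.length) (l : Fin n), (l : ℕ) ≠ (B.get j).1 →
          (l : ℕ) ≠ (B.get j).1 + 1 → x j.castSucc l = x j.succ l := by
        intro j l h1 h2
        refine h (l, j.castSucc) (l, j.succ) (.arc (Or.inl ⟨j, rfl, rfl, rfl, ?_, ?_⟩))
        · intro e; exact h1 (congrArg Fin.val e)
        · intro e; exact h2 (congrArg Fin.val e)
      refine ⟨?_, fun j => ?_⟩
      · funext l
        exact h (l, Fin.last _) (l, 0) (.arc (Or.inr ⟨rfl, rfl, rfl⟩))
      · by_cases hs : s j = true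
        · simp only [r, if_pos hs]
          have e1 := h _ _ (LinkDiagram.Joined.cup (L := traceClosure B) (s := s) j hs)
          have e2 := h _ _ (LinkDiagram.Joined.cap (L := traceClosure B) (s := s) j hs)
          exact ⟨e1.symm, e2.symm, harc j⟩
        · simp only [r, if_neg hs]
          have hs : s j = false := by simpa using hs
          funext l
          by_cases h1 : (l : ℕ) = (B.get j).1
          · obtain rfl : l = posL (B.get j).1 := Fin.ext h1
            exact h _ _ (LinkDiagram.Joined.left (L := traceClosure B) (s := s) j hs)
          by_cases h2 : (l : ℕ) = (B.get j).1 + 1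
          · obtain rfl : l = posR (B.get j).1 := Fin.ext h2
            exact h _ _ (LinkDiagram.Joined.right (L := traceClosure B) (s := s) j hs)
          exact harc j l h1 h2
  refine Nat.card_congr ?_
  refine Equiv.trans (Equiv.subtypeEquivRight (q := fun x => Resp fun a => x a.2 a.1)
    fun x => ?_) ?_
  · rw [← key]; simp
  refine
    { toFun := fun x => Quot.lift (fun a => x.1 a.2 a.1) x.2
      invFun := fun g => ⟨fun j l => g (Quot.mk _ (l, j)), fun a b hab => ?_⟩
      left_inv := fun x => rfl
      right_inv := fun g => ?_ }
  · exact congrArg g (Quot.sound hab)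
  · funext a
    induction a using Quot.ind
    rfl

end StateSum

/-! ## The Jones polynomial as a weighted trace -/

section Jones

variable {n k : ℕ} (hk : 3 ≤ k)

theorem rootA_ne_zero (k : ℕ) : rootA k ≠ 0 :=
  mul_ne_zero Complex.I_ne_zero (Complex.exp_ne_zero _)

/-- The coefficient of the capcup in the operator of a crossing. -/
def crossingCoeff (k : ℕ) (b : Bool) : ℂ := if b then rootA k else (rootA k)⁻¹

/-- The Temperley-Lieb generator of the path model as a complex matrix. -/
def tlC (n i : ℕ) : Matrix (Fin n → Bool) (Fin n → Bool) ℂ :=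
  Complex.ofRealHom.mapMatrix ((pathModel k hk).tl n i)

/-- The operator of a crossing, with the paths and the other bit strings treated alike. -/
def crossOp (c : Fin (n - 1) × Bool) : Matrix (Fin n → Bool) (Fin n → Bool) ℂ :=
  crossingCoeff k c.2 • tlC hk n c.1 + (crossingCoeff k c.2)⁻¹ • 1

/-- The product of the operators of the crossings of a braid. -/
def braidOp (B : Braid n) : Matrix (Fin n → Bool) (Fin n → Bool) ℂ := (B.map (crossOp hk)).prod

theorem stateExponent_pow (B : Braid n) (s : Fin B.length → Bool) :
    rootA k ^ (traceClosure B).stateExponent s =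
      ∏ j, (if s j then crossingCoeff k (B.get j).2 else (crossingCoeff k (B.get j).2)⁻¹) := by
  have h : ∀ (m : ℕ) (e : Fin m → ℤ), rootA k ^ (∑ j, e j) = ∏ j, rootA k ^ e j := by
    intro m e
    induction m with
    | zero => simp
    | succ m ih => rw [Fin.sum_univ_succ, zpow_add₀ (rootA_ne_zero k), ih, Fin.prod_univ_succ]
  refine (h _ _).trans (Finset.prod_congr rfl fun j _ => ?_)
  have e : (traceClosure B).positive j = (B.get j).2 := rfl
  rw [e]
  rcases hs : s j <;> rcases hb : (B.get j).2 <;> simp [crossingCoeff]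

theorem braidOp_eq_sum (B : Braid n) : braidOp hk B = ∑ s : Fin B.length → Bool,
    rootA k ^ (traceClosure B).stateExponent s •
      Complex.ofRealHom.mapMatrix ((pathModel k hk).word n (stateWord B s)) := by
  have hB : B.map (crossOp hk) = List.ofFn fun j => crossOp hk (B.get j) := by
    conv_lhs => rw [← List.ofFn_get B]
    rw [List.map_ofFn]
    rfl
  rw [braidOp, hB]
  let f : Fin B.length → Bool → Matrix (Fin n → Bool) (Fin n → Bool) ℂ := fun j b =>
    (if b then crossingCoeff k (B.get j).2 else (crossingCoeff k (B.get j).2)⁻¹) •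
      Complex.ofRealHom.mapMatrix (if b then (pathModel k hk).tl n (B.get j).1 else 1)
  have hf : (fun j => crossOp hk (B.get j)) = fun j => f j true + f j false := by
    funext j
    simp only [f, crossOp, tlC, if_true, map_one, Bool.false_eq_true, if_false]
  rw [hf, prod_ofFn_add]
  refine Finset.sum_congr rfl fun s _ => ?_
  rw [prod_ofFn_smul, stateExponent_pow, word_stateWord, map_list_prod, List.map_ofFn]
  rfl

theorem loops_pos (hn : 1 ≤ n) (B : Braid n) (s : Fin B.length → Bool) :
    0 < (traceClosure B).loops s := by
  have h1 : Finite (traceClosure B).Point := inferInstanceAs (Finite (Fin n × Fin (B.length + 1)))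
  have h2 : Nonempty (traceClosure B).Point := ⟨((⟨0, by omega⟩, 0) : Fin n × Fin (B.length + 1))⟩
  have h3 : Nonempty (Quot ((traceClosure B).Joined s)) := h2.map (Quot.mk _)
  exact Nat.card_pos

/-- The exponent common to the two models is read off in the labelling model, where the trace is a
power of 2 and determines it. -/
theorem pathModel_wtr (B : Braid n) (s : Fin B.length → Bool) :
    (pathModel k hk).wtr ((pathModel k hk).word n (stateWord B s)) =
      lam k 1 * dval k ^ (traceClosure B).loops s := by
  obtain ⟨l, h1, h2⟩ := (pathModel k hk).exists_wtr_eq_pow labelModel n (stateWord B s)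
    (stateWord_lt B s)
  rw [labelModel_wtr] at h2
  have h3 : (2 : ℝ) ^ (traceClosure B).loops s = 2 ^ l := h2.trans (one_mul _)
  have h4 : (traceClosure B).loops s = l := by
    have : (2 : ℕ) ^ (traceClosure B).loops s = 2 ^ l := by exact_mod_cast h3
    exact Nat.pow_right_injective le_rfl this
  rw [h1, h4]
  rfl

theorem pathModel_wtr_eq (X : Matrix (Fin n → Bool) (Fin n → Bool) ℝ) :
    (pathModel k hk).wtr X = ∑ p, pathWeight k p * X p p := by
  classical
  rw [StepModel.wtr]
  refine Finset.sum_congr rfl fun p _ => ?_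
  by_cases h : IsPath k p
  · rw [if_pos ((pathModel_good hk p).2 h), pathWeight, if_pos h]; rfl
  · rw [if_neg fun h' => h ((pathModel_good hk p).1 h'), pathWeight, if_neg h, zero_mul]

theorem pathWeight_nonneg (p : Fin n → Bool) : 0 ≤ pathWeight k p := by
  rw [pathWeight]
  split_ifs
  · exact lam_nonneg _ _
  · exact le_rfl

theorem dval_pos (hk : 3 ≤ k) : 0 < dval k := by
  have hk' : (3 : ℝ) ≤ k := by exact_mod_cast hk
  rw [dval]
  have := Real.cos_pos_of_mem_Ioo (x := Real.pi / k) ⟨by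
    have := Real.pi_pos; have : 0 < Real.pi / k := by positivity
    linarith, by
    exact div_lt_div_of_pos_left Real.pi_pos (by norm_num) (by linarith)⟩
  linarith

/-- This is the weighted trace of the empty word: each strand contributes one factor $d$. -/
theorem sum_pathWeight (hk : 3 ≤ k) : ∑ p : Fin n → Bool, pathWeight k p = lam k 1 * dval k ^ n := by
  have h : ∀ n : ℕ, (pathModel k hk).wtr (1 : Matrix (Fin n → Bool) (Fin n → Bool) ℝ) =
      lam k 1 * dval k ^ n := by
    intro n
    induction n with
    | zero =>
      rw [pow_zero, mul_one]
      exact (pathModel k hk).wtr_zero_strands [] (by simp)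
    | succ n ih =>
      have := (pathModel k hk).wtr_word_succ (n := n) (w := []) (by simp)
      simp only [StepModel.word, List.map_nil, List.prod_nil] at this
      rw [this, ih, pow_succ]
      change dval k * _ = _
      ring
  rw [← h n, pathModel_wtr_eq]
  simp

/-- The probability of a path in the path sampling algorithm. -/
def pathProb {n : ℕ} (k : ℕ) (p : Fin n → Bool) : ℝ :=
  pathWeight k p / ∑ p : Fin n → Bool, pathWeight k p

theorem sum_pathWeight_pos (hk : 3 ≤ k) : 0 < ∑ p : Fin n → Bool, pathWeight k p := by
  rw [sum_pathWeight hk]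
  exact mul_pos (lam_pos le_rfl (by omega)) (pow_pos (dval_pos hk) _)

theorem pathProb_nonneg (p : Fin n → Bool) : 0 ≤ pathProb k p :=
  div_nonneg (pathWeight_nonneg p) (Finset.sum_nonneg fun q _ => pathWeight_nonneg q)

theorem sum_pathProb (hk : 3 ≤ k) : ∑ p : Fin n → Bool, pathProb k p = 1 := by
  simp only [pathProb]
  rw [← Finset.sum_div, div_self (sum_pathWeight_pos hk).ne']

theorem pathProb_eq_zero {p : Fin n → Bool} (hp : ¬ IsPath k p) : pathProb k p = 0 := by
  rw [pathProb, pathWeight, if_neg hp, zero_div]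

/-- The state sum is the weighted trace of the expanded product, with one factor $d$ more than in
the bracket and a factor $\lambda_1$. Division by the total weight $\lambda_1d^n$ leaves the
prefactor $d^{n-1}$. -/
theorem jonesTrace_eq (hn : 1 ≤ n) (B : Braid n) : jonesTrace B k =
    (-rootA k) ^ (3 * (traceClosure B).writhe) * (dval k : ℂ) ^ (n - 1) *
      ∑ p, (pathProb k p : ℂ) * braidOp hk B p p := by
  have hl : (lam k 1 : ℂ) ≠ 0 := by exact_mod_cast (lam_pos le_rfl (by omega)).ne'
  have hd : (dval k : ℂ) ≠ 0 := by exact_mod_cast (dval_pos hk).ne'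
  have h1 : ∑ p, (pathWeight k p : ℂ) * braidOp hk B p p =
      lam k 1 * dval k * (traceClosure B).bracket (rootA k) := by
    simp only [braidOp_eq_sum, Matrix.sum_apply, Matrix.smul_apply, smul_eq_mul, Finset.mul_sum]
    rw [Finset.sum_comm, LinkDiagram.bracket, Finset.mul_sum]
    refine Finset.sum_congr rfl fun s _ => ?_
    have h2 := pathModel_wtr hk B s
    rw [pathModel_wtr_eq] at h2
    have h3 : ∑ p, (pathWeight k p : ℂ) * (Complex.ofRealHom.mapMatrix
        ((pathModel k hk).word n (stateWord B s))) p p =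
          lam k 1 * dval k ^ (traceClosure B).loops s := by
      have := congrArg (fun x : ℝ => (x : ℂ)) h2
      push_cast at this
      exact this
    -- The exponent `loops - 1` in the bracket is a truncated subtraction; it is harmless because a
    -- diagram with at least one strand has a loop.
    obtain ⟨l, hl'⟩ : ∃ l, (traceClosure B).loops s = l + 1 :=
      ⟨_, (Nat.succ_pred_eq_of_pos (loops_pos hn B s)).symm⟩
    rw [loopValue_rootA, hl', Nat.add_sub_cancel]
    rw [hl'] at h3
    calc _ = rootA k ^ (traceClosure B).stateExponent s * ∑ p, (pathWeight k p : ℂ) *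
          (Complex.ofRealHom.mapMatrix ((pathModel k hk).word n (stateWord B s))) p p := by
          rw [Finset.mul_sum]
          exact Finset.sum_congr rfl fun p _ => by ring
      _ = _ := by rw [h3, pow_succ]; ring
  have h2 : ∑ p, (pathProb k p : ℂ) * braidOp hk B p p =
      (∑ p, (pathWeight k p : ℂ) * braidOp hk B p p) / (lam k 1 * dval k ^ n) := by
    rw [Finset.sum_div]
    refine Finset.sum_congr rfl fun p _ => ?_
    rw [pathProb, sum_pathWeight hk]
    push_cast
    ring
  rw [h2, h1, jonesTrace, LinkDiagram.jones, mul_assoc]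
  congr 1
  obtain ⟨m, rfl⟩ : ∃ m, n = m + 1 := ⟨n - 1, by omega⟩
  rw [Nat.add_sub_cancel, pow_succ]
  field_simp

/-! ## Unitarity and the comparison with the matrices on paths -/

theorem norm_rootA (k : ℕ) : ‖rootA k‖ = 1 := by
  have : (-(Real.pi * Complex.I) / (2 * k) : ℂ) = ((-Real.pi / (2 * k) : ℝ) : ℂ) * Complex.I := by
    push_cast; ring
  rw [rootA, norm_mul, Complex.norm_I, one_mul, this, Complex.norm_exp_ofReal_mul_I]

theorem star_rootA (k : ℕ) : star (rootA k) = (rootA k)⁻¹ := by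
  rw [Complex.inv_eq_conj (norm_rootA k)]
  rfl

theorem star_crossingCoeff (b : Bool) : star (crossingCoeff k b) = (crossingCoeff k b)⁻¹ := by
  cases b
  · simp only [crossingCoeff, Bool.false_eq_true, if_false]
    rw [star_inv₀, star_rootA]
  · simpa [crossingCoeff] using star_rootA k

theorem crossingCoeff_ne_zero (b : Bool) : crossingCoeff k b ≠ 0 := by
  cases b <;> simp [crossingCoeff, rootA_ne_zero]

theorem crossingCoeff_sq_add (b : Bool) :
    crossingCoeff k b ^ 2 + (crossingCoeff k b)⁻¹ ^ 2 = -dval k := by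
  rw [← loopValue_rootA, loopValue]
  cases b
  · simp [crossingCoeff]
  · simp [crossingCoeff]; ring

/-- The local weight is symmetric, and exchanging the two walks does not change the site before the
pair. -/
theorem tl_symm (M : StepModel Bool) {i : ℕ} (h : i + 1 < n) (q p : Fin n → Bool) :
    M.tl n i q p = M.tl n i p q := by
  classical
  have key : ∀ q p : Fin n → Bool, M.tl n i q p ≠ 0 → M.tl n i q p = M.tl n i p q := by
    intro q p hne
    obtain ⟨-, hgp, -⟩ := M.tl_ne_zero h hne
    rw [M.tl_apply h] at hne
    obtain ⟨s, -, hs⟩ := Finset.exists_ne_zero_of_sum_ne_zero hne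
    obtain ⟨⟨hg, hq⟩, rfl⟩ : (M.Good q ∧ q ⟨i + 1, h⟩ = M.bar (q ⟨i, by omega⟩)) ∧
        p = M.pair i h s q := by
      by_contra hc
      exact hs (if_neg hc)
    have hinj : ∀ t u : Bool, M.pair i h t q = M.pair i h u q ↔ t = u := by
      intro t u
      constructor
      · intro e
        rw [← M.pair_left h t q, e, M.pair_left]
      · rintro rfl; rfl
    have e1 : ∀ t, (q = M.pair i h t q) ↔ t = q ⟨i, by omega⟩ := by
      intro t
      constructor
      · intro e
        conv_rhs => rw [e]
        rw [M.pair_left]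
      · rintro rfl
        exact (M.pair_self h hq).symm
    rw [M.tl_apply h, M.tl_apply h]
    simp only [hg, hq, hgp, M.pair_left, M.pair_right, M.pair_pair, true_and, hinj, e1,
      M.site_pair_le h _ _ le_rfl, Finset.sum_ite_eq, Finset.sum_ite_eq', Finset.mem_univ, if_true]
    rw [M.wt_comm]
  by_cases h1 : M.tl n i q p = 0
  · by_cases h2 : M.tl n i p q = 0
    · rw [h1, h2]
    · exact (key p q h2).symm
  · exact key q p h1

theorem conjTranspose_tlC {i : ℕ} (h : i + 1 < n) : (tlC hk n i).conjTranspose = tlC hk n i := by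
  ext q p
  rw [Matrix.conjTranspose_apply]
  simp only [tlC, RingHom.mapMatrix_apply, Matrix.map_apply, Complex.ofRealHom_eq_coe]
  rw [tl_symm _ h]
  exact Complex.conj_ofReal _

theorem tlC_mul_self {i : ℕ} (h : i + 1 < n) :
    tlC hk n i * tlC hk n i = (dval k : ℂ) • tlC hk n i := by
  rw [tlC, ← map_mul, (pathModel k hk).tl_mul_self h]
  ext q p
  simp [pathModel]

/-- For a real symmetric $E$ with $E^2=dE$ and $|a|=1$, the product $(a^{-1}E+a)(aE+a^{-1})$ equals
$1+(d+a^2+a^{-2})E$, and the bracket vanishes for the chosen $A$. -/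
theorem crossOp_unitary (c : Fin (n - 1) × Bool) :
    (crossOp hk c).conjTranspose * crossOp hk c = 1 := by
  have hc : (c.1 : ℕ) + 1 < n := by have := c.1.2; omega
  have ha := crossingCoeff_ne_zero (k := k) c.2
  have h2 := crossingCoeff_sq_add (k := k) c.2
  have e : (crossOp hk c).conjTranspose =
      (crossingCoeff k c.2)⁻¹ • tlC hk n c.1 + crossingCoeff k c.2 • 1 := by
    rw [crossOp, Matrix.conjTranspose_add, Matrix.conjTranspose_smul, Matrix.conjTranspose_smul,
      conjTranspose_tlC hk hc, star_crossingCoeff, Matrix.conjTranspose_one, star_inv₀,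
      star_crossingCoeff, inv_inv]
  rw [e, crossOp]
  generalize crossingCoeff k c.2 = a at *
  rw [add_mul, mul_add, mul_add, smul_mul_smul_comm, smul_mul_smul_comm, smul_mul_smul_comm,
    smul_mul_smul_comm, tlC_mul_self hk hc, one_mul, mul_one, one_mul, inv_mul_cancel₀ ha,
    mul_inv_cancel₀ ha, one_smul, one_smul]
  have : (dval k : ℂ) = -(a ^ 2 + a⁻¹ ^ 2) := by rw [h2, neg_neg]
  rw [this]
  module

theorem braidOp_unitary (B : Braid n) : (braidOp hk B).conjTranspose * braidOp hk B = 1 := by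
  induction B with
  | nil => simp [braidOp]
  | cons c B ih =>
    have e : braidOp hk (c :: B) = crossOp hk c * braidOp hk B := by simp [braidOp]
    rw [e, Matrix.conjTranspose_mul, Matrix.mul_assoc, ← Matrix.mul_assoc _ (crossOp hk c),
      crossOp_unitary, Matrix.one_mul, ih]

/-- The diagonal entries of `pathEntry` are the case of equal steps, in which the square root of a
square disappears; the denominator is evaluated at the site before the pair, which the two walks
share. -/
theorem pathEntry_eq_tl (i : Fin (n - 1)) {q p : Fin n → Bool} (hq : IsPath k q) :
    pathEntry k i q p = (pathModel k hk).tl n i q p := by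
  classical
  have hi : (i : ℕ) + 1 < n := by have := i.2; omega
  rw [(pathModel k hk).tl_apply hi]
  have hL : (⟨i, by omega⟩ : Fin n) = posL i := rfl
  have hR : (⟨i + 1, hi⟩ : Fin n) = posR i := rfl
  simp only [(pathModel_good hk q).2 hq, true_and, hL, hR]
  have hbar : ∀ b, (pathModel k hk).bar b = !b := fun _ => rfl
  by_cases hc : (∀ j, j ≠ posL i → j ≠ posR i → q j = p j) ∧
      p (posL i) ≠ p (posR i) ∧ q (posL i) ≠ q (posR i)
  · rw [pathEntry, if_pos hc]
    obtain ⟨h1, h2, h3⟩ := hc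
    have h2' : p (posR i) = !p (posL i) := by
      revert h2; cases p (posL i) <;> cases p (posR i) <;> simp
    have h3' : q (posR i) = !q (posL i) := by
      revert h3; cases q (posL i) <;> cases q (posR i) <;> simp
    have hpair : p = (pathModel k hk).pair i hi (p (posL i)) q := by
      funext j
      by_cases hj1 : j = posL i
      · rw [hj1]; exact ((pathModel k hk).pair_left hi _ q).symm
      by_cases hj2 : j = posR i
      · rw [hj2, h2']; exact ((pathModel k hk).pair_right hi _ q).symm
      rw [(pathModel k hk).pair_of_ne hi _ _ (fun h => hj1 (Fin.ext h)) (fun h => hj2 (Fin.ext h)),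
        h1 j hj1 hj2]
    rw [Finset.sum_eq_single (p (posL i))]
    · rw [if_pos (show q (posR i) = (pathModel k hk).bar (q (posL i)) ∧
        p = (pathModel k hk).pair i hi (p (posL i)) q from ⟨by rw [h3', hbar], hpair⟩),
        StepModel.wt, pathModel_site]
      have hs : site p i = site q i := by
        rw [hpair]; exact (pathModel k hk).site_pair_le hi _ _ le_rfl
      rw [hs]
      change _ = Real.sqrt (lam k (_ + if q (posL i) then 1 else -1) *
        lam k (_ + if p (posL i) then 1 else -1)) / lam k _
      rcases hqL : q (posL i) <;> rcases hpL : p (posL i) <;>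
        simp [Real.sqrt_mul_self (lam_nonneg k _), sub_eq_add_neg, mul_comm]
    · intro s _ hs
      refine if_neg ?_
      rintro ⟨-, h⟩
      apply hs
      rw [h]
      exact ((pathModel k hk).pair_left hi _ q).symm
    · simp
  · rw [pathEntry, if_neg hc]
    symm
    refine Finset.sum_eq_zero fun s _ => if_neg ?_
    rintro ⟨h1, rfl⟩
    refine hc ⟨fun j hj1 hj2 => ?_, ?_, ?_⟩
    · exact ((pathModel k hk).pair_of_ne hi _ _ (fun h => hj1 (Fin.ext h))
        (fun h => hj2 (Fin.ext h))).symm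
    · have e1 := (pathModel k hk).pair_left hi s q
      have e2 := (pathModel k hk).pair_right hi s q
      rw [hL] at e1
      rw [hR] at e2
      rw [e1, e2, hbar]
      cases s <;> simp
    · rw [h1, hbar]
      cases q (posL i) <;> simp

theorem crossOp_apply_eq_zero (c : Fin (n - 1) × Bool) {q p : Fin n → Bool} (hp : IsPath k p)
    (hq : ¬ IsPath k q) : crossOp hk c q p = 0 := by
  have hi : (c.1 : ℕ) + 1 < n := by have := c.1.2; omega
  have h1 : (pathModel k hk).tl n c.1 q p = 0 := by
    by_contra h
    exact hq ((pathModel_good hk q).1 ((pathModel k hk).tl_ne_zero hi h).1)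
  have h2 : q ≠ p := by rintro rfl; exact hq hp
  simp [crossOp, tlC, h1, Matrix.one_apply, h2]

theorem crossingMatrix_apply (c : Fin (n - 1) × Bool) {q p : Fin n → Bool} (hp : IsPath k p) :
    crossingMatrix k c q p = crossOp hk c q p := by
  classical
  by_cases hq : IsPath k q
  · rw [crossingMatrix, if_pos ⟨hp, hq⟩, pathEntry_eq_tl hk _ hq]
    rcases hb : c.2 <;> simp [crossOp, tlC, crossingCoeff, hb]
  · rw [crossOp_apply_eq_zero hk c hp hq, crossingMatrix, if_neg fun h => hq h.2]
    have h2 : q ≠ p := by rintro rfl; exact hq hp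
    simp [h2]

theorem braidOp_apply_eq_zero (B : Braid n) {q p : Fin n → Bool} (hp : IsPath k p)
    (hq : ¬ IsPath k q) : braidOp hk B q p = 0 := by
  induction B generalizing q with
  | nil =>
    have h2 : q ≠ p := by rintro rfl; exact hq hp
    simp [braidOp, h2]
  | cons c B ih =>
    have e : braidOp hk (c :: B) = crossOp hk c * braidOp hk B := by simp [braidOp]
    rw [e, Matrix.mul_apply]
    refine Finset.sum_eq_zero fun r _ => ?_
    by_cases hr : IsPath k r
    · rw [crossOp_apply_eq_zero hk c hr hq, zero_mul]
    · rw [ih hr, mul_zero]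

/-- The two families of crossing operators differ only on bit strings that are not paths. The span
of the paths is invariant under `crossOp`, so the columns that belong to paths agree. -/
theorem braidMatrix_apply (B : Braid n) {q p : Fin n → Bool} (hp : IsPath k p) :
    braidMatrix k B q p = braidOp hk B q p := by
  induction B generalizing q with
  | nil => simp [braidOp, braidMatrix]
  | cons c B ih =>
    have e : braidOp hk (c :: B) = crossOp hk c * braidOp hk B := by simp [braidOp]
    have e' : braidMatrix k (c :: B) = crossingMatrix k c * braidMatrix k B := by
      simp [braidMatrix]
    rw [e, e', Matrix.mul_apply, Matrix.mul_apply]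
    refine Finset.sum_congr rfl fun r _ => ?_
    rw [ih]
    by_cases hr : IsPath k r
    · rw [crossingMatrix_apply hk c hr]
    · rw [braidOp_apply_eq_zero hk B hp hr, mul_zero, mul_zero]

end Jones

/-! ## A Hoeffding bound -/

/-- For $|x|\le1$ one has $e^x\le1+x+x^2$; after averaging, $1+y\le e^y$. This elementary form of
Hoeffding's lemma loses only a constant factor. -/
theorem exp_moment_le {ι : Type*} [Fintype ι] {w f : ι → ℝ} (hw : ∀ i, 0 ≤ w i)
    (hs : ∑ i, w i = 1) (hf : ∀ i, |f i| ≤ 1) {t : ℝ} (ht : |t| ≤ 1) :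
    ∑ i, w i * Real.exp (t * f i) ≤ Real.exp (t * ∑ i, w i * f i + t ^ 2) := by
  have h1 : ∀ i, w i * Real.exp (t * f i) ≤ w i * (1 + t * f i + t ^ 2) := by
    intro i
    refine mul_le_mul_of_nonneg_left ?_ (hw i)
    have hx : |t * f i| ≤ 1 := by
      rw [abs_mul]; exact mul_le_one₀ ht (abs_nonneg _) (hf i)
    have h2 := (abs_le.1 (Real.abs_exp_sub_one_sub_id_le hx)).2
    have h3 : (t * f i) ^ 2 ≤ t ^ 2 := by
      rw [mul_pow]
      have : f i ^ 2 ≤ 1 := by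
        have := hf i
        rw [← sq_abs]; nlinarith [abs_nonneg (f i)]
      nlinarith [sq_nonneg t]
    linarith
  calc ∑ i, w i * Real.exp (t * f i) ≤ ∑ i, w i * (1 + t * f i + t ^ 2) :=
        Finset.sum_le_sum fun i _ => h1 i
    _ = ∑ i, (w i * (1 + t ^ 2) + t * (w i * f i)) :=
        Finset.sum_congr rfl fun i _ => by ring
    _ = t * ∑ i, w i * f i + t ^ 2 + 1 := by
        rw [Finset.sum_add_distrib, ← Finset.sum_mul, hs, ← Finset.mul_sum]; ring
    _ ≤ _ := Real.add_one_le_exp _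

open Classical in
theorem hoeffding_upper {ι : Type*} [Fintype ι] {w f : ι → ℝ} (hw : ∀ i, 0 ≤ w i)
    (hs : ∑ i, w i = 1) (hf : ∀ i, |f i| ≤ 1) (M : ℕ) {δ : ℝ} (h0 : 0 ≤ δ) (h2 : δ ≤ 2) :
    ∑ s : Fin M → ι with M * (∑ i, w i * f i + δ) ≤ ∑ j, f (s j), ∏ j, w (s j) ≤
      Real.exp (-(M * δ ^ 2 / 4)) := by
  set μ := ∑ i, w i * f i
  -- The choice that minimizes the exponent $M(t^2-t\delta)$; it also gives $|t|\le1$, as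
  -- `exp_moment_le` requires.
  set t := δ / 2 with ht
  have ht0 : 0 ≤ t := by positivity
  have ht1 : |t| ≤ 1 := by rw [abs_of_nonneg ht0]; linarith
  have hmom := exp_moment_le hw hs hf ht1
  have hprod : ∀ s : Fin M → ι, 0 ≤ ∏ j, w (s j) := fun s => Finset.prod_nonneg fun j _ => hw _
  calc ∑ s : Fin M → ι with M * (μ + δ) ≤ ∑ j, f (s j), ∏ j, w (s j)
      ≤ ∑ s : Fin M → ι with M * (μ + δ) ≤ ∑ j, f (s j),
          Real.exp (-(t * (M * (μ + δ)))) * ∏ j, (w (s j) * Real.exp (t * f (s j))) := by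
        refine Finset.sum_le_sum fun s hs' => ?_
        rw [Finset.prod_mul_distrib, ← Real.exp_sum, ← Finset.mul_sum]
        have : 1 ≤ Real.exp (-(t * (M * (μ + δ)))) * Real.exp (t * ∑ j, f (s j)) := by
          rw [← Real.exp_add, Real.one_le_exp_iff]
          have := mul_le_mul_of_nonneg_left (Finset.mem_filter.1 hs').2 ht0
          linarith
        nlinarith [hprod s]
    _ ≤ ∑ s : Fin M → ι, Real.exp (-(t * (M * (μ + δ)))) *
          ∏ j, (w (s j) * Real.exp (t * f (s j))) := by
        refine Finset.sum_le_sum_of_subset_of_nonneg (Finset.filter_subset _ _) fun s _ _ => ?_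
        exact mul_nonneg (Real.exp_pos _).le
          (Finset.prod_nonneg fun j _ => mul_nonneg (hw _) (Real.exp_pos _).le)
    _ = Real.exp (-(t * (M * (μ + δ)))) * (∑ i, w i * Real.exp (t * f i)) ^ M := by
        rw [← Finset.mul_sum, Fintype.sum_pow]
    _ ≤ Real.exp (-(t * (M * (μ + δ)))) * Real.exp (t * μ + t ^ 2) ^ M := by
        refine mul_le_mul_of_nonneg_left (pow_le_pow_left₀ ?_ hmom M) (Real.exp_pos _).le
        exact Finset.sum_nonneg fun i _ => mul_nonneg (hw _) (Real.exp_pos _).le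
    _ = _ := by
        rw [← Real.exp_nat_mul, ← Real.exp_add]
        congr 1
        rw [ht]
        ring

open Classical in
theorem hoeffding_abs {ι : Type*} [Fintype ι] {w f : ι → ℝ} (hw : ∀ i, 0 ≤ w i)
    (hs : ∑ i, w i = 1) (hf : ∀ i, |f i| ≤ 1) (M : ℕ) {δ : ℝ} (h0 : 0 ≤ δ) (h2 : δ ≤ 2) :
    ∑ s : Fin M → ι with M * δ ≤ |∑ j, f (s j) - M * ∑ i, w i * f i|, ∏ j, w (s j) ≤
      2 * Real.exp (-(M * δ ^ 2 / 4)) := by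
  have hprod : ∀ s : Fin M → ι, 0 ≤ ∏ j, w (s j) := fun s => Finset.prod_nonneg fun j _ => hw _
  have h1 := hoeffding_upper hw hs hf M h0 h2
  have h3 := hoeffding_upper (f := fun i => -f i) hw hs (fun i => by rw [abs_neg]; exact hf i) M h0 h2
  rw [two_mul]
  refine le_trans ?_ (add_le_add h1 h3)
  refine le_trans (Finset.sum_le_sum_of_subset_of_nonneg (t := (Finset.univ.filter fun s : Fin M → ι =>
    M * (∑ i, w i * f i + δ) ≤ ∑ j, f (s j)) ∪ (Finset.univ.filter fun s : Fin M → ι =>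
    M * (∑ i, w i * (-f i) + δ) ≤ ∑ j, -f (s j))) ?_ fun s _ _ => hprod s) ?_
  · intro s hs'
    simp only [Finset.mem_union, Finset.mem_filter, Finset.mem_univ, true_and] at hs' ⊢
    rcases le_abs.1 hs' with h | h
    · left; linarith
    · right
      simp only [mul_neg, Finset.sum_neg_distrib]
      linarith
  · rw [← Finset.sum_union_inter]
    exact le_add_of_nonneg_right (Finset.sum_nonneg fun s _ => hprod s)

/-! ## The path sampling algorithm -/

section Sampling

variable {n k : ℕ} (hk : 3 ≤ k) (B : Braid n)

/-- The outcome of a Hadamard test as a real number. -/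
def signR (b : Bool) : ℝ := if b then 1 else -1

theorem sign_eq (b : Bool) : sign b = (signR b : ℂ) := by
  cases b <;> simp [sign, signR]

theorem abs_signR (b : Bool) : |signR b| = 1 := by
  cases b <;> simp [signR]

theorem sum_norm_sq_braidOp (p : Fin n → Bool) : ∑ q, ‖braidOp hk B q p‖ ^ 2 = 1 := by
  have h := congrFun (congrFun (braidOp_unitary hk B) p) p
  rw [Matrix.mul_apply, Matrix.one_apply_eq] at h
  have h' : ((∑ q, ‖braidOp hk B q p‖ ^ 2 : ℝ) : ℂ) = 1 := by
    rw [← h]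
    push_cast
    refine Finset.sum_congr rfl fun q _ => ?_
    rw [Matrix.conjTranspose_apply]
    exact (Complex.conj_mul' _).symm
  exact_mod_cast h'

/-- Expanding the squared norms, the cross terms vanish off the diagonal, and the squares of the
column of a unitary matrix add up to 1. -/
theorem hadamardProb_eq {u : ℂ} (hu : ‖u‖ = 1) {p : Fin n → Bool} (hp : IsPath k p) (b : Bool) :
    hadamardProb k B u p b = (1 + signR b * (u * braidOp hk B p p).re) / 2 := by
  have h1 : ∀ q, ‖((1 : Matrix (Fin n → Bool) (Fin n → Bool) ℂ) q p +
      sign b * u * braidMatrix k B q p) / 2‖ ^ 2 =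
      (if q = p then (1 + 2 * signR b * (u * braidOp hk B p p).re) else 0) / 4 +
        ‖braidOp hk B q p‖ ^ 2 / 4 := by
    intro q
    rw [braidMatrix_apply hk B hp, norm_div, div_pow, sign_eq]
    have hn : ‖(signR b : ℂ) * u * braidOp hk B q p‖ = ‖braidOp hk B q p‖ := by
      rw [norm_mul, norm_mul, hu, Complex.norm_real, Real.norm_eq_abs, abs_signR]; ring
    have h2 : ‖(2 : ℂ)‖ ^ 2 = 4 := by norm_num
    rw [h2, Complex.sq_norm, Complex.normSq_add, ← Complex.sq_norm, ← Complex.sq_norm, hn]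
    by_cases hq : q = p
    · subst hq
      rw [Matrix.one_apply_eq, if_pos rfl, one_mul, norm_one, Complex.conj_re, mul_assoc,
        Complex.re_ofReal_mul]
      ring
    · rw [Matrix.one_apply_ne hq, if_neg hq]
      simp
  rw [hadamardProb, Finset.sum_congr rfl fun q _ => h1 q, Finset.sum_add_distrib,
    ← Finset.sum_div, ← Finset.sum_div, sum_norm_sq_braidOp]
  simp only [Finset.sum_ite_eq', Finset.mem_univ, if_true]
  ring

theorem roundProb_eq {u : ℂ} (hu : ‖u‖ = 1) (x : (Fin n → Bool) × Bool) :
    roundProb k B u x = pathProb k x.1 * ((1 + signR x.2 * (u * braidOp hk B x.1 x.1).re) / 2) := by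
  rw [roundProb]
  change pathProb k x.1 * _ = _
  by_cases hp : IsPath k x.1
  · rw [hadamardProb_eq hk B hu hp]
  · rw [pathProb_eq_zero hp, zero_mul, zero_mul]

theorem roundProb_nonneg (u : ℂ) (x : (Fin n → Bool) × Bool) : 0 ≤ roundProb k B u x :=
  mul_nonneg (pathProb_nonneg _) (Finset.sum_nonneg fun q _ => by positivity)

theorem sum_roundProb {u : ℂ} (hk : 3 ≤ k) (hu : ‖u‖ = 1) : ∑ x, roundProb k B u x = 1 := by
  rw [Fintype.sum_prod_type]
  simp only [roundProb_eq hk B hu, Fintype.sum_bool, signR]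
  refine Eq.trans (Finset.sum_congr rfl fun p _ => ?_) (sum_pathProb (n := n) hk)
  simp only [if_true, Bool.false_eq_true, if_false]
  ring

theorem sum_roundProb_signR {u : ℂ} (hu : ‖u‖ = 1) : ∑ x, roundProb k B u x * signR x.2 =
    (u * ∑ p, (pathProb k p : ℂ) * braidOp hk B p p).re := by
  rw [Fintype.sum_prod_type, Finset.mul_sum, Complex.re_sum]
  refine Finset.sum_congr rfl fun p _ => ?_
  simp only [roundProb_eq hk B hu, Fintype.sum_bool, signR, if_true, Bool.false_eq_true, if_false]
  rw [mul_left_comm, Complex.re_ofReal_mul]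
  ring

theorem neg_rootA_zpow_norm (e : ℤ) : ‖(-rootA k) ^ e‖ = 1 := by
  rw [norm_zpow, norm_neg, norm_rootA, one_zpow]

/-- Since $e^{-1}\le1/2$, the summand 2 in the exponent pays for the factor 4, which comes from two
tails for each of the real and the imaginary part. -/
theorem four_mul_exp_le (q : ℕ) : 4 * Real.exp (-((q : ℝ) + 2)) ≤ (1 / 2) ^ q := by
  have h1 : Real.exp (-((q : ℝ) + 2)) = Real.exp (-1) ^ (q + 2) := by
    rw [← Real.exp_nat_mul]; push_cast; ring_nf
  have h2 : Real.exp (-1) ≤ 1 / 2 := by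
    rw [Real.exp_neg, inv_eq_one_div]
    exact one_div_le_one_div_of_le (by norm_num) (by linarith [Real.add_one_le_exp (1 : ℝ)])
  calc 4 * Real.exp (-((q : ℝ) + 2)) ≤ 4 * (1 / 2) ^ (q + 2) := by
        rw [h1]
        exact mul_le_mul_of_nonneg_left (pow_le_pow_left₀ (Real.exp_pos _).le h2 _) (by norm_num)
    _ = _ := by rw [pow_add]; ring

theorem half_le_abs_re_or_im {z : ℂ} {ε : ℝ} (h : ε ≤ ‖z‖) : ε / 2 ≤ |z.re| ∨ ε / 2 ≤ |z.im| := by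
  by_contra hc
  push Not at hc
  have := Complex.norm_le_abs_re_add_abs_im z
  linarith

/-- The prefactor has modulus $d^{n-1}$, so a failure forces the average of the real or of the
imaginary outcomes to deviate by at least $\varepsilon/2$. A union bound over the two batches of
rounds finishes; a batch that is not involved sums to 1. -/
theorem samplingFailure_le (hk : 3 ≤ k) (hn : 1 ≤ n) (M : ℕ) (hM : 0 < M) {ε : ℝ} (h0 : 0 < ε)
    (h1 : ε ≤ 1) : samplingFailure k B M (jonesTrace B k) (ε * dval k ^ (n - 1)) ≤
      4 * Real.exp (-(M * ε ^ 2 / 16)) := by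
  classical
  have hu1 : ‖(1 : ℂ)‖ = 1 := norm_one
  have hu2 : ‖-Complex.I‖ = 1 := by rw [norm_neg, Complex.norm_I]
  set κ := ∑ p, (pathProb k p : ℂ) * braidOp hk B p p with hκ
  have hd := dval_pos hk
  have hM' : (0 : ℝ) < M := by exact_mod_cast hM
  have key : ∀ s : (Fin M → (Fin n → Bool) × Bool) × (Fin M → (Fin n → Bool) × Bool),
      ¬ ‖samplingOutput k B s.1 s.2 - jonesTrace B k‖ < ε * dval k ^ (n - 1) →
        M * (ε / 2) ≤ |∑ j, signR (s.1 j).2 - M * ∑ x, roundProb k B 1 x * signR x.2| ∨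
        M * (ε / 2) ≤ |∑ j, signR (s.2 j).2 - M * ∑ x, roundProb k B (-Complex.I) x * signR x.2| := by
    intro s hs
    rw [sum_roundProb_signR hk B hu1, sum_roundProb_signR hk B hu2, ← hκ]
    rw [not_lt, jonesTrace_eq hk hn, ← hκ, samplingOutput, ← mul_sub, norm_mul, norm_mul,
      neg_rootA_zpow_norm, norm_pow, Complex.norm_real, Real.norm_eq_abs, abs_of_pos hd, one_mul,
      mul_comm ε] at hs
    have hs := le_of_mul_le_mul_left hs (pow_pos hd _)
    have hre : ((∑ j, (sign (s.1 j).2 + Complex.I * sign (s.2 j).2)) / (M : ℂ) - κ) =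
        (((∑ j, signR (s.1 j).2 - M * κ.re) / M : ℝ) : ℂ) +
        (((∑ j, signR (s.2 j).2 - M * κ.im) / M : ℝ) : ℂ) * Complex.I := by
      have hMC : (M : ℂ) ≠ 0 := by exact_mod_cast hM.ne'
      simp only [sign_eq]
      rw [Finset.sum_add_distrib, ← Finset.mul_sum]
      push_cast
      conv_lhs => rw [← Complex.re_add_im κ]
      field_simp
      ring
    rcases half_le_abs_re_or_im hs with h | h
    · left
      simp only [hre, Complex.add_re, Complex.ofReal_re, Complex.re_ofReal_mul, Complex.I_re,
        mul_zero, add_zero] at h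
      rw [abs_div, abs_of_pos hM', le_div_iff₀ hM'] at h
      simpa [mul_comm] using h
    · right
      simp only [hre, Complex.add_im, Complex.ofReal_im, Complex.im_ofReal_mul, Complex.I_im,
        mul_one, zero_add] at h
      rw [abs_div, abs_of_pos hM', le_div_iff₀ hM'] at h
      -- The start with $u=-i$ turns the real part of the test into the imaginary part.
      have e : (-Complex.I * κ).re = κ.im := by simp
      rw [e]
      simpa [mul_comm] using h
  have hone : ∀ u : ℂ, ‖u‖ = 1 →
      ∑ s : Fin M → (Fin n → Bool) × Bool, ∏ j, roundProb k B u (s j) = 1 := by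
    intro u hu
    rw [← Fintype.sum_pow, sum_roundProb B hk hu, one_pow]
  have hbound : ∀ u : ℂ, ‖u‖ = 1 → ∑ s : Fin M → (Fin n → Bool) × Bool with
      M * (ε / 2) ≤ |∑ j, signR (s j).2 - M * ∑ x, roundProb k B u x * signR x.2|,
        ∏ j, roundProb k B u (s j) ≤ 2 * Real.exp (-(M * ε ^ 2 / 16)) := by
    intro u hu
    refine (hoeffding_abs (f := fun x : (Fin n → Bool) × Bool => signR x.2)
      (roundProb_nonneg B u) (sum_roundProb B hk hu) (fun x => (abs_signR _).le) M
      (by positivity : (0 : ℝ) ≤ ε / 2) (by linarith)).trans (le_of_eq ?_)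
    ring_nf
  have hnn : ∀ s : (Fin M → (Fin n → Bool) × Bool) × (Fin M → (Fin n → Bool) × Bool),
      0 ≤ (∏ j, roundProb k B 1 (s.1 j)) * ∏ j, roundProb k B (-Complex.I) (s.2 j) := fun s =>
    mul_nonneg (Finset.prod_nonneg fun j _ => roundProb_nonneg B _ _)
      (Finset.prod_nonneg fun j _ => roundProb_nonneg B _ _)
  rw [samplingFailure]
  set F1 := Finset.univ.filter fun s : Fin M → (Fin n → Bool) × Bool =>
    M * (ε / 2) ≤ |∑ j, signR (s j).2 - M * ∑ x, roundProb k B 1 x * signR x.2| with hF1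
  set F2 := Finset.univ.filter fun s : Fin M → (Fin n → Bool) × Bool =>
    M * (ε / 2) ≤ |∑ j, signR (s j).2 - M * ∑ x, roundProb k B (-Complex.I) x * signR x.2| with hF2
  refine le_trans (Finset.sum_le_sum_of_subset_of_nonneg
    (t := (F1 ×ˢ Finset.univ) ∪ (Finset.univ ×ˢ F2)) ?_ fun s _ _ => hnn s) ?_
  · intro s hs
    simp only [Finset.mem_filter, Finset.mem_univ, true_and, Finset.mem_union,
      Finset.mem_product, and_true, hF1, hF2] at hs ⊢
    exact key s hs
  refine le_trans (le_add_of_nonneg_right (Finset.sum_nonneg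
    (s := (F1 ×ˢ Finset.univ) ∩ (Finset.univ ×ˢ F2)) fun s _ => hnn s)) ?_
  rw [Finset.sum_union_inter, Finset.sum_product, Finset.sum_product]
  simp only [← Finset.mul_sum, hone _ hu2, mul_one]
  rw [← Finset.sum_mul, hone _ hu1, one_mul]
  linarith [hbound _ hu1, hbound _ hu2]

theorem exists_samplingFailure_le (p q : MvPolynomial (Fin 3) ℕ) :
    ∃ M : MvPolynomial (Fin 3) ℕ, ∀ (n k : ℕ), 1 ≤ n → 3 ≤ k → ∀ B : Braid n,
      samplingFailure k B (polyVal M B k) (jonesTrace B k)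
        (1 / ((polyVal p B k : ℝ) + 1) * dval k ^ (n - 1)) ≤ (1 / 2) ^ polyVal q B k := by
  -- With $\varepsilon=1/(p+1)$ this makes $M\varepsilon^2/16=q+2$, the exponent of
  -- `four_mul_exp_le`.
  refine ⟨16 * (q + 2) * (p + 1) ^ 2, fun n k hn hk B => ?_⟩
  set P := polyVal p B k with hP
  set Q := polyVal q B k with hQ
  have hM : polyVal (16 * (q + 2) * (p + 1) ^ 2) B k = 16 * (Q + 2) * (P + 1) ^ 2 := by
    simp [polyVal, hP, hQ]
  rw [hM]
  have hP0 : (0 : ℝ) < (P : ℝ) + 1 := by positivity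
  refine (samplingFailure_le B hk hn _ (by positivity) (by positivity) ?_).trans
    (le_trans (le_of_eq ?_) (four_mul_exp_le Q))
  · rw [div_le_one hP0]
    linarith [(Nat.cast_nonneg P : (0 : ℝ) ≤ P)]
  · congr 2
    push_cast
    field_simp

end Sampling

/-! ## The action of circuits on basis vectors -/

/-- A vector of the computational basis. -/
def ket (S : Finset ℕ) : QState := fun x => if x = S then 1 else 0

theorem ket_self (S : Finset ℕ) : ket S S = 1 := if_pos rfl

theorem ket_of_ne {S x : Finset ℕ} (h : x ≠ S) : ket S x = 0 := if_neg h

/-- The action of a gate as a linear map. -/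
def Gate.lin (g : Gate) : QState →ₗ[ℂ] QState where
  toFun := g.apply
  map_add' ψ φ := by
    funext x
    cases g with
    | had i => simp only [Gate.apply, Pi.add_apply]; ring
    | cnot c t => simp only [Gate.apply, Pi.add_apply]; split_ifs <;> rfl
    | cphase j a b => simp only [Gate.apply, Pi.add_apply]; split_ifs <;> ring
  map_smul' r ψ := by
    funext x
    cases g with
    | had i => simp only [Gate.apply, Pi.smul_apply, smul_eq_mul, RingHom.id_apply]; ring
    | cnot c t =>
      simp only [Gate.apply, Pi.smul_apply, smul_eq_mul, RingHom.id_apply]; split_ifs <;> rfl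
    | cphase j a b =>
      simp only [Gate.apply, Pi.smul_apply, smul_eq_mul, RingHom.id_apply]; split_ifs <;> ring

/-- The action of a circuit as a linear map. -/
def act : List Gate → QState →ₗ[ℂ] QState
  | [] => LinearMap.id
  | g :: C => act C ∘ₗ g.lin

@[simp] theorem act_nil (ψ : QState) : act [] ψ = ψ := rfl

@[simp] theorem act_cons (g : Gate) (C : List Gate) (ψ : QState) :
    act (g :: C) ψ = act C (g.lin ψ) := rfl

@[simp] theorem act_append (C D : List Gate) (ψ : QState) :
    act (C ++ D) ψ = act D (act C ψ) := by
  induction C generalizing ψ with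
  | nil => rfl
  | cons g C ih => simp [ih]

theorem zeroState_eq : zeroState = ket ∅ := rfl

theorem runCircuit_eq (C : List Gate) : runCircuit C = act C (ket ∅) := by
  rw [runCircuit, zeroState_eq]
  generalize ket ∅ = ψ
  induction C generalizing ψ with
  | nil => rfl
  | cons g C ih => rw [List.foldl_cons, act_cons, ih]; rfl

theorem had_ket {a : ℕ} {S : Finset ℕ} (h : a ∉ S) :
    (Gate.had a).lin (ket S) = ((Real.sqrt 2 : ℂ)⁻¹) • (ket S + ket (insert a S)) := by
  funext x
  change (ket S (x.erase a) + (if a ∈ x then -1 else 1) * ket S (insert a x)) / _ = _ * (_ + _)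
  rw [ket_of_ne (S := S) (x := insert a x) (fun e => h (e ▸ Finset.mem_insert_self a x)),
    mul_zero, add_zero, div_eq_inv_mul]
  congr 1
  by_cases hx : a ∈ x
  · rw [ket_of_ne (S := S) (x := x) (fun e => h (e ▸ hx)), zero_add]
    refine if_congr ⟨fun e => ?_, fun e => ?_⟩ rfl rfl
    · rw [← e, Finset.insert_erase hx]
    · rw [e, Finset.erase_insert h]
  · rw [ket_of_ne (S := insert a S) (x := x) (fun e => hx (e ▸ Finset.mem_insert_self a S)),
      add_zero, Finset.erase_eq_of_notMem hx]

theorem had_ket_insert {a : ℕ} {S : Finset ℕ} (h : a ∉ S) :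
    (Gate.had a).lin (ket (insert a S)) = ((Real.sqrt 2 : ℂ)⁻¹) • (ket S - ket (insert a S)) := by
  funext x
  change (ket _ (x.erase a) + (if a ∈ x then -1 else 1) * ket _ (insert a x)) / _ = _ * (_ - _)
  rw [ket_of_ne (x := x.erase a) (fun e => Finset.notMem_erase a x
    (e ▸ Finset.mem_insert_self a S)), zero_add, div_eq_inv_mul]
  congr 1
  by_cases hx : a ∈ x
  · rw [ket_of_ne (S := S) (x := x) (fun e => h (e ▸ hx)), zero_sub, if_pos hx,
      Finset.insert_eq_of_mem hx, neg_one_mul]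
  · rw [ket_of_ne (S := insert a S) (x := x) (fun e => hx (e ▸ Finset.mem_insert_self a S)),
      sub_zero, if_neg hx, one_mul]
    refine if_congr ⟨fun e => ?_, fun e => by rw [e]⟩ rfl rfl
    rw [← Finset.erase_insert hx, e, Finset.erase_insert h]

theorem cnot_ket {c t : ℕ} (h : c ≠ t) (S : Finset ℕ) :
    (Gate.cnot c t).lin (ket S) = ket (if c ∈ S then symmDiff S {t} else S) := by
  funext x
  change (if c ≠ t ∧ c ∈ x then ket S (symmDiff x {t}) else ket S x) = _
  have hmem : ∀ y : Finset ℕ, c ∈ symmDiff y {t} ↔ c ∈ y := by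
    intro y; simp [Finset.mem_symmDiff, h]
  have hinv : ∀ y : Finset ℕ, symmDiff (symmDiff y {t}) {t} = y := by
    intro y; rw [symmDiff_assoc, symmDiff_self, symmDiff_bot]
  by_cases hx : c ∈ x
  · rw [if_pos ⟨h, hx⟩]
    by_cases hS : c ∈ S
    · rw [if_pos hS]
      refine if_congr ⟨fun e => by rw [← e, hinv], fun e => by rw [e, hinv]⟩ rfl rfl
    · rw [if_neg hS, ket_of_ne, ket_of_ne]
      · rintro rfl; exact hS hx
      · rintro rfl; exact hS ((hmem x).2 hx)
  · rw [if_neg fun h' => hx h'.2]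
    by_cases hS : c ∈ S
    · rw [if_pos hS, ket_of_ne, ket_of_ne]
      · rintro rfl; exact hx ((hmem S).2 hS)
      · rintro rfl; exact hx hS
    · rw [if_neg hS]

theorem cnot_ket_of_notMem {c t : ℕ} {S : Finset ℕ} (hS : c ∉ S) :
    (Gate.cnot c t).lin (ket S) = ket S := by
  by_cases h : c = t
  · funext x
    change (if c ≠ t ∧ c ∈ x then _ else ket S x) = _
    simp [h]
  · rw [cnot_ket h, if_neg hS]

/-- The phase of the gate `cphase j`. -/
def phase (j : ℕ) : ℂ := Complex.exp (2 * Real.pi * Complex.I / 2 ^ j)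

theorem cphase_ket (j a b : ℕ) (S : Finset ℕ) :
    (Gate.cphase j a b).lin (ket S) = (if a ∈ S ∧ b ∈ S then phase j else 1) • ket S := by
  funext x
  change (if a ∈ x ∧ b ∈ x then phase j * ket S x else ket S x) = _ * ket S x
  by_cases hx : x = S
  · rw [hx]; split_ifs <;> ring
  · rw [ket_of_ne hx]; simp

theorem act_replicate_cphase (t j a b : ℕ) (S : Finset ℕ) :
    act (List.replicate t (Gate.cphase j a b)) (ket S) =
      (if a ∈ S ∧ b ∈ S then phase j ^ t else 1) • ket S := by
  induction t with
  | zero => simp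
  | succ t ih =>
    rw [List.replicate_succ, act_cons, cphase_ket, map_smul, ih, smul_smul]
    split_ifs
    · rw [pow_succ']
    · rw [one_mul]

theorem phase_pow (j t : ℕ) : phase j ^ t = Complex.exp ((2 * Real.pi * t / 2 ^ j : ℝ) * Complex.I) := by
  rw [phase, ← Complex.exp_nat_mul]
  congr 1
  push_cast
  ring

theorem phase_pow_two_pow (j : ℕ) : phase j ^ 2 ^ j = 1 := by
  rw [phase, ← Complex.exp_nat_mul]
  have : ((2 ^ j : ℕ) : ℂ) * (2 * Real.pi * Complex.I / 2 ^ j) = 2 * Real.pi * Complex.I := by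
    push_cast
    field_simp
  rw [this, Complex.exp_two_pi_mul_I]

theorem phase_ne_zero (j : ℕ) : phase j ≠ 0 := Complex.exp_ne_zero _

theorem phase_pow_sub (j : ℕ) {t : ℕ} (h : t ≤ 2 ^ j) :
    phase j ^ (2 ^ j - t) = (phase j ^ t)⁻¹ := by
  refine eq_inv_of_mul_eq_one_left ?_
  rw [← pow_add, Nat.sub_add_cancel h, phase_pow_two_pow]

theorem phase_succ_sq (j : ℕ) : phase (j + 1) ^ 2 = phase j := by
  rw [phase, phase, ← Complex.exp_nat_mul]
  congr 1
  rw [pow_succ]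
  push_cast
  field_simp

theorem phase_two : phase 2 = Complex.I := by
  rw [phase]
  have : (2 * Real.pi * Complex.I / 2 ^ 2 : ℂ) = Real.pi / 2 * Complex.I := by ring
  rw [this, Complex.exp_pi_div_two_mul_I]

theorem inv_sqrt_two_sq : ((Real.sqrt 2 : ℂ)⁻¹) * (Real.sqrt 2 : ℂ)⁻¹ = 1 / 2 := by
  rw [← mul_inv, ← Complex.ofReal_mul, Real.mul_self_sqrt (by norm_num)]
  norm_num

/-! ## A phase about a vector in the plane of two basis vectors -/

/-- The superposition `α |S⟩ + β |S ∪ {a}⟩`. -/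
def qpair (a : ℕ) (S : Finset ℕ) (α β : ℂ) : QState := α • ket S + β • ket (insert a S)

theorem qpair_smul (a : ℕ) (S : Finset ℕ) (r α β : ℂ) :
    r • qpair a S α β = qpair a S (r * α) (r * β) := by
  rw [qpair, qpair, smul_add, smul_smul, smul_smul]

theorem had_qpair {a : ℕ} {S : Finset ℕ} (h : a ∉ S) (α β : ℂ) :
    (Gate.had a).lin (qpair a S α β) =
      (Real.sqrt 2 : ℂ)⁻¹ • qpair a S (α + β) (α - β) := by
  rw [qpair, map_add, map_smul, map_smul, had_ket h, had_ket_insert h, qpair]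
  module

theorem phase_qpair {a : ℕ} {S : Finset ℕ} (h : a ∉ S) (j t : ℕ) (α β : ℂ) :
    act (List.replicate t (Gate.cphase j a a)) (qpair a S α β) =
      qpair a S α (phase j ^ t * β) := by
  rw [qpair, map_add, map_smul, map_smul, act_replicate_cphase, act_replicate_cphase, qpair]
  simp only [h, and_self, if_false, Finset.mem_insert_self, if_true]
  module

theorem cphase_qpair {a u : ℕ} {S : Finset ℕ} (h : a ∉ S) (hu : u ≠ a) (j t : ℕ) (α β : ℂ) :
    act (List.replicate t (Gate.cphase j u a)) (qpair a S α β) =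
      qpair a S α ((if u ∈ S then phase j ^ t else 1) * β) := by
  rw [qpair, map_add, map_smul, map_smul, act_replicate_cphase, act_replicate_cphase, qpair]
  simp only [h, and_false, if_false, Finset.mem_insert_self, and_true, Finset.mem_insert, hu,
    false_or]
  module

theorem cnot_qpair {a u v : ℕ} {S : Finset ℕ} (huv : u ≠ v) (hu : u ≠ a) (hv : v ≠ a) (α β : ℂ) :
    (Gate.cnot u v).lin (qpair a S α β) = qpair a (if u ∈ S then symmDiff S {v} else S) α β := by
  rw [qpair, map_add, map_smul, map_smul, cnot_ket huv, cnot_ket huv, qpair]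
  congr 3
  simp only [Finset.mem_insert, hu, false_or]
  split_ifs
  · ext x
    simp only [Finset.mem_symmDiff, Finset.mem_insert, Finset.mem_singleton]
    by_cases hx : x = a
    · subst hx; simp [Ne.symm hv]
    · simp [hx]
  · rfl

/-- The gates of a phase about a vector, controlled by the qubits `u` and `v`, without the
initial and the final controlled NOT. -/
def midGates (J a u v t r : ℕ) : List Gate :=
  List.replicate 1 (Gate.cphase 2 a a) ++ ([Gate.had a] ++ (List.replicate (2 ^ J - t) (Gate.cphase J a a) ++
  ([Gate.had a] ++ (List.replicate r (Gate.cphase (J + 1) u a) ++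
  (List.replicate r (Gate.cphase (J + 1) v a) ++ ([Gate.cnot u v] ++
  (List.replicate (2 * 2 ^ J - r) (Gate.cphase (J + 1) v a) ++ ([Gate.cnot u v] ++
  ([Gate.had a] ++ (List.replicate t (Gate.cphase J a a) ++ ([Gate.had a] ++
    List.replicate 3 (Gate.cphase 2 a a))))))))))))

/-- The gates of a phase about a vector in the plane of `|a⟩` and `|b⟩`, controlled by the qubits
`u` and `v`. -/
def blockGates (J a b u v t r : ℕ) : List Gate :=
  [Gate.cnot a b] ++ (midGates J a u v t r ++ [Gate.cnot a b])

/-- The entries of the projection to the vector `(sin φ, cos φ)`, where `w = e^{2 i φ}`; the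
first coordinate belongs to `true`. -/
def proj (w : ℂ) (s t : Bool) : ℂ :=
  if s then (if t then (2 - w - w⁻¹) / 4 else (w - w⁻¹) / (4 * Complex.I))
  else (if t then (w - w⁻¹) / (4 * Complex.I) else (2 + w + w⁻¹) / 4)

/-- The first gates on the qubit `a` ($i$, Hadamard, inverse of $w$, Hadamard) rotate the vector
$(\sin\varphi,\cos\varphi)$ into the basis vector with `a` set, where a phase controlled by `u` and
`v` is applied; the last gates undo the rotation. Inverse phases are obtained by completing the full
turn of $2^J$ gates, and $i^{-1}$ as $i^3$. -/
theorem act_midGates {J a u v t r : ℕ} {S : Finset ℕ} (ha : a ∉ S) (hu : u ≠ a) (hv : v ≠ a)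
    (huv : u ≠ v) (ht : t ≤ 2 ^ J) (hr : r ≤ 2 ^ J) (α β : ℂ) :
    act (midGates J a u v t r) (qpair a S α β) = qpair a S
      (α + ((if u ∈ S ∧ v ∈ S then phase J ^ r else 1) - 1) *
        (proj (phase J ^ t) true true * α + proj (phase J ^ t) true false * β))
      (β + ((if u ∈ S ∧ v ∈ S then phase J ^ r else 1) - 1) *
        (proj (phase J ^ t) false true * α + proj (phase J ^ t) false false * β)) := by
  have hw := pow_ne_zero t (phase_ne_zero J)
  have ha' : a ∉ (if u ∈ S then symmDiff S {v} else S) := by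
    split_ifs
    · simp [Finset.mem_symmDiff, ha, Ne.symm hv]
    · exact ha
  have hu' : u ∈ (if u ∈ S then symmDiff S {v} else S) ↔ u ∈ S := by
    split_ifs with h
    · simp [Finset.mem_symmDiff, h, huv]
    · rfl
  have hv' : v ∈ (if u ∈ S then symmDiff S {v} else S) ↔ (u ∈ S ↔ ¬ v ∈ S) := by
    split_ifs with h
    · simp [Finset.mem_symmDiff, h]
    · simp [h]
  have hback : (if u ∈ (if u ∈ S then symmDiff S {v} else S) then
      symmDiff (if u ∈ S then symmDiff S {v} else S) {v} else
        (if u ∈ S then symmDiff S {v} else S)) = S := by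
    simp only [hu']
    split_ifs with h
    · rw [symmDiff_assoc, symmDiff_self, symmDiff_bot]
    · rfl
  have h2 : 2 * 2 ^ J = 2 ^ (J + 1) := by rw [pow_succ, mul_comm]
  have hη : phase (J + 1) ^ (2 * 2 ^ J - r) = (phase (J + 1) ^ r)⁻¹ := by
    rw [h2, phase_pow_sub _ (by rw [← h2]; omega)]
  have hη2 : phase (J + 1) ^ r * phase (J + 1) ^ r = phase J ^ r := by
    rw [← mul_pow, ← sq, phase_succ_sq]
  have hη0 := pow_ne_zero r (phase_ne_zero (J + 1))
  -- The doubly controlled phase from singly controlled ones of half the angle: $u+v-(u\oplus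
  -- v)=2uv$ for bits $u$, $v$.
  have hζ : (if v ∈ (if u ∈ S then symmDiff S {v} else S) then phase (J + 1) ^ (2 * 2 ^ J - r)
      else 1) * ((if v ∈ S then phase (J + 1) ^ r else 1) *
        (if u ∈ S then phase (J + 1) ^ r else 1)) =
      if u ∈ S ∧ v ∈ S then phase J ^ r else 1 := by
    rw [hη]
    simp only [hv']
    by_cases h1 : u ∈ S <;> by_cases h2 : v ∈ S <;> simp [h1, h2, hη2, hη0]
  have hI3 : Complex.I ^ 3 = -Complex.I := Complex.I_pow_three
  simp only [midGates, act_append, act_cons, act_nil, phase_qpair ha,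
    had_qpair ha, map_smul, cphase_qpair ha hu, cphase_qpair ha hv, cnot_qpair huv hu hv,
    cphase_qpair ha' hv, hback, phase_pow_sub J ht, phase_two, smul_smul, hI3, pow_one]
  rw [show ((Real.sqrt 2 : ℂ)⁻¹) * ((Real.sqrt 2 : ℂ)⁻¹ * ((Real.sqrt 2 : ℂ)⁻¹ *
    (Real.sqrt 2 : ℂ)⁻¹)) = 1 / 4 by rw [inv_sqrt_two_sq, ← mul_assoc, inv_sqrt_two_sq]; norm_num]
  rw [qpair_smul]
  simp only [← mul_assoc] at hζ ⊢
  rw [hζ]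
  -- What remains is a polynomial identity modulo $ww'=1$ and $i^2=-1$.
  generalize (if u ∈ S ∧ v ∈ S then phase J ^ r else 1) = ζ
  generalize phase J ^ t = w at hw ⊢
  have hI := Complex.I_mul_I
  simp only [proj, if_true, Bool.false_eq_true, if_false]
  have hIinv : (4 * Complex.I)⁻¹ = -Complex.I / 4 := by
    rw [mul_inv, Complex.inv_I]; ring
  simp only [div_eq_mul_inv (_ - _) (4 * Complex.I), hIinv]
  have hww := mul_inv_cancel₀ hw
  generalize w⁻¹ = w' at hww ⊢
  generalize Complex.I = i at hI ⊢
  congr 1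
  · linear_combination (1 / 4) * (1 + ζ) * (α - i * β) * hww
  · linear_combination (i / 4) * (1 + ζ) * (α - i * β) * hww +
      (β / 4 * (1 + ζ) * (w * w' - 1) -
        β / 4 * ((1 - w) * (1 - w') + ζ * (1 + w) * (1 + w'))) * hI

theorem ket_eq_qpair (a : ℕ) (S : Finset ℕ) :
    ∃ α β : ℂ, ket S = qpair a (S.erase a) α β := by
  by_cases h : a ∈ S
  · exact ⟨0, 1, by rw [qpair, Finset.insert_erase h]; simp⟩
  · exact ⟨1, 0, by rw [qpair, Finset.erase_eq_of_notMem h]; simp⟩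

theorem act_midGates_ket {J a u v t r : ℕ} {S : Finset ℕ} (hu : u ≠ a) (hv : v ≠ a)
    (huv : u ≠ v) (ht : t ≤ 2 ^ J) (hr : r ≤ 2 ^ J) (h : ¬ (u ∈ S ∧ v ∈ S)) :
    act (midGates J a u v t r) (ket S) = ket S := by
  obtain ⟨α, β, e⟩ := ket_eq_qpair a S
  rw [e, act_midGates (Finset.notMem_erase a S) hu hv huv ht hr]
  have : ¬ (u ∈ S.erase a ∧ v ∈ S.erase a) := fun h' =>
    h ⟨Finset.mem_of_mem_erase h'.1, Finset.mem_of_mem_erase h'.2⟩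
  rw [if_neg this, sub_self, zero_mul, zero_mul, add_zero, add_zero]

theorem act_blockGates_of_not {J a b u v t r : ℕ} {S : Finset ℕ} (hab : a ≠ b) (hu : u ≠ a)
    (hv : v ≠ a) (hub : u ≠ b) (hvb : v ≠ b) (huv : u ≠ v) (ht : t ≤ 2 ^ J) (hr : r ≤ 2 ^ J)
    (h : ¬ (u ∈ S ∧ v ∈ S)) :
    act (blockGates J a b u v t r) (ket S) = ket S := by
  have h1 : ∀ x : ℕ, x ≠ b → (x ∈ (if a ∈ S then symmDiff S {b} else S) ↔ x ∈ S) := by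
    intro x hx
    split_ifs
    · simp [Finset.mem_symmDiff, hx]
    · rfl
  rw [blockGates, act_append, act_append, act_cons, act_nil, act_cons, act_nil, cnot_ket hab,
    act_midGates_ket hu hv huv ht hr (by rwa [h1 u hub, h1 v hvb]), cnot_ket hab]
  congr 1
  rw [if_congr (h1 a hab) rfl rfl]
  split_ifs
  · rw [symmDiff_assoc, symmDiff_self, symmDiff_bot]
  · rfl

/-- The first controlled NOT sends $|a\rangle$ to $|ab\rangle$ and fixes $|b\rangle$. The plane of
the two basis vectors becomes the plane of the qubit `a` alone, with `b` set, and `act_midGates`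
applies. -/
theorem act_blockGates {J a b u v t r : ℕ} {S : Finset ℕ} (hab : a ≠ b) (ha : a ∉ S) (hb : b ∉ S)
    (hu : u ∈ S) (hv : v ∈ S) (huv : u ≠ v) (ht : t ≤ 2 ^ J) (hr : r ≤ 2 ^ J) (s : Bool) :
    act (blockGates J a b u v t r) (ket (insert (if s then b else a) S)) =
      ket (insert (if s then b else a) S) + (phase J ^ r - 1) •
        ∑ s', proj (phase J ^ t) s' s • ket (insert (if s' then b else a) S) := by
  have hua : u ≠ a := fun e => ha (e ▸ hu)
  have hva : v ≠ a := fun e => ha (e ▸ hv)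
  have haS : a ∉ insert b S := by simp [hab, ha]
  have e1 : symmDiff (insert a S) {b} = insert a (insert b S) := by
    ext x
    simp only [Finset.mem_symmDiff, Finset.mem_insert, Finset.mem_singleton]
    by_cases hx : x = b
    · subst hx; simp [hb, hab.symm]
    · simp [hx]
  have e2 : symmDiff (insert a (insert b S)) {b} = insert a S := by
    rw [← e1, symmDiff_assoc, symmDiff_self, symmDiff_bot]
  have hstart : (Gate.cnot a b).lin (ket (insert (if s then b else a) S)) =
      qpair a (insert b S) (if s then 1 else 0) (if s then 0 else 1) := by
    cases s
    · simp only [Bool.false_eq_true, if_false]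
      rw [cnot_ket hab, if_pos (Finset.mem_insert_self _ _), e1, qpair]
      simp
    · simp only [if_true]
      rw [cnot_ket hab, if_neg haS, qpair]
      simp
  have hend : ∀ α β, (Gate.cnot a b).lin (qpair a (insert b S) α β) =
      α • ket (insert b S) + β • ket (insert a S) := by
    intro α β
    rw [qpair, map_add, map_smul, map_smul, cnot_ket hab, cnot_ket hab, if_neg haS,
      if_pos (Finset.mem_insert_self _ _), e2]
  rw [blockGates, act_append, act_append, act_cons, act_nil, act_cons, act_nil, hstart,
    act_midGates haS hua hva huv ht hr, hend,
    if_pos (show u ∈ insert b S ∧ v ∈ insert b S from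
      ⟨Finset.mem_insert_of_mem hu, Finset.mem_insert_of_mem hv⟩), Fintype.sum_bool]
  cases s <;> simp only [Bool.false_eq_true, if_false, if_true, mul_one, mul_zero, add_zero,
    zero_add] <;> module

/-! ## Bit strings on the register -/

/-- The qubit that tells whether the site after `i` steps is `h`. -/
def code (n k i : ℕ) (h : ℤ) : ℕ := (1 + i * (2 * n + k + 2) + (h + n) : ℤ).toNat

/-- The heights that have a qubit. -/
def InRange (n k : ℕ) (h : ℤ) : Prop := 0 ≤ h + n ∧ h < n + k + 2

theorem code_pos {n k i : ℕ} {h : ℤ} (hh : InRange n k h) : 0 < code n k i h := by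
  have : (0 : ℤ) ≤ i * (2 * n + k + 2) := by positivity
  have := hh.1
  rw [code]
  omega

/-- A number in base $2n+k+2$ with the digit $h+n$, shifted by 1 so that the qubit 0 remains free
for the control. The range of heights contains every site a bit string can reach and all the heights
up to $k+1$. -/
theorem code_inj {n k i j : ℕ} {h h' : ℤ} (hh : InRange n k h) (hh' : InRange n k h')
    (e : code n k i h = code n k j h') : i = j ∧ h = h' := by
  have h1 : (0 : ℤ) ≤ i * (2 * n + k + 2) := by positivity
  have h2 : (0 : ℤ) ≤ j * (2 * n + k + 2) := by positivity
  obtain ⟨a1, a2⟩ := hh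
  obtain ⟨b1, b2⟩ := hh'
  have e' : (i : ℤ) * (2 * n + k + 2) + (h + n) = j * (2 * n + k + 2) + (h' + n) := by
    simp only [code] at e
    omega
  have hij : (i : ℤ) = j := by
    rcases lt_trichotomy (i : ℤ) j with hlt | heq | hlt
    · nlinarith
    · exact heq
    · nlinarith
  refine ⟨by exact_mod_cast hij, ?_⟩
  rw [hij] at e'
  linarith

theorem code_eq_iff {n k i j : ℕ} {h h' : ℤ} (hh : InRange n k h) (hh' : InRange n k h') :
    code n k i h = code n k j h' ↔ i = j ∧ h = h' :=
  ⟨code_inj hh hh', fun e => by rw [e.1, e.2]⟩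

theorem site_mem_Icc {n : ℕ} (p : Fin n → Bool) (i : ℕ) : 1 - (n : ℤ) ≤ site p i ∧ site p i ≤ 1 + n := by
  have h : |∑ j ∈ Finset.univ.filter (fun j : Fin n => (j : ℕ) < i), (if p j then (1 : ℤ) else -1)|
      ≤ n := by
    refine (Finset.abs_sum_le_sum_abs _ _).trans ?_
    refine (Finset.sum_le_card_nsmul _ _ 1 fun j _ => by split_ifs <;> simp).trans ?_
    have := Finset.card_filter_le (Finset.univ : Finset (Fin n)) (fun j => (j : ℕ) < i)
    simp at this
    simpa using this
  rw [abs_le] at h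
  rw [site]
  constructor <;> linarith [h.1, h.2]

theorem inRange_site {n k : ℕ} (p : Fin n → Bool) (i : ℕ) : InRange n k (site p i) := by
  have := site_mem_Icc p i
  exact ⟨by omega, by omega⟩

/-- The basis vector of a bit string: the qubit `0` and the qubits of its sites are `1`. -/
def pset {n : ℕ} (k : ℕ) (p : Fin n → Bool) : Finset ℕ :=
  insert 0 ((Finset.range (n + 1)).image fun i => code n k i (site p i))

theorem zero_mem_pset {n k : ℕ} (p : Fin n → Bool) : 0 ∈ pset k p := Finset.mem_insert_self _ _

theorem code_mem_pset {n k i : ℕ} {h : ℤ} (hi : i ≤ n) (hh : InRange n k h) (p : Fin n → Bool) :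
    code n k i h ∈ pset k p ↔ site p i = h := by
  rw [pset, Finset.mem_insert, Finset.mem_image]
  constructor
  · rintro (h0 | ⟨j, _, e⟩)
    · exact absurd h0 (code_pos hh).ne'
    · obtain ⟨e1, e2⟩ := code_inj (inRange_site p j) hh e
      rw [← e1, e2]
  · rintro rfl
    exact Or.inr ⟨i, Finset.mem_range.2 (by omega), rfl⟩

theorem site_succ {n : ℕ} (p : Fin n → Bool) {i : ℕ} (h : i < n) :
    site p (i + 1) = site p i + if p ⟨i, h⟩ then 1 else -1 := by
  have : Finset.univ.filter (fun j : Fin n => (j : ℕ) < i + 1) =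
      insert ⟨i, h⟩ (Finset.univ.filter (fun j : Fin n => (j : ℕ) < i)) := by
    ext j
    simp only [Finset.mem_filter, Finset.mem_univ, true_and, Finset.mem_insert, Fin.ext_iff]
    omega
  rw [site, site, this, Finset.sum_insert (by simp)]
  ring

theorem pset_injective (n k : ℕ) : Function.Injective (pset k : (Fin n → Bool) → Finset ℕ) := by
  intro p q e
  have hs : ∀ i ≤ n, site p i = site q i := by
    intro i hi
    have h := (code_mem_pset hi (inRange_site (k := k) q i) q).2 rfl
    rw [← e] at h
    exact (code_mem_pset hi (inRange_site q i) p).1 h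
  funext j
  have h1 := hs _ (Nat.succ_le_of_lt j.2)
  have h2 := hs _ j.2.le
  rw [Nat.succ_eq_add_one, site_succ p j.2, site_succ q j.2, h2] at h1
  simp only [Fin.eta] at h1
  cases hp : p j <;> cases hq : q j <;> simp [hp, hq] at h1 ⊢

/-! ## The gates of a crossing -/

/-- The number of phase gates for an angle or its negative. -/
def signed (J : ℕ) (b : Bool) (x : ℕ) : ℕ := if b then x else 2 ^ J - x

theorem signed_le {J x : ℕ} (h : x ≤ 2 ^ J) (b : Bool) : signed J b x ≤ 2 ^ J := by
  rw [signed]; split_ifs <;> omega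

/-- The block of the site `z + 1` of a crossing at the steps `i` and `i + 1`. -/
def siteGates (n k J t r i z : ℕ) : List Gate :=
  blockGates J (code n k (i + 1) z) (code n k (i + 1) (z + 2)) (code n k i (z + 1))
    (code n k (i + 2) (z + 1)) t r

/-- The gates of a crossing. The phase of the crossing is applied to the qubit `0`. -/
def crossGates (n k J th r : ℕ) (tab : ℕ → ℕ) (i : ℕ) (b : Bool) : List Gate :=
  List.replicate (signed J (!b) th) (Gate.cphase J 0 0) ++
    (List.range (k - 1)).flatMap fun z => siteGates n k J (tab (z + 1)) (signed J b r) i z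

theorem site_add_two_eq_iff {n i : ℕ} (h : i + 1 < n) (p : Fin n → Bool) :
    site p (i + 2) = site p i ↔ p ⟨i + 1, h⟩ = !p ⟨i, by omega⟩ := by
  rw [site_succ p h, site_succ p (by omega : i < n)]
  cases p ⟨i, by omega⟩ <;> cases p ⟨i + 1, h⟩ <;> simp <;> omega

section Crossing

variable {n k : ℕ} (hk : 3 ≤ k) {i : ℕ} (h : i + 1 < n)

/-- The basis vector of a bit string without the qubit of the site after `i` steps. -/
def psetErase {n : ℕ} (k i : ℕ) (p : Fin n → Bool) : Finset ℕ :=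
  insert 0 (((Finset.range (n + 1)).erase i).image fun j => code n k j (site p j))

theorem pset_eq_insert {i : ℕ} (h : i ≤ n) (p : Fin n → Bool) :
    pset k p = insert (code n k i (site p i)) (psetErase k i p) := by
  rw [pset, psetErase, Finset.insert_comm, ← Finset.image_insert (fun j => code n k j (site p j)),
    Finset.insert_erase (Finset.mem_range.2 (by omega))]

theorem code_mem_psetErase {i j : ℕ} {x : ℤ} (hj : j ≤ n) (hx : InRange n k x) (p : Fin n → Bool) :
    code n k j x ∈ psetErase k i p ↔ j ≠ i ∧ site p j = x := by
  rw [psetErase, Finset.mem_insert, Finset.mem_image]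
  constructor
  · rintro (h0 | ⟨l, hl, e⟩)
    · exact absurd h0 (code_pos hx).ne'
    · obtain ⟨e1, e2⟩ := code_inj (inRange_site p l) hx e
      rw [← e1, e2]
      exact ⟨(Finset.mem_erase.1 hl).1, rfl⟩
  · rintro ⟨h1, rfl⟩
    exact Or.inr ⟨j, Finset.mem_erase.2 ⟨h1, Finset.mem_range.2 (by omega)⟩, rfl⟩

/-- A step followed by its reversal moves only the site between them, so among the qubits of the
path only that of the middle site changes. -/
theorem pset_pair (s : Bool) {p : Fin n → Bool} (hp : p ⟨i + 1, h⟩ = !p ⟨i, by omega⟩) :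
    pset k ((pathModel k hk).pair i h s p) =
      insert (if s then code n k (i + 1) (site p i + 1) else code n k (i + 1) (site p i - 1))
        (psetErase k (i + 1) p) := by
  rw [pset_eq_insert (i := i + 1) h.le]
  congr 1
  · rw [← pathModel_site hk, (pathModel k hk).site_pair_mid h s p, pathModel_site]
    cases s <;> simp [pathModel, sub_eq_add_neg]
  · rw [psetErase, psetErase]
    congr 1
    refine Finset.image_congr fun j hj => ?_
    have hj' : j ≠ i + 1 := (Finset.mem_erase.1 hj).1
    change code n k j ((pathModel k hk).site _ j) = code n k j ((pathModel k hk).site _ j)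
    rw [(pathModel k hk).site_pair h s hp hj']

theorem inRange_of_le {z : ℕ} (hz : z ≤ k + 1) : InRange n k z := ⟨by positivity, by omega⟩

theorem act_siteGates_of_not {J t r z : ℕ} (hz : z + 2 ≤ k) (ht : t ≤ 2 ^ J) (hr : r ≤ 2 ^ J)
    {S : Finset ℕ} (hS : ¬ (code n k i (z + 1) ∈ S ∧ code n k (i + 2) (z + 1) ∈ S)) :
    act (siteGates n k J t r i z) (ket S) = ket S := by
  have h0 : InRange n k (z : ℤ) := inRange_of_le (by omega)
  have h1 : InRange n k (z + 1 : ℤ) := by exact_mod_cast inRange_of_le (n := n) (by omega : z + 1 ≤ k + 1)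
  have h2 : InRange n k (z + 2 : ℤ) := by exact_mod_cast inRange_of_le (n := n) (by omega : z + 2 ≤ k + 1)
  refine act_blockGates_of_not ?_ ?_ ?_ ?_ ?_ ?_ ht hr hS <;>
    simp [code_eq_iff, *]

theorem act_siteGates_pset_of_not {J t r z : ℕ} (hz : z + 2 ≤ k) (ht : t ≤ 2 ^ J) (hr : r ≤ 2 ^ J)
    (p : Fin n → Bool) (hp : ¬ (p ⟨i + 1, h⟩ = (!p ⟨i, by omega⟩) ∧ site p i = z + 1)) :
    act (siteGates n k J t r i z) (ket (pset k p)) = ket (pset k p) := by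
  have h1 : InRange n k (z + 1 : ℤ) := by exact_mod_cast inRange_of_le (n := n) (by omega : z + 1 ≤ k + 1)
  refine act_siteGates_of_not hz ht hr fun h' => hp ?_
  rw [code_mem_pset (by omega) h1, code_mem_pset (by omega) h1] at h'
  exact ⟨(site_add_two_eq_iff h p).1 (h'.2.trans h'.1.symm), h'.1⟩

theorem act_siteGates_pset {J t r z : ℕ} (hz : z + 2 ≤ k) (ht : t ≤ 2 ^ J) (hr : r ≤ 2 ^ J)
    {p : Fin n → Bool} (hp : p ⟨i + 1, h⟩ = !p ⟨i, by omega⟩) (hpz : site p i = z + 1) :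
    act (siteGates n k J t r i z) (ket (pset k p)) = ket (pset k p) + (phase J ^ r - 1) •
      ∑ s, proj (phase J ^ t) s (p ⟨i, by omega⟩) • ket (pset k ((pathModel k hk).pair i h s p)) := by
  have h0 : InRange n k (z : ℤ) := inRange_of_le (by omega)
  have h1 : InRange n k (z + 1 : ℤ) := by exact_mod_cast inRange_of_le (n := n) (by omega : z + 1 ≤ k + 1)
  have h2 : InRange n k (z + 2 : ℤ) := by exact_mod_cast inRange_of_le (n := n) (by omega : z + 2 ≤ k + 1)
  have hself : pset k p = pset k ((pathModel k hk).pair i h (p ⟨i, by omega⟩) p) := by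
    rw [(pathModel k hk).pair_self h hp]
  have e2 : site p i + 1 = z + 2 := by rw [hpz]; ring
  have e0 : site p i - 1 = z := by rw [hpz]; ring
  conv_lhs => rw [hself]
  conv_rhs => rw [hself]
  simp only [pset_pair hk h _ hp, e0, e2]
  refine act_blockGates ?_ ?_ ?_ ?_ ?_ ?_ ht hr _
  · simp [code_eq_iff, *]
  · simp [code_mem_psetErase, h.le, h0]
  · simp [code_mem_psetErase, h.le, h2]
  · rw [code_mem_psetErase (by omega) h1]; exact ⟨by omega, hpz⟩
  · rw [code_mem_psetErase (by omega) h1]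
    exact ⟨by omega, by rw [(site_add_two_eq_iff h p).2 hp, hpz]⟩
  · simp [code_eq_iff, *]

/-- Only the block of the site actually reached before the pair is active, and only if the walk
returns to it after two steps. The block keeps this site, so the later blocks act as the identity on
every term it creates. -/
theorem act_sites_pset {J r : ℕ} (hr : r ≤ 2 ^ J) {tab : ℕ → ℕ} (htab : ∀ z, tab z ≤ 2 ^ J)
    (p : Fin n → Bool) {j : ℕ} (hj : j + 1 ≤ k) :
    act ((List.range j).flatMap fun z => siteGates n k J (tab (z + 1)) r i z) (ket (pset k p)) =
      ket (pset k p) + (if p ⟨i + 1, h⟩ = (!p ⟨i, by omega⟩) ∧ 1 ≤ site p i ∧ site p i < j + 1 then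
        phase J ^ r - 1 else 0) •
      ∑ s, proj (phase J ^ tab (site p i).toNat) s (p ⟨i, by omega⟩) •
        ket (pset k ((pathModel k hk).pair i h s p)) := by
  induction j with
  | zero => rw [if_neg (by push_cast; omega)]; simp
  | succ j ih =>
    rw [List.range_succ, List.flatMap_append, act_append, ih (by omega), List.flatMap_singleton]
    by_cases hc : p ⟨i + 1, h⟩ = (!p ⟨i, by omega⟩) ∧ site p i = j + 1
    · rw [if_neg (by omega), if_pos ⟨hc.1, by omega⟩, zero_smul, add_zero,
        act_siteGates_pset hk h (by omega) (htab _) hr hc.1 hc.2, hc.2]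
      rfl
    · rw [map_add, map_smul, map_sum, act_siteGates_pset_of_not h (by omega) (htab _) hr p hc]
      congr 1
      rw [if_congr (P := p ⟨i + 1, h⟩ = (!p ⟨i, by omega⟩) ∧ 1 ≤ site p i ∧
        site p i < ((j + 1 : ℕ) : ℤ) + 1)
        (Q := p ⟨i + 1, h⟩ = (!p ⟨i, by omega⟩) ∧ 1 ≤ site p i ∧ site p i < j + 1)
        ⟨fun h' => ⟨h'.1, h'.2.1, by
          have h3 := h'.2.2
          have h4 : site p i ≠ j + 1 := fun e => hc ⟨h'.1, e⟩
          push_cast at h3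
          omega⟩,
          fun h' => ⟨h'.1, h'.2.1, by omega⟩⟩ rfl rfl]
      split_ifs with h'
      · congr 1
        refine Finset.sum_congr rfl fun s _ => ?_
        rw [map_smul, act_siteGates_pset_of_not h (by omega) (htab _) hr]
        have e := (pathModel k hk).site_pair_le h s p le_rfl
        rw [pathModel_site, pathModel_site] at e
        rw [e]
        omega
      · rw [zero_smul, zero_smul]

end Crossing

/-! ### Operators that act on two consecutive steps -/

section Local

variable {n k : ℕ} (hk : 3 ≤ k) {i : ℕ} (h : i + 1 < n)

/-- The operator that acts on the steps `i` and `i + 1` by a matrix that depends on the site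
reached before them, and kills the bit strings on which they are equal. -/
def loc (f : ℤ → Bool → Bool → ℂ) : Matrix (Fin n → Bool) (Fin n → Bool) ℂ := fun q p =>
  if p ⟨i + 1, h⟩ = (!p ⟨i, by omega⟩) ∧ q = (pathModel k hk).pair i h (q ⟨i, by omega⟩) p then
    f (site p i) (q ⟨i, by omega⟩) (p ⟨i, by omega⟩) else 0

theorem sum_loc_smul {E : Type*} [AddCommGroup E] [Module ℂ E] (f : ℤ → Bool → Bool → ℂ)
    (g : (Fin n → Bool) → E) (p : Fin n → Bool) :
    ∑ q, loc hk h f q p • g q = if p ⟨i + 1, h⟩ = !p ⟨i, by omega⟩ then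
      ∑ s, f (site p i) s (p ⟨i, by omega⟩) • g ((pathModel k hk).pair i h s p) else 0 := by
  classical
  split_ifs with hp
  · have key : ∀ q, loc hk h f q p • g q = ∑ s, if q = (pathModel k hk).pair i h s p then
        f (site p i) s (p ⟨i, by omega⟩) • g q else 0 := by
      intro q
      rw [loc]
      by_cases hq : q = (pathModel k hk).pair i h (q ⟨i, by omega⟩) p
      · rw [if_pos ⟨hp, hq⟩, Finset.sum_eq_single (q ⟨i, by omega⟩), if_pos hq]
        · intro s _ hs
          rw [if_neg]
          intro e
          apply hs
          rw [e, (pathModel k hk).pair_left h]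
        · simp
      · rw [if_neg fun h' => hq h'.2, zero_smul, Finset.sum_eq_zero]
        intro s _
        rw [if_neg]
        intro e
        apply hq
        rw [e, (pathModel k hk).pair_left h]
    simp only [key]
    rw [Finset.sum_comm]
    simp
  · refine Finset.sum_eq_zero fun q _ => ?_
    rw [loc, if_neg fun h' => hp h'.1, zero_smul]

theorem pair_iff_pair {p q : Fin n → Bool} :
    (p ⟨i + 1, h⟩ = (!p ⟨i, by omega⟩) ∧ q = (pathModel k hk).pair i h (q ⟨i, by omega⟩) p) ↔
    (q ⟨i + 1, h⟩ = (!q ⟨i, by omega⟩) ∧ p = (pathModel k hk).pair i h (p ⟨i, by omega⟩) q) := by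
  have key : ∀ {p q : Fin n → Bool},
      (p ⟨i + 1, h⟩ = (!p ⟨i, by omega⟩) ∧ q = (pathModel k hk).pair i h (q ⟨i, by omega⟩) p) →
      (q ⟨i + 1, h⟩ = (!q ⟨i, by omega⟩) ∧ p = (pathModel k hk).pair i h (p ⟨i, by omega⟩) q) := by
    rintro p q ⟨h1, h2⟩
    constructor
    · conv_lhs => rw [h2, (pathModel k hk).pair_right h]
      rfl
    · conv_rhs => rw [h2, (pathModel k hk).pair_pair h, (pathModel k hk).pair_self h h1]
  exact ⟨key, key⟩

theorem site_eq_of_pair {p q : Fin n → Bool} {s : Bool} (e : q = (pathModel k hk).pair i h s p) :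
    site q i = site p i := by
  have := (pathModel k hk).site_pair_le h s p le_rfl
  rw [← e] at this
  exact this

/-- Together with `loc_mul_loc`, `loc_add` and `smul_loc` this reduces operator identities to
identities of 2 by 2 matrices at each site. The pair operation is symmetric in the two walks, hence
the exchange of the indices. -/
theorem conjTranspose_loc (f : ℤ → Bool → Bool → ℂ) :
    (loc hk h f).conjTranspose = loc hk h fun z s t => star (f z t s) := by
  ext q p
  rw [Matrix.conjTranspose_apply, loc, loc]
  by_cases hp : p ⟨i + 1, h⟩ = (!p ⟨i, by omega⟩) ∧ q = (pathModel k hk).pair i h (q ⟨i, by omega⟩) p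
  · rw [if_pos hp, if_pos ((pair_iff_pair hk h).1 hp), site_eq_of_pair hk h hp.2]
  · rw [if_neg hp, if_neg fun h' => hp ((pair_iff_pair hk h).1 h'), star_zero]

theorem loc_mul_loc (f g : ℤ → Bool → Bool → ℂ) :
    loc hk h f * loc hk h g = loc hk h fun z s t => ∑ r, f z s r * g z r t := by
  ext q p
  rw [Matrix.mul_apply]
  have e := sum_loc_smul hk h g (fun r => loc hk h f q r) p
  simp only [smul_eq_mul] at e
  simp only [mul_comm (loc hk h f q _)]
  rw [e, loc]
  by_cases hp : p ⟨i + 1, h⟩ = (!p ⟨i, by omega⟩)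
  · rw [if_pos hp]
    have key : ∀ s, loc hk h f q ((pathModel k hk).pair i h s p) =
        if q = (pathModel k hk).pair i h (q ⟨i, by omega⟩) p then
          f (site p i) (q ⟨i, by omega⟩) s else 0 := by
      intro s
      rw [loc, (pathModel k hk).pair_left h, (pathModel k hk).pair_right h,
        (pathModel k hk).pair_pair h, site_eq_of_pair hk h (p := p) (s := s) rfl]
      exact if_congr ⟨fun h' => h'.2, fun h' => ⟨rfl, h'⟩⟩ rfl rfl
    simp only [key]
    by_cases hq : q = (pathModel k hk).pair i h (q ⟨i, by omega⟩) p
    · rw [if_pos ⟨hp, hq⟩]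
      simp only [if_pos hq]
      exact Finset.sum_congr rfl fun s _ => mul_comm _ _
    · rw [if_neg fun h' => hq h'.2]
      simp only [if_neg hq, mul_zero, Finset.sum_const_zero]
  · rw [if_neg hp, if_neg fun h' => hp h'.1]

theorem loc_add (f g : ℤ → Bool → Bool → ℂ) :
    loc hk h f + loc hk h g = loc hk h fun z s t => f z s t + g z s t := by
  ext q p
  simp only [Matrix.add_apply, loc]
  split_ifs <;> simp

theorem smul_loc (c : ℂ) (f : ℤ → Bool → Bool → ℂ) :
    c • loc hk h f = loc hk h fun z s t => c * f z s t := by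
  ext q p
  simp only [Matrix.smul_apply, loc]
  split_ifs <;> simp

theorem norm_loc_apply (f : ℤ → Bool → Bool → ℂ) (q p : Fin n → Bool) :
    (‖loc hk h f q p‖ : ℂ) = loc hk h (fun z s t => (‖f z s t‖ : ℂ)) q p := by
  simp only [loc]
  split_ifs <;> simp

/-- A column of a local operator has at most two nonzero entries. -/
theorem sum_norm_loc_le {f : ℤ → Bool → Bool → ℂ} {δ : ℝ} (hf : ∀ z s t, ‖f z s t‖ ≤ δ)
    (p : Fin n → Bool) : ∑ q, ‖loc hk h f q p‖ ≤ 2 * δ := by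
  have hδ : 0 ≤ δ := (norm_nonneg _).trans (hf 0 true true)
  have e := sum_loc_smul hk h (fun z s t => (‖f z s t‖ : ℂ)) (fun _ => (1 : ℂ)) p
  simp only [smul_eq_mul, mul_one, ← norm_loc_apply] at e
  by_cases hp : p ⟨i + 1, h⟩ = (!p ⟨i, by omega⟩)
  · rw [if_pos hp] at e
    have e' : ∑ q, ‖loc hk h f q p‖ = ∑ s, ‖f (site p i) s (p ⟨i, by omega⟩)‖ := by exact_mod_cast e
    rw [e', Fintype.sum_bool]
    linarith [hf (site p i) true (p ⟨i, by omega⟩), hf (site p i) false (p ⟨i, by omega⟩)]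
  · rw [if_neg hp] at e
    have e' : ∑ q, ‖loc hk h f q p‖ = 0 := by exact_mod_cast e
    rw [e']
    positivity

theorem sum_norm_loc_row_le {f : ℤ → Bool → Bool → ℂ} {δ : ℝ} (hf : ∀ z s t, ‖f z s t‖ ≤ δ)
    (q : Fin n → Bool) : ∑ p, ‖loc hk h f q p‖ ≤ 2 * δ := by
  have e : ∀ p, ‖loc hk h f q p‖ = ‖loc hk h (fun z s t => star (f z t s)) p q‖ := by
    intro p
    rw [← conjTranspose_loc, Matrix.conjTranspose_apply, norm_star]
  simp only [e]
  exact sum_norm_loc_le hk h (fun z s t => by rw [norm_star]; exact hf z t s) q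

end Local

/-! ## The Euclidean norm -/

/-- The Euclidean norm of a vector. -/
def nrm {ι : Type*} [Fintype ι] (x : ι → ℂ) : ℝ := ‖WithLp.toLp 2 x‖

section Norm

variable {ι : Type*} [Fintype ι]

theorem nrm_sq (x : ι → ℂ) : nrm x ^ 2 = ∑ j, ‖x j‖ ^ 2 := by
  rw [nrm, EuclideanSpace.norm_sq_eq]

theorem nrm_nonneg (x : ι → ℂ) : 0 ≤ nrm x := norm_nonneg _

theorem nrm_add_le (x y : ι → ℂ) : nrm (x + y) ≤ nrm x + nrm y := by
  rw [nrm, WithLp.toLp_add]; exact norm_add_le _ _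

theorem nrm_smul (c : ℂ) (x : ι → ℂ) : nrm (c • x) = ‖c‖ * nrm x := by
  rw [nrm, WithLp.toLp_smul, norm_smul]; rfl

theorem norm_apply_le_nrm (x : ι → ℂ) (j : ι) : ‖x j‖ ≤ nrm x :=
  PiLp.norm_apply_le (WithLp.toLp 2 x) j

/-- The Schur test with one bound for rows and columns: Cauchy-Schwarz with the weights
$\|D_{qp}\|$, then an exchange of the sums. -/
theorem nrm_mulVec_le {D : Matrix ι ι ℂ} {a : ℝ} (h1 : ∀ q, ∑ p, ‖D q p‖ ≤ a)
    (h2 : ∀ p, ∑ q, ‖D q p‖ ≤ a) (ha : 0 ≤ a) (x : ι → ℂ) : nrm (D.mulVec x) ≤ a * nrm x := by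
  refine abs_le_of_sq_le_sq' ?_ (mul_nonneg ha (nrm_nonneg x)) |>.2
  rw [mul_pow, nrm_sq, nrm_sq]
  have key : ∀ q, ‖D.mulVec x q‖ ^ 2 ≤ a * ∑ p, ‖D q p‖ * ‖x p‖ ^ 2 := by
    intro q
    have h3 : ‖D.mulVec x q‖ ≤ ∑ p, ‖D q p‖ * ‖x p‖ := by
      rw [Matrix.mulVec, dotProduct]
      exact (norm_sum_le _ _).trans (Finset.sum_le_sum fun p _ => by rw [norm_mul])
    have h4 : (∑ p, ‖D q p‖ * ‖x p‖) ^ 2 ≤ (∑ p, ‖D q p‖) * ∑ p, ‖D q p‖ * ‖x p‖ ^ 2 :=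
      Finset.sum_sq_le_sum_mul_sum_of_sq_le_mul _ (fun _ _ => norm_nonneg _)
        (fun _ _ => by positivity) fun _ _ => le_of_eq (by ring)
    refine (pow_le_pow_left₀ (norm_nonneg _) h3 2).trans (h4.trans ?_)
    exact mul_le_mul_of_nonneg_right (h1 q) (Finset.sum_nonneg fun _ _ => by positivity)
  refine (Finset.sum_le_sum fun q _ => key q).trans ?_
  rw [← Finset.mul_sum, Finset.sum_comm, sq, mul_assoc]
  refine mul_le_mul_of_nonneg_left ?_ ha
  rw [Finset.mul_sum]
  refine Finset.sum_le_sum fun p _ => ?_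
  rw [← Finset.sum_mul]
  exact mul_le_mul_of_nonneg_right (h2 p) (by positivity)

theorem nrm_mulVec_of_unitary [DecidableEq ι] {U : Matrix ι ι ℂ} (hU : U.conjTranspose * U = 1)
    (x : ι → ℂ) : nrm (U.mulVec x) = nrm x := by
  have key : ∀ y : ι → ℂ, ((nrm y ^ 2 : ℝ) : ℂ) = star y ⬝ᵥ y := by
    intro y
    rw [nrm_sq, dotProduct]
    push_cast
    refine Finset.sum_congr rfl fun j _ => ?_
    rw [Pi.star_apply, ← Complex.conj_mul']
    rfl
  have h2 : ((nrm (U.mulVec x) ^ 2 : ℝ) : ℂ) = ((nrm x ^ 2 : ℝ) : ℂ) := by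
    rw [key, key, Matrix.star_mulVec, Matrix.dotProduct_mulVec, Matrix.vecMul_vecMul, hU,
      Matrix.vecMul_one]
  have h3 : nrm (U.mulVec x) ^ 2 = nrm x ^ 2 := by exact_mod_cast h2
  exact (sq_eq_sq₀ (nrm_nonneg _) (nrm_nonneg _)).1 h3

end Norm

/-! ## The circuit of a braid -/

theorem proj_mul_proj {w : ℂ} (hw : w ≠ 0) (s t : Bool) :
    ∑ r, proj w s r * proj w r t = proj w s t := by
  have hww := mul_inv_cancel₀ hw
  have hIinv : (4 * Complex.I)⁻¹ = -Complex.I / 4 := by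
    rw [mul_inv, Complex.inv_I]; ring
  have hI := Complex.I_mul_I
  rw [Fintype.sum_bool]
  cases s <;> cases t <;>
    simp only [proj, if_true, Bool.false_eq_true, if_false, div_eq_mul_inv _ (4 * Complex.I),
      hIinv] <;> generalize w⁻¹ = w' at hww ⊢ <;> generalize Complex.I = i at hI ⊢
  · linear_combination (1 / 4) * hww + ((w - w') ^ 2 / 16) * hI
  · linear_combination 0 * hww
  · linear_combination 0 * hww
  · linear_combination (1 / 4) * hww + ((w - w') ^ 2 / 16) * hI

theorem star_proj {w : ℂ} (hw : star w = w⁻¹) (s t : Bool) : star (proj w t s) = proj w s t := by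
  have hw' : (starRingEnd ℂ) w = w⁻¹ := hw
  have h1 : star (proj w true true) = proj w true true := by
    simp only [proj, if_true, Complex.star_def, map_div₀, map_sub, map_inv₀, hw', inv_inv, map_ofNat]
    ring
  have h2 : star (proj w false false) = proj w false false := by
    simp only [proj, Bool.false_eq_true, if_false, Complex.star_def, map_div₀, map_add, map_inv₀,
      hw', inv_inv, map_ofNat]
    ring
  have h3 : star (proj w true false) = proj w true false := by
    simp only [proj, if_true, Bool.false_eq_true, if_false, Complex.star_def, map_div₀, map_sub,
      map_inv₀, map_mul, hw', inv_inv, map_ofNat, Complex.conj_I]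
    rw [mul_neg, div_neg, ← neg_div, neg_sub]
  have h4 : proj w false true = proj w true false := by simp [proj]
  cases s <;> cases t
  · exact h2
  · rw [h3, h4]
  · rw [h4, h3]
  · exact h1

theorem star_phase_pow (j t : ℕ) : star (phase j ^ t) = (phase j ^ t)⁻¹ := by
  rw [Complex.inv_eq_conj, Complex.star_def]
  rw [phase_pow, Complex.norm_exp_ofReal_mul_I]

theorem norm_phase_pow (j t : ℕ) : ‖phase j ^ t‖ = 1 := by
  rw [phase_pow, Complex.norm_exp_ofReal_mul_I]

/-- The numbers of phase gates that a circuit uses: `2 ^ J` gates make a full turn, `th` stands for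
the phase of a crossing, `r` for its eigenvalue and `tab z` for the angle of the site `z`. -/
structure Calib where
  J : ℕ
  th : ℕ
  r : ℕ
  tab : ℕ → ℕ

/-- None of the angles exceeds a full turn. -/
structure Calib.Valid (C : Calib) : Prop where
  th_le : C.th ≤ 2 ^ C.J
  r_le : C.r ≤ 2 ^ C.J
  tab_le : ∀ z, C.tab z ≤ 2 ^ C.J

/-- The projections at the sites `1, …, k - 1`. -/
def siteProj (k : ℕ) (C : Calib) (z : ℤ) (s t : Bool) : ℂ :=
  if 1 ≤ z ∧ z < k then proj (phase C.J ^ C.tab z.toNat) s t else 0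

section Operators

variable {n k : ℕ} (hk : 3 ≤ k) (C : Calib)

/-- The operator of a crossing that the circuit implements. -/
def circOp (c : Fin (n - 1) × Bool) : Matrix (Fin n → Bool) (Fin n → Bool) ℂ :=
  phase C.J ^ signed C.J (!c.2) C.th • (1 + (phase C.J ^ signed C.J c.2 C.r - 1) •
    loc hk (by have := c.1.2; omega : (c.1 : ℕ) + 1 < n) (siteProj k C))

/-- A unit scalar times $1+(y-1)P$ with a self-adjoint projection $P$ and $|y|=1$. The accuracy of
the calibration plays no role, which is why errors do not grow along the braid. -/
theorem circOp_unitary (c : Fin (n - 1) × Bool) :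
    (circOp hk C c).conjTranspose * circOp hk C c = 1 := by
  have hc : (c.1 : ℕ) + 1 < n := by have := c.1.2; omega
  have hP1 : (loc hk hc (siteProj k C)).conjTranspose = loc hk hc (siteProj k C) := by
    rw [conjTranspose_loc]
    congr 1
    funext z s t
    simp only [siteProj]
    split_ifs
    · exact star_proj (star_phase_pow _ _) s t
    · exact star_zero ℂ
  have hP2 : loc hk hc (siteProj k C) * loc hk hc (siteProj k C) = loc hk hc (siteProj k C) := by
    rw [loc_mul_loc]
    congr 1
    funext z s t
    simp only [siteProj]
    split_ifs
    · exact proj_mul_proj (pow_ne_zero _ (phase_ne_zero _)) s t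
    · simp
  have e1 := star_phase_pow C.J (signed C.J (!c.2) C.th)
  have e2 := star_phase_pow C.J (signed C.J c.2 C.r)
  have n1 := pow_ne_zero (signed C.J (!c.2) C.th) (phase_ne_zero C.J)
  have n2 := pow_ne_zero (signed C.J c.2 C.r) (phase_ne_zero C.J)
  rw [circOp]
  generalize phase C.J ^ signed C.J (!c.2) C.th = x at e1 n1 ⊢
  generalize phase C.J ^ signed C.J c.2 C.r = y at e2 n2 ⊢
  rw [Matrix.conjTranspose_smul, Matrix.conjTranspose_add, Matrix.conjTranspose_smul,
    Matrix.conjTranspose_one, hP1, star_sub, e1, e2, star_one]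
  generalize loc hk hc (siteProj k C) = P at hP2 ⊢
  rw [smul_mul_smul_comm, inv_mul_cancel₀ n1, one_smul, add_mul, mul_add, mul_add, smul_mul_smul_comm,
    hP2, mul_one, mul_one, one_mul]
  have : (y⁻¹ - 1) * (y - 1) = - (y - 1) - (y⁻¹ - 1) := by
    field_simp
    ring
  rw [this]
  module

/-- The superposition of bit strings on the register. -/
def emb (k : ℕ) (x : (Fin n → Bool) → ℂ) : QState := ∑ q, x q • ket (pset k q)

theorem act_emb_of_column {D : List Gate} {U : Matrix (Fin n → Bool) (Fin n → Bool) ℂ}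
    (hD : ∀ p, act D (ket (pset k p)) = ∑ q, U q p • ket (pset k q)) (x : (Fin n → Bool) → ℂ) :
    act D (emb k x) = emb k (U.mulVec x) := by
  simp only [emb, map_sum, map_smul, hD, Matrix.mulVec, dotProduct, Finset.smul_sum,
    Finset.sum_smul, smul_smul]
  rw [Finset.sum_comm]
  simp only [mul_comm]

variable {C}

theorem act_crossGates_pset (hC : C.Valid) (c : Fin (n - 1) × Bool) (p : Fin n → Bool) :
    act (crossGates n k C.J C.th C.r C.tab c.1 c.2) (ket (pset k p)) =
      ∑ q, circOp hk C c q p • ket (pset k q) := by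
  have hc : (c.1 : ℕ) + 1 < n := by have := c.1.2; omega
  rw [crossGates, act_append, act_replicate_cphase, if_pos ⟨zero_mem_pset p, zero_mem_pset p⟩,
    map_smul, act_sites_pset hk hc (signed_le hC.r_le _) hC.tab_le p (by omega)]
  simp only [circOp, Matrix.smul_apply, Matrix.add_apply, smul_assoc, ← Finset.smul_sum, add_smul,
    Finset.sum_add_distrib]
  rw [sum_loc_smul hk hc]
  congr 2
  · rw [Finset.sum_eq_single p]
    · simp
    · intro q _ hq
      simp [Matrix.one_apply_ne hq]
    · simp
  · by_cases h1 : p ⟨c.1 + 1, hc⟩ = (!p ⟨c.1, by omega⟩)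
    · rw [if_pos h1]
      by_cases h2 : 1 ≤ site p c.1 ∧ site p c.1 < k
      · rw [if_pos ⟨h1, by omega⟩]
        simp only [siteProj, if_pos h2]
      · rw [if_neg (by omega)]
        simp only [siteProj, if_neg h2]
        simp
    · rw [if_neg h1, if_neg fun h' => h1 h'.1]
      simp

/-- On the empty register no control qubit is set. The braid circuit is therefore controlled by the
qubit 0 as soon as the path is written only when this qubit is 1; no gate needs an extra control. -/
theorem act_crossGates_empty (hC : C.Valid) (i : ℕ) (b : Bool) :
    act (crossGates n k C.J C.th C.r C.tab i b) (ket ∅) = ket ∅ := by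
  rw [crossGates, act_append, act_replicate_cphase, if_neg (by simp), one_smul]
  have : ∀ j, j ≤ k - 1 → act ((List.range j).flatMap fun z =>
      siteGates n k C.J (C.tab (z + 1)) (signed C.J b C.r) i z) (ket ∅) = ket ∅ := by
    intro j hj
    induction j with
    | zero => simp
    | succ j ih =>
      rw [List.range_succ, List.flatMap_append, act_append, ih (by omega), List.flatMap_singleton,
        act_siteGates_of_not (by omega) (hC.tab_le _) (signed_le hC.r_le _) (by simp)]
  exact this _ le_rfl

/-- The gates of a braid; the last crossing is applied first. -/
def braidGates (n k : ℕ) (C : Calib) : Braid n → List Gate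
  | [] => []
  | c :: B => braidGates n k C B ++ crossGates n k C.J C.th C.r C.tab c.1 c.2

variable (C) in
/-- The operator of a braid that the circuit implements. -/
def circBraid (B : Braid n) : Matrix (Fin n → Bool) (Fin n → Bool) ℂ := (B.map (circOp hk C)).prod

theorem act_braidGates_emb (hC : C.Valid) (B : Braid n) (x : (Fin n → Bool) → ℂ) :
    act (braidGates n k C B) (emb k x) = emb k ((circBraid hk C B).mulVec x) := by
  induction B with
  | nil => simp [braidGates, circBraid]
  | cons c B ih =>
    rw [braidGates, act_append, ih, act_emb_of_column (act_crossGates_pset hk hC c),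
      Matrix.mulVec_mulVec]
    simp [circBraid]

theorem act_braidGates_empty (hC : C.Valid) (B : Braid n) :
    act (braidGates n k C B) (ket ∅) = ket ∅ := by
  induction B with
  | nil => simp [braidGates]
  | cons c B ih => rw [braidGates, act_append, ih, act_crossGates_empty hC]

end Operators

/-! ## The Hadamard test -/

/-- A circuit that controls its action by the qubit `0`. -/
theorem outcomeProb_sub {D : List Gate} {χ : QState}
    (hD : act D (ket ∅) = (Real.sqrt 2 : ℂ)⁻¹ • (ket ∅ + χ)) (hχ : ∀ x, 0 ∉ x → χ x = 0) :
    outcomeProb (D ++ [Gate.had 0]) false - outcomeProb (D ++ [Gate.had 0]) true = (χ {0}).re := by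
  set W := circuitWidth (D ++ [Gate.had 0]) with hW
  have h0 : 0 ∈ Finset.range W := by
    have := width_le_circuitWidth (D ++ [Gate.had 0]) (Gate.had 0) (by simp)
    simp only [Gate.width] at this
    simp
    omega
  have hfin : ∀ x, runCircuit (D ++ [Gate.had 0]) x =
      ((ket ∅ + χ) (x.erase 0) + (if 0 ∈ x then -1 else 1) * (ket ∅ + χ) (insert 0 x)) / 2 := by
    intro x
    rw [runCircuit_eq, act_append, hD, act_cons, act_nil, map_smul]
    change (Real.sqrt 2 : ℂ)⁻¹ * (((ket ∅ + χ) (x.erase 0) + (if 0 ∈ x then -1 else 1) *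
      (ket ∅ + χ) (insert 0 x)) / (Real.sqrt 2 : ℂ)) = _
    rw [div_eq_inv_mul, ← mul_assoc, inv_sqrt_two_sq]
    ring
  have e1 : ∀ b, outcomeProb (D ++ [Gate.had 0]) b =
      ∑ x ∈ ((Finset.range W).erase 0).powerset,
        ‖((ket ∅ + χ) x + (if b then -1 else 1) * (ket ∅ + χ) (insert 0 x)) / 2‖ ^ 2 := by
    intro b
    rw [outcomeProb, ← hW, Finset.sum_filter]
    rw [← Finset.insert_erase h0, Finset.sum_powerset_insert (Finset.notMem_erase _ _),
      ← Finset.sum_add_distrib]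
    have hE : (insert 0 ((Finset.range W).erase 0)).erase 0 = (Finset.range W).erase 0 := by simp
    rw [hE]
    refine Finset.sum_congr rfl fun t ht => ?_
    have ht0 : 0 ∉ t := fun h' => by simpa using Finset.mem_powerset.1 ht h'
    rw [hfin, hfin]
    cases b <;> simp [ht0]
  -- A register content other than `∅` occurs only in the branch with the qubit 0 set, so both
  -- outcomes have the same probability there; the interference is at `∅` alone.
  rw [e1, e1, ← Finset.sum_sub_distrib, Finset.sum_eq_single ∅]
  · have h1 : (ket ∅ + χ) (∅ : Finset ℕ) = 1 := by
      change ket ∅ ∅ + χ ∅ = 1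
      rw [ket_self, hχ _ (by simp), add_zero]
    have h2 : (ket ∅ + χ) (insert 0 ∅ : Finset ℕ) = χ {0} := by
      change ket ∅ _ + χ _ = _
      rw [ket_of_ne (by simp), zero_add]
      rfl
    rw [h1, h2]
    simp only [Bool.false_eq_true, if_false, if_true, norm_div, div_pow, one_mul, neg_one_mul,
      Complex.sq_norm, Complex.normSq_apply, Complex.add_re, Complex.add_im, Complex.one_re,
      Complex.one_im, Complex.neg_re, Complex.neg_im]
    norm_num
    ring
  · intro x hx hne
    have hx0 : 0 ∉ x := fun h' => by simpa using Finset.mem_powerset.1 hx h'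
    have : (ket ∅ + χ) x = 0 := by
      change ket ∅ x + χ x = 0
      rw [ket_of_ne hne, hχ x hx0, add_zero]
    simp only [this, zero_add, Bool.false_eq_true, if_false, if_true, one_mul, neg_one_mul,
      norm_div, norm_neg, sub_self]
  · simp

/-- The circuit that samples a step: `1` is measured with probability `sin² φ`, where `2 φ` is
the angle of `t` phase gates. -/
def stepCircuit (J t : ℕ) : List Gate :=
  ([Gate.had 0] ++ List.replicate t (Gate.cphase J 0 0)) ++ [Gate.had 0]

theorem outcomeProb_stepCircuit_sub (J t : ℕ) :
    outcomeProb (stepCircuit J t) false - outcomeProb (stepCircuit J t) true =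
      (phase J ^ t).re := by
  rw [stepCircuit, outcomeProb_sub (χ := phase J ^ t • ket {0})]
  · change (_ * ket {0} {0}).re = _
    rw [ket_self, mul_one]
  · rw [act_append, act_cons, act_nil, had_ket (by simp), map_smul, map_add, act_replicate_cphase,
      act_replicate_cphase]
    simp
  · intro x hx
    change _ * ket {0} x = 0
    rw [ket_of_ne (by rintro rfl; simp at hx), mul_zero]

/-- The gates that write the sites `s 0, …, s (j - 1)` on the register if the qubit `0` is `1`. -/
def copyGates (n k : ℕ) (s : ℕ → ℤ) (j : ℕ) : List Gate :=
  (List.range j).map fun i => Gate.cnot 0 (code n k i (s i))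

theorem act_copyGates_of_notMem {n k : ℕ} (s : ℕ → ℤ) (j : ℕ) {S : Finset ℕ} (hS : 0 ∉ S) :
    act (copyGates n k s j) (ket S) = ket S := by
  induction j with
  | zero => simp [copyGates]
  | succ j ih =>
    rw [copyGates, List.range_succ, List.map_append, act_append]
    rw [copyGates] at ih
    rw [ih]
    simp [cnot_ket_of_notMem hS]

theorem act_copyGates {n k : ℕ} {s : ℕ → ℤ} (hs : ∀ i, InRange n k (s i)) (j : ℕ) {S : Finset ℕ}
    (hS : 0 ∈ S) : act (copyGates n k s j) (ket S) =
      ket (symmDiff S ((Finset.range j).image fun i => code n k i (s i))) := by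
  induction j with
  | zero => exact congrArg ket (symmDiff_bot S).symm
  | succ j ih =>
    rw [copyGates, List.range_succ, List.map_append, act_append]
    rw [copyGates] at ih
    rw [ih, List.map_singleton, act_cons, act_nil, cnot_ket (code_pos (hs j)).ne, if_pos]
    · rw [symmDiff_assoc, Finset.range_add_one, Finset.image_insert]
      congr 2
      have : code n k j (s j) ∉ (Finset.range j).image fun i => code n k i (s i) := by
        simp only [Finset.mem_image, not_exists, not_and]
        intro i hi e
        have := (code_inj (hs i) (hs j) e).1
        simp at hi
        omega
      ext x
      simp only [Finset.mem_symmDiff, Finset.mem_insert, Finset.mem_singleton]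
      by_cases hx : x = code n k j (s j)
      · subst hx; simp only [this, true_or, not_true, and_false, not_false_eq_true, and_true, or_true]
      · simp [hx]
    · rw [Finset.mem_symmDiff]
      refine Or.inl ⟨hS, ?_⟩
      simp only [Finset.mem_image, not_exists, not_and]
      intro i _ e
      exact (code_pos (hs i)).ne' e

/-- The circuit of the Hadamard test of a braid on a bit string with the sites `s 0, …, s n`. -/
def testCircuit (n k ph : ℕ) (C : Calib) (B : Braid n) (s : ℕ → ℤ) : List Gate :=
  ([Gate.had 0] ++ (List.replicate ph (Gate.cphase 2 0 0) ++ (copyGates n k s (n + 1) ++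
    (braidGates n k C B ++ copyGates n k s (n + 1))))) ++ [Gate.had 0]

/-- The second copy of the sites is added modulo 2 and erases the path `p` from the register. The
component that interferes with the empty register is exactly the coefficient of `p` after the braid;
injectivity of `pset` excludes the others. -/
theorem outcomeProb_testCircuit_sub {n k : ℕ} (hk : 3 ≤ k) (ph : ℕ) {C : Calib} (hC : C.Valid)
    (B : Braid n) (p : Fin n → Bool) :
    outcomeProb (testCircuit n k ph C B (site p)) false -
      outcomeProb (testCircuit n k ph C B (site p)) true =
        (Complex.I ^ ph * circBraid hk C B p p).re := by
  set I := (Finset.range (n + 1)).image fun i => code n k i (site p i) with hI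
  have hps : pset k p = symmDiff {0} I := by
    have : 0 ∉ I := by
      simp only [hI, Finset.mem_image, not_exists, not_and]
      intro i _ e
      exact (code_pos (inRange_site p i)).ne' e
    ext x
    simp only [pset, ← hI, Finset.mem_symmDiff, Finset.mem_insert, Finset.mem_singleton]
    by_cases hx : x = 0
    · subst hx; simp [this]
    · simp [hx]
  set y := (circBraid hk C B).mulVec (Pi.single p 1) with hy
  have hemb : ket (pset k p) = emb k (Pi.single p 1) := by
    rw [emb, Finset.sum_eq_single p]
    · simp
    · intro q _ hq; simp [Pi.single_eq_of_ne hq]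
    · simp
  rw [testCircuit, outcomeProb_sub
    (χ := Complex.I ^ ph • ∑ q, y q • ket (symmDiff (pset k q) I))]
  · have h0 : ∀ q : Fin n → Bool, y q • ket (symmDiff (pset k q) I) {0} = if q = p then y p else 0 := by
      intro q
      by_cases hq : q = p
      · rw [hq, hps, symmDiff_assoc, symmDiff_self, symmDiff_bot, ket_self, if_pos rfl]
        simp
      · rw [if_neg hq, ket_of_ne, smul_zero]
        intro e
        apply hq
        apply pset_injective n k
        rw [hps, e, symmDiff_assoc, symmDiff_self, symmDiff_bot]
    have h1 : (∑ q, y q • ket (symmDiff (pset k q) I)) {0} = y p := by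
      rw [Finset.sum_apply]
      change ∑ q, y q • ket (symmDiff (pset k q) I) {0} = y p
      simp only [h0]
      simp
    rw [Pi.smul_apply, h1, hy, Matrix.mulVec_single_one]
    rfl
  · rw [act_append, act_cons, act_nil, had_ket (by simp), map_smul, map_add]
    simp only [act_append, act_replicate_cphase]
    simp only [Finset.notMem_empty, and_self, if_false, insert_empty_eq, Finset.mem_singleton,
      if_true, one_smul, map_smul]
    rw [act_copyGates_of_notMem _ _ (Finset.notMem_empty 0), act_braidGates_empty hC,
      act_copyGates_of_notMem _ _ (Finset.notMem_empty 0),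
      act_copyGates (fun i => inRange_site p i) _ (Finset.mem_singleton_self 0), ← hI, ← hps, hemb,
      act_braidGates_emb hk hC, emb, map_sum, phase_two]
    congr 3
    refine Finset.sum_congr rfl fun q _ => ?_
    rw [map_smul, act_copyGates (fun i => inRange_site p i) _ (zero_mem_pset q)]
  · intro x hx
    rw [Pi.smul_apply, Finset.sum_apply]
    rw [Finset.sum_eq_zero, smul_zero]
    intro q _
    rw [Pi.smul_apply, ket_of_ne, smul_zero]
    rintro rfl
    apply hx
    rw [Finset.mem_symmDiff]
    refine Or.inl ⟨zero_mem_pset q, ?_⟩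
    simp only [hI, Finset.mem_image, not_exists, not_and]
    intro i _ e
    exact (code_pos (inRange_site p i)).ne' e

/-! ## The error of the circuit of a braid -/

theorem norm_proj_le {w : ℂ} (hw : ‖w‖ = 1) (s t : Bool) : ‖proj w s t‖ ≤ 1 := by
  have h1 : ‖w⁻¹‖ = 1 := by rw [norm_inv, hw, inv_one]
  have hd : ‖(w - w⁻¹) / (4 * Complex.I)‖ ≤ 1 := by
    rw [norm_div, norm_mul, Complex.norm_I, mul_one]
    have := norm_sub_le w w⁻¹
    rw [hw, h1] at this
    norm_num
    linarith
  have hp : ∀ x : ℂ, ‖x‖ ≤ 4 → ‖x / 4‖ ≤ 1 := by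
    intro x hx
    rw [norm_div]
    norm_num
    linarith
  cases s <;> cases t <;> simp only [proj, if_true, Bool.false_eq_true, if_false]
  · apply hp
    have a1 := norm_add_le (2 + w) w⁻¹
    have a2 := norm_add_le (2 : ℂ) w
    rw [hw] at a2
    rw [h1] at a1
    norm_num at a1 a2
    linarith
  · exact hd
  · exact hd
  · apply hp
    have a1 := norm_sub_le (2 - w) w⁻¹
    have a2 := norm_sub_le (2 : ℂ) w
    rw [hw] at a2
    rw [h1] at a1
    norm_num at a1 a2
    linarith

/-! ### Crossings with the writhe factor, and the error of their implementation -/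

section

variable {n k : ℕ} (hk : 3 ≤ k)

/-- The operator of a crossing with its contribution to the writhe factor. -/
def normOp (c : Fin (n - 1) × Bool) : Matrix (Fin n → Bool) (Fin n → Bool) ℂ :=
  (-crossingCoeff k c.2) ^ 3 • crossOp hk c

/-- The operator of a braid with the writhe factor. -/
def normBraid (B : Braid n) : Matrix (Fin n → Bool) (Fin n → Bool) ℂ := (B.map (normOp hk)).prod

theorem writhe_eq_sum (B : Braid n) :
    (traceClosure B).writhe = (B.map fun c => if c.2 then (1 : ℤ) else -1).sum := by
  rw [← List.ofFn_get (B.map _)]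
  rw [List.sum_ofFn]
  rw [LinkDiagram.writhe]
  refine Fintype.sum_equiv (finCongr (by simp [traceClosure])) _ _ fun j => ?_
  simp [traceClosure]
  rfl

theorem normBraid_eq (B : Braid n) :
    normBraid hk B = (-rootA k) ^ (3 * (traceClosure B).writhe) • braidOp hk B := by
  rw [writhe_eq_sum]
  have hA : -rootA k ≠ 0 := neg_ne_zero.2 (rootA_ne_zero k)
  induction B with
  | nil => simp [normBraid, braidOp]
  | cons c B ih =>
    have e1 : normBraid hk (c :: B) = normOp hk c * normBraid hk B := by simp [normBraid]
    have e2 : braidOp hk (c :: B) = crossOp hk c * braidOp hk B := by simp [braidOp]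
    have e3 : (-crossingCoeff k c.2) ^ 3 = (-rootA k) ^ (3 * if c.2 then (1 : ℤ) else -1) := by
      cases c.2
      · simp only [crossingCoeff, Bool.false_eq_true, if_false]
        rw [neg_inv, inv_pow, show (3 * -1 : ℤ) = -((3 : ℕ) : ℤ) from rfl, zpow_neg, zpow_natCast]
      · simp only [crossingCoeff, if_true]
        rw [show (3 * 1 : ℤ) = ((3 : ℕ) : ℤ) from rfl, zpow_natCast]
    rw [e1, e2, ih, normOp, e3, List.map_cons, List.sum_cons, mul_add, zpow_add₀ hA,
      smul_mul_smul_comm]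

theorem jonesTrace_eq_normBraid (hn : 1 ≤ n) (B : Braid n) : jonesTrace B k =
    (dval k : ℂ) ^ (n - 1) * ∑ p, (pathProb k p : ℂ) * normBraid hk B p p := by
  rw [jonesTrace_eq hk hn, normBraid_eq]
  simp only [Matrix.smul_apply, smul_eq_mul, Finset.mul_sum]
  refine Finset.sum_congr rfl fun p _ => ?_
  ring

theorem normOp_unitary (c : Fin (n - 1) × Bool) :
    (normOp hk c).conjTranspose * normOp hk c = 1 := by
  have ha := crossingCoeff_ne_zero (k := k) c.2
  rw [normOp, Matrix.conjTranspose_smul, smul_mul_smul_comm, crossOp_unitary, star_pow, star_neg,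
    star_crossingCoeff, ← mul_pow]
  rw [show -(crossingCoeff k c.2)⁻¹ * -crossingCoeff k c.2 = 1 by
    rw [neg_mul_neg, inv_mul_cancel₀ ha], one_pow, one_smul]

theorem normBraid_apply_eq_zero (B : Braid n) {q p : Fin n → Bool} (hp : IsPath k p)
    (hq : ¬ IsPath k q) : normBraid hk B q p = 0 := by
  rw [normBraid_eq, Matrix.smul_apply, braidOp_apply_eq_zero hk B hp hq, smul_zero]

/-- The entries of the exact projection at the site `z`. -/
def exactProj (k : ℕ) (z : ℤ) (s t : Bool) : ℝ :=
  Real.sqrt (lam k (if s then z + 1 else z - 1) * lam k (if t then z + 1 else z - 1)) /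
    (dval k * lam k z)

/-- The calibration is accurate up to the error `δ`. -/
structure Calib.Accurate (C : Calib) (k : ℕ) (δ : ℝ) : Prop where
  th : ‖phase C.J ^ C.th - (-(rootA k) ^ 2)⁻¹‖ ≤ δ
  r : ‖phase C.J ^ C.r + rootA k ^ 4‖ ≤ δ
  tab : ∀ z : ℤ, 1 ≤ z → z < k → ∀ s t,
    ‖proj (phase C.J ^ C.tab z.toNat) s t - exactProj k z s t‖ ≤ δ

/-- On the paths the Temperley-Lieb generator is $d$ times a local operator whose matrix at each
site is the projection `exactProj`. -/
theorem tlC_apply_of_isPath {i : ℕ} (h : i + 1 < n) {p : Fin n → Bool} (hp : IsPath k p)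
    (q : Fin n → Bool) : tlC hk n i q p = (dval k : ℂ) *
      loc hk h (fun z s t => if 1 ≤ z ∧ z < k then (exactProj k z s t : ℂ) else 0) q p := by
  classical
  have hd := (dval_pos hk).ne'
  have hz := hp i (by omega)
  have e1 : tlC hk n i q p = (((pathModel k hk).tl n i p q : ℝ) : ℂ) := by
    rw [tl_symm _ h]
    simp [tlC]
  rw [e1, (pathModel k hk).tl_apply h, loc]
  have hg : (pathModel k hk).Good p := (pathModel_good hk p).2 hp
  simp only [hg, true_and, pathModel_site]
  by_cases hc : p ⟨i + 1, h⟩ = (!p ⟨i, by omega⟩) ∧ q = (pathModel k hk).pair i h (q ⟨i, by omega⟩) p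
  · rw [if_pos hc, if_pos hz, Finset.sum_eq_single (q ⟨i, by omega⟩)]
    · rw [if_pos ⟨hc.1, hc.2⟩, exactProj, ← Complex.ofReal_mul]
      congr 1
      rw [StepModel.wt, mul_div_assoc', mul_div_mul_left _ _ hd]
      congr 2
      cases q ⟨i, by omega⟩ <;> cases p ⟨i, by omega⟩ <;> simp [pathModel, sub_eq_add_neg, mul_comm]
    · intro s _ hs
      rw [if_neg]
      rintro ⟨_, e⟩
      apply hs
      rw [e, (pathModel k hk).pair_left h]
    · simp
  · rw [if_neg hc, mul_zero, Finset.sum_eq_zero, Complex.ofReal_zero]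
    intro s _
    rw [if_neg]
    rintro ⟨e0, e⟩
    apply hc
    refine ⟨e0, ?_⟩
    rw [e, (pathModel k hk).pair_left h]

theorem phase_signed_sub {J x : ℕ} (hx : x ≤ 2 ^ J) {y : ℂ} (hy : ‖y‖ = 1) {δ : ℝ}
    (h : ‖phase J ^ x - y‖ ≤ δ) (b : Bool) :
    ‖phase J ^ signed J b x - (if b then y else y⁻¹)‖ ≤ δ := by
  cases b
  · simp only [signed, Bool.false_eq_true, if_false]
    rw [phase_pow_sub J hx, ← star_phase_pow, Complex.inv_eq_conj hy, ← Complex.star_def, ← star_sub,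
      norm_star]
    exact h
  · simpa [signed] using h

/-- With $\Phi=dP$ and $d=-(a^2+a^{-2})$ one finds $(-a)^3(a\Phi+a^{-1})=-a^2(1+(-a^4-1)P)$ on the
paths, which has the form of `circOp`. The difference is a scalar of size $\delta$ plus a local
operator with entries at most $5\delta$, whose norm is at most $10\delta$ by the Schur test. -/
theorem nrm_circOp_sub_normOp_le {C : Calib} (hC : C.Valid) {δ : ℝ} (hδ : C.Accurate k δ)
    (c : Fin (n - 1) × Bool) {x : (Fin n → Bool) → ℂ} (hx : ∀ p, ¬ IsPath k p → x p = 0) :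
    nrm ((circOp hk C c).mulVec x - (normOp hk c).mulVec x) ≤ 11 * δ * nrm x := by
  have hc : (c.1 : ℕ) + 1 < n := by have := c.1.2; omega
  have hδ0 : 0 ≤ δ := (norm_nonneg _).trans hδ.th
  have ha := crossingCoeff_ne_zero (k := k) c.2
  have hA := rootA_ne_zero k
  set a := crossingCoeff k c.2 with haa
  have hn2 : ‖(-(rootA k) ^ 2)⁻¹‖ = 1 := by rw [norm_inv, norm_neg, norm_pow, norm_rootA]; norm_num
  have hn4 : ‖-(rootA k) ^ 4‖ = 1 := by rw [norm_neg, norm_pow, norm_rootA]; norm_num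
  have h1 : ‖phase C.J ^ signed C.J (!c.2) C.th - -a ^ 2‖ ≤ δ := by
    have := phase_signed_sub hC.th_le hn2 hδ.th (!c.2)
    rw [haa, crossingCoeff]
    revert this
    cases c.2 <;> simp [inv_neg]
  have h2 : ‖phase C.J ^ signed C.J c.2 C.r - -a ^ 4‖ ≤ δ := by
    have := phase_signed_sub hC.r_le hn4 (δ := δ) (by rw [sub_neg_eq_add]; exact hδ.r) c.2
    rw [haa, crossingCoeff]
    revert this
    cases c.2 <;> simp [inv_neg]
  have hsq := crossingCoeff_sq_add (k := k) c.2
  rw [← haa] at hsq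
  have hn1 := norm_phase_pow C.J (signed C.J (!c.2) C.th)
  have hn3 := norm_phase_pow C.J (signed C.J c.2 C.r)
  have hna : ‖-a ^ 2‖ = 1 := by
    rw [haa, crossingCoeff]; split_ifs <;> simp [norm_rootA]
  have hna4 : ‖-a ^ 4‖ = 1 := by
    rw [haa, crossingCoeff]; split_ifs <;> simp [norm_rootA]
  set X := phase C.J ^ signed C.J (!c.2) C.th
  set Y := phase C.J ^ signed C.J c.2 C.r
  set f : ℤ → Bool → Bool → ℂ := fun z s t => if 1 ≤ z ∧ z < k then (exactProj k z s t : ℂ) else 0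
  set g : ℤ → Bool → Bool → ℂ := fun z s t =>
    X * (Y - 1) * siteProj k C z s t - -a ^ 2 * (-a ^ 4 - 1) * f z s t with hg
  have hgle : ∀ z s t, ‖g z s t‖ ≤ 5 * δ := by
    intro z s t
    simp only [hg, f, siteProj]
    split_ifs with hz
    · have h3 := hδ.tab z hz.1 hz.2 s t
      have h4 := norm_proj_le (norm_phase_pow C.J (C.tab z.toNat)) s t
      set P := proj (phase C.J ^ C.tab z.toNat) s t
      -- The three factors are replaced one by one; the contributions are $2\delta$, $\delta$ and
      -- $2\delta$.
      have e : X * (Y - 1) * P - -a ^ 2 * (-a ^ 4 - 1) * (exactProj k z s t : ℂ) =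
          (X - -a ^ 2) * ((Y - 1) * P) + -a ^ 2 * ((Y - -a ^ 4) * P) +
            -a ^ 2 * ((-a ^ 4 - 1) * (P - exactProj k z s t)) := by ring
      rw [e]
      have b1 : ‖Y - 1‖ ≤ 2 := (norm_sub_le _ _).trans (by rw [hn3, norm_one]; norm_num)
      have b2 : ‖-a ^ 4 - 1‖ ≤ 2 := (norm_sub_le _ _).trans (by rw [hna4, norm_one]; norm_num)
      refine (norm_add₃_le).trans ?_
      simp only [norm_mul, hna, one_mul]
      have c1 : ‖X - -a ^ 2‖ * (‖Y - 1‖ * ‖P‖) ≤ δ * (2 * 1) := by gcongr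
      have c2 : ‖Y - -a ^ 4‖ * ‖P‖ ≤ δ * 1 := by gcongr
      have c3 : ‖-a ^ 4 - 1‖ * ‖P - exactProj k z s t‖ ≤ 2 * δ := by gcongr
      linarith
    · simpa using hδ0
  have hmain : (circOp hk C c).mulVec x - (normOp hk c).mulVec x =
      (X - -a ^ 2) • x + (loc hk hc g).mulVec x := by
    have e1 : (normOp hk c).mulVec x =
        ((-a ^ 2) • (1 + (-a ^ 4 - 1) • loc hk hc f)).mulVec x := by
      funext q
      rw [Matrix.mulVec, Matrix.mulVec, dotProduct, dotProduct]
      refine Finset.sum_congr rfl fun p _ => ?_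
      by_cases hp : IsPath k p
      · congr 1
        simp only [normOp, crossOp, ← haa, Matrix.smul_apply, Matrix.add_apply, smul_eq_mul,
          tlC_apply_of_isPath hk hc hp]
        have : (dval k : ℂ) = -(a ^ 2 + a⁻¹ ^ 2) := by rw [hsq, neg_neg]
        rw [this]
        have hai := mul_inv_cancel₀ ha
        generalize a⁻¹ = a' at hai ⊢
        generalize loc hk hc f q p = Lq
        generalize (1 : Matrix (Fin n → Bool) (Fin n → Bool) ℂ) q p = O
        linear_combination (a ^ 2 * (1 + a * a') * Lq - a ^ 2 * O) * hai
      · rw [hx p hp, mul_zero, mul_zero]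
    have e2 : loc hk hc g = (X * (Y - 1)) • loc hk hc (siteProj k C) +
        (-(-a ^ 2 * (-a ^ 4 - 1))) • loc hk hc f := by
      rw [smul_loc, smul_loc, loc_add]
      congr 1
      funext z s t
      simp only [hg]
      ring
    rw [e1, e2, circOp, ← Matrix.sub_mulVec]
    conv_rhs => rw [← Matrix.one_mulVec x, ← Matrix.smul_mulVec, Matrix.mulVec_mulVec, mul_one,
      ← Matrix.add_mulVec]
    congr 1
    module
  rw [hmain]
  refine (nrm_add_le _ _).trans ?_
  rw [nrm_smul]
  have h5 := nrm_mulVec_le (D := loc hk hc g) (a := 2 * (5 * δ)) (sum_norm_loc_row_le hk hc hgle)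
    (sum_norm_loc_le hk hc hgle) (by positivity) x
  have h6 : ‖X - -a ^ 2‖ * nrm x ≤ δ * nrm x := mul_le_mul_of_nonneg_right h1 (nrm_nonneg x)
  linarith

/-- A hybrid argument: the approximate operators are unitary and do not enlarge the earlier error,
while the exact vector stays in the span of the paths, where the bound for one crossing applies. -/
theorem norm_circBraid_sub_normBraid_le {C : Calib} (hC : C.Valid) {δ : ℝ} (hδ : C.Accurate k δ)
    (B : Braid n) {p : Fin n → Bool} (hp : IsPath k p) :
    ‖circBraid hk C B p p - normBraid hk B p p‖ ≤ 11 * δ * B.length := by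
  have hone : nrm (Pi.single p 1 : (Fin n → Bool) → ℂ) = 1 := by
    have : nrm (Pi.single p 1 : (Fin n → Bool) → ℂ) ^ 2 = 1 := by
      rw [nrm_sq, Finset.sum_eq_single p]
      · simp
      · intro q _ hq; simp [Pi.single_eq_of_ne hq]
      · simp
    nlinarith [nrm_nonneg (Pi.single p 1 : (Fin n → Bool) → ℂ)]
  have hnb : ∀ B : Braid n, nrm ((normBraid hk B).mulVec (Pi.single p 1)) = 1 := by
    intro B
    induction B with
    | nil => rw [normBraid, List.map_nil, List.prod_nil, Matrix.one_mulVec, hone]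
    | cons c B ih =>
      have e1 : normBraid hk (c :: B) = normOp hk c * normBraid hk B := by simp [normBraid]
      rw [e1, ← Matrix.mulVec_mulVec, nrm_mulVec_of_unitary (normOp_unitary hk c), ih]
  have key : nrm ((circBraid hk C B).mulVec (Pi.single p 1) -
      (normBraid hk B).mulVec (Pi.single p 1)) ≤ 11 * δ * B.length := by
    induction B with
    | nil => simp [circBraid, normBraid, nrm]
    | cons c B ih =>
      have e1 : normBraid hk (c :: B) = normOp hk c * normBraid hk B := by simp [normBraid]
      have e2 : circBraid hk C (c :: B) = circOp hk C c * circBraid hk C B := by simp [circBraid]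
      rw [e1, e2, ← Matrix.mulVec_mulVec, ← Matrix.mulVec_mulVec]
      set y := (circBraid hk C B).mulVec (Pi.single p 1)
      set x := (normBraid hk B).mulVec (Pi.single p 1) with hxx
      have e3 : (circOp hk C c).mulVec y - (normOp hk c).mulVec x =
          (circOp hk C c).mulVec (y - x) + ((circOp hk C c).mulVec x - (normOp hk c).mulVec x) := by
        rw [Matrix.mulVec_sub]; abel
      rw [e3]
      refine (nrm_add_le _ _).trans ?_
      rw [nrm_mulVec_of_unitary (circOp_unitary hk C c)]
      have h4 := nrm_circOp_sub_normOp_le hk hC hδ c (x := x) (fun q hq => by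
        rw [hxx, Matrix.mulVec_single_one]
        exact normBraid_apply_eq_zero hk B hp hq)
      rw [hnb B, mul_one] at h4
      rw [List.length_cons]
      push_cast
      linarith
  refine le_trans ?_ key
  have := norm_apply_le_nrm ((circBraid hk C B).mulVec (Pi.single p 1) -
      (normBraid hk B).mulVec (Pi.single p 1)) p
  rw [Matrix.mulVec_single_one, Matrix.mulVec_single_one] at this ⊢
  exact this

end

/-! ## Sampling of paths -/

/-- The probability of a bit string when the steps are drawn one by one, with probabilities that
depend on the current site. -/
def walkProb (κ : ℤ → Bool → ℝ) {n : ℕ} (p : Fin n → Bool) : ℝ := ∏ i : Fin n, κ (site p i) (p i)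

theorem site_snoc {n : ℕ} (p : Fin n → Bool) (b : Bool) {i : ℕ} (hi : i ≤ n) :
    site (Fin.snoc p b : Fin (n + 1) → Bool) i = site p i := by
  induction i with
  | zero => simp [site]
  | succ i ih =>
    rw [site_succ _ (by omega : i < n + 1), site_succ _ (by omega : i < n), ih (by omega)]
    congr 2
    have : (⟨i, by omega⟩ : Fin (n + 1)) = Fin.castSucc ⟨i, by omega⟩ := rfl
    rw [this, Fin.snoc_castSucc (α := fun _ => Bool)]

theorem site_snoc_last {n : ℕ} (p : Fin n → Bool) (b : Bool) :
    site (Fin.snoc p b : Fin (n + 1) → Bool) (n + 1) = site p n + if b then 1 else -1 := by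
  rw [site_succ _ (by omega : n < n + 1), site_snoc p b le_rfl]
  congr 2
  have : (⟨n, by omega⟩ : Fin (n + 1)) = Fin.last n := rfl
  rw [this, Fin.snoc_last (α := fun _ => Bool)]

theorem sum_snoc {R : Type*} [AddCommMonoid R] {n : ℕ} (F : (Fin (n + 1) → Bool) → R) :
    ∑ p, F p = ∑ p : Fin n → Bool, ∑ b, F (Fin.snoc p b) := by
  rw [← (Fin.snocEquiv fun _ : Fin (n + 1) => Bool).sum_comp, Fintype.sum_prod_type, Finset.sum_comm]
  rfl

theorem walkProb_snoc (κ : ℤ → Bool → ℝ) {n : ℕ} (p : Fin n → Bool) (b : Bool) :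
    walkProb κ (Fin.snoc p b : Fin (n + 1) → Bool) = walkProb κ p * κ (site p n) b := by
  rw [walkProb, Fin.prod_univ_castSucc, walkProb]
  congr 1
  · refine Finset.prod_congr rfl fun i _ => ?_
    rw [Fin.snoc_castSucc (α := fun _ => Bool), Fin.val_castSucc, site_snoc p b i.2.le]
  · rw [Fin.snoc_last (α := fun _ => Bool), Fin.val_last, site_snoc p b le_rfl]

theorem walkProb_nonneg {κ : ℤ → Bool → ℝ} (h : ∀ z b, 0 ≤ κ z b) {n : ℕ} (p : Fin n → Bool) :
    0 ≤ walkProb κ p := Finset.prod_nonneg fun _ _ => h _ _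

theorem sum_walkProb {κ : ℤ → Bool → ℝ} (h : ∀ z, ∑ b, κ z b = 1) (n : ℕ) :
    ∑ p : Fin n → Bool, walkProb κ p = 1 := by
  induction n with
  | zero => simp [walkProb]
  | succ n ih =>
    rw [sum_snoc]
    simp only [walkProb_snoc, ← Finset.mul_sum, h, mul_one, ih]

/-- One step at a time: the earlier difference is propagated by transition probabilities of sum 1,
and the new step adds $\delta$ for each of its two values. -/
theorem sum_abs_walkProb_sub_le {κ κ' : ℤ → Bool → ℝ} (h0 : ∀ z b, 0 ≤ κ z b)
    (h0' : ∀ z b, 0 ≤ κ' z b) (h1 : ∀ z, ∑ b, κ z b = 1) (h1' : ∀ z, ∑ b, κ' z b = 1) {δ : ℝ}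
    (h : ∀ z b, |κ z b - κ' z b| ≤ δ) (n : ℕ) :
    ∑ p : Fin n → Bool, |walkProb κ p - walkProb κ' p| ≤ 2 * δ * n := by
  induction n with
  | zero => simp [walkProb]
  | succ n ih =>
    rw [sum_snoc]
    have key : ∀ p : Fin n → Bool, ∑ b, |walkProb κ (Fin.snoc p b : Fin (n + 1) → Bool) -
        walkProb κ' (Fin.snoc p b : Fin (n + 1) → Bool)| ≤
        |walkProb κ p - walkProb κ' p| + walkProb κ' p * (2 * δ) := by
      intro p
      have hb : ∀ b, |walkProb κ (Fin.snoc p b : Fin (n + 1) → Bool) -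
          walkProb κ' (Fin.snoc p b : Fin (n + 1) → Bool)| ≤
          |walkProb κ p - walkProb κ' p| * κ (site p n) b + walkProb κ' p * δ := by
        intro b
        rw [walkProb_snoc, walkProb_snoc]
        have e : walkProb κ p * κ (site p n) b - walkProb κ' p * κ' (site p n) b =
            (walkProb κ p - walkProb κ' p) * κ (site p n) b +
              walkProb κ' p * (κ (site p n) b - κ' (site p n) b) := by ring
        rw [e]
        refine (abs_add_le _ _).trans ?_
        rw [abs_mul, abs_mul, abs_of_nonneg (h0 _ _), abs_of_nonneg (walkProb_nonneg h0' p)]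
        have := mul_le_mul_of_nonneg_left (h (site p n) b) (walkProb_nonneg h0' p)
        linarith
      refine (Finset.sum_le_sum fun b _ => hb b).trans ?_
      rw [Finset.sum_add_distrib, ← Finset.mul_sum, h1, mul_one, Finset.sum_const, Finset.card_univ,
        Fintype.card_bool]
      simp only [nsmul_eq_mul]
      push_cast
      linarith
    refine (Finset.sum_le_sum fun p _ => key p).trans ?_
    rw [Finset.sum_add_distrib, ← Finset.sum_mul, sum_walkProb h1']
    push_cast
    linarith

/-! ### The law of the sampled path and the mean of a round -/

section

variable {k : ℕ} (hk : 3 ≤ k)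

theorem exactProj_self {z : ℤ} (b : Bool) :
    exactProj k z b b = lam k (z + if b then 1 else -1) / (dval k * lam k z) := by
  rw [exactProj, Real.sqrt_mul_self (lam_nonneg _ _)]
  cases b <;> simp [sub_eq_add_neg]

/-- Doob's transform by the eigenfunction: the weight changes from $\lambda_z$ to $\lambda_{z\pm1}$
and the total weight by the factor $d$. A step out of the graph has $\lambda=0$, and a bit string
that is not a path has weight zero, so $\kappa$ is only constrained at the sites. -/
theorem pathProb_snoc (hk : 3 ≤ k) {κ : ℤ → Bool → ℝ}
    (h : ∀ z : ℤ, 1 ≤ z → z < k → ∀ b, κ z b = exactProj k z b b)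
    {n : ℕ} (p : Fin n → Bool) (b : Bool) :
    pathProb k (Fin.snoc p b : Fin (n + 1) → Bool) = pathProb k p * κ (site p n) b := by
  have hd := (dval_pos hk).ne'
  by_cases hp : IsPath k p
  · have hz := hp n le_rfl
    have hl := (lam_pos hz.1 hz.2).ne'
    rw [h _ hz.1 hz.2, exactProj_self]
    have e : pathWeight k (Fin.snoc p b : Fin (n + 1) → Bool) =
        lam k (site p n + if b then 1 else -1) := by
      rw [pathWeight]
      by_cases hq : IsPath k (Fin.snoc p b : Fin (n + 1) → Bool)
      · rw [if_pos hq, site_snoc_last]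
      · rw [if_neg hq]
        symm
        by_contra hne
        apply hq
        intro i hi
        rcases Nat.lt_or_ge n i with hi' | hi'
        · have : i = n + 1 := by omega
          rw [this, site_snoc_last]
          exact lam_ne_zero_iff.1 hne
        · rw [site_snoc p b hi']
          exact hp i hi'
    rw [pathProb, pathProb, sum_pathWeight hk, sum_pathWeight hk, e, pathWeight, if_pos hp, pow_succ]
    have hl1 : lam k 1 ≠ 0 := (lam_pos le_rfl (by omega)).ne'
    field_simp
  · rw [pathProb_eq_zero hp, zero_mul, pathProb_eq_zero]
    intro hq
    apply hp
    intro i hi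
    rw [← site_snoc p b hi]
    exact hq i (by omega)

theorem walkProb_eq_pathProb (hk : 3 ≤ k) {κ : ℤ → Bool → ℝ}
    (h : ∀ z : ℤ, 1 ≤ z → z < k → ∀ b, κ z b = exactProj k z b b)
    {n : ℕ} (p : Fin n → Bool) : walkProb κ p = pathProb k p := by
  induction n with
  | zero =>
    have : IsPath k p := by
      intro i _
      have : site p i = 1 := by simp [site]
      rw [this]
      omega
    rw [walkProb, Finset.univ_eq_empty, Finset.prod_empty, pathProb, sum_pathWeight hk, pathWeight,
      if_pos this, pow_zero, mul_one, show site p 0 = 1 by simp [site], div_self]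
    exact (lam_pos le_rfl (by omega)).ne'
  | succ n ih =>
    rw [← Fin.snoc_init_self (α := fun _ => Bool) p, walkProb_snoc, ih, pathProb_snoc hk h]

/-- The number of phase gates for the step from the site `z`. -/
def Calib.stepCount (C : Calib) (k : ℕ) (z : ℤ) : ℕ := if 1 ≤ z ∧ z < k then C.tab z.toNat else 0

/-- The probability of a step from the site `z` of the sampled walk. -/
def stepProb (C : Calib) (k : ℕ) (z : ℤ) (b : Bool) : ℝ :=
  outcomeProb (stepCircuit C.J (C.stepCount k z)) b

theorem outcomeProb_nonneg (D : List Gate) (b : Bool) : 0 ≤ outcomeProb D b :=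
  Finset.sum_nonneg fun _ _ => by positivity

theorem stepProb_nonneg (C : Calib) (z : ℤ) (b : Bool) : 0 ≤ stepProb C k z b :=
  outcomeProb_nonneg _ _

theorem sum_stepProb (C : Calib) (z : ℤ) : ∑ b, stepProb C k z b = 1 := by
  rw [Fintype.sum_bool]; exact outcomeProb_sum _

theorem stepProb_eq_proj (C : Calib) {z : ℤ} (h1 : 1 ≤ z) (h2 : z < k) (b : Bool) :
    (stepProb C k z b : ℂ) = proj (phase C.J ^ C.tab z.toNat) b b := by
  have a1 := outcomeProb_sum (stepCircuit C.J (C.tab z.toNat))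
  have a2 := outcomeProb_stepCircuit_sub C.J (C.tab z.toNat)
  rw [stepProb, Calib.stepCount, if_pos ⟨h1, h2⟩]
  have a3 : phase C.J ^ C.tab z.toNat + (phase C.J ^ C.tab z.toNat)⁻¹ =
      ((2 * (phase C.J ^ C.tab z.toNat).re : ℝ) : ℂ) := by
    rw [← star_phase_pow, Complex.star_def, Complex.add_conj]
  cases b
  · have : outcomeProb (stepCircuit C.J (C.tab z.toNat)) false =
        (1 + (phase C.J ^ C.tab z.toNat).re) / 2 := by linarith
    rw [this]
    simp only [proj, Bool.false_eq_true, if_false]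
    rw [add_assoc, a3]
    push_cast
    ring
  · have : outcomeProb (stepCircuit C.J (C.tab z.toNat)) true =
        (1 - (phase C.J ^ C.tab z.toNat).re) / 2 := by linarith
    rw [this]
    simp only [proj, if_true]
    rw [sub_sub, a3]
    push_cast
    ring

theorem sum_exactProj (hk : 3 ≤ k) {z : ℤ} (h1 : 1 ≤ z) (h2 : z < k) :
    ∑ b, exactProj k z b b = 1 := by
  have hl := (lam_pos h1 h2)
  have hd := dval_pos hk
  simp only [exactProj_self]
  rw [← Finset.sum_div, div_eq_one_iff_eq (by positivity)]
  exact (pathModel k hk).harmonic z hl.ne'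

theorem sum_abs_walkProb_sub_pathProb_le (hk : 3 ≤ k) {C : Calib} {δ : ℝ} (hδ : C.Accurate k δ)
    (n : ℕ) : ∑ p : Fin n → Bool, |walkProb (stepProb C k) p - pathProb k p| ≤ 2 * δ * n := by
  have hδ0 : 0 ≤ δ := (norm_nonneg _).trans hδ.th
  -- Exact at the sites, and equal to the law of the circuit elsewhere. The walk with these
  -- probabilities still has the law `pathProb`, and off the sites there is nothing to compare.
  set κ' : ℤ → Bool → ℝ := fun z b => if 1 ≤ z ∧ z < k then exactProj k z b b else stepProb C k z b
    with hκ'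
  have e : ∀ p : Fin n → Bool, pathProb k p = walkProb κ' p := fun p =>
    (walkProb_eq_pathProb hk (fun z h1 h2 b => if_pos ⟨h1, h2⟩) p).symm
  simp only [e]
  refine sum_abs_walkProb_sub_le (stepProb_nonneg C) ?_ (sum_stepProb C) ?_ ?_ n
  · intro z b
    simp only [hκ']
    split_ifs with hz
    · rw [exactProj]
      have := (lam_pos hz.1 hz.2).le
      have := (dval_pos hk).le
      positivity
    · exact stepProb_nonneg C z b
  · intro z
    simp only [hκ']
    split_ifs with hz
    · exact sum_exactProj hk hz.1 hz.2
    · exact sum_stepProb C z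
  · intro z b
    simp only [hκ']
    split_ifs with hz
    · have := hδ.tab z hz.1 hz.2 b b
      rw [← stepProb_eq_proj C hz.1 hz.2, ← Complex.ofReal_sub, Complex.norm_real,
        Real.norm_eq_abs] at this
      exact this
    · simpa using hδ0

/-- The mean of the outcome of a round of the circuit. -/
def roundMean (hk : 3 ≤ k) (C : Calib) {n : ℕ} (B : Braid n) (ph : ℕ) : ℝ :=
  ∑ p, walkProb (stepProb C k) p * (Complex.I ^ ph * circBraid hk C B p p).re

theorem norm_circBraid_apply_le (hk : 3 ≤ k) (C : Calib) {n : ℕ} (B : Braid n)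
    (p : Fin n → Bool) : ‖circBraid hk C B p p‖ ≤ 1 := by
  have hone : nrm (Pi.single p 1 : (Fin n → Bool) → ℂ) = 1 := by
    have : nrm (Pi.single p 1 : (Fin n → Bool) → ℂ) ^ 2 = 1 := by
      rw [nrm_sq, Finset.sum_eq_single p]
      · simp
      · intro q _ hq; simp [Pi.single_eq_of_ne hq]
      · simp
    nlinarith [nrm_nonneg (Pi.single p 1 : (Fin n → Bool) → ℂ)]
  have h : nrm ((circBraid hk C B).mulVec (Pi.single p 1)) = 1 := by
    induction B with
    | nil => rw [circBraid, List.map_nil, List.prod_nil, Matrix.one_mulVec, hone]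
    | cons c B ih =>
      have e2 : circBraid hk C (c :: B) = circOp hk C c * circBraid hk C B := by simp [circBraid]
      rw [e2, ← Matrix.mulVec_mulVec, nrm_mulVec_of_unitary (circOp_unitary hk C c), ih]
  rw [← h]
  have := norm_apply_le_nrm ((circBraid hk C B).mulVec (Pi.single p 1)) p
  rw [Matrix.mulVec_single_one] at this ⊢
  exact this

/-- Two independent sources of error: the law of the path, tested against a function bounded by 1,
and the circuit operator on a true path. Bit strings that are not paths have probability zero under
the exact law, so the operators need not agree there. -/
theorem abs_roundMean_sub_le (hk : 3 ≤ k) {C : Calib} (hC : C.Valid) {δ : ℝ} (hδ : C.Accurate k δ)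
    {n : ℕ} (B : Braid n) (ph : ℕ) :
    |roundMean hk C B ph - (Complex.I ^ ph * ∑ p, (pathProb k p : ℂ) * normBraid hk B p p).re| ≤
      2 * δ * n + 11 * δ * B.length := by
  have hre : ∀ z : ℂ, |(Complex.I ^ ph * z).re| ≤ ‖z‖ := by
    intro z
    refine (Complex.abs_re_le_norm _).trans ?_
    rw [norm_mul, norm_pow, Complex.norm_I, one_pow, one_mul]
  have e : roundMean hk C B ph - (Complex.I ^ ph * ∑ p, (pathProb k p : ℂ) * normBraid hk B p p).re =
      ∑ p, ((walkProb (stepProb C k) p - pathProb k p) * (Complex.I ^ ph * circBraid hk C B p p).re +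
        pathProb k p * (Complex.I ^ ph * (circBraid hk C B p p - normBraid hk B p p)).re) := by
    rw [roundMean, Finset.mul_sum, Complex.re_sum, ← Finset.sum_sub_distrib]
    refine Finset.sum_congr rfl fun p _ => ?_
    rw [mul_left_comm, Complex.re_ofReal_mul, mul_sub, Complex.sub_re]
    ring
  rw [e]
  refine (Finset.abs_sum_le_sum_abs _ _).trans ?_
  have key : ∀ p : Fin n → Bool, |(walkProb (stepProb C k) p - pathProb k p) *
      (Complex.I ^ ph * circBraid hk C B p p).re + pathProb k p *
        (Complex.I ^ ph * (circBraid hk C B p p - normBraid hk B p p)).re| ≤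
      |walkProb (stepProb C k) p - pathProb k p| + pathProb k p * (11 * δ * B.length) := by
    intro p
    refine (abs_add_le _ _).trans (add_le_add ?_ ?_)
    · rw [abs_mul]
      exact mul_le_of_le_one_right (abs_nonneg _)
        ((hre _).trans (norm_circBraid_apply_le hk C B p))
    · rw [abs_mul, abs_of_nonneg (pathProb_nonneg p)]
      by_cases hp : IsPath k p
      · exact mul_le_mul_of_nonneg_left ((hre _).trans
          (norm_circBraid_sub_normBraid_le hk hC hδ B hp)) (pathProb_nonneg p)
      · rw [pathProb_eq_zero hp, zero_mul, zero_mul]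
  refine (Finset.sum_le_sum fun p _ => key p).trans ?_
  rw [Finset.sum_add_distrib, ← Finset.sum_mul, sum_pathProb hk, one_mul]
  linarith [sum_abs_walkProb_sub_pathProb_le hk hδ n]

end

/-! ## Computation of the angles -/

/-- The real and the imaginary part of the power `(N² - 1 + 2 N i) ^ a`. -/
def rot (N : ℤ) : ℕ → ℤ × ℤ
  | 0 => (1, 0)
  | a + 1 => ((rot N a).1 * (N ^ 2 - 1) - (rot N a).2 * (2 * N),
      (rot N a).1 * (2 * N) + (rot N a).2 * (N ^ 2 - 1))

/-- The number of `a < l` for which `cos (a η) A + C` is positive, where `η` is the argument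
of `N² - 1 + 2 N i`. -/
def scanCount (N : ℤ) (l : ℕ) (A C : ℤ) : ℕ :=
  ((Finset.range l).filter fun a => 1 ≤ (rot N a).1 * A + (N ^ 2 + 1) ^ a * C).card

/-- The number of steps of angle `η` in a quarter turn. -/
def quarter (N : ℕ) : ℕ := scanCount N (2 * N) 1 0

/-- The number of steps of angle `η` in the angle `π / k`. -/
def unitCount (N k : ℕ) : ℕ := 2 * quarter N / k

/-- The number of steps of angle `η` in the angle of the site `z`. -/
def angleCount (N k z : ℕ) : ℕ :=
  scanCount N (2 * quarter N - 1) ((rot N (z * unitCount N k)).2 * (rot N (unitCount N k)).1)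
    ((rot N (z * unitCount N k)).1 * (rot N (unitCount N k)).2)

/-- The numbers of phase gates, when `2 ^ J` gates make a full turn. -/
def calib (N k J : ℕ) : Calib where
  J := J
  th := 2 ^ J / (2 * k)
  r := (k - 2) * 2 ^ J / (2 * k)
  tab z := angleCount N k z * 2 ^ J / (4 * quarter N)

theorem scanCount_le (N : ℤ) (l : ℕ) (A C : ℤ) : scanCount N l A C ≤ l := by
  refine (Finset.card_filter_le _ _).trans ?_
  rw [Finset.card_range]

theorem calib_valid (N k J : ℕ) : (calib N k J).Valid := by
  refine ⟨Nat.div_le_self _ _, ?_, fun z => ?_⟩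
  · refine Nat.div_le_of_le_mul ?_
    exact Nat.mul_le_mul_right _ (by omega)
  · refine Nat.div_le_of_le_mul ?_
    refine Nat.mul_le_mul_right _ ((scanCount_le _ _ _ _).trans ?_)
    omega

/-- The angle `η`. -/
def eta (N : ℕ) : ℝ := 2 * Real.arctan (1 / N)

theorem cos_eta {N : ℕ} (hN : 1 ≤ N) : Real.cos (eta N) * ((N : ℝ) ^ 2 + 1) = (N : ℝ) ^ 2 - 1 := by
  have h : (0 : ℝ) < N := by exact_mod_cast hN
  rw [eta, Real.cos_two_mul, Real.cos_sq_arctan]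
  field_simp
  ring

theorem sin_eta {N : ℕ} (hN : 1 ≤ N) : Real.sin (eta N) * ((N : ℝ) ^ 2 + 1) = 2 * N := by
  have h : (0 : ℝ) < N := by exact_mod_cast hN
  have hc : Real.cos (Real.arctan (1 / N)) ≠ 0 := (Real.cos_arctan_pos _).ne'
  have h1 : Real.sin (Real.arctan (1 / N)) = 1 / N * Real.cos (Real.arctan (1 / N)) := by
    have := Real.tan_arctan (1 / (N : ℝ))
    rw [Real.tan_eq_sin_div_cos, div_eq_iff hc] at this
    exact this
  rw [eta, Real.sin_two_mul, h1]
  have h2 := Real.cos_sq_arctan (1 / (N : ℝ))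
  have e : 2 * (1 / (N : ℝ) * Real.cos (Real.arctan (1 / N))) * Real.cos (Real.arctan (1 / N)) =
    2 / N * Real.cos (Real.arctan (1 / N)) ^ 2 := by ring
  rw [e, h2]
  field_simp

theorem eta_le {N : ℕ} (hN : 1 ≤ N) : eta N ≤ 2 / N := by
  have h : (0 : ℝ) < N := by exact_mod_cast hN
  have h0 : 0 ≤ Real.arctan (1 / N) := Real.arctan_nonneg.2 (by positivity)
  have := Real.le_tan h0 (Real.arctan_lt_pi_div_two _)
  rw [Real.tan_arctan] at this
  rw [eta]
  have e : (2 : ℝ) / N = 2 * (1 / N) := by ring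
  rw [e]
  linarith

theorem le_eta {N : ℕ} (hN : 1 ≤ N) : 1 / N ≤ eta N := by
  have h : (1 : ℝ) ≤ N := by exact_mod_cast hN
  have h0 : 0 < eta N := by
    have : 0 < Real.arctan (1 / N) := Real.arctan_pos.2 (by positivity)
    rw [eta]; linarith
  have h1 := Real.sin_lt h0
  have h2 := sin_eta hN
  rw [div_le_iff₀ (by positivity)]
  have h3 : Real.sin (eta N) = 2 * N / ((N : ℝ) ^ 2 + 1) := by
    rw [eq_div_iff (by positivity)]; exact h2
  rw [h3, div_lt_iff₀ (by positivity)] at h1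
  nlinarith

theorem eta_pos {N : ℕ} (hN : 1 ≤ N) : 0 < eta N := by
  have h : (0 : ℝ) < N := by exact_mod_cast hN
  exact lt_of_lt_of_le (by positivity) (le_eta hN)

theorem rot_eq {N : ℕ} (hN : 1 ≤ N) (a : ℕ) :
    ((rot N a).1 : ℝ) = ((N : ℝ) ^ 2 + 1) ^ a * Real.cos (a * eta N) ∧
      ((rot N a).2 : ℝ) = ((N : ℝ) ^ 2 + 1) ^ a * Real.sin (a * eta N) := by
  induction a with
  | zero => simp [rot]
  | succ a ih =>
    have hc := cos_eta hN
    have hs := sin_eta hN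
    have e : ((a + 1 : ℕ) : ℝ) * eta N = a * eta N + eta N := by push_cast; ring
    simp only [rot]
    push_cast
    rw [ih.1, ih.2, ← hc, ← hs]
    push_cast at e
    rw [e, Real.cos_add, Real.sin_add, pow_succ]
    constructor <;> ring

/-- For a predicate that holds on an initial segment, the number of successes is the first failure.
This turns the counts of `scanCount` into thresholds. -/
theorem card_filter_range {P : ℕ → Prop} [DecidablePred P] {l : ℕ}
    (h : ∀ a b, a ≤ b → b < l → P b → P a) :
    (∀ a, a < ((Finset.range l).filter P).card → P a) ∧
      (((Finset.range l).filter P).card < l → ¬ P ((Finset.range l).filter P).card) := by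
  set c := ((Finset.range l).filter P).card with hc
  have hcl : c ≤ l := by
    refine (Finset.card_filter_le _ _).trans ?_
    rw [Finset.card_range]
  constructor
  · intro a ha
    by_contra hP
    have : (Finset.range l).filter P ⊆ Finset.range a := by
      intro b hb
      rw [Finset.mem_filter, Finset.mem_range] at hb
      rw [Finset.mem_range]
      by_contra hab
      exact hP (h a b (by omega) hb.1 hb.2)
    have := Finset.card_le_card this
    rw [Finset.card_range, ← hc] at this
    omega
  · intro hcl' hP
    have : Finset.range (c + 1) ⊆ (Finset.range l).filter P := by
      intro b hb
      rw [Finset.mem_range] at hb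
      rw [Finset.mem_filter, Finset.mem_range]
      exact ⟨by omega, h b c (by omega) hcl' hP⟩
    have := Finset.card_le_card this
    rw [Finset.card_range, ← hc] at this
    omega

/-- Division by the positive number $(N^2+1)^a$; for an integer, `1 ≤` is strict positivity. -/
theorem scan_iff {N : ℕ} (hN : 1 ≤ N) (a : ℕ) (A C : ℤ) :
    1 ≤ (rot N a).1 * A + ((N : ℤ) ^ 2 + 1) ^ a * C ↔ 0 < Real.cos (a * eta N) * A + C := by
  have h1 : (0 : ℝ) < ((N : ℝ) ^ 2 + 1) ^ a := by positivity
  have e : (((rot N a).1 * A + ((N : ℤ) ^ 2 + 1) ^ a * C : ℤ) : ℝ) =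
      ((N : ℝ) ^ 2 + 1) ^ a * (Real.cos (a * eta N) * A + C) := by
    push_cast
    rw [(rot_eq hN a).1]
    ring
  rw [← mul_pos_iff_of_pos_left h1, ← e]
  norm_cast

/-- The $2N$ angles scanned reach beyond a quarter turn, since $2N\eta\ge2>\pi/2$, but not so far
that the cosine could become positive again, since $2N\eta\le4<3\pi/2$. -/
theorem quarter_spec {N : ℕ} (hN : 1 ≤ N) :
    1 ≤ quarter N ∧ quarter N ≤ 2 * N ∧ Real.pi / 2 ≤ quarter N * eta N ∧
      (quarter N - 1) * eta N < Real.pi / 2 := by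
  have hN' : (1 : ℝ) ≤ N := by exact_mod_cast hN
  have hη := eta_pos hN
  have h2N : 2 * N * eta N ≤ 4 := by
    have := mul_le_mul_of_nonneg_left (eta_le hN) (by positivity : (0 : ℝ) ≤ 2 * N)
    have e : 2 * (N : ℝ) * (2 / N) = 4 := by field_simp; norm_num
    linarith
  have h2N' : 2 ≤ 2 * N * eta N := by
    have := mul_le_mul_of_nonneg_left (le_eta hN) (by positivity : (0 : ℝ) ≤ 2 * N)
    have e : 2 * (N : ℝ) * (1 / N) = 2 := by field_simp
    linarith
  have hP : ∀ a, a < 2 * N → (1 ≤ (rot N a).1 * 1 + ((N : ℤ) ^ 2 + 1) ^ a * 0 ↔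
      a * eta N < Real.pi / 2) := by
    intro a ha
    rw [scan_iff hN]
    have ha' : (a : ℝ) * eta N ≤ 4 := by
      have : (a : ℝ) ≤ 2 * N := by exact_mod_cast ha.le
      nlinarith
    have h0 : 0 ≤ (a : ℝ) * eta N := by positivity
    constructor
    · intro h
      by_contra hge
      push Not at hge
      have := Real.cos_nonpos_of_pi_div_two_le_of_le hge (by linarith [Real.pi_gt_d2])
      simp at h
      linarith
    · intro h
      have := Real.cos_pos_of_mem_Ioo (x := a * eta N) ⟨by linarith [Real.pi_pos], h⟩
      simpa using this
  have hmono : ∀ a b, a ≤ b → b < 2 * N → 1 ≤ (rot N b).1 * 1 + ((N : ℤ) ^ 2 + 1) ^ b * 0 →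
      1 ≤ (rot N a).1 * 1 + ((N : ℤ) ^ 2 + 1) ^ a * 0 := by
    intro a b hab hb h
    rw [hP b hb] at h
    rw [hP a (by omega)]
    have : (a : ℝ) ≤ b := by exact_mod_cast hab
    nlinarith
  obtain ⟨c1, c2⟩ := card_filter_range hmono
  have hle := scanCount_le N (2 * N) 1 0
  change quarter N ≤ 2 * N at hle
  change ∀ a, a < quarter N → _ at c1
  change quarter N < 2 * N → ¬ 1 ≤ (rot N (quarter N)).1 * 1 + ((N : ℤ) ^ 2 + 1) ^ quarter N * 0 at c2
  have h1 : 1 ≤ quarter N := by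
    by_contra h
    have h0 : quarter N = 0 := by omega
    apply c2 (by omega)
    rw [h0, hP 0 (by omega)]
    simp [Real.pi_pos]
  refine ⟨h1, hle, ?_, ?_⟩
  · rcases Nat.lt_or_ge (quarter N) (2 * N) with h | h
    · have := c2 h
      rw [hP _ h] at this
      linarith
    · have : (2 * N : ℝ) ≤ quarter N := by exact_mod_cast h
      have h5 : 2 * N * eta N ≤ quarter N * eta N := mul_le_mul_of_nonneg_right this hη.le
      linarith [Real.pi_lt_d2]
  · have := (hP (quarter N - 1) (by omega)).1 (c1 _ (by omega))
    rw [Nat.cast_sub h1] at this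
    simpa using this

/-- The count of the quarter turn is rounded up and the division by $k$ is rounded down. The errors
have opposite signs, and each is at most one $\eta$. -/
theorem abs_unit_sub_le {N k : ℕ} (hN : 1 ≤ N) (hk : 3 ≤ k) :
    |unitCount N k * eta N - Real.pi / k| ≤ 2 / N := by
  obtain ⟨h1, h2, h3, h4⟩ := quarter_spec hN
  have hk' : (3 : ℝ) ≤ k := by exact_mod_cast hk
  have hη := eta_pos hN
  refine le_trans ?_ (eta_le hN)
  have u1 : (unitCount N k : ℝ) ≤ 2 * quarter N / k := by
    have := Nat.cast_div_le (α := ℝ) (m := 2 * quarter N) (n := k)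
    push_cast at this
    exact this
  have u2 : 2 * (quarter N : ℝ) / k < unitCount N k + 1 := by
    rw [div_lt_iff₀ (by positivity)]
    have := Nat.lt_div_mul_add (a := 2 * quarter N) (b := k) (by omega)
    have h : 2 * quarter N < (unitCount N k + 1) * k := by
      rw [unitCount, Nat.add_mul, one_mul]; exact this
    exact_mod_cast h
  have e1 : 2 * (quarter N : ℝ) / k * eta N = 2 * (quarter N * eta N) / k := by ring
  have b1 : 2 * (quarter N * eta N) / k ≤ Real.pi / k + eta N := by
    rw [div_add' _ _ _ (by positivity), div_le_div_iff_of_pos_right (by positivity)]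
    nlinarith
  have b2 : Real.pi / k ≤ 2 * (quarter N * eta N) / k := by
    rw [div_le_div_iff_of_pos_right (by positivity)]
    linarith
  have v1 := mul_le_mul_of_nonneg_right u1 hη.le
  have v2 := mul_lt_mul_of_pos_right u2 hη
  rw [e1] at v1 v2
  rw [abs_le]
  constructor <;> nlinarith

/-! ### The angles of the sites -/

/-- The cosine of twice the angle of the site `z`. -/
def siteCos (k z : ℕ) : ℝ :=
  -(Real.sin (Real.pi / k) * Real.cos (z * (Real.pi / k))) /
    (Real.cos (Real.pi / k) * Real.sin (z * (Real.pi / k)))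

/-- One has $\cos(\pi/k)\ge1/2$, and by concavity $\sin(z\pi/k)\ge\sin(\pi/k)\ge2/k$. This lower
bound keeps the quotient `siteCos` stable under perturbation. -/
theorem site_denominator {k z : ℕ} (hk : 3 ≤ k) (h1 : 1 ≤ z) (h2 : z < k) :
    1 / (k : ℝ) ≤ Real.cos (Real.pi / k) * Real.sin (z * (Real.pi / k)) := by
  have hk' : (3 : ℝ) ≤ k := by exact_mod_cast hk
  have h1' : (1 : ℝ) ≤ z := by exact_mod_cast h1
  have h2' : (z : ℝ) + 1 ≤ k := by exact_mod_cast h2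
  have hπ := Real.pi_pos
  set x := Real.pi / k with hx
  have hx0 : 0 < x := by positivity
  have hkx : (k : ℝ) * x = Real.pi := by rw [hx]; field_simp
  have hx3 : x ≤ Real.pi / 3 := by
    rw [hx]; exact div_le_div_of_nonneg_left hπ.le (by norm_num) hk'
  have hc : 1 / 2 ≤ Real.cos x := by
    rw [← Real.cos_pi_div_three]
    exact Real.cos_le_cos_of_nonneg_of_le_pi hx0.le (by linarith) hx3
  have hsx : 2 / (k : ℝ) ≤ Real.sin x := by
    have := Real.mul_le_sin hx0.le (by linarith)
    have e : 2 / Real.pi * x = 2 / k := by rw [hx]; field_simp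
    rwa [e] at this
  have hs : Real.sin x ≤ Real.sin (z * x) := by
    have hzx : x ≤ z * x := by nlinarith
    have hzx' : z * x ≤ Real.pi - x := by nlinarith
    rcases le_total (z * x) (Real.pi / 2) with h | h
    · exact Real.sin_le_sin_of_le_of_le_pi_div_two (by linarith) h hzx
    · rw [← Real.sin_pi_sub (z * x)]
      exact Real.sin_le_sin_of_le_of_le_pi_div_two (by linarith) (by linarith) (by linarith)
  have : 1 / (k : ℝ) = 1 / 2 * (2 / k) := by ring
  rw [this]
  exact mul_le_mul hc (hsx.trans hs) (by positivity) (by linarith)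

/-- The addition formulas give $\lambda_{z\pm1}/(d\lambda_z)=(1\mp c)/2$. With $c=\cos2\varphi$
these are $\sin^2\varphi$ and $\cos^2\varphi$, and the off-diagonal entry is their geometric mean.
-/
theorem exactProj_eq {k z : ℕ} (hk : 3 ≤ k) (h1 : 1 ≤ z) (h2 : z < k) :
    exactProj k z true true = (1 - siteCos k z) / 2 ∧
    exactProj k z false false = (1 + siteCos k z) / 2 ∧
    exactProj k z true false = Real.sqrt (1 - siteCos k z ^ 2) / 2 ∧
    exactProj k z false true = Real.sqrt (1 - siteCos k z ^ 2) / 2 := by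
  have hk' : (0 : ℝ) < k := by exact_mod_cast (by omega : 0 < k)
  have hb := site_denominator hk h1 h2
  have hb0 : 0 < Real.cos (Real.pi / k) * Real.sin (z * (Real.pi / k)) :=
    lt_of_lt_of_le (by positivity) hb
  have l0 : lam k z = Real.sin (z * (Real.pi / k)) := by
    rw [lam_eq_sin (by omega) (by omega) (by omega)]
    congr 1
    push_cast
    ring
  have lp : lam k (z + 1) = Real.sin (z * (Real.pi / k)) * Real.cos (Real.pi / k) +
      Real.cos (z * (Real.pi / k)) * Real.sin (Real.pi / k) := by
    rw [lam_eq_sin (by omega) (by omega) (by omega), ← Real.sin_add]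
    congr 1
    push_cast
    ring
  have lm : lam k (z - 1) = Real.sin (z * (Real.pi / k)) * Real.cos (Real.pi / k) -
      Real.cos (z * (Real.pi / k)) * Real.sin (Real.pi / k) := by
    rw [lam_eq_sin (by omega) (by omega) (by omega), ← Real.sin_sub]
    congr 1
    push_cast
    ring
  have t1 : lam k (z + 1) / (dval k * lam k z) = (1 - siteCos k z) / 2 := by
    rw [lp, l0, dval, siteCos]
    generalize Real.sin (z * (Real.pi / k)) = sz at hb0 ⊢
    generalize Real.cos (Real.pi / k) = cz at hb0 ⊢
    have n1 : cz ≠ 0 := left_ne_zero_of_mul hb0.ne'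
    have n2 : sz ≠ 0 := right_ne_zero_of_mul hb0.ne'
    field_simp
    ring
  have t2 : lam k (z - 1) / (dval k * lam k z) = (1 + siteCos k z) / 2 := by
    rw [lm, l0, dval, siteCos]
    generalize Real.sin (z * (Real.pi / k)) = sz at hb0 ⊢
    generalize Real.cos (Real.pi / k) = cz at hb0 ⊢
    have n1 : cz ≠ 0 := left_ne_zero_of_mul hb0.ne'
    have n2 : sz ≠ 0 := right_ne_zero_of_mul hb0.ne'
    field_simp
    ring
  have hd : 0 < dval k * lam k z := by
    rw [l0, dval, mul_assoc]; positivity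
  have t3 : Real.sqrt (lam k (z + 1) * lam k (z - 1)) / (dval k * lam k z) =
      Real.sqrt (1 - siteCos k z ^ 2) / 2 := by
    have e : (1 - siteCos k z ^ 2) = lam k (z + 1) * lam k (z - 1) * (2 / (dval k * lam k z)) ^ 2 := by
      have : 1 - siteCos k z ^ 2 = 4 * (((1 - siteCos k z) / 2) * ((1 + siteCos k z) / 2)) := by ring
      rw [this, ← t1, ← t2]
      field_simp
      ring
    rw [e, Real.sqrt_mul (mul_nonneg (lam_nonneg _ _) (lam_nonneg _ _)),
      Real.sqrt_sq (by positivity)]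
    field_simp
  refine ⟨?_, ?_, ?_, ?_⟩ <;> simp only [exactProj, if_true, Bool.false_eq_true, if_false]
  · rw [Real.sqrt_mul_self (lam_nonneg _ _), t1]
  · rw [Real.sqrt_mul_self (lam_nonneg _ _), t2]
  · exact t3
  · rw [mul_comm (lam k _)]; exact t3

theorem abs_siteCos_le {k z : ℕ} (hk : 3 ≤ k) (h1 : 1 ≤ z) (h2 : z < k) : |siteCos k z| ≤ 1 := by
  obtain ⟨e1, e2, -, -⟩ := exactProj_eq hk h1 h2
  have h : ∀ b, 0 ≤ exactProj k z b b := by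
    intro b
    rw [exactProj]
    have := lam_nonneg k z
    have := (dval_pos hk).le
    positivity
  have h3 := h true
  have h4 := h false
  rw [e1] at h3
  rw [e2] at h4
  rw [abs_le]
  constructor <;> linarith

theorem abs_div_sub_div_le {a b a' b' e β : ℝ} (hβ : 0 < β) (hb : β ≤ b) (hb1 : b ≤ 1)
    (ha : |a| ≤ 1) (hae : |a' - a| ≤ e) (hbe : |b' - b| ≤ e) (he : e ≤ β / 2) :
    |a' / b' - a / b| ≤ 4 * e / β ^ 2 := by
  have hb' : β / 2 ≤ b' := by linarith [(abs_le.1 hbe).1]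
  have hb0 : 0 < b := by linarith
  have hb0' : 0 < b' := by linarith
  have he0 : 0 ≤ e := (abs_nonneg _).trans hae
  have e1 : a' / b' - a / b = ((a' - a) * b - a * (b' - b)) / (b' * b) := by
    field_simp
    ring
  rw [e1, abs_div, abs_of_pos (mul_pos hb0' hb0)]
  have h1 : |(a' - a) * b - a * (b' - b)| ≤ 2 * e := by
    refine (abs_sub _ _).trans ?_
    rw [abs_mul, abs_mul, abs_of_pos hb0]
    have c1 : |a' - a| * b ≤ e * 1 := by gcongr
    have c2 : |a| * |b' - b| ≤ 1 * e := by gcongr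
    linarith
  rw [div_le_div_iff₀ (mul_pos hb0' hb0) (by positivity)]
  have h2 : β ^ 2 / 2 ≤ b' * b := by nlinarith
  nlinarith [abs_nonneg ((a' - a) * b - a * (b' - b))]

theorem abs_mul_sub_mul_le {a b a' b' e f : ℝ} (ha : |a'| ≤ 1) (hb : |b| ≤ 1)
    (h1 : |a' - a| ≤ e) (h2 : |b' - b| ≤ f) : |a' * b' - a * b| ≤ e + f := by
  have e1 : a' * b' - a * b = (a' - a) * b + a' * (b' - b) := by ring
  rw [e1]
  refine (abs_add_le _ _).trans ?_
  rw [abs_mul, abs_mul]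
  have c1 : |a' - a| * |b| ≤ e * 1 := by
    have := (abs_nonneg _).trans h1
    gcongr
  have c2 : |a'| * |b' - b| ≤ 1 * f := by gcongr
  linarith

theorem angleCount_le (N k z : ℕ) : angleCount N k z ≤ 2 * quarter N - 1 := scanCount_le _ _ _ _

/-- The quotient `siteCos` is evaluated at the approximate angle $y$ of $\pi/k$, which costs
$8k^3/N$. The threshold found by the scan has a cosine within one step $\eta\le2/N$ of the result.
The condition on $N$ keeps the perturbed denominator positive. -/
theorem cos_angleCount {N k z : ℕ} (hk : 3 ≤ k) (hN : 18 * k ^ 3 ≤ N) (h1 : 1 ≤ z) (h2 : z < k) :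
    |Real.cos (angleCount N k z * eta N) - siteCos k z| ≤ 8 * k ^ 3 / N + 2 / N := by
  have hN1 : 1 ≤ N := le_trans (by have : 0 < k ^ 3 := by positivity
                                   omega) hN
  have hk' : (3 : ℝ) ≤ k := by exact_mod_cast hk
  have hz' : (z : ℝ) + 1 ≤ k := by exact_mod_cast h2
  have hN' : 18 * (k : ℝ) ^ 3 ≤ N := by exact_mod_cast hN
  have hN0 : (0 : ℝ) < N := by exact_mod_cast hN1
  have hη := eta_pos hN1
  have hη2 := eta_le hN1
  obtain ⟨q1, q2, q3, q4⟩ := quarter_spec hN1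
  have hx := abs_unit_sub_le hN1 hk
  have hden := site_denominator hk h1 h2
  set x := Real.pi / k with hxdef
  set y := unitCount N k * eta N with hy
  have hzx : |z * y - z * x| ≤ z * (2 / N) := by
    rw [← mul_sub, abs_mul, Nat.abs_cast]
    exact mul_le_mul_of_nonneg_left hx (by positivity)
  have hd1 := (Real.abs_sin_sub_sin_le y x).trans hx
  have hd2 := (Real.abs_cos_sub_cos_le y x).trans hx
  have hd3 := (Real.abs_sin_sub_sin_le (z * y) (z * x)).trans hzx
  have hd4 := (Real.abs_cos_sub_cos_le (z * y) (z * x)).trans hzx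
  have hsum : 2 / (N : ℝ) + z * (2 / N) ≤ 2 * k / N := by
    have e : 2 / (N : ℝ) + z * (2 / N) = 2 * (z + 1) / N := by ring
    rw [e]
    gcongr
  have ha := (abs_mul_sub_mul_le (Real.abs_sin_le_one y) (Real.abs_cos_le_one (z * x)) hd1 hd4).trans hsum
  have hb := (abs_mul_sub_mul_le (Real.abs_cos_le_one y) (Real.abs_sin_le_one (z * x)) hd2 hd3).trans hsum
  have hsmall : 2 * (k : ℝ) / N ≤ 1 / k / 2 := by
    rw [div_div, div_le_div_iff₀ hN0 (by positivity)]
    nlinarith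
  have hpos : 0 < Real.cos y * Real.sin (z * y) := by
    have := (abs_le.1 hb).1
    have : 0 < 1 / (k : ℝ) := by positivity
    linarith
  have hc : |-(Real.sin y * Real.cos (z * y)) / (Real.cos y * Real.sin (z * y)) - siteCos k z| ≤
      8 * k ^ 3 / N := by
    -- Numerator and denominator are off by at most $2k/N$, and the denominator is at least $1/k$,
    -- whence $4(2k/N)k^2$.
    have := abs_div_sub_div_le (β := 1 / k) (e := 2 * k / N) (a := -(Real.sin x * Real.cos (z * x)))
      (b := Real.cos x * Real.sin (z * x)) (a' := -(Real.sin y * Real.cos (z * y)))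
      (b' := Real.cos y * Real.sin (z * y)) (by positivity) hden
      ((le_abs_self _).trans (by
        rw [abs_mul]
        exact mul_le_one₀ (Real.abs_cos_le_one _) (abs_nonneg _) (Real.abs_sin_le_one _)))
      (by
        rw [abs_neg, abs_mul]
        exact mul_le_one₀ (Real.abs_sin_le_one _) (abs_nonneg _) (Real.abs_cos_le_one _))
      (by rw [← neg_sub', abs_neg]; exact ha) hb hsmall
    refine this.trans (le_of_eq ?_)
    field_simp
    norm_num
  set c' := -(Real.sin y * Real.cos (z * y)) / (Real.cos y * Real.sin (z * y)) with hc'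
  -- The integer test is the comparison of $\cos(a\eta)$ with the quotient `c'`, with positive
  -- denominators cleared.
  have hP : ∀ a, (1 ≤ (rot N a).1 * ((rot N (z * unitCount N k)).2 * (rot N (unitCount N k)).1) +
      ((N : ℤ) ^ 2 + 1) ^ a * ((rot N (z * unitCount N k)).1 * (rot N (unitCount N k)).2) ↔
      c' < Real.cos (a * eta N)) := by
    intro a
    rw [scan_iff hN1]
    push_cast
    rw [(rot_eq hN1 _).1, (rot_eq hN1 _).2, (rot_eq hN1 _).1, (rot_eq hN1 _).2, ← hy]
    have e1 : ((z * unitCount N k : ℕ) : ℝ) * eta N = z * y := by rw [hy]; push_cast; ring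
    rw [e1]
    set D1 := ((N : ℝ) ^ 2 + 1) ^ (z * unitCount N k)
    set D2 := ((N : ℝ) ^ 2 + 1) ^ unitCount N k
    have hD : 0 < D1 * D2 := by positivity
    have e2 : Real.cos (a * eta N) * (D1 * Real.sin (z * y) * (D2 * Real.cos y)) +
        D1 * Real.cos (z * y) * (D2 * Real.sin y) =
        (D1 * D2) * (Real.cos (a * eta N) * (Real.cos y * Real.sin (z * y)) +
          Real.sin y * Real.cos (z * y)) := by ring
    rw [e2, mul_pos_iff_of_pos_left hD, hc', div_lt_iff₀ hpos]
    constructor <;> intro h <;> linarith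
  have hle : ∀ a, a < 2 * quarter N - 1 → (a : ℝ) * eta N ≤ Real.pi := by
    intro a ha
    have : (a : ℝ) ≤ 2 * (quarter N - 1) := by
      have h3 : a + 2 ≤ 2 * quarter N := by omega
      have h4 : (a : ℝ) + 2 ≤ 2 * quarter N := by exact_mod_cast h3
      linarith
    nlinarith
  have hmono : ∀ a b, a ≤ b → b < 2 * quarter N - 1 →
      1 ≤ (rot N b).1 * ((rot N (z * unitCount N k)).2 * (rot N (unitCount N k)).1) +
      ((N : ℤ) ^ 2 + 1) ^ b * ((rot N (z * unitCount N k)).1 * (rot N (unitCount N k)).2) →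
      1 ≤ (rot N a).1 * ((rot N (z * unitCount N k)).2 * (rot N (unitCount N k)).1) +
      ((N : ℤ) ^ 2 + 1) ^ a * ((rot N (z * unitCount N k)).1 * (rot N (unitCount N k)).2) := by
    intro a b hab hb' h
    rw [hP] at h ⊢
    refine h.trans_le (Real.cos_le_cos_of_nonneg_of_le_pi (by positivity) (hle b hb') ?_)
    have : (a : ℝ) ≤ b := by exact_mod_cast hab
    exact mul_le_mul_of_nonneg_right this hη.le
  obtain ⟨c1, c2⟩ := card_filter_range hmono
  change ∀ a, a < angleCount N k z → _ at c1
  change angleCount N k z < 2 * quarter N - 1 → ¬ 1 ≤ (rot N (angleCount N k z)).1 * _ +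
    ((N : ℤ) ^ 2 + 1) ^ (angleCount N k z) * _ at c2
  have hac := angleCount_le N k z
  have hsc := abs_le.1 (abs_siteCos_le hk h1 h2)
  have hcc := abs_le.1 hc
  rw [abs_le]
  constructor
  -- The two ends of the scan need separate treatment: a count of zero means the cosine 1, and a
  -- full count means an angle within one $\eta$ of $\pi$.
  · rcases Nat.eq_zero_or_pos (angleCount N k z) with h0 | h0
    · rw [h0]
      simp only [Nat.cast_zero, zero_mul, Real.cos_zero]
      have : 0 ≤ 8 * (k : ℝ) ^ 3 / N + 2 / N := by positivity
      linarith
    · have h3 := (hP _).1 (c1 (angleCount N k z - 1) (by omega))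
      have h4 := Real.abs_cos_sub_cos_le (angleCount N k z * eta N)
        ((angleCount N k z - 1 : ℕ) * eta N)
      rw [Nat.cast_sub h0] at h3 h4
      rw [← sub_mul] at h4
      have e3 : (angleCount N k z : ℝ) - (angleCount N k z - (1 : ℕ)) = 1 := by push_cast; ring
      rw [e3, one_mul, abs_of_pos hη] at h4
      linarith [(abs_le.1 h4).1]
  · rcases Nat.lt_or_ge (angleCount N k z) (2 * quarter N - 1) with h0 | h0
    · have h3 := c2 h0
      rw [hP] at h3
      linarith [div_nonneg (zero_le_two : (0 : ℝ) ≤ 2) hN0.le]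
    · have h3 : angleCount N k z = 2 * quarter N - 1 := le_antisymm hac h0
      have h4 : (angleCount N k z : ℝ) = 2 * quarter N - 1 := by
        rw [h3, Nat.cast_sub (by omega)]; push_cast; ring
      have h5 := Real.abs_cos_sub_cos_le (angleCount N k z * eta N) Real.pi
      rw [Real.cos_pi] at h5
      have h6 : |angleCount N k z * eta N - Real.pi| ≤ eta N := by
        have e4 : (2 * (quarter N : ℝ) - 1) * eta N = 2 * (quarter N * eta N) - eta N := by ring
        rw [sub_mul, one_mul] at q4
        rw [h4, e4, abs_le]
        constructor <;> linarith
      have : 0 ≤ 8 * (k : ℝ) ^ 3 / N := by positivity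
      linarith [(abs_le.1 (h5.trans h6)).2]

/-! ### Rounding to whole numbers of phase gates -/

theorem cast_div_sub_le (a b : ℕ) (hb : 0 < b) : |((a / b : ℕ) : ℝ) - a / b| ≤ 1 := by
  have hb' : (0 : ℝ) < b := by exact_mod_cast hb
  have h1 := Nat.cast_div_le (α := ℝ) (m := a) (n := b)
  have h2 : (a : ℝ) / b < ((a / b : ℕ) : ℝ) + 1 := by
    rw [div_lt_iff₀ hb']
    have := Nat.lt_div_mul_add (a := a) (b := b) hb
    have h : a < (a / b + 1) * b := by rw [Nat.add_mul, one_mul]; exact this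
    exact_mod_cast h
  rw [abs_le]
  constructor <;> linarith

theorem norm_exp_sub_exp_le (x y : ℝ) :
    ‖Complex.exp (x * Complex.I) - Complex.exp (y * Complex.I)‖ ≤ |x - y| := by
  have e : Complex.exp (x * Complex.I) - Complex.exp (y * Complex.I) =
      Complex.exp (y * Complex.I) * (Complex.exp (Complex.I * ((x - y : ℝ) : ℂ)) - 1) := by
    rw [mul_sub, ← Complex.exp_add, mul_one]
    congr 2
    push_cast
    ring
  rw [e, norm_mul, Complex.norm_exp_ofReal_mul_I, one_mul]
  exact Real.norm_exp_I_mul_ofReal_sub_one_le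

theorem abs_sqrt_sub_sqrt_le {a b : ℝ} (ha : 0 ≤ a) (hb : 0 ≤ b) :
    |Real.sqrt a - Real.sqrt b| ≤ Real.sqrt |a - b| := by
  apply Real.le_sqrt_of_sq_le
  rw [sq_abs]
  have h1 := Real.sq_sqrt ha
  have h2 := Real.sq_sqrt hb
  have p1 := Real.sqrt_nonneg a
  have p2 := Real.sqrt_nonneg b
  rcases le_total b a with h | h
  · rw [abs_of_nonneg (by linarith)]
    have := Real.sqrt_le_sqrt h
    nlinarith
  · rw [abs_of_nonpos (by linarith)]
    have := Real.sqrt_le_sqrt h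
    nlinarith

theorem abs_round_sub_le {N J : ℕ} (hN : 1 ≤ N) (hJ : N < 2 ^ J) (a : ℕ) {b : ℕ} (hb : 0 < b) :
    |2 * Real.pi * ((a * 2 ^ J / b : ℕ) : ℝ) / 2 ^ J - 2 * Real.pi * (a / b)| ≤ 7 / N := by
  have hN0 : (0 : ℝ) < N := by exact_mod_cast hN
  have hJ' : (N : ℝ) ≤ 2 ^ J := by exact_mod_cast hJ.le
  have hπ := Real.pi_pos
  have hb' : (0 : ℝ) < b := by exact_mod_cast hb
  have h := cast_div_sub_le (a * 2 ^ J) b hb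
  have e : 2 * Real.pi * ((a * 2 ^ J / b : ℕ) : ℝ) / 2 ^ J - 2 * Real.pi * (a / b) =
      2 * Real.pi / 2 ^ J * (((a * 2 ^ J / b : ℕ) : ℝ) - ((a * 2 ^ J : ℕ) : ℝ) / b) := by
    push_cast
    field_simp
  rw [e, abs_mul, abs_of_pos (by positivity)]
  calc 2 * Real.pi / 2 ^ J * _ ≤ 2 * Real.pi / 2 ^ J * 1 := by gcongr
    _ ≤ 7 / N := by
      rw [mul_one]
      exact div_le_div₀ (by norm_num) (by linarith [Real.pi_lt_d2]) hN0 hJ'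

/-- The angle of the phase gates for the site `z`. -/
def tabAngle (N k J z : ℕ) : ℝ := 2 * Real.pi * ((calib N k J).tab z : ℕ) / 2 ^ J

theorem cos_tabAngle {N k J z : ℕ} (hk : 3 ≤ k) (hN : 18 * k ^ 3 ≤ N) (hJ : N < 2 ^ J)
    (h1 : 1 ≤ z) (h2 : z < k) : |Real.cos (tabAngle N k J z) - siteCos k z| ≤ 9 * k ^ 3 / N := by
  have hk' : (3 : ℝ) ≤ k := by exact_mod_cast hk
  have hN1 : 1 ≤ N := le_trans (by have : 0 < k ^ 3 := by positivity
                                   omega) hN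
  have hN0 : (0 : ℝ) < N := by exact_mod_cast hN1
  have hk3 : (3 : ℝ) ^ 3 ≤ (k : ℝ) ^ 3 := by gcongr
  obtain ⟨q1, q2, q3, q4⟩ := quarter_spec hN1
  have hq0 : (1 : ℝ) ≤ quarter N := by exact_mod_cast q1
  have hη2 := eta_le hN1
  have hac := angleCount_le N k z
  have a1 := abs_round_sub_le hN1 hJ (angleCount N k z) (by omega : 0 < 4 * quarter N)
  have a2 : |2 * Real.pi * ((angleCount N k z : ℕ) / (4 * quarter N : ℕ)) -
      angleCount N k z * eta N| ≤ 2 * eta N := by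
    have hc : (angleCount N k z : ℝ) ≤ 2 * quarter N := by
      exact_mod_cast (by omega : angleCount N k z ≤ 2 * quarter N)
    have e : 2 * Real.pi * ((angleCount N k z : ℕ) / (4 * quarter N : ℕ)) -
        angleCount N k z * eta N =
        (angleCount N k z / quarter N : ℝ) * (Real.pi / 2 - quarter N * eta N) := by
      push_cast
      field_simp
      ring
    rw [e, abs_mul, abs_of_nonneg (by positivity)]
    have b1 : (angleCount N k z / quarter N : ℝ) ≤ 2 := by
      rw [div_le_iff₀ (by linarith)]; exact hc
    have b2 : |Real.pi / 2 - quarter N * eta N| ≤ eta N := by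
      rw [sub_mul, one_mul] at q4
      have := eta_pos hN1
      rw [abs_le]; constructor <;> linarith
    exact mul_le_mul b1 b2 (abs_nonneg _) (by norm_num)
  have a3 := cos_angleCount hk hN h1 h2
  have a4 := Real.abs_cos_sub_cos_le (tabAngle N k J z) (angleCount N k z * eta N)
  have a5 : |tabAngle N k J z - angleCount N k z * eta N| ≤ 7 / N + 2 * (2 / N) := by
    have := abs_add_le (tabAngle N k J z -
        2 * Real.pi * ((angleCount N k z : ℕ) / (4 * quarter N : ℕ)))
      (2 * Real.pi * ((angleCount N k z : ℕ) / (4 * quarter N : ℕ)) - angleCount N k z * eta N)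
    rw [sub_add_sub_cancel] at this
    have a1' : |tabAngle N k J z - 2 * Real.pi * ((angleCount N k z : ℕ) / (4 * quarter N : ℕ))| ≤
      7 / N := a1
    linarith
  have a6 := abs_add_le (Real.cos (tabAngle N k J z) - Real.cos (angleCount N k z * eta N))
    (Real.cos (angleCount N k z * eta N) - siteCos k z)
  rw [sub_add_sub_cancel] at a6
  -- The rounding to phase gates, the error of the quarter turn and the scan together give
  -- $(13+8k^3)/N$, and $k^3\ge27$ absorbs the 13.
  have a7 : 7 / (N : ℝ) + 2 * (2 / N) + (8 * k ^ 3 / N + 2 / N) ≤ 9 * k ^ 3 / N := by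
    have e : 7 / (N : ℝ) + 2 * (2 / N) + (8 * k ^ 3 / N + 2 / N) = (13 + 8 * k ^ 3) / N := by
      ring
    rw [e]
    exact div_le_div_of_nonneg_right (by linarith) hN0.le
  linarith

/-- The angle stays within a half turn. This fixes the sign of the off-diagonal entry, which the
cosine alone would leave open. -/
theorem sin_tabAngle_nonneg {N : ℕ} (hN : 1 ≤ N) (k J z : ℕ) : 0 ≤ Real.sin (tabAngle N k J z) := by
  obtain ⟨q1, -, -, -⟩ := quarter_spec hN
  have hac := angleCount_le N k z
  have hπ := Real.pi_pos
  refine Real.sin_nonneg_of_nonneg_of_le_pi (by rw [tabAngle]; positivity) ?_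
  have h3 : ((calib N k J).tab z : ℕ) * 2 ≤ 2 ^ J := by
    change angleCount N k z * 2 ^ J / (4 * quarter N) * 2 ≤ 2 ^ J
    have h4 : angleCount N k z * 2 ^ J / (4 * quarter N) ≤ 2 ^ J / 2 := by
      calc angleCount N k z * 2 ^ J / (4 * quarter N)
          ≤ (2 * quarter N) * 2 ^ J / (4 * quarter N) :=
            Nat.div_le_div_right (Nat.mul_le_mul_right _ (by omega))
        _ = 2 ^ J / 2 := by
          rw [show 4 * quarter N = (2 * quarter N) * 2 by ring,
            Nat.mul_div_mul_left _ _ (by omega)]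
    omega
  have h4 : (((calib N k J).tab z : ℕ) : ℝ) * 2 ≤ 2 ^ J := by exact_mod_cast h3
  rw [tabAngle, div_le_iff₀ (by positivity)]
  have := mul_le_mul_of_nonneg_left h4 hπ.le
  linarith

/-- Only $|\sqrt a-\sqrt b|\le\sqrt{|a-b|}$ is available when the cosine may be near $\pm1$. The
square root is the reason why $N$ must grow like the square of the inverse accuracy. -/
theorem abs_sin_sub_sqrt_le {x c ε : ℝ} (hx : 0 ≤ Real.sin x) (hc : |c| ≤ 1)
    (h : |Real.cos x - c| ≤ ε) : |Real.sin x - Real.sqrt (1 - c ^ 2)| ≤ Real.sqrt (2 * ε) := by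
  have hcos := abs_le.1 (Real.abs_cos_le_one x)
  have hc' := abs_le.1 hc
  have e1 : Real.sin x = Real.sqrt (1 - Real.cos x ^ 2) := by
    rw [← Real.sin_sq, Real.sqrt_sq hx]
  rw [e1]
  refine (abs_sqrt_sub_sqrt_le (by nlinarith) (by nlinarith)).trans (Real.sqrt_le_sqrt ?_)
  have e2 : 1 - Real.cos x ^ 2 - (1 - c ^ 2) = (c + Real.cos x) * -(Real.cos x - c) := by ring
  rw [e2, abs_mul, abs_neg]
  have h3 : |c + Real.cos x| ≤ 2 := by
    rw [abs_le]; constructor <;> linarith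
  exact mul_le_mul h3 h (abs_nonneg _) (by norm_num)

theorem norm_half_sub_half_le {x y ε : ℝ} (h : |x - y| ≤ ε) :
    ‖((x / 2 : ℝ) : ℂ) - ((y / 2 : ℝ) : ℂ)‖ ≤ ε := by
  rw [← Complex.ofReal_sub, Complex.norm_real, Real.norm_eq_abs, ← sub_div, abs_div]
  norm_num
  linarith [abs_nonneg (x - y)]

theorem proj_exp (θ : ℝ) :
    proj (Complex.exp (θ * Complex.I)) true true = ((1 - Real.cos θ) / 2 : ℝ) ∧
    proj (Complex.exp (θ * Complex.I)) false false = ((1 + Real.cos θ) / 2 : ℝ) ∧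
    proj (Complex.exp (θ * Complex.I)) true false = (Real.sin θ / 2 : ℝ) ∧
    proj (Complex.exp (θ * Complex.I)) false true = (Real.sin θ / 2 : ℝ) := by
  have hexp : Complex.exp (θ * Complex.I) = Real.cos θ + Real.sin θ * Complex.I := by
    rw [Complex.exp_mul_I]; push_cast; rfl
  have hinv : (Complex.exp (θ * Complex.I))⁻¹ = Real.cos θ - Real.sin θ * Complex.I := by
    rw [← Complex.exp_neg, ← neg_mul, ← Complex.ofReal_neg, Complex.exp_mul_I]
    push_cast
    rw [Complex.cos_neg, Complex.sin_neg]
    ring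
  have hI := Complex.I_ne_zero
  have o1 : (Complex.exp (θ * Complex.I) - (Complex.exp (θ * Complex.I))⁻¹) / (4 * Complex.I) =
      ((Real.sin θ / 2 : ℝ) : ℂ) := by
    rw [hinv, hexp]
    push_cast
    field_simp
    ring
  refine ⟨?_, ?_, ?_, ?_⟩ <;> simp only [proj, if_true, Bool.false_eq_true, if_false]
  · rw [hinv, hexp]; push_cast; ring
  · rw [hinv, hexp]; push_cast; ring
  · exact o1
  · exact o1

theorem norm_proj_sub_exactProj_le {N k J z s : ℕ} (hk : 3 ≤ k) (hs : 1 ≤ s)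
    (hN : 18 * k ^ 3 * s ^ 2 ≤ N) (hJ : N < 2 ^ J) (h1 : 1 ≤ z) (h2 : z < k) (a b : Bool) :
    ‖proj (Complex.exp (tabAngle N k J z * Complex.I)) a b - exactProj k z a b‖ ≤ 1 / s := by
  have hs' : (1 : ℝ) ≤ s := by exact_mod_cast hs
  have hN' : 18 * (k : ℝ) ^ 3 * (s : ℝ) ^ 2 ≤ N := by exact_mod_cast hN
  have hN18 : 18 * k ^ 3 ≤ N := le_trans (Nat.le_mul_of_pos_right _ (by positivity)) hN
  have hN1 : 1 ≤ N := le_trans (by have : 0 < k ^ 3 := by positivity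
                                   omega) hN18
  have hN0 : (0 : ℝ) < N := by exact_mod_cast hN1
  have hcos := cos_tabAngle hk hN18 hJ h1 h2
  have hsin := abs_sin_sub_sqrt_le (sin_tabAngle_nonneg hN1 k J z) (abs_siteCos_le hk h1 h2) hcos
  -- This is where the factor $18k^3s^2$ comes from.
  have hle : 2 * (9 * (k : ℝ) ^ 3 / N) ≤ (1 / s) ^ 2 := by
    rw [div_pow, one_pow, ← mul_div_assoc, div_le_div_iff₀ hN0 (by positivity)]
    linarith
  have hsin' : Real.sqrt (2 * (9 * (k : ℝ) ^ 3 / N)) ≤ 1 / s :=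
    Real.sqrt_le_iff.2 ⟨by positivity, hle⟩
  have hs1 : 1 / (s : ℝ) ≤ 1 := by rw [div_le_one (by linarith)]; exact hs'
  have hs0 : 0 ≤ 1 / (s : ℝ) := by positivity
  have hcos' : 9 * (k : ℝ) ^ 3 / N ≤ 1 / s := by nlinarith
  obtain ⟨p1, p2, p3, p4⟩ := exactProj_eq hk h1 h2
  obtain ⟨r1, r2, r3, r4⟩ := proj_exp (tabAngle N k J z)
  cases a <;> cases b
  · rw [p2, r2]
    refine norm_half_sub_half_le (le_trans ?_ hcos')
    rwa [add_sub_add_left_eq_sub]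
  · rw [p4, r4]
    exact norm_half_sub_half_le (hsin.trans hsin')
  · rw [p3, r3]
    exact norm_half_sub_half_le (hsin.trans hsin')
  · rw [p1, r1]
    refine norm_half_sub_half_le (le_trans ?_ hcos')
    rwa [sub_sub_sub_cancel_left, abs_sub_comm]

theorem rootA_pow_four {k : ℕ} (hk : 2 ≤ k) : rootA k ^ 4 =
    -Complex.exp (((2 * Real.pi * ((k - 2 : ℕ) / (2 * k : ℕ)) : ℝ) : ℂ) * Complex.I) := by
  have h4 : rootA k ^ 4 = Complex.exp (-(2 * (Real.pi / k * Complex.I))) := by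
    rw [show 4 = 2 * 2 from rfl, pow_mul, rootA_sq, neg_sq, ← Complex.exp_nat_mul]
    congr 1
    push_cast
    ring
  have hk0 : (k : ℂ) ≠ 0 := by exact_mod_cast (by omega : k ≠ 0)
  have h5 : ∀ x : ℂ, -Complex.exp x = Complex.exp (Real.pi * Complex.I + x) := by
    intro x
    rw [Complex.exp_add, Complex.exp_pi_mul_I, neg_one_mul]
  rw [h4, h5, Complex.exp_eq_exp_iff_exists_int]
  -- The sign contributes half a turn; the exponents then differ by one full turn.
  refine ⟨-1, ?_⟩
  rw [Nat.cast_sub hk]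
  push_cast
  field_simp
  ring

theorem calib_accurate {N k J s : ℕ} (hk : 3 ≤ k) (hs : 1 ≤ s) (hN : 18 * k ^ 3 * s ^ 2 ≤ N)
    (hJ : N < 2 ^ J) : (calib N k J).Accurate k (1 / s) := by
  have hk' : (3 : ℝ) ≤ k := by exact_mod_cast hk
  have hs' : (1 : ℝ) ≤ s := by exact_mod_cast hs
  have hk0 : (k : ℂ) ≠ 0 := by exact_mod_cast (by omega : k ≠ 0)
  have h7 : 7 * s ≤ N := by
    refine le_trans ?_ hN
    have h3 : 1 ≤ k ^ 3 := Nat.one_le_pow _ _ (by omega)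
    nlinarith
  have hN1 : 1 ≤ N := by omega
  have hN0 : (0 : ℝ) < N := by exact_mod_cast hN1
  have hsmall : 7 / (N : ℝ) ≤ 1 / s := by
    rw [div_le_div_iff₀ hN0 (by positivity), one_mul]
    exact_mod_cast h7
  refine ⟨?_, ?_, ?_⟩
  · have e : (-(rootA k) ^ 2)⁻¹ = Complex.exp (((2 * Real.pi * ((1 : ℕ) / (2 * k : ℕ)) : ℝ) : ℂ) *
        Complex.I) := by
      rw [rootA_sq, neg_neg, ← Complex.exp_neg, neg_neg]
      congr 1
      push_cast
      field_simp
    rw [e, phase_pow]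
    refine (norm_exp_sub_exp_le _ _).trans (le_trans ?_ hsmall)
    have := abs_round_sub_le hN1 hJ 1 (by omega : 0 < 2 * k)
    rw [one_mul] at this
    exact this
  · rw [rootA_pow_four (by omega), ← sub_eq_add_neg, phase_pow]
    exact (norm_exp_sub_exp_le _ _).trans
      ((abs_round_sub_le hN1 hJ (k - 2) (by omega : 0 < 2 * k)).trans hsmall)
  · intro z' hz1 hz2 a b
    obtain ⟨z, rfl⟩ := Int.eq_ofNat_of_zero_le (by omega : 0 ≤ z')
    have hw : phase (calib N k J).J ^ (calib N k J).tab z =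
        Complex.exp (tabAngle N k J z * Complex.I) := by
      rw [phase_pow]; rfl
    rw [Int.toNat_natCast, hw]
    exact norm_proj_sub_exactProj_le hk hs hN hJ (by exact_mod_cast hz1) (by exact_mod_cast hz2) a b

/-! ## Time bounds for expressions -/

/-- All the cells hold numbers of at most `β` bits, up to powers of two. -/
def MemLE (β : ℕ) (μ : Memory) : Prop := ∀ c, |μ c| ≤ 2 ^ β

/-- The number of bits of the value of an expression, in units of the size of the memory cells. -/
def Expr.bits : Expr → ℕ
  | .lit z => bitLength z + 1
  | .load _ => 1
  | .add e f => e.bits + f.bits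
  | .sub e f => e.bits + f.bits
  | .mul e f => e.bits + f.bits
  | .div e f => e.bits + f.bits
  | .le _ _ => 1

/-- The time of an expression, in units of the size of the memory cells. -/
def Expr.cost : Expr → ℕ
  | .lit z => 1 + (bitLength z + 1)
  | .load a => a.cost + 1 + 1
  | .add e f => e.cost + f.cost + 1 + (e.bits + f.bits)
  | .sub e f => e.cost + f.cost + 1 + (e.bits + f.bits)
  | .mul e f => e.cost + f.cost + 1 + (e.bits + f.bits)
  | .div e f => e.cost + f.cost + 1 + (e.bits + f.bits)
  | .le e f => e.cost + f.cost + 1 + 1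

theorem Expr.bits_pos (e : Expr) : 1 ≤ e.bits := by
  induction e <;> simp only [Expr.bits] <;> omega

theorem bitLength_le {z : ℤ} {b : ℕ} (h : |z| < 2 ^ b) : bitLength z ≤ b := by
  rw [bitLength, Nat.size_le]
  have : ((z.natAbs : ℕ) : ℤ) < ((2 ^ b : ℕ) : ℤ) := by
    rw [Int.natCast_natAbs]; push_cast; exact h
  exact_mod_cast this

theorem lt_two_pow_bitLength (z : ℤ) : |z| < 2 ^ bitLength z := by
  have : z.natAbs < 2 ^ bitLength z := Nat.lt_size_self _
  rw [Int.abs_eq_natAbs]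
  exact_mod_cast this

theorem two_pow_add_le {x y : ℕ} (hx : 1 ≤ x) (hy : 1 ≤ y) : (2 : ℤ) ^ x + 2 ^ y ≤ 2 ^ (x + y) := by
  have h1 : (2 : ℤ) ^ 1 ≤ 2 ^ x := pow_le_pow_right₀ (by norm_num) hx
  have h2 : (2 : ℤ) ^ 1 ≤ 2 ^ y := pow_le_pow_right₀ (by norm_num) hy
  rw [pow_add]
  nlinarith

/-- Bit lengths add under products, and also under sums because both exponents are at least 1; an
integer quotient is no larger than the dividend. The unit $\beta+1$ makes the bound for a cell
strict. -/
theorem Expr.abs_eval_lt {β : ℕ} {μ : Memory} (h : MemLE β μ) (e : Expr) :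
    |e.eval μ| < 2 ^ (e.bits * (β + 1)) := by
  have hpos : ∀ e : Expr, 1 ≤ e.bits * (β + 1) := fun e =>
    Nat.mul_pos e.bits_pos (Nat.succ_pos β)
  induction e with
  | lit z =>
    refine (lt_two_pow_bitLength z).trans_le (pow_le_pow_right₀ (by norm_num) ?_)
    simp only [Expr.bits]
    nlinarith
  | load a _ =>
    refine (h _).trans_lt (pow_lt_pow_right₀ (by norm_num) ?_)
    simp only [Expr.bits]
    omega
  | add e f he hf =>
    simp only [Expr.bits, Expr.eval, Nat.add_mul]
    exact (abs_add_le _ _).trans_lt ((add_lt_add he hf).trans_le (two_pow_add_le (hpos e) (hpos f)))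
  | sub e f he hf =>
    simp only [Expr.bits, Expr.eval, Nat.add_mul]
    exact (abs_sub _ _).trans_lt ((add_lt_add he hf).trans_le (two_pow_add_le (hpos e) (hpos f)))
  | mul e f he hf =>
    simp only [Expr.bits, Expr.eval, Nat.add_mul, pow_add, abs_mul]
    exact mul_lt_mul'' he hf (abs_nonneg _) (abs_nonneg _)
  | div e f he hf =>
    simp only [Expr.bits, Expr.eval]
    refine (Int.abs_ediv_le_abs _ _).trans_lt (he.trans_le (pow_le_pow_right₀ (by norm_num) ?_))
    exact Nat.mul_le_mul_right _ (by omega)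
  | le e f _ _ =>
    simp only [Expr.bits, Expr.eval]
    have : (2 : ℤ) ^ 1 ≤ 2 ^ (1 * (β + 1)) := pow_le_pow_right₀ (by norm_num) (by omega)
    rw [one_mul] at this ⊢
    split_ifs <;> simp only [abs_one, abs_zero] <;> linarith

theorem Expr.time_le {β : ℕ} {μ : Memory} (h : MemLE β μ) (e : Expr) :
    e.time μ ≤ e.cost * (β + 1) := by
  have hb : ∀ e : Expr, bitLength (e.eval μ) ≤ e.bits * (β + 1) := fun e =>
    bitLength_le (e.abs_eval_lt h)
  induction e with
  | lit z =>
    have := hb (.lit z)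
    simp only [Expr.time, Expr.cost, Expr.eval, Expr.bits] at *
    nlinarith
  | load a ha =>
    have := hb (.load a)
    simp only [Expr.time, Expr.cost, Expr.bits] at *
    nlinarith
  | add e f he hf =>
    have := hb (.add e f)
    simp only [Expr.time, Expr.cost, Expr.bits] at *
    nlinarith
  | sub e f he hf =>
    have := hb (.sub e f)
    simp only [Expr.time, Expr.cost, Expr.bits] at *
    nlinarith
  | mul e f he hf =>
    have := hb (.mul e f)
    simp only [Expr.time, Expr.cost, Expr.bits] at *
    nlinarith
  | div e f he hf =>
    have := hb (.div e f)
    simp only [Expr.time, Expr.cost, Expr.bits] at *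
    nlinarith
  | le e f he hf =>
    have := hb (.le e f)
    simp only [Expr.time, Expr.cost, Expr.bits] at *
    nlinarith

/-! ## Runs of programs -/

/-- The time of a program, in units of the size of the memory cells, as a polynomial in the
maximal number of iterations of a loop. -/
def Prog.cost : Prog → Polynomial ℕ
  | .store a e => ((a.cost + e.cost + 1 : ℕ) : Polynomial ℕ)
  | .had i => ((i.cost + 1 : ℕ) : Polynomial ℕ)
  | .cnot c t => ((c.cost + t.cost + 1 : ℕ) : Polynomial ℕ)
  | .cphase j a b => ((j.cost + a.cost + b.cost + 1 : ℕ) : Polynomial ℕ)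
  | .measure a => ((a.cost + 1 : ℕ) : Polynomial ℕ)
  | .seq P Q => P.cost + Q.cost
  | .ite e P Q => ((e.cost + 1 : ℕ) : Polynomial ℕ) + P.cost + Q.cost
  | .loop e P => ((e.cost + 1 : ℕ) : Polynomial ℕ) + Polynomial.X * P.cost

/-- A configuration without the time. -/
abbrev PState : Type := Memory × List Gate

/-- The time is forgotten. -/
def Config.forget (s : Config) : PState := (s.mem, s.circuit)

/-- A random configuration whose memory and circuit have the law `μ`, and whose time is at most `T`. -/
def HasLaw (ν : PMF Config) (μ : PMF PState) (T : ℕ) : Prop :=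
  ν.map Config.forget = μ ∧ ∀ s ∈ ν.support, s.time ≤ T

/-- A run of the program from the state `s` ends in a random state of law `μ`, within the time
that `Prog.cost` predicts for cells of `β` bits. -/
def Runs (β : ℕ) (P : Prog) (s : PState) (μ : PMF PState) : Prop :=
  ∀ t, HasLaw (P.run ⟨s.1, s.2, t⟩) μ (t + P.cost.eval β * (β + 1))

theorem bind_congr_support {α γ : Type*} (ν : PMF α) {f g : α → PMF γ}
    (h : ∀ a ∈ ν.support, f a = g a) : ν.bind f = ν.bind g := by
  ext c
  rw [PMF.bind_apply, PMF.bind_apply]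
  refine tsum_congr fun a => ?_
  by_cases ha : a ∈ ν.support
  · rw [h a ha]
  · rw [PMF.mem_support_iff, not_not] at ha
    rw [ha, zero_mul, zero_mul]

theorem hasLaw_pure {s : Config} {x : PState} {T : ℕ} (h : s.forget = x) (hT : s.time ≤ T) :
    HasLaw (PMF.pure s) (PMF.pure x) T := by
  refine ⟨by rw [PMF.pure_map, h], ?_⟩
  intro s' hs'
  rw [PMF.mem_support_pure_iff] at hs'
  rw [hs']
  exact hT

/-- Both claims concern the support only: the law after `P` need be known only for states that
occur, and the time bound holds for each outcome, not merely on average. -/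
theorem HasLaw.bind {β : ℕ} {ν : PMF Config} {μ : PMF PState} {T : ℕ} (h : HasLaw ν μ T) {P : Prog}
    {κ : PState → PMF PState} (hP : ∀ s ∈ μ.support, Runs β P s (κ s)) :
    HasLaw (ν.bind P.run) (μ.bind κ) (T + P.cost.eval β * (β + 1)) := by
  have hmem : ∀ c ∈ ν.support, c.forget ∈ μ.support := by
    intro c hc
    rw [← h.1, PMF.mem_support_map_iff]
    exact ⟨c, hc, rfl⟩
  constructor
  · rw [PMF.map_bind, ← h.1, PMF.bind_map]
    exact bind_congr_support _ fun c hc => (hP _ (hmem c hc) c.time).1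
  · intro s hs
    rw [PMF.mem_support_bind_iff] at hs
    obtain ⟨c, hc, hs⟩ := hs
    exact ((hP _ (hmem c hc) c.time).2 s hs).trans (Nat.add_le_add_right (h.2 c hc) _)

theorem runs_store {β : ℕ} (a e : Expr) {s : PState} (hs : MemLE β s.1) :
    Runs β (.store a e) s (PMF.pure (Function.update s.1 (a.eval s.1).toNat (e.eval s.1), s.2)) := by
  intro t
  refine hasLaw_pure rfl ?_
  have h1 := a.time_le hs
  have h2 := e.time_le hs
  simp only [Config.tick, Prog.cost, Polynomial.eval_natCast]
  push_cast
  nlinarith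

theorem runs_had {β : ℕ} (i : Expr) {s : PState} (hs : MemLE β s.1) :
    Runs β (.had i) s (PMF.pure (s.1, s.2 ++ [Gate.had (i.eval s.1).toNat])) := by
  intro t
  refine hasLaw_pure rfl ?_
  have h1 := i.time_le hs
  simp only [Config.tick, Config.addGate, Prog.cost, Polynomial.eval_natCast]
  push_cast
  nlinarith

theorem runs_cnot {β : ℕ} (c t : Expr) {s : PState} (hs : MemLE β s.1) :
    Runs β (.cnot c t) s (PMF.pure (s.1, s.2 ++
      [Gate.cnot (c.eval s.1).toNat (t.eval s.1).toNat])) := by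
  intro t'
  refine hasLaw_pure rfl ?_
  have h1 := c.time_le hs
  have h2 := t.time_le hs
  simp only [Config.tick, Config.addGate, Prog.cost, Polynomial.eval_natCast]
  push_cast
  nlinarith

/-- The charge $j+1$ of the gate fits into one unit $\beta+1$ because $j\le\beta$. -/
theorem runs_cphase {β : ℕ} (j a b : Expr) {s : PState} (hs : MemLE β s.1)
    (hj : (j.eval s.1).toNat ≤ β) :
    Runs β (.cphase j a b) s (PMF.pure (s.1, s.2 ++
      [Gate.cphase (j.eval s.1).toNat (a.eval s.1).toNat (b.eval s.1).toNat])) := by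
  intro t
  refine hasLaw_pure rfl ?_
  have h1 := j.time_le hs
  have h2 := a.time_le hs
  have h3 := b.time_le hs
  simp only [Config.tick, Config.addGate, Prog.cost, Polynomial.eval_natCast]
  push_cast
  nlinarith

theorem runs_measure {β : ℕ} (a : Expr) {s : PState} (hs : MemLE β s.1) :
    Runs β (.measure a) s ((measureDist s.2).map fun b =>
      (Function.update s.1 (a.eval s.1).toNat (if b then 1 else 0), [])) := by
  intro t
  constructor
  · rw [Prog.run, PMF.map_comp]
    rfl
  · intro s' hs'
    rw [Prog.run, PMF.mem_support_map_iff] at hs'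
    obtain ⟨b, -, rfl⟩ := hs'
    have h1 := a.time_le hs
    simp only [Config.tick, Prog.cost, Polynomial.eval_natCast]
    push_cast
    nlinarith

theorem runs_seq {β : ℕ} {P Q : Prog} {s : PState} {μ : PMF PState} {κ : PState → PMF PState}
    (hP : Runs β P s μ) (hQ : ∀ s' ∈ μ.support, Runs β Q s' (κ s')) :
    Runs β (.seq P Q) s (μ.bind κ) := by
  intro t
  have := (hP t).bind hQ
  simp only [Prog.cost, Polynomial.eval_add, Nat.add_mul, ← Nat.add_assoc]
  exact this

/-- The count is at most $\beta$, which is why the cost polynomial of a loop carries the factor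
`Polynomial.X`. The kernel may vary from one iteration to the next. -/
theorem runs_loop {β : ℕ} {e : Expr} {P : Prog} {s : PState} {c : ℕ} (hs : MemLE β s.1)
    (he : (e.eval s.1).toNat = c) (hc : c ≤ β) {μ : ℕ → PMF PState} (h0 : μ 0 = PMF.pure s)
    {κ : ℕ → PState → PMF PState} (hμ : ∀ i < c, μ (i + 1) = (μ i).bind (κ i))
    (hP : ∀ i < c, ∀ s' ∈ (μ i).support, Runs β P s' (κ i s')) : Runs β (.loop e P) s (μ c) := by
  intro t
  have key : ∀ i ≤ c, HasLaw ((fun ν : PMF Config => ν.bind P.run)^[i]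
      (PMF.pure ((⟨s.1, s.2, t⟩ : Config).tick (e.time s.1 + 1)))) (μ i)
        (t + (e.time s.1 + 1) + i * (P.cost.eval β * (β + 1))) := by
    intro i hi
    induction i with
    | zero => rw [h0]; exact hasLaw_pure rfl (by simp [Config.tick])
    | succ i ih =>
      rw [Function.iterate_succ_apply', hμ i (by omega), Nat.add_mul, one_mul, ← Nat.add_assoc]
      exact (ih (by omega)).bind (hP i (by omega))
  have h := key c le_rfl
  rw [Prog.run]
  simp only [he]
  refine ⟨h.1, fun s' hs' => (h.2 s' hs').trans ?_⟩
  have h1 := e.time_le hs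
  simp only [Prog.cost, Polynomial.eval_add, Polynomial.eval_natCast, Polynomial.eval_mul,
    Polynomial.eval_X]
  push_cast
  have h2 : c * (P.cost.eval β * (β + 1)) ≤ β * (P.cost.eval β * (β + 1)) :=
    Nat.mul_le_mul_right _ hc
  nlinarith

/-! ## Named variables -/

/-- The variables of the program: numbers, two arrays, and the circuit prepared so far. -/
structure Vars where
  (N M T J q u X Y D cnt A C cx : ℤ)
  (sx cd z t b i j g acc accRe pnum pden : ℤ)
  (arr tab : ℕ → ℤ)
  circ : List Gate

/-- The contents of the cells behind the input. -/
def Vars.get (v : Vars) : ℕ → ℤ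
  | 0 => v.N
  | 1 => v.M
  | 2 => v.T
  | 3 => v.J
  | 4 => v.q
  | 5 => v.u
  | 6 => v.X
  | 7 => v.Y
  | 8 => v.D
  | 9 => v.cnt
  | 10 => v.A
  | 11 => v.C
  | 12 => v.cx
  | 13 => v.sx
  | 14 => v.cd
  | 15 => v.z
  | 16 => v.t
  | 17 => v.b
  | 18 => v.i
  | 19 => v.j
  | 20 => v.g
  | 21 => v.acc
  | 22 => v.accRe
  | 23 => v.pnum
  | 24 => v.pden
  | c + 25 => if c % 2 = 0 then v.arr (c / 2) else v.tab (c / 2)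

/-- A named variable: its cell, its value, and the way to change it. -/
structure Slot where
  idx : ℕ
  read : Vars → ℤ
  upd : Vars → ℤ → Vars
  get_idx : ∀ v, v.get idx = read v
  get_upd : ∀ v x, (upd v x).get = Function.update v.get idx x
  circ_upd : ∀ v x, (upd v x).circ = v.circ

theorem get_eq_update {v w : Vars} {i : ℕ} {x : ℤ} (h : w.get i = x)
    (h' : ∀ c < 25, c ≠ i → w.get c = v.get c) (ha : w.arr = v.arr) (ht : w.tab = v.tab) :
    w.get = Function.update v.get i x := by
  funext c
  by_cases hc : c = i
  · rw [hc, h, Function.update_self]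
  · rw [Function.update_of_ne hc]
    rcases Nat.lt_or_ge c 25 with hl | hl
    · exact h' c hl hc
    · obtain ⟨c, rfl⟩ := Nat.exists_eq_add_of_le' hl
      simp only [Vars.get, ha, ht]

namespace Slot

/-- The variable `N`. -/
def N : Slot where
  idx := 0
  read v := v.N
  upd v x := { v with N := x }
  get_idx _ := rfl
  get_upd v x := get_eq_update rfl (by intro c hc h; interval_cases c <;> first | rfl | omega) rfl rfl
  circ_upd _ _ := rfl

/-- The variable `M`. -/
def M : Slot where
  idx := 1
  read v := v.M
  upd v x := { v with M := x }
  get_idx _ := rfl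
  get_upd v x := get_eq_update rfl (by intro c hc h; interval_cases c <;> first | rfl | omega) rfl rfl
  circ_upd _ _ := rfl

/-- The variable `T`. -/
def T : Slot where
  idx := 2
  read v := v.T
  upd v x := { v with T := x }
  get_idx _ := rfl
  get_upd v x := get_eq_update rfl (by intro c hc h; interval_cases c <;> first | rfl | omega) rfl rfl
  circ_upd _ _ := rfl

/-- The variable `J`. -/
def J : Slot where
  idx := 3
  read v := v.J
  upd v x := { v with J := x }
  get_idx _ := rfl
  get_upd v x := get_eq_update rfl (by intro c hc h; interval_cases c <;> first | rfl | omega) rfl rfl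
  circ_upd _ _ := rfl

/-- The variable `q`. -/
def q : Slot where
  idx := 4
  read v := v.q
  upd v x := { v with q := x }
  get_idx _ := rfl
  get_upd v x := get_eq_update rfl (by intro c hc h; interval_cases c <;> first | rfl | omega) rfl rfl
  circ_upd _ _ := rfl

/-- The variable `u`. -/
def u : Slot where
  idx := 5
  read v := v.u
  upd v x := { v with u := x }
  get_idx _ := rfl
  get_upd v x := get_eq_update rfl (by intro c hc h; interval_cases c <;> first | rfl | omega) rfl rfl
  circ_upd _ _ := rfl

/-- The variable `X`. -/
def X : Slot where
  idx := 6
  read v := v.X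
  upd v x := { v with X := x }
  get_idx _ := rfl
  get_upd v x := get_eq_update rfl (by intro c hc h; interval_cases c <;> first | rfl | omega) rfl rfl
  circ_upd _ _ := rfl

/-- The variable `Y`. -/
def Y : Slot where
  idx := 7
  read v := v.Y
  upd v x := { v with Y := x }
  get_idx _ := rfl
  get_upd v x := get_eq_update rfl (by intro c hc h; interval_cases c <;> first | rfl | omega) rfl rfl
  circ_upd _ _ := rfl

/-- The variable `D`. -/
def D : Slot where
  idx := 8
  read v := v.D
  upd v x := { v with D := x }
  get_idx _ := rfl
  get_upd v x := get_eq_update rfl (by intro c hc h; interval_cases c <;> first | rfl | omega) rfl rfl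
  circ_upd _ _ := rfl

/-- The variable `cnt`. -/
def cnt : Slot where
  idx := 9
  read v := v.cnt
  upd v x := { v with cnt := x }
  get_idx _ := rfl
  get_upd v x := get_eq_update rfl (by intro c hc h; interval_cases c <;> first | rfl | omega) rfl rfl
  circ_upd _ _ := rfl

/-- The variable `A`. -/
def A : Slot where
  idx := 10
  read v := v.A
  upd v x := { v with A := x }
  get_idx _ := rfl
  get_upd v x := get_eq_update rfl (by intro c hc h; interval_cases c <;> first | rfl | omega) rfl rfl
  circ_upd _ _ := rfl

/-- The variable `C`. -/
def C : Slot where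
  idx := 11
  read v := v.C
  upd v x := { v with C := x }
  get_idx _ := rfl
  get_upd v x := get_eq_update rfl (by intro c hc h; interval_cases c <;> first | rfl | omega) rfl rfl
  circ_upd _ _ := rfl

/-- The variable `cx`. -/
def cx : Slot where
  idx := 12
  read v := v.cx
  upd v x := { v with cx := x }
  get_idx _ := rfl
  get_upd v x := get_eq_update rfl (by intro c hc h; interval_cases c <;> first | rfl | omega) rfl rfl
  circ_upd _ _ := rfl

/-- The variable `sx`. -/
def sx : Slot where
  idx := 13
  read v := v.sx
  upd v x := { v with sx := x }
  get_idx _ := rfl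
  get_upd v x := get_eq_update rfl (by intro c hc h; interval_cases c <;> first | rfl | omega) rfl rfl
  circ_upd _ _ := rfl

/-- The variable `cd`. -/
def cd : Slot where
  idx := 14
  read v := v.cd
  upd v x := { v with cd := x }
  get_idx _ := rfl
  get_upd v x := get_eq_update rfl (by intro c hc h; interval_cases c <;> first | rfl | omega) rfl rfl
  circ_upd _ _ := rfl

/-- The variable `z`. -/
def z : Slot where
  idx := 15
  read v := v.z
  upd v x := { v with z := x }
  get_idx _ := rfl
  get_upd v x := get_eq_update rfl (by intro c hc h; interval_cases c <;> first | rfl | omega) rfl rfl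
  circ_upd _ _ := rfl

/-- The variable `t`. -/
def t : Slot where
  idx := 16
  read v := v.t
  upd v x := { v with t := x }
  get_idx _ := rfl
  get_upd v x := get_eq_update rfl (by intro c hc h; interval_cases c <;> first | rfl | omega) rfl rfl
  circ_upd _ _ := rfl

/-- The variable `b`. -/
def b : Slot where
  idx := 17
  read v := v.b
  upd v x := { v with b := x }
  get_idx _ := rfl
  get_upd v x := get_eq_update rfl (by intro c hc h; interval_cases c <;> first | rfl | omega) rfl rfl
  circ_upd _ _ := rfl

/-- The variable `i`. -/
def i : Slot where
  idx := 18
  read v := v.i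
  upd v x := { v with i := x }
  get_idx _ := rfl
  get_upd v x := get_eq_update rfl (by intro c hc h; interval_cases c <;> first | rfl | omega) rfl rfl
  circ_upd _ _ := rfl

/-- The variable `j`. -/
def j : Slot where
  idx := 19
  read v := v.j
  upd v x := { v with j := x }
  get_idx _ := rfl
  get_upd v x := get_eq_update rfl (by intro c hc h; interval_cases c <;> first | rfl | omega) rfl rfl
  circ_upd _ _ := rfl

/-- The variable `g`. -/
def g : Slot where
  idx := 20
  read v := v.g
  upd v x := { v with g := x }
  get_idx _ := rfl
  get_upd v x := get_eq_update rfl (by intro c hc h; interval_cases c <;> first | rfl | omega) rfl rfl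
  circ_upd _ _ := rfl

/-- The variable `acc`. -/
def acc : Slot where
  idx := 21
  read v := v.acc
  upd v x := { v with acc := x }
  get_idx _ := rfl
  get_upd v x := get_eq_update rfl (by intro c hc h; interval_cases c <;> first | rfl | omega) rfl rfl
  circ_upd _ _ := rfl

/-- The variable `accRe`. -/
def accRe : Slot where
  idx := 22
  read v := v.accRe
  upd v x := { v with accRe := x }
  get_idx _ := rfl
  get_upd v x := get_eq_update rfl (by intro c hc h; interval_cases c <;> first | rfl | omega) rfl rfl
  circ_upd _ _ := rfl

/-- The variable `pnum`. -/
def pnum : Slot where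
  idx := 23
  read v := v.pnum
  upd v x := { v with pnum := x }
  get_idx _ := rfl
  get_upd v x := get_eq_update rfl (by intro c hc h; interval_cases c <;> first | rfl | omega) rfl rfl
  circ_upd _ _ := rfl

/-- The variable `pden`. -/
def pden : Slot where
  idx := 24
  read v := v.pden
  upd v x := { v with pden := x }
  get_idx _ := rfl
  get_upd v x := get_eq_update rfl (by intro c hc h; interval_cases c <;> first | rfl | omega) rfl rfl
  circ_upd _ _ := rfl

@[simp]
theorem N_read (v : Vars) : N.read v = v.N := rfl
@[simp]
theorem N_upd (v : Vars) (x : ℤ) : N.upd v x = { v with N := x } := rfl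
@[simp]
theorem M_read (v : Vars) : M.read v = v.M := rfl
@[simp]
theorem M_upd (v : Vars) (x : ℤ) : M.upd v x = { v with M := x } := rfl
@[simp]
theorem T_read (v : Vars) : T.read v = v.T := rfl
@[simp]
theorem T_upd (v : Vars) (x : ℤ) : T.upd v x = { v with T := x } := rfl
@[simp]
theorem J_read (v : Vars) : J.read v = v.J := rfl
@[simp]
theorem J_upd (v : Vars) (x : ℤ) : J.upd v x = { v with J := x } := rfl
@[simp]
theorem q_read (v : Vars) : q.read v = v.q := rfl
@[simp]
theorem q_upd (v : Vars) (x : ℤ) : q.upd v x = { v with q := x } := rfl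
@[simp]
theorem u_read (v : Vars) : u.read v = v.u := rfl
@[simp]
theorem u_upd (v : Vars) (x : ℤ) : u.upd v x = { v with u := x } := rfl
@[simp]
theorem X_read (v : Vars) : X.read v = v.X := rfl
@[simp]
theorem X_upd (v : Vars) (x : ℤ) : X.upd v x = { v with X := x } := rfl
@[simp]
theorem Y_read (v : Vars) : Y.read v = v.Y := rfl
@[simp]
theorem Y_upd (v : Vars) (x : ℤ) : Y.upd v x = { v with Y := x } := rfl
@[simp]
theorem D_read (v : Vars) : D.read v = v.D := rfl
@[simp]
theorem D_upd (v : Vars) (x : ℤ) : D.upd v x = { v with D := x } := rfl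
@[simp]
theorem cnt_read (v : Vars) : cnt.read v = v.cnt := rfl
@[simp]
theorem cnt_upd (v : Vars) (x : ℤ) : cnt.upd v x = { v with cnt := x } := rfl
@[simp]
theorem A_read (v : Vars) : A.read v = v.A := rfl
@[simp]
theorem A_upd (v : Vars) (x : ℤ) : A.upd v x = { v with A := x } := rfl
@[simp]
theorem C_read (v : Vars) : C.read v = v.C := rfl
@[simp]
theorem C_upd (v : Vars) (x : ℤ) : C.upd v x = { v with C := x } := rfl
@[simp]
theorem cx_read (v : Vars) : cx.read v = v.cx := rfl
@[simp]
theorem cx_upd (v : Vars) (x : ℤ) : cx.upd v x = { v with cx := x } := rfl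
@[simp]
theorem sx_read (v : Vars) : sx.read v = v.sx := rfl
@[simp]
theorem sx_upd (v : Vars) (x : ℤ) : sx.upd v x = { v with sx := x } := rfl
@[simp]
theorem cd_read (v : Vars) : cd.read v = v.cd := rfl
@[simp]
theorem cd_upd (v : Vars) (x : ℤ) : cd.upd v x = { v with cd := x } := rfl
@[simp]
theorem z_read (v : Vars) : z.read v = v.z := rfl
@[simp]
theorem z_upd (v : Vars) (x : ℤ) : z.upd v x = { v with z := x } := rfl
@[simp]
theorem t_read (v : Vars) : t.read v = v.t := rfl
@[simp]
theorem t_upd (v : Vars) (x : ℤ) : t.upd v x = { v with t := x } := rfl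
@[simp]
theorem b_read (v : Vars) : b.read v = v.b := rfl
@[simp]
theorem b_upd (v : Vars) (x : ℤ) : b.upd v x = { v with b := x } := rfl
@[simp]
theorem i_read (v : Vars) : i.read v = v.i := rfl
@[simp]
theorem i_upd (v : Vars) (x : ℤ) : i.upd v x = { v with i := x } := rfl
@[simp]
theorem j_read (v : Vars) : j.read v = v.j := rfl
@[simp]
theorem j_upd (v : Vars) (x : ℤ) : j.upd v x = { v with j := x } := rfl
@[simp]
theorem g_read (v : Vars) : g.read v = v.g := rfl
@[simp]
theorem g_upd (v : Vars) (x : ℤ) : g.upd v x = { v with g := x } := rfl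
@[simp]
theorem acc_read (v : Vars) : acc.read v = v.acc := rfl
@[simp]
theorem acc_upd (v : Vars) (x : ℤ) : acc.upd v x = { v with acc := x } := rfl
@[simp]
theorem accRe_read (v : Vars) : accRe.read v = v.accRe := rfl
@[simp]
theorem accRe_upd (v : Vars) (x : ℤ) : accRe.upd v x = { v with accRe := x } := rfl
@[simp]
theorem pnum_read (v : Vars) : pnum.read v = v.pnum := rfl
@[simp]
theorem pnum_upd (v : Vars) (x : ℤ) : pnum.upd v x = { v with pnum := x } := rfl
@[simp]
theorem pden_read (v : Vars) : pden.read v = v.pden := rfl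
@[simp]
theorem pden_upd (v : Vars) (x : ℤ) : pden.upd v x = { v with pden := x } := rfl

end Slot

instance : Add Expr := ⟨Expr.add⟩
instance : Sub Expr := ⟨Expr.sub⟩
instance : Mul Expr := ⟨Expr.mul⟩
instance : Div Expr := ⟨Expr.div⟩
instance (a : ℕ) : OfNat Expr a := ⟨Expr.lit a⟩

@[simp]
theorem Expr.eval_add' (μ : Memory) (e f : Expr) : (e + f).eval μ = e.eval μ + f.eval μ := rfl
@[simp]
theorem Expr.eval_sub' (μ : Memory) (e f : Expr) : (e - f).eval μ = e.eval μ - f.eval μ := rfl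
@[simp]
theorem Expr.eval_mul' (μ : Memory) (e f : Expr) : (e * f).eval μ = e.eval μ * f.eval μ := rfl
@[simp]
theorem Expr.eval_div' (μ : Memory) (e f : Expr) : (e / f).eval μ = e.eval μ / f.eval μ := rfl
@[simp]
theorem Expr.eval_le' (μ : Memory) (e f : Expr) :
    (Expr.le e f).eval μ = if e.eval μ ≤ f.eval μ then 1 else 0 := rfl
theorem Expr.eval_ofNat' (μ : Memory) (a : ℕ) : (no_index (OfNat.ofNat a : Expr)).eval μ = a := rfl

@[simp]
theorem Expr.eval_zero (μ : Memory) : (0 : Expr).eval μ = 0 := rfl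
@[simp]
theorem Expr.eval_one (μ : Memory) : (1 : Expr).eval μ = 1 := rfl
@[simp]
theorem Expr.eval_two (μ : Memory) : (2 : Expr).eval μ = 2 := rfl
@[simp]
theorem Expr.eval_four (μ : Memory) : (4 : Expr).eval μ = 4 := rfl

/-! ### The memory as input and named variables, and runs in terms of variables -/

/-- The input of a run, and the bound for the size of the cells. -/
structure Ctx where
  inp : Memory
  m : ℕ
  β : ℕ
  inp_two : inp 2 = m
  inp_le : ∀ c, |inp c| ≤ 2 ^ β

namespace Ctx

variable (K : Ctx)

/-- The memory: the input, followed by the variables. -/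
def mem (v : Vars) : Memory := fun c => if c < K.m + 3 then K.inp c else v.get (c - (K.m + 3))

/-- The state given by the values of the variables. -/
def st (v : Vars) : PState := (K.mem v, v.circ)

theorem mem_add (v : Vars) (c : ℕ) : K.mem v (K.m + 3 + c) = v.get c := by
  rw [mem, if_neg (by omega), Nat.add_sub_cancel_left]

theorem mem_of_lt (v : Vars) {c : ℕ} (h : c < K.m + 3) : K.mem v c = K.inp c := if_pos h

theorem update_mem {v w : Vars} {c : ℕ} {x : ℤ} (h : w.get = Function.update v.get c x) :
    Function.update (K.mem v) (K.m + 3 + c) x = K.mem w := by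
  funext d
  by_cases hd : d < K.m + 3
  · rw [Function.update_of_ne (by omega), K.mem_of_lt v hd, K.mem_of_lt w hd]
  · obtain ⟨e, rfl⟩ := Nat.exists_eq_add_of_le (Nat.le_of_not_lt hd)
    rw [K.mem_add w, h]
    by_cases he : e = c
    · rw [he, Function.update_self, Function.update_self]
    · rw [Function.update_of_ne he, Function.update_of_ne (by omega), K.mem_add]

/-- The values of all the variables are bounded. -/
def Bd (v : Vars) : Prop := ∀ c, |v.get c| ≤ 2 ^ K.β

variable {K}

theorem Bd.memLE {v : Vars} (h : K.Bd v) : MemLE K.β (K.mem v) := by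
  intro c
  rw [mem]
  split_ifs
  · exact K.inp_le c
  · exact h _

theorem Bd.update {v w : Vars} (h : K.Bd v) {c : ℕ} {x : ℤ} (hw : w.get = Function.update v.get c x)
    (hx : |x| ≤ 2 ^ K.β) : K.Bd w := by
  intro d
  rw [hw]
  by_cases hd : d = c
  · rw [hd, Function.update_self]; exact hx
  · rw [Function.update_of_ne hd]; exact h d

end Ctx

/-- A run of the program, from bounded variables `v`, ends with bounded variables of law `μ`. -/
def RExec (K : Ctx) (P : Prog) (v : Vars) (μ : PMF Vars) : Prop :=
  K.Bd v → Runs K.β P (K.st v) (μ.map K.st) ∧ ∀ w ∈ μ.support, K.Bd w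

/-- A run of the program, from bounded variables `v`, ends with the bounded variables `w`. -/
def Exec (K : Ctx) (P : Prog) (v w : Vars) : Prop := RExec K P v (PMF.pure w)

variable {K : Ctx}

theorem Exec.of_runs {P : Prog} {v w : Vars} (h : K.Bd v → Runs K.β P (K.st v) (PMF.pure (K.st w)))
    (hb : K.Bd v → K.Bd w) : Exec K P v w := by
  intro hv
  refine ⟨by rw [PMF.pure_map]; exact h hv, ?_⟩
  intro w' hw'
  rw [PMF.mem_support_pure_iff] at hw'
  rw [hw']
  exact hb hv

theorem Runs.unique {β : ℕ} {P : Prog} {s : PState} {μ ν : PMF PState} (h1 : Runs β P s μ)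
    (h2 : Runs β P s ν) : μ = ν := (h1 0).1.symm.trans (h2 0).1

/-- A kernel on variables is carried over to machine states by choosing a preimage. The map `st`
need not be injective: the law of a run is determined by the machine state, so the choice does not
matter. -/
theorem exists_kernel {β : ℕ} {P : Prog} {μ : PMF Vars} {κ : Vars → PMF PState} {st : Vars → PState}
    (h : ∀ v ∈ μ.support, Runs β P (st v) (κ v)) :
    ∃ κ' : PState → PMF PState, (∀ s ∈ (μ.map st).support, Runs β P s (κ' s)) ∧
      (μ.map st).bind κ' = μ.bind κ := by
  classical
  have key : ∀ s ∈ (μ.map st).support, ∃ v ∈ μ.support, st v = s := by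
    intro s hs
    rw [PMF.mem_support_map_iff] at hs
    exact hs
  refine ⟨fun s => if hs : s ∈ (μ.map st).support then κ (key s hs).choose else PMF.pure s, ?_, ?_⟩
  · intro s hs
    simp only [dif_pos hs]
    have := h _ (key s hs).choose_spec.1
    rwa [(key s hs).choose_spec.2] at this
  · rw [PMF.bind_map]
    refine bind_congr_support _ fun v hv => ?_
    have hs : st v ∈ (μ.map st).support := (PMF.mem_support_map_iff _ _ _).2 ⟨v, hv, rfl⟩
    simp only [Function.comp, dif_pos hs]
    have h1 := h _ (key _ hs).choose_spec.1
    rw [(key _ hs).choose_spec.2] at h1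
    exact h1.unique (h v hv)

theorem RExec.seq {P Q : Prog} {v : Vars} {μ : PMF Vars} {κ : Vars → PMF Vars} (hP : RExec K P v μ)
    (hQ : ∀ w ∈ μ.support, RExec K Q w (κ w)) : RExec K (.seq P Q) v (μ.bind κ) := by
  intro hv
  obtain ⟨h1, h2⟩ := hP hv
  obtain ⟨κ', h3, h4⟩ := exists_kernel (st := K.st) (κ := fun w => (κ w).map K.st)
    fun w hw => (hQ w hw (h2 w hw)).1
  refine ⟨?_, ?_⟩
  · rw [PMF.map_bind, ← h4]
    exact runs_seq h1 h3
  · intro w hw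
    rw [PMF.mem_support_bind_iff] at hw
    obtain ⟨u, hu, hw⟩ := hw
    exact (hQ u hu (h2 u hu)).2 w hw

theorem Exec.seq_rexec {P Q : Prog} {v w : Vars} {μ : PMF Vars} (hP : Exec K P v w)
    (hQ : RExec K Q w μ) : RExec K (.seq P Q) v μ := by
  have := RExec.seq hP (κ := fun _ => μ) (by
    intro u hu
    rw [PMF.mem_support_pure_iff] at hu
    rw [hu]
    exact hQ)
  rwa [PMF.pure_bind] at this

theorem Exec.seq {P Q : Prog} {u v w : Vars} (hP : Exec K P u v) (hQ : Exec K Q v w) :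
    Exec K (.seq P Q) u w := hP.seq_rexec hQ

theorem RExec.seq_exec {P Q : Prog} {v : Vars} {μ : PMF Vars} {f : Vars → Vars} (hP : RExec K P v μ)
    (hQ : ∀ w ∈ μ.support, Exec K Q w (f w)) : RExec K (.seq P Q) v (μ.map f) :=
  RExec.seq hP hQ

theorem rexec_loop {e : Expr} {P : Prog} {v : Vars} {c : ℕ}
    (he : (e.eval (K.mem v)).toNat = c) (hc : c ≤ K.β) {μ : ℕ → PMF Vars} (h0 : μ 0 = PMF.pure v)
    {κ : ℕ → Vars → PMF Vars} (hμ : ∀ i < c, μ (i + 1) = (μ i).bind (κ i))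
    (hP : ∀ i < c, ∀ w ∈ (μ i).support, RExec K P w (κ i w)) : RExec K (.loop e P) v (μ c) := by
  intro hv
  have hB : ∀ i ≤ c, ∀ w ∈ (μ i).support, K.Bd w := by
    intro i hi
    induction i with
    | zero =>
      intro w hw
      rw [h0, PMF.mem_support_pure_iff] at hw
      rw [hw]
      exact hv
    | succ i ih =>
      intro w hw
      rw [hμ i (by omega), PMF.mem_support_bind_iff] at hw
      obtain ⟨u, hu, hw⟩ := hw
      exact (hP i (by omega) u hu (ih (by omega) u hu)).2 w hw
  have hex : ∀ i, ∃ κ' : PState → PMF PState, i < c →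
      ((∀ s ∈ ((μ i).map K.st).support, Runs K.β P s (κ' s)) ∧
        ((μ i).map K.st).bind κ' = (μ i).bind fun w => (κ i w).map K.st) := by
    intro i
    by_cases hi : i < c
    · obtain ⟨κ', h⟩ := exists_kernel (β := K.β) (P := P) (μ := μ i) (st := K.st)
        (κ := fun w => (κ i w).map K.st) fun w hw => (hP i hi w hw (hB i hi.le w hw)).1
      exact ⟨κ', fun _ => h⟩
    · exact ⟨fun s => PMF.pure s, fun h => absurd h hi⟩
  choose κ' hκ' using hex
  refine ⟨runs_loop (s := K.st v) hv.memLE he hc (μ := fun i => (μ i).map K.st) ?_ (κ := κ') ?_ ?_,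
    hB c le_rfl⟩
  · rw [h0, PMF.pure_map]
  · intro i hi
    rw [(hκ' i hi).2, hμ i hi, PMF.map_bind]
  · intro i hi
    exact (hκ' i hi).1

theorem exec_loop {e : Expr} {P : Prog} {c : ℕ} (f : ℕ → Vars)
    (he : (e.eval (K.mem (f 0))).toNat = c) (hc : c ≤ K.β)
    (hP : ∀ i < c, Exec K P (f i) (f (i + 1))) : Exec K (.loop e P) (f 0) (f c) := by
  refine rexec_loop he hc (μ := fun i => PMF.pure (f i)) rfl (κ := fun i _ => PMF.pure (f (i + 1)))
    (fun i _ => by rw [PMF.pure_bind]) ?_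
  intro i hi w hw
  rw [PMF.mem_support_pure_iff] at hw
  rw [hw]
  exact hP i hi

/-! ## Access to the variables -/

/-- The value of a variable. -/
def Slot.ex (s : Slot) : Expr := .load (.load 2 + .lit (s.idx + 3 : ℕ))

/-- The assignment to a variable. -/
def Slot.set (s : Slot) (e : Expr) : Prog := .store (.load 2 + .lit (s.idx + 3 : ℕ)) e

/-- The entry number `e` of the array `arr`. -/
def arrEx (e : Expr) : Expr := .load (.load 2 + (28 + 2 * e))

/-- The entry number `e` of the array `tab`. -/
def tabEx (e : Expr) : Expr := .load (.load 2 + (29 + 2 * e))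

/-- The assignment to an entry of the array `arr`. -/
def setArr (e f : Expr) : Prog := .store (.load 2 + (28 + 2 * e)) f

/-- The assignment to an entry of the array `tab`. -/
def setTab (e f : Expr) : Prog := .store (.load 2 + (29 + 2 * e)) f

theorem eval_input (v : Vars) {c : ℕ} (h : c < K.m + 3) :
    (Expr.load (.lit c)).eval (K.mem v) = K.inp c := by
  simp only [Expr.eval, Int.toNat_natCast, K.mem_of_lt v h]

theorem eval_load_two (v : Vars) : (Expr.load 2).eval (K.mem v) = K.m := by
  rw [← K.inp_two]; exact eval_input v (c := 2) (by omega)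

/-- The cell 2 holds the number `m` of crossings, so the cells behind the input are addressed
relative to it. It must keep its value until the output is written. -/
theorem eval_addr (v : Vars) {e : Expr} {x : ℕ} (h : e.eval (K.mem v) = (x + 3 : ℕ)) :
    ((Expr.load 2 + e).eval (K.mem v)).toNat = K.m + 3 + x := by
  rw [Expr.eval_add', eval_load_two, h]
  omega

@[simp]
theorem Slot.eval_ex (s : Slot) (v : Vars) : s.ex.eval (K.mem v) = s.read v := by
  rw [Slot.ex, Expr.eval, eval_addr (x := s.idx) v rfl, K.mem_add, s.get_idx]

theorem get_arr (v : Vars) (x : ℕ) : v.get (25 + 2 * x) = v.arr x := by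
  rw [Nat.add_comm, Vars.get]; simp

theorem get_tab (v : Vars) (x : ℕ) : v.get (26 + 2 * x) = v.tab x := by
  rw [show 26 + 2 * x = (2 * x + 1) + 25 by omega, Vars.get]
  rw [if_neg (by omega), show (2 * x + 1) / 2 = x by omega]

theorem eval_arrEx {v : Vars} {e : Expr} {x : ℕ} (h : e.eval (K.mem v) = x) :
    (arrEx e).eval (K.mem v) = v.arr x := by
  rw [arrEx, Expr.eval, eval_addr (x := 25 + 2 * x), K.mem_add, get_arr]
  rw [Expr.eval_add', Expr.eval_mul', h, Expr.eval_ofNat', Expr.eval_ofNat']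
  push_cast
  ring

theorem eval_tabEx {v : Vars} {e : Expr} {x : ℕ} (h : e.eval (K.mem v) = x) :
    (tabEx e).eval (K.mem v) = v.tab x := by
  rw [tabEx, Expr.eval, eval_addr (x := 26 + 2 * x), K.mem_add, get_tab]
  rw [Expr.eval_add', Expr.eval_mul', h, Expr.eval_ofNat', Expr.eval_ofNat']
  push_cast
  ring

theorem get_eq_update_arr (v : Vars) (x : ℕ) (y : ℤ) :
    ({ v with arr := Function.update v.arr x y } : Vars).get = Function.update v.get (25 + 2 * x) y := by
  funext c
  by_cases hc : c = 25 + 2 * x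
  · rw [hc, Function.update_self, get_arr]
    exact Function.update_self ..
  · rw [Function.update_of_ne hc]
    rcases Nat.lt_or_ge c 25 with hl | hl
    · interval_cases c <;> rfl
    · obtain ⟨c, rfl⟩ := Nat.exists_eq_add_of_le' hl
      simp only [Vars.get]
      split_ifs
      · rw [Function.update_of_ne (by omega)]
      · rfl

theorem get_eq_update_tab (v : Vars) (x : ℕ) (y : ℤ) :
    ({ v with tab := Function.update v.tab x y } : Vars).get = Function.update v.get (26 + 2 * x) y := by
  funext c
  by_cases hc : c = 26 + 2 * x
  · rw [hc, Function.update_self, get_tab]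
    exact Function.update_self ..
  · rw [Function.update_of_ne hc]
    rcases Nat.lt_or_ge c 25 with hl | hl
    · interval_cases c <;> rfl
    · obtain ⟨c, rfl⟩ := Nat.exists_eq_add_of_le' hl
      simp only [Vars.get]
      split_ifs
      · rfl
      · rw [Function.update_of_ne (by omega)]

theorem exec_store {v w : Vars} {a e : Expr} {c : ℕ} {x : ℤ} (ha : a.eval (K.mem v) = (c + 3 : ℕ))
    (hx : e.eval (K.mem v) = x) (hb : |x| ≤ 2 ^ K.β) (hw : w.get = Function.update v.get c x)
    (hc : w.circ = v.circ) : Exec K (.store (.load 2 + a) e) v w := by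
  refine Exec.of_runs (fun hv => ?_) fun hv => hv.update hw hb
  have := runs_store (.load 2 + a) e (s := K.st v) hv.memLE
  have e1 : K.st w = (Function.update (K.st v).1 ((Expr.load 2 + a).eval (K.st v).1).toNat
      (e.eval (K.st v).1), (K.st v).2) := by
    simp only [Ctx.st, eval_addr v ha, hx, K.update_mem hw, hc]
  rw [e1]
  exact this

theorem Slot.exec_set (s : Slot) {e : Expr} {v : Vars} {x : ℤ} (hx : e.eval (K.mem v) = x)
    (hb : |x| ≤ 2 ^ K.β) : Exec K (s.set e) v (s.upd v x) :=
  exec_store rfl hx hb (s.get_upd v x) (s.circ_upd v x)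

theorem exec_setArr {v : Vars} {e f : Expr} {x : ℕ} {y : ℤ} (he : e.eval (K.mem v) = x)
    (hy : f.eval (K.mem v) = y) (hb : |y| ≤ 2 ^ K.β) :
    Exec K (setArr e f) v { v with arr := Function.update v.arr x y } := by
  refine exec_store (c := 25 + 2 * x) ?_ hy hb (get_eq_update_arr v x y) rfl
  rw [Expr.eval_add', Expr.eval_mul', he, Expr.eval_ofNat', Expr.eval_ofNat']
  push_cast
  ring

theorem exec_setTab {v : Vars} {e f : Expr} {x : ℕ} {y : ℤ} (he : e.eval (K.mem v) = x)
    (hy : f.eval (K.mem v) = y) (hb : |y| ≤ 2 ^ K.β) :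
    Exec K (setTab e f) v { v with tab := Function.update v.tab x y } := by
  refine exec_store (c := 26 + 2 * x) ?_ hy hb (get_eq_update_tab v x y) rfl
  rw [Expr.eval_add', Expr.eval_mul', he, Expr.eval_ofNat', Expr.eval_ofNat']
  push_cast
  ring

/-! ## Gates -/

/-- Gates are appended to the circuit. -/
def Vars.emit (v : Vars) (l : List Gate) : Vars := { v with circ := v.circ ++ l }

theorem Vars.emit_nil (v : Vars) : v.emit [] = v := by simp [Vars.emit]

theorem Vars.emit_emit (v : Vars) (l l' : List Gate) : (v.emit l).emit l' = v.emit (l ++ l') := by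
  simp [Vars.emit]

theorem Vars.get_emit (v : Vars) (l : List Gate) : (v.emit l).get = v.get := by
  funext c
  rcases Nat.lt_or_ge c 25 with hl | hl
  · interval_cases c <;> rfl
  · obtain ⟨c, rfl⟩ := Nat.exists_eq_add_of_le' hl
    rfl

theorem Ctx.mem_emit (v : Vars) (l : List Gate) : K.mem (v.emit l) = K.mem v := by
  funext c
  rw [Ctx.mem, Ctx.mem, Vars.get_emit]

theorem exec_gate {P : Prog} {v : Vars} {g : Gate}
    (h : K.Bd v → Runs K.β P (K.st v) (PMF.pure (K.mem v, v.circ ++ [g]))) :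
    Exec K P v (v.emit [g]) := by
  refine Exec.of_runs (fun hv => ?_) fun hv => ?_
  · have e : K.st (v.emit [g]) = (K.mem v, v.circ ++ [g]) := by
      unfold Ctx.st
      rw [Ctx.mem_emit]
      rfl
    rw [e]
    exact h hv
  · intro c
    rw [Vars.get_emit]
    exact hv c

theorem exec_had {v : Vars} {i : Expr} {a : ℕ} (hi : (i.eval (K.mem v)).toNat = a) :
    Exec K (.had i) v (v.emit [Gate.had a]) := by
  refine exec_gate fun hv => ?_
  have := runs_had i (s := K.st v) hv.memLE
  simp only [Ctx.st, hi] at this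
  exact this

theorem exec_cnot {v : Vars} {i j : Expr} {a b : ℕ} (hi : (i.eval (K.mem v)).toNat = a)
    (hj : (j.eval (K.mem v)).toNat = b) : Exec K (.cnot i j) v (v.emit [Gate.cnot a b]) := by
  refine exec_gate fun hv => ?_
  have := runs_cnot i j (s := K.st v) hv.memLE
  simp only [Ctx.st, hi, hj] at this
  exact this

theorem exec_cphase {v : Vars} {l i j : Expr} {c a b : ℕ} (hl : (l.eval (K.mem v)).toNat = c)
    (hi : (i.eval (K.mem v)).toNat = a) (hj : (j.eval (K.mem v)).toNat = b) (hc : c ≤ K.β) :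
    Exec K (.cphase l i j) v (v.emit [Gate.cphase c a b]) := by
  refine exec_gate fun hv => ?_
  have := runs_cphase l i j (s := K.st v) hv.memLE (by simp only [Ctx.st, hl]; exact hc)
  simp only [Ctx.st, hl, hi, hj] at this
  exact this

/-- A program that appends the gates `l` to the circuit. -/
def Emits (K : Ctx) (P : Prog) (v : Vars) (l : List Gate) : Prop :=
  ∀ l', Exec K P (v.emit l') (v.emit (l' ++ l))

theorem Emits.exec {P : Prog} {v : Vars} {l : List Gate} (h : Emits K P v l) :
    Exec K P v (v.emit l) := by
  have := h []
  rwa [Vars.emit_nil] at this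

/-- Appending gates leaves the memory alone, so both programs evaluate their expressions with the
same variables `v`; the freedom in the gates already present makes them composable. -/
theorem Emits.seq {P Q : Prog} {v : Vars} {l l' : List Gate} (hP : Emits K P v l)
    (hQ : Emits K Q v l') : Emits K (.seq P Q) v (l ++ l') := by
  intro l''
  rw [← List.append_assoc]
  exact (hP l'').seq (hQ _)

theorem emits_had {v : Vars} {i : Expr} {a : ℕ} (hi : (i.eval (K.mem v)).toNat = a) :
    Emits K (.had i) v [Gate.had a] := by
  intro l
  rw [← Vars.emit_emit]
  exact exec_had (by rwa [Ctx.mem_emit])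

theorem emits_cnot {v : Vars} {i j : Expr} {a b : ℕ} (hi : (i.eval (K.mem v)).toNat = a)
    (hj : (j.eval (K.mem v)).toNat = b) : Emits K (.cnot i j) v [Gate.cnot a b] := by
  intro l
  rw [← Vars.emit_emit]
  exact exec_cnot (by rwa [Ctx.mem_emit]) (by rwa [Ctx.mem_emit])

/-- Repeated phase gates. -/
def repPhase (e l i j : Expr) : Prog := .loop e (.cphase l i j)

theorem emits_repPhase {v : Vars} {e l i j : Expr} {r c a b : ℕ} (he : (e.eval (K.mem v)).toNat = r)
    (hl : (l.eval (K.mem v)).toNat = c) (hi : (i.eval (K.mem v)).toNat = a)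
    (hj : (j.eval (K.mem v)).toNat = b) (hr : r ≤ K.β) (hc : c ≤ K.β) :
    Emits K (repPhase e l i j) v (List.replicate r (Gate.cphase c a b)) := by
  intro l'
  have := exec_loop (K := K) (e := e) (P := .cphase l i j) (c := r)
    (fun s => v.emit (l' ++ List.replicate s (Gate.cphase c a b))) (by rwa [Ctx.mem_emit]) hr (by
      intro s _
      rw [List.replicate_succ', ← List.append_assoc, ← Vars.emit_emit v (l' ++ _)]
      exact exec_cphase (by rwa [Ctx.mem_emit]) (by rwa [Ctx.mem_emit]) (by rwa [Ctx.mem_emit]) hc)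
  simpa [repPhase] using this

/-- The measurement of the current circuit. -/
theorem rexec_measure (v : Vars) :
    RExec K (.measure (.load 2 + .lit (Slot.b.idx + 3 : ℕ))) v
      ((measureDist v.circ).map fun b => { v with b := if b then 1 else 0, circ := [] }) := by
  intro hv
  have e1 : ∀ x : ℤ, ({ v with b := x, circ := [] } : Vars).get = Function.update v.get Slot.b.idx x := by
    intro x
    rw [← Slot.b.get_upd v x]
    have := Vars.get_emit { v with b := x, circ := [] } v.circ
    exact this.symm
  constructor
  · have := runs_measure (.load 2 + .lit (Slot.b.idx + 3 : ℕ)) (s := K.st v) hv.memLE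
    rw [PMF.map_comp]
    have ea := eval_addr (K := K) (e := .lit (Slot.b.idx + 3 : ℕ)) (x := Slot.b.idx) v rfl
    convert this using 3 with b
    · simp only [Ctx.st, Function.comp, ea]
      rw [K.update_mem (e1 _)]
    · rfl
  · intro w hw
    rw [PMF.mem_support_map_iff] at hw
    obtain ⟨b, -, rfl⟩ := hw
    refine hv.update (e1 _) ?_
    have : (1 : ℤ) ≤ 2 ^ K.β := one_le_pow₀ (by norm_num)
    split_ifs <;> simp [this]

variable {K : Ctx}

notation:67 P:68 "⨟" Q:67 => Prog.seq P Q

/-! ## The circuit of the Hadamard test -/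

theorem Ctx.small {x : ℤ} (h : |x| ≤ K.β) : |x| ≤ 2 ^ K.β :=
  h.trans (by exact_mod_cast Nat.lt_two_pow_self.le)

theorem Exec.congr {P : Prog} {v w v' w' : Vars} (h : Exec K P v w) (hv : v = v') (hw : w = w') :
    Exec K P v' w' := hv ▸ hw ▸ h

/-- The gates of a block. -/
def blockProg (a b u v t r : Expr) : Prog :=
  .cnot a b ⨟ (repPhase 1 2 a a ⨟ .had a ⨟ repPhase (Slot.T.ex - t) Slot.J.ex a a ⨟ .had a ⨟
    repPhase r (Slot.J.ex + 1) u a ⨟ repPhase r (Slot.J.ex + 1) v a ⨟ .cnot u v ⨟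
    repPhase (2 * Slot.T.ex - r) (Slot.J.ex + 1) v a ⨟ .cnot u v ⨟ .had a ⨟
    repPhase t Slot.J.ex a a ⨟ .had a ⨟ repPhase (.lit 3) 2 a a) ⨟ .cnot a b

theorem emits_blockProg {w : Vars} {a b u v t r : Expr} {J a' b' u' v' t' r' : ℕ}
    (ha : (a.eval (K.mem w)).toNat = a') (hb : (b.eval (K.mem w)).toNat = b')
    (hu : (u.eval (K.mem w)).toNat = u') (hv : (v.eval (K.mem w)).toNat = v')
    (ht : t.eval (K.mem w) = t') (hr : r.eval (K.mem w) = r') (hJ : w.J = J) (hT : w.T = 2 ^ J)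
    (htJ : t' ≤ 2 ^ J) (hrJ : r' ≤ 2 ^ J) (hβ : 2 * 2 ^ J + 3 ≤ K.β) :
    Emits K (blockProg a b u v t r) w (blockGates J a' b' u' v' t' r') := by
  have hJ2 : J < 2 ^ J := Nat.lt_two_pow_self
  have eJ : (Slot.J.ex.eval (K.mem w)).toNat = J := by simp [hJ]
  have eJ1 : ((Slot.J.ex + 1).eval (K.mem w)).toNat = J + 1 := by simp [hJ]
  have et : (t.eval (K.mem w)).toNat = t' := by simp [ht]
  have er : (r.eval (K.mem w)).toNat = r' := by simp [hr]
  have e1 : ((Slot.T.ex - t).eval (K.mem w)).toNat = 2 ^ J - t' := by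
    simp only [Expr.eval_sub', Slot.eval_ex, Slot.T_read, hT, ht]
    have : (2 : ℤ) ^ J = (2 ^ J : ℕ) := by push_cast; rfl
    omega
  have e2 : ((2 * Slot.T.ex - r).eval (K.mem w)).toNat = 2 * 2 ^ J - r' := by
    simp only [Expr.eval_sub', Expr.eval_mul', Expr.eval_two, Slot.eval_ex, Slot.T_read, hT, hr]
    have : (2 : ℤ) ^ J = (2 ^ J : ℕ) := by push_cast; rfl
    omega
  have l1 : ((1 : Expr).eval (K.mem w)).toNat = 1 := rfl
  have l2 : ((2 : Expr).eval (K.mem w)).toNat = 2 := rfl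
  have l3 : ((Expr.lit 3).eval (K.mem w)).toNat = 3 := rfl
  exact (emits_cnot ha hb).seq (((emits_repPhase l1 l2 ha ha (by omega) (by omega)).seq
    ((emits_had ha).seq ((emits_repPhase e1 eJ ha ha (by omega) (by omega)).seq
    ((emits_had ha).seq ((emits_repPhase er eJ1 hu ha (by omega) (by omega)).seq
    ((emits_repPhase er eJ1 hv ha (by omega) (by omega)).seq ((emits_cnot hu hv).seq
    ((emits_repPhase e2 eJ1 hv ha (by omega) (by omega)).seq ((emits_cnot hu hv).seq
    ((emits_had ha).seq ((emits_repPhase et eJ ha ha (by omega) (by omega)).seq ((emits_had ha).seq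
    (emits_repPhase l3 l2 ha ha (by omega) (by omega)))))))))))))).seq (emits_cnot ha hb))

/-- The number of strands. -/
def nEx : Expr := .load 0

/-- The parameter `k`. -/
def kEx : Expr := .load 1

/-- The number of crossings. -/
def mEx : Expr := .load 2

/-- The qubit of the height `h` after `i` steps. -/
def codeEx (i h : Expr) : Expr := 1 + i * (2 * nEx + kEx + 2) + (h + nEx)

/-- The input is the braid `B` and `k`. -/
structure Ctx.Has (K : Ctx) {n : ℕ} (B : Braid n) (k : ℕ) : Prop where
  inp : K.inp = inputMemory B k

section Input

variable {n : ℕ} {B : Braid n} {k : ℕ} (hK : K.Has B k)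

theorem Ctx.Has.m_eq (hK : K.Has B k) : K.m = B.length := by
  have := K.inp_two
  rw [hK.inp] at this
  exact (Int.ofNat.inj this).symm

theorem Ctx.Has.eval_nEx (hK : K.Has B k) (v : Vars) : nEx.eval (K.mem v) = n :=
  (eval_input v (c := 0) (by omega)).trans (by rw [hK.inp]; rfl)

theorem Ctx.Has.eval_kEx (hK : K.Has B k) (v : Vars) : kEx.eval (K.mem v) = k :=
  (eval_input v (c := 1) (by omega)).trans (by rw [hK.inp]; rfl)

theorem Ctx.Has.eval_mEx (hK : K.Has B k) (v : Vars) : mEx.eval (K.mem v) = B.length := by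
  rw [← hK.m_eq]
  exact eval_load_two v

theorem Ctx.Has.eval_codeEx (hK : K.Has B k) {v : Vars} {i h : Expr} {i' : ℕ} {h' : ℤ}
    (hi : i.eval (K.mem v) = i') (hh : h.eval (K.mem v) = h') :
    ((codeEx i h).eval (K.mem v)).toNat = code n k i' h' := by
  simp [codeEx, code, hi, hh, hK.eval_nEx, hK.eval_kEx]

end Input

/-- The values of the variables before a round. -/
structure Ready (C : Calib) (k : ℕ) (v : Vars) : Prop where
  J : v.J = C.J
  T : v.T = 2 ^ C.J
  tab_zero : v.tab 0 = 0
  tab : ∀ z : ℕ, 1 ≤ z → z < k → v.tab z = C.tab z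

/-- The gates of a crossing at the sites `1, …, k - 1`. -/
def sitesProg : Prog :=
  Slot.z.set 0 ⨟ .loop (kEx - 1) (Slot.t.set (tabEx (Slot.z.ex + 1)) ⨟
    blockProg (codeEx (Slot.i.ex + 1) Slot.z.ex) (codeEx (Slot.i.ex + 1) (Slot.z.ex + 2))
      (codeEx Slot.i.ex (Slot.z.ex + 1)) (codeEx (Slot.i.ex + 2) (Slot.z.ex + 1)) Slot.t.ex
      Slot.C.ex ⨟ Slot.t.set 0 ⨟ Slot.z.set (Slot.z.ex + 1)) ⨟ Slot.z.set 0

section Crossing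

variable {n : ℕ} {B : Braid n} {k : ℕ} {C : Calib}

/-- The loop is described by an explicit family of variable records, one for each iteration.
Resetting the auxiliary variables `z` and `t` to zero keeps this description short and lets programs
be chained. -/
theorem exec_sitesProg (hK : K.Has B k) (hC : C.Valid) {v : Vars} (hv : Ready C k v) {i r : ℕ}
    (hi : v.i = i) (hr : v.C = r) (hrJ : r ≤ 2 ^ C.J) (ht : v.t = 0)
    (hβ : 2 * 2 ^ C.J + 3 ≤ K.β) (hk : k ≤ K.β) (hk0 : 1 ≤ k) :
    Exec K sitesProg v { v with
      z := 0
      circ := v.circ ++ (List.range (k - 1)).flatMap fun z =>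
        siteGates n k C.J (C.tab (z + 1)) r i z } := by
  set f : ℕ → Vars := fun s => { v with
      z := s
      circ := v.circ ++ (List.range s).flatMap fun z =>
        siteGates n k C.J (C.tab (z + 1)) r i z } with hf
  have h0 : ∀ w : Vars, (0 : Expr).eval (K.mem w) = 0 := fun w => rfl
  have b0 : |(0 : ℤ)| ≤ 2 ^ K.β := by simp
  have h1 : Exec K (Slot.z.set 0) v (f 0) := (Slot.z.exec_set (h0 v) b0).congr rfl (by simp [hf])
  have h3 : Exec K (Slot.z.set 0) (f (k - 1)) { f (k - 1) with z := 0 } :=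
    Slot.z.exec_set (h0 _) b0
  refine h1.seq (Exec.seq ?_ h3)
  refine exec_loop f ?_ (by omega) fun s hs => ?_
  · simp only [Expr.eval_sub', hK.eval_kEx, Expr.eval_one]
    omega
  have etab : (tabEx (Slot.z.ex + 1)).eval (K.mem (f s)) = C.tab (s + 1) := by
    rw [eval_tabEx (x := s + 1) (by simp [hf])]
    exact hv.tab _ (by omega) (by omega)
  have hT := hC.tab_le (s + 1)
  have g1 := Slot.t.exec_set (K := K) etab (Ctx.small (by
    rw [abs_of_nonneg (by positivity)]
    exact_mod_cast (by omega : C.tab (s + 1) ≤ K.β)))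
  set w := Slot.t.upd (f s) (C.tab (s + 1)) with hw
  have g2 := (emits_blockProg (K := K) (w := w) (a := codeEx (Slot.i.ex + 1) Slot.z.ex)
    (b := codeEx (Slot.i.ex + 1) (Slot.z.ex + 2)) (u := codeEx Slot.i.ex (Slot.z.ex + 1))
    (v := codeEx (Slot.i.ex + 2) (Slot.z.ex + 1)) (t := Slot.t.ex) (r := Slot.C.ex) (J := C.J)
    (t' := C.tab (s + 1)) (r' := r)
    (hK.eval_codeEx (i' := i + 1) (h' := s) (by simp [hw, hf, hi]) (by simp [hw, hf]))
    (hK.eval_codeEx (i' := i + 1) (h' := s + 2) (by simp [hw, hf, hi]) (by simp [hw, hf]))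
    (hK.eval_codeEx (i' := i) (h' := s + 1) (by simp [hw, hf, hi]) (by simp [hw, hf]))
    (hK.eval_codeEx (i' := i + 2) (h' := s + 1) (by simp [hw, hf, hi]) (by simp [hw, hf]))
    (by simp [hw]) (by simp [hw, hf, hr]) hv.J hv.T hT hrJ hβ).exec
  refine g1.seq (g2.seq ((Slot.t.exec_set (h0 _) b0).seq
    ((Slot.z.exec_set (x := s + 1) (by simp [hw, hf, Vars.emit]) (Ctx.small ?_)).congr rfl ?_)))
  · rw [abs_of_nonneg (by positivity)]
    exact_mod_cast (by omega : s + 1 ≤ K.β)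
  · simp [hw, hf, Vars.emit, ht, List.range_succ, siteGates]

/-- The value of a crossing in the input. -/
def crossCode (c : Fin (n - 1) × Bool) : ℤ := if c.2 then (c.1 : ℤ) + 1 else -((c.1 : ℤ) + 1)

/-- `1` for a generator and `0` for an inverse. -/
def posEx : Expr := .le 1 Slot.g.ex

/-- The number of phase gates for the phase of a crossing. -/
def thEx : Expr := Slot.T.ex / (2 * kEx)

/-- The number of phase gates for the eigenvalue of a crossing. -/
def rEx : Expr := (kEx - 2) * Slot.T.ex / (2 * kEx)

/-- The gates of a crossing. -/
def crossProg : Prog :=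
  Slot.i.set ((2 * posEx - 1) * Slot.g.ex - 1) ⨟
  Slot.A.set ((1 - posEx) * thEx + posEx * (Slot.T.ex - thEx)) ⨟
  Slot.C.set (posEx * rEx + (1 - posEx) * (Slot.T.ex - rEx)) ⨟
  repPhase Slot.A.ex Slot.J.ex 0 0 ⨟ sitesProg

theorem signed_cast {J x : ℕ} (h : x ≤ 2 ^ J) (b : Bool) :
    (signed J b x : ℤ) = if b then (x : ℤ) else 2 ^ J - x := by
  rw [signed]
  split_ifs
  · rfl
  · push_cast [h]; rfl

theorem exec_crossProg (hK : K.Has B k) {N J : ℕ} (hk : 3 ≤ k) {v : Vars}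
    (hv : Ready (calib N k J) k v) {c : Fin (n - 1) × Bool} (hg : v.g = crossCode c) (ht : v.t = 0)
    (hβ : 2 * 2 ^ J + 3 ≤ K.β) (hkβ : k ≤ K.β) (hn : n ≤ K.β) :
    Exec K crossProg v { v with
      i := c.1
      A := signed J (!c.2) (calib N k J).th
      C := signed J c.2 (calib N k J).r
      z := 0
      circ := v.circ ++ crossGates n k J (calib N k J).th (calib N k J).r (calib N k J).tab c.1 c.2 } := by
  have hC := calib_valid N k J
  have hc1 := c.1.2
  have hpos : ∀ w : Vars, w.g = v.g → posEx.eval (K.mem w) = if c.2 then 1 else 0 := by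
    intro w hw
    simp only [posEx, Expr.eval_le', Expr.eval_one, Slot.eval_ex, Slot.g_read, hw, hg, crossCode]
    cases c.2
    · simp; omega
    · simp
  have hth : ∀ w : Vars, w.T = v.T → thEx.eval (K.mem w) = (calib N k J).th := by
    intro w hw
    simp [thEx, hw, hv.T, hK.eval_kEx, calib]
  have hrr : ∀ w : Vars, w.T = v.T → rEx.eval (K.mem w) = (calib N k J).r := by
    intro w hw
    simp [rEx, hw, hv.T, hK.eval_kEx, calib, Nat.cast_sub (by omega : 2 ≤ k)]
  have bd : ∀ {b : Bool} {x : ℕ}, x ≤ 2 ^ J → |(signed J b x : ℤ)| ≤ 2 ^ K.β := by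
    intro b x hx
    refine Ctx.small ?_
    rw [abs_of_nonneg (by positivity)]
    exact_mod_cast (by have := signed_le hx b; omega : signed J b x ≤ K.β)
  -- The factor `2 * posEx - 1` is the sign of the crossing, so the expression is the absolute value
  -- of its code minus 1, which is the 0-based position.
  have s1 := Slot.i.exec_set (K := K) (v := v) (e := (2 * posEx - 1) * Slot.g.ex - 1) (x := c.1) (by
    simp only [Expr.eval_sub', Expr.eval_mul', Expr.eval_two, Expr.eval_one, hpos v rfl, Slot.eval_ex,
      Slot.g_read, hg, crossCode]
    cases c.2 <;> simp) (Ctx.small (by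
      rw [abs_of_nonneg (by positivity)]
      exact_mod_cast (by omega : (c.1 : ℕ) ≤ K.β)))
  set v1 := Slot.i.upd v c.1 with hv1
  have s2 := Slot.A.exec_set (K := K) (v := v1)
    (e := (1 - posEx) * thEx + posEx * (Slot.T.ex - thEx))
    (x := signed J (!c.2) (calib N k J).th) (by
      simp only [Expr.eval_sub', Expr.eval_mul', Expr.eval_add', Expr.eval_one, hpos v1 rfl,
        hth v1 rfl, Slot.eval_ex, Slot.T_read]
      rw [signed_cast (J := J) hC.th_le]
      have : v1.T = 2 ^ J := hv.T
      rw [this]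
      cases c.2 <;> simp [calib]) (bd hC.th_le)
  set v2 := Slot.A.upd v1 (signed J (!c.2) (calib N k J).th) with hv2
  have s3 := Slot.C.exec_set (K := K) (v := v2)
    (e := posEx * rEx + (1 - posEx) * (Slot.T.ex - rEx))
    (x := signed J c.2 (calib N k J).r) (by
      simp only [Expr.eval_sub', Expr.eval_mul', Expr.eval_add', Expr.eval_one, hpos v2 rfl,
        hrr v2 rfl, Slot.eval_ex, Slot.T_read]
      rw [signed_cast (J := J) hC.r_le]
      have : v2.T = 2 ^ J := hv.T
      rw [this]
      cases c.2 <;> simp [calib]) (bd hC.r_le)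
  set v3 := Slot.C.upd v2 (signed J c.2 (calib N k J).r) with hv3
  have hA := signed_le (J := J) hC.th_le (!c.2)
  have hJ2 : J < 2 ^ J := Nat.lt_two_pow_self
  have s4 := (emits_repPhase (K := K) (v := v3) (e := Slot.A.ex) (l := Slot.J.ex) (i := 0) (j := 0)
    (r := signed J (!c.2) (calib N k J).th) (c := J) (a := 0) (b := 0)
    (by simp [hv3, hv2]) (by simp [hv3, hv2, hv1, hv.J, calib]) rfl rfl (by omega) (by omega)).exec
  have s5 := exec_sitesProg (K := K) (i := c.1) (r := signed J c.2 (calib N k J).r) hK hC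
    (v := v3.emit (List.replicate (signed J (!c.2) (calib N k J).th) (Gate.cphase J 0 0)))
    ⟨hv.J, hv.T, hv.tab_zero, hv.tab⟩ rfl rfl (signed_le hC.r_le _) ht hβ hkβ (by omega)
  refine s1.seq (s2.seq (s3.seq (s4.seq (s5.congr rfl ?_))))
  simp [hv3, hv2, hv1, Vars.emit, crossGates, calib]

end Crossing

variable {K : Ctx}

/-- The auxiliary variables are zero. -/
structure Clean (v : Vars) : Prop where
  z : v.z = 0
  t : v.t = 0
  b : v.b = 0
  i : v.i = 0
  j : v.j = 0
  g : v.g = 0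
  A : v.A = 0
  C : v.C = 0

theorem RExec.congr {P : Prog} {v : Vars} {μ ν : PMF Vars} (h : RExec K P v μ) (e : μ = ν) :
    RExec K P v ν := e ▸ h

theorem Slot.exec_zero (s : Slot) (v : Vars) : Exec K (s.set 0) v (s.upd v 0) :=
  s.exec_set rfl (by simp)

theorem inputMemory_add_three {n : ℕ} (B : Braid n) (k : ℕ) {j : ℕ} (h : j < B.length) :
    inputMemory B k (j + 3) = crossCode B[j] := by
  rw [inputMemory, List.getElem?_eq_getElem h]
  rcases e : B[j] with ⟨i, b⟩
  cases b <;> rfl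

/-- The gates of all the crossings, from the last one to the first one. -/
def braidProg : Prog :=
  .loop mEx (Slot.g.set (.load (mEx + 2 - Slot.j.ex)) ⨟ crossProg ⨟ Slot.i.set 0 ⨟ Slot.A.set 0 ⨟
    Slot.C.set 0 ⨟ Slot.g.set 0 ⨟ Slot.j.set (Slot.j.ex + 1)) ⨟ Slot.j.set 0

/-- The controlled preparation of the path. -/
def copyProg : Prog :=
  .loop (nEx + 1) (.cnot 0 (codeEx Slot.i.ex (arrEx Slot.i.ex)) ⨟ Slot.i.set (Slot.i.ex + 1)) ⨟
    Slot.i.set 0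

section

variable {n : ℕ} {B : Braid n} {k : ℕ}

theorem emits_copyProg (hK : K.Has B k) {v : Vars} (hv : v.i = 0) {s : ℕ → ℤ}
    (hs : ∀ i ≤ n, v.arr i = s i) (hβ : n + 1 ≤ K.β) :
    Emits K copyProg v (copyGates n k s (n + 1)) := by
  intro l
  set f : ℕ → Vars := fun j => { v.emit (l ++ copyGates n k s j) with i := j } with hf
  have h1 : Exec K (.loop (nEx + 1) (.cnot 0 (codeEx Slot.i.ex (arrEx Slot.i.ex)) ⨟
      Slot.i.set (Slot.i.ex + 1))) (f 0) (f (n + 1)) := by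
    refine exec_loop f ?_ hβ fun j hj => ?_
    · simp [hK.eval_nEx]
    · have e : (arrEx Slot.i.ex).eval (K.mem (f j)) = s j := by
        rw [eval_arrEx (x := j) (by simp [hf])]
        exact hs j (by omega)
      refine (exec_cnot (a := 0) (b := code n k j (s j)) rfl
        (hK.eval_codeEx (by simp [hf]) e)).seq ?_
      refine (Slot.i.exec_set (x := j + 1) (by simp [hf, Vars.emit]) (Ctx.small ?_)).congr rfl ?_
      · rw [abs_of_nonneg (by positivity)]
        exact_mod_cast (by omega : j + 1 ≤ K.β)
      · simp [hf, Vars.emit, copyGates, List.range_succ]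
  refine (h1.seq (Slot.i.exec_zero _)).congr ?_ ?_
  · simp [hf, Vars.emit, copyGates, ← hv]
  · simp [hf, Vars.emit, ← hv]

theorem emits_braidProg (hK : K.Has B k) {N J : ℕ} (hk : 3 ≤ k) {v : Vars}
    (hv : Ready (calib N k J) k v) (hc : Clean v)
    (hβ : 2 * 2 ^ J + 3 ≤ K.β) (hkβ : k ≤ K.β) (hn : n ≤ K.β) (hm : B.length ≤ K.β) :
    Emits K braidProg v (braidGates n k (calib N k J) B) := by
  intro l
  -- After `s` iterations the last `s` crossings have been treated, because a product of matrices
  -- acts from the right.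
  set f : ℕ → Vars := fun s =>
    { v.emit (l ++ braidGates n k (calib N k J) (B.drop (B.length - s))) with j := s } with hf
  have h1 : Exec K (.loop mEx (Slot.g.set (.load (mEx + 2 - Slot.j.ex)) ⨟ crossProg ⨟
      Slot.i.set 0 ⨟ Slot.A.set 0 ⨟ Slot.C.set 0 ⨟ Slot.g.set 0 ⨟ Slot.j.set (Slot.j.ex + 1)))
      (f 0) (f B.length) := by
    refine exec_loop f ?_ hm fun s hs => ?_
    · simp [hK.eval_mEx]
    have hlt : B.length - (s + 1) < B.length := by omega
    set c := B[B.length - (s + 1)] with hcc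
    have e1 : (Expr.load (mEx + 2 - Slot.j.ex)).eval (K.mem (f s)) = crossCode c := by
      -- The crossing number $j$ is stored in the cell $j+3$; for $j=m-(s+1)$ this is the cell
      -- $m+2-s$.
      have e0 : ((mEx + 2 - Slot.j.ex).eval (K.mem (f s))).toNat = B.length - (s + 1) + 3 := by
        simp only [Expr.eval_sub', Expr.eval_add', hK.eval_mEx, Expr.eval_two, Slot.eval_ex,
          Slot.j_read, hf]
        omega
      rw [Expr.eval, e0, K.mem_of_lt _ (by rw [hK.m_eq]; omega), hK.inp,
        inputMemory_add_three B k hlt]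
    have hc1 := c.1.2
    have b1 : |crossCode c| ≤ 2 ^ K.β := by
      refine Ctx.small ?_
      rw [crossCode, abs_le]
      constructor <;> split_ifs <;> omega
    have g1 := Slot.g.exec_set (K := K) e1 b1
    have g2 := exec_crossProg (K := K) hK (N := N) (J := J) hk (v := Slot.g.upd (f s) (crossCode c))
      (c := c) ⟨hv.J, hv.T, hv.tab_zero, hv.tab⟩ rfl hc.t hβ hkβ hn
    refine g1.seq (g2.seq ((Slot.i.exec_zero _).seq ((Slot.A.exec_zero _).seq
      ((Slot.C.exec_zero _).seq ((Slot.g.exec_zero _).seq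
      ((Slot.j.exec_set (x := s + 1) (by simp [hf]) (Ctx.small ?_)).congr rfl ?_))))))
    · rw [abs_of_nonneg (by positivity)]
      exact_mod_cast (by omega : s + 1 ≤ K.β)
    · have hd : B.drop (B.length - (s + 1)) = c :: B.drop (B.length - s) := by
        rw [List.drop_eq_getElem_cons hlt]
        congr 2
        omega
      simp [hf, Vars.emit, hd, braidGates, hc.i, hc.A, hc.C, hc.g, hc.z]
      rfl
  refine (h1.seq (Slot.j.exec_zero _)).congr ?_ ?_
  · simp [hf, Vars.emit, braidGates, ← hc.j]
  · simp [hf, Vars.emit, ← hc.j]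

/-- The circuit of the Hadamard test, with `ph` additional phase gates. -/
def testProg (ph : ℕ) : Prog :=
  (.had 0 ⨟ repPhase (.lit ph) 2 0 0 ⨟ copyProg ⨟ braidProg ⨟ copyProg) ⨟ .had 0

theorem emits_testProg (hK : K.Has B k) {N J : ℕ} (hk : 3 ≤ k) {v : Vars}
    (hv : Ready (calib N k J) k v) (hc : Clean v) {s : ℕ → ℤ} (hs : ∀ i ≤ n, v.arr i = s i)
    (hβ : 2 * 2 ^ J + 3 ≤ K.β) (hkβ : k ≤ K.β) (hn : n + 1 ≤ K.β) (hm : B.length ≤ K.β) {ph : ℕ}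
    (hph : ph ≤ 1) :
    Emits K (testProg ph) v (testCircuit n k ph (calib N k J) B s) :=
  ((emits_had rfl).seq ((emits_repPhase (r := ph) (c := 2) rfl rfl rfl rfl (by omega) (by omega)).seq
    ((emits_copyProg hK hc.i hs hn).seq ((emits_braidProg hK hk hv hc hβ hkβ (by omega) hm).seq
      (emits_copyProg hK hc.i hs hn))))).seq (emits_had rfl)

/-! ## One round -/

/-- The measurement of the circuit. -/
def measureProg : Prog := .measure (.load 2 + .lit (Slot.b.idx + 3 : ℕ))

/-- A step of the sampled path. -/
def stepProg : Prog :=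
  Slot.z.set (arrEx Slot.i.ex) ⨟
  Slot.t.set (tabEx (Slot.z.ex * .le 1 Slot.z.ex * .le (Slot.z.ex + 1) kEx)) ⨟
  ((.had 0 ⨟ repPhase Slot.t.ex Slot.J.ex 0 0) ⨟ .had 0) ⨟ measureProg ⨟
  setArr (Slot.i.ex + 1) (Slot.z.ex + 2 * Slot.b.ex - 1) ⨟ Slot.i.set (Slot.i.ex + 1) ⨟
  Slot.z.set 0 ⨟ Slot.t.set 0 ⨟ Slot.b.set 0

theorem rexec_stepProg (hK : K.Has B k) {N J : ℕ} {v : Vars}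
    (hv : Ready (calib N k J) k v) (hc : v.circ = []) {i : ℕ} (hi : v.i = i)
    (hz : |v.arr i| + 1 ≤ K.β) (hβ : 2 * 2 ^ J + 3 ≤ K.β) (hiβ : i + 1 ≤ K.β) :
    RExec K stepProg v
      ((measureDist (stepCircuit J ((calib N k J).stepCount k (v.arr i)))).map fun b =>
        { v with
          arr := Function.update v.arr (i + 1) (v.arr i + if b then 1 else -1)
          i := (i + 1 : ℕ)
          z := 0
          t := 0
          b := 0 }) := by
  set C := calib N k J with hCC
  have hC : C.Valid := calib_valid N k J
  have hJ2 : J < 2 ^ J := Nat.lt_two_pow_self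
  set y := v.arr i with hy
  have s1 := Slot.z.exec_set (K := K) (v := v) (e := arrEx Slot.i.ex) (x := y)
    (eval_arrEx (by simp [hi])) (Ctx.small (by omega))
  set v1 := Slot.z.upd v y with hv1
  set c := C.stepCount k y with hcdef
  have hcJ : c ≤ 2 ^ J := by
    rw [hcdef, Calib.stepCount]
    split_ifs
    · exact hC.tab_le _
    · exact Nat.zero_le _
  -- Off the sites the product of the two comparisons is 0, and the entry 0 of the table is 0; this
  -- reproduces the default of `stepCount`.
  have e2 : (tabEx (Slot.z.ex * .le 1 Slot.z.ex * .le (Slot.z.ex + 1) kEx)).eval (K.mem v1) = c := by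
    by_cases h : 1 ≤ y ∧ y < k
    · rw [eval_tabEx (x := y.toNat), hcdef, Calib.stepCount, if_pos h]
      · exact hv.tab _ (by omega) (by omega)
      · have h' : y + 1 ≤ k := by omega
        simp [hv1, hK.eval_kEx, h.1, h']
        omega
    · rw [eval_tabEx (x := 0), hcdef, Calib.stepCount, if_neg h]
      · exact hv.tab_zero
      · simp [hv1, hK.eval_kEx]
        omega
  have s2 := Slot.t.exec_set (K := K) e2 (Ctx.small (by
    rw [abs_of_nonneg (by positivity)]
    exact_mod_cast (by omega : c ≤ K.β)))
  set v2 := Slot.t.upd v1 c with hv2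
  have s3 := (((emits_had (K := K) (v := v2) (i := 0) (a := 0) rfl).seq
    (emits_repPhase (e := Slot.t.ex) (l := Slot.J.ex) (i := 0) (j := 0) (r := c) (c := J) (a := 0)
      (b := 0) (by simp [hv2]) (by simp [hv2, hv1, hv.J, hCC, calib]) rfl rfl (by omega)
      (by omega))).seq (emits_had (i := 0) (a := 0) rfl)).exec
  set v3 := v2.emit (stepCircuit J c) with hv3
  have s4 := rexec_measure (K := K) v3
  have hcirc : v3.circ = stepCircuit J c := by simp [hv3, hv2, hv1, Vars.emit, hc]
  rw [hcirc] at s4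
  have key := s1.seq_rexec (s2.seq_rexec (Exec.seq_rexec s3 (RExec.seq (Q :=
    setArr (Slot.i.ex + 1) (Slot.z.ex + 2 * Slot.b.ex - 1) ⨟ Slot.i.set (Slot.i.ex + 1) ⨟
    Slot.z.set 0 ⨟ Slot.t.set 0 ⨟ Slot.b.set 0) (κ := fun w => PMF.pure { v with
      arr := Function.update v.arr (i + 1) (y + 2 * w.b - 1)
      i := (i + 1 : ℕ)
      z := 0
      t := 0
      b := 0 }) s4 ?_)))
  · refine key.congr ?_
    rw [PMF.bind_map, ← PMF.bind_pure_comp]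
    congr 1
    funext b
    cases b <;> simp [sub_eq_add_neg, add_assoc]
  · intro w hw
    rw [PMF.mem_support_map_iff] at hw
    obtain ⟨b, -, rfl⟩ := hw
    have a1 := exec_setArr (K := K) (v := { v3 with b := if b then 1 else 0, circ := [] })
      (e := Slot.i.ex + 1) (f := Slot.z.ex + 2 * Slot.b.ex - 1) (x := i + 1)
      (y := y + 2 * (if b then 1 else 0) - 1) (by simp [hv3, hv2, hv1, Vars.emit, hi])
      (by simp [hv3, hv2, hv1, Vars.emit])
      (Ctx.small (by cases b <;> simp <;> rw [abs_le] <;> have := abs_le.1 (le_refl |y|) <;> omega))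
    refine a1.seq ((Slot.i.exec_set (x := (i + 1 : ℕ)) (by simp [hv3, hv2, hv1, Vars.emit, hi])
      (Ctx.small (by rw [abs_of_nonneg (by positivity)]; exact_mod_cast hiβ))).seq
      ((Slot.z.exec_zero _).seq ((Slot.t.exec_zero _).seq ((Slot.b.exec_zero _).congr rfl ?_))))
    simp [hv3, hv2, hv1, Vars.emit, hc]

/-- The law of the sampled path. -/
def walkPMF (C : Calib) (k : ℕ) : (n : ℕ) → PMF (Fin n → Bool)
  | 0 => PMF.pure Fin.elim0
  | n + 1 => (walkPMF C k n).bind fun p =>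
      (measureDist (stepCircuit C.J (C.stepCount k (site p n)))).map fun b => Fin.snoc p b

/-- The sites of a path are written to an array. -/
def place {n : ℕ} (p : Fin n → Bool) (a : ℕ → ℤ) : ℕ → ℤ := fun i => if i ≤ n then site p i else a i

theorem place_snoc {n : ℕ} (p : Fin n → Bool) (b : Bool) (a : ℕ → ℤ) :
    place (Fin.snoc p b : Fin (n + 1) → Bool) a =
      Function.update (place p a) (n + 1) (site p n + if b then 1 else -1) := by
  funext i
  by_cases h : i = n + 1
  · rw [h, Function.update_self, place, if_pos le_rfl, site_snoc_last]
  · rw [Function.update_of_ne h, place, place]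
    by_cases h' : i ≤ n
    · rw [if_pos (by omega), if_pos h', site_snoc p b h']
    · rw [if_neg (by omega), if_neg h']

theorem abs_site_le {n : ℕ} (p : Fin n → Bool) (i : ℕ) : |site p i| ≤ n + 1 := by
  have := site_mem_Icc p i
  rw [abs_le]
  omega

/-- The sampling of a path. -/
def walkProg : Prog := setArr 0 1 ⨟ .loop nEx stepProg ⨟ Slot.i.set 0

theorem rexec_walkProg (hK : K.Has B k) {N J : ℕ} {v : Vars}
    (hv : Ready (calib N k J) k v) (hc : v.circ = []) (hcl : Clean v)
    (hβ : 2 * 2 ^ J + 3 ≤ K.β) (hn : n + 2 ≤ K.β) :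
    RExec K walkProg v ((walkPMF (calib N k J) k n).map fun p => { v with arr := place p v.arr }) := by
  have s1 := exec_setArr (K := K) (v := v) (e := 0) (f := 1) (x := 0) (y := 1) rfl rfl
    (Ctx.small (by simp; omega))
  have h0 : Function.update v.arr 0 1 = place (Fin.elim0 : Fin 0 → Bool) v.arr := by
    funext i
    by_cases h : i = 0
    · rw [h, Function.update_self, place, if_pos le_rfl]; simp [site]
    · rw [Function.update_of_ne h, place, if_neg (by omega)]
  set F : (i : ℕ) → (Fin i → Bool) → Vars := fun i p =>
    { v with arr := place p v.arr, i := i } with hF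
  have hb1 : ∀ (i : ℕ) (p : Fin i → Bool), place p v.arr i = site p i := fun i p => if_pos le_rfl
  have s2 : RExec K (.loop nEx stepProg) { v with arr := Function.update v.arr 0 1 }
      ((walkPMF (calib N k J) k n).map (F n)) := by
    refine rexec_loop (μ := fun i => (walkPMF (calib N k J) k i).map (F i)) (c := n)
      (by simp [hK.eval_nEx]) (by omega) ?_ (κ := fun i w =>
      (measureDist (stepCircuit J ((calib N k J).stepCount k (w.arr i)))).map fun b =>
        { w with
          arr := Function.update w.arr (i + 1) (w.arr i + if b then 1 else -1)
          i := (i + 1 : ℕ)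
          z := 0
          t := 0
          b := 0 }) ?_ ?_
    · rw [walkPMF, PMF.pure_map, hF, h0]
      simp [← hcl.i]
    · intro i _
      rw [walkPMF, PMF.map_bind, PMF.bind_map]
      congr 1
      funext p
      simp only [Function.comp, PMF.map_comp, hF, hb1]
      congr 1
      funext b
      simp [place_snoc, hcl.z, hcl.t, hcl.b]
    · intro i hi w hw
      rw [PMF.mem_support_map_iff] at hw
      obtain ⟨p, -, rfl⟩ := hw
      refine rexec_stepProg hK (v := F i p) (i := i) ⟨hv.J, hv.T, hv.tab_zero, hv.tab⟩ hc rfl ?_ hβ (by omega)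
      have := abs_site_le p i
      simp only [hF, hb1]
      omega
  refine s1.seq_rexec ?_
  have := s2.seq_exec (Q := Slot.i.set 0) (f := fun w => { w with i := 0 }) fun w _ =>
    Slot.i.exec_zero w
  rw [PMF.map_comp] at this
  refine this.congr ?_
  congr 1
  funext p
  simp [hF, ← hcl.i]

/-- A round. -/
def roundProg (ph : ℕ) : Prog :=
  walkProg ⨟ testProg ph ⨟ measureProg ⨟ Slot.acc.set (Slot.acc.ex + 1 - 2 * Slot.b.ex) ⨟ Slot.b.set 0

/-- The law of the path and the outcome of a round. -/
def roundPMF (C : Calib) (k ph : ℕ) {n : ℕ} (B : Braid n) : PMF ((Fin n → Bool) × Bool) :=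
  (walkPMF C k n).bind fun p => (measureDist (testCircuit n k ph C B (site p))).map fun b => (p, b)

theorem rexec_roundProg (hK : K.Has B k) {N J : ℕ} {v : Vars} (hk : 3 ≤ k)
    (hv : Ready (calib N k J) k v) (hc : v.circ = []) (hcl : Clean v)
    (hβ : 2 * 2 ^ J + 3 ≤ K.β) (hn : n + 2 ≤ K.β) (hkβ : k ≤ K.β) (hm : B.length ≤ K.β) {ph : ℕ}
    (hph : ph ≤ 1) (hacc : |v.acc| + 1 ≤ K.β) :
    RExec K (roundProg ph) v ((roundPMF (calib N k J) k ph B).map fun x =>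
      { v with arr := place x.1 v.arr, acc := v.acc + if x.2 then -1 else 1 }) := by
  have s1 := rexec_walkProg hK hv hc hcl hβ hn
  have key := RExec.seq s1 (Q := testProg ph ⨟ measureProg ⨟
    Slot.acc.set (Slot.acc.ex + 1 - 2 * Slot.b.ex) ⨟ Slot.b.set 0)
    (κ := fun w => (measureDist (testCircuit n k ph (calib N k J) B w.arr)).map fun b =>
      { w with acc := v.acc + if b then -1 else 1 }) ?_
  · refine key.congr ?_
    rw [roundPMF, PMF.map_bind, PMF.bind_map]
    congr 1
    funext p
    -- The circuit reads only the entries $0,\dots,n$ of the array, so remainders of earlier rounds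
    -- are irrelevant.
    have e : testCircuit n k ph (calib N k J) B (place p v.arr) =
        testCircuit n k ph (calib N k J) B (site p) := by
      have : copyGates n k (place p v.arr) (n + 1) = copyGates n k (site p) (n + 1) := by
        refine List.map_congr_left fun i hi => ?_
        rw [place, if_pos (by have := List.mem_range.1 hi; omega)]
      rw [testCircuit, testCircuit, this]
    simp only [Function.comp, PMF.map_comp, e]
    rfl
  · intro w hw
    rw [PMF.mem_support_map_iff] at hw
    obtain ⟨p, -, rfl⟩ := hw
    set w : Vars := { v with arr := place p v.arr } with hw
    have t1 := (emits_testProg hK hk (v := w) (s := w.arr) ⟨hv.J, hv.T, hv.tab_zero, hv.tab⟩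
      ⟨hcl.z, hcl.t, hcl.b, hcl.i, hcl.j, hcl.g, hcl.A, hcl.C⟩ (fun _ _ => rfl) hβ hkβ
      (by omega) hm hph).exec
    set w1 := w.emit (testCircuit n k ph (calib N k J) B w.arr) with hw1
    have t2 := rexec_measure (K := K) w1
    have hcirc : w1.circ = testCircuit n k ph (calib N k J) B w.arr := by
      simp [hw1, hw, Vars.emit, hc]
    rw [hcirc] at t2
    have t3 := RExec.seq_exec t2 (Q := Slot.acc.set (Slot.acc.ex + 1 - 2 * Slot.b.ex) ⨟ Slot.b.set 0)
      (f := fun u => { u with acc := v.acc + 1 - 2 * u.b, b := 0 }) (by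
        intro u hu
        rw [PMF.mem_support_map_iff] at hu
        obtain ⟨b, -, rfl⟩ := hu
        refine (Slot.acc.exec_set (x := v.acc + 1 - 2 * (if b then 1 else 0))
          (by simp [hw1, hw, Vars.emit]) (Ctx.small ?_)).seq (Slot.b.exec_zero _)
        have := abs_le.1 (le_refl |v.acc|)
        cases b <;> simp <;> rw [abs_le] <;> omega)
    refine t1.seq_rexec ?_
    rw [PMF.map_comp] at t3
    refine t3.congr ?_
    congr 1
    funext b
    cases b <;> simp [hw1, hw, Vars.emit, hc, hcl.b, add_sub_assoc]

end

variable {K : Ctx}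

/-! ## The calibration -/

/-- The modulus of $N^2-1+2Ni$ is $N^2+1$; this bounds the size of all the numbers of a scan. -/
theorem rot_sq_add_sq (N : ℤ) (a : ℕ) :
    (rot N a).1 ^ 2 + (rot N a).2 ^ 2 = ((N ^ 2 + 1) ^ a) ^ 2 := by
  induction a with
  | zero => simp [rot]
  | succ a ih =>
    rw [rot, pow_succ (N ^ 2 + 1), mul_pow, ← ih]
    ring

theorem abs_rot_fst_le (N : ℤ) (a : ℕ) : |(rot N a).1| ≤ (N ^ 2 + 1) ^ a := by
  refine abs_le_of_sq_le_sq ?_ (by positivity)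
  have := rot_sq_add_sq N a
  nlinarith [sq_nonneg (rot N a).2]

theorem abs_rot_snd_le (N : ℤ) (a : ℕ) : |(rot N a).2| ≤ (N ^ 2 + 1) ^ a := by
  refine abs_le_of_sq_le_sq ?_ (by positivity)
  have := rot_sq_add_sq N a
  nlinarith [sq_nonneg (rot N a).1]

theorem scanCount_succ (N : ℤ) (l : ℕ) (A C : ℤ) : (scanCount N (l + 1) A C : ℤ) =
    scanCount N l A C + if 1 ≤ (rot N l).1 * A + (N ^ 2 + 1) ^ l * C then 1 else 0 := by
  rw [scanCount, Finset.range_add_one, Finset.filter_insert]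
  split_ifs
  · rw [Finset.card_insert_of_notMem (by simp)]
    push_cast
    rfl
  · simp [scanCount]

theorem abs_natCast_le_of_le {x : ℕ} (h : x ≤ K.β) : |(x : ℤ)| ≤ 2 ^ K.β :=
  Ctx.small (by rw [abs_of_nonneg (by positivity)]; exact_mod_cast h)

/-- The powers of `N² - 1 + 2 N i`, and the number of those that pass a test. -/
def scanProg (len : Expr) : Prog :=
  Slot.X.set 1 ⨟ Slot.Y.set 0 ⨟ Slot.D.set 1 ⨟ Slot.cnt.set 0 ⨟ .loop len (
    Slot.cnt.set (Slot.cnt.ex + .le 1 (Slot.X.ex * Slot.A.ex + Slot.D.ex * Slot.C.ex)) ⨟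
    Slot.t.set Slot.X.ex ⨟
    Slot.X.set (Slot.X.ex * (Slot.N.ex * Slot.N.ex - 1) - Slot.Y.ex * (2 * Slot.N.ex)) ⨟
    Slot.Y.set (Slot.t.ex * (2 * Slot.N.ex) + Slot.Y.ex * (Slot.N.ex * Slot.N.ex - 1)) ⨟
    Slot.D.set (Slot.D.ex * (Slot.N.ex * Slot.N.ex + 1)) ⨟ Slot.t.set 0)

/-- The hypothesis on `len` ranges over all values of the four variables that are initialized before
the loop count is read. During an update `t` holds the old real part. -/
theorem exec_scanProg {v : Vars} {len : Expr} {l : ℕ}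
    (hl : ∀ x y d c, (len.eval (K.mem { v with X := x, Y := y, D := d, cnt := c })).toNat = l)
    (ht : v.t = 0) (hlβ : l ≤ K.β) (hβ : (v.N ^ 2 + 1) ^ l ≤ 2 ^ K.β) :
    Exec K (scanProg len) v { v with
      X := (rot v.N l).1
      Y := (rot v.N l).2
      D := (v.N ^ 2 + 1) ^ l
      cnt := scanCount v.N l v.A v.C } := by
  set f : ℕ → Vars := fun a => { v with
      X := (rot v.N a).1
      Y := (rot v.N a).2
      D := (v.N ^ 2 + 1) ^ a
      cnt := scanCount v.N a v.A v.C } with hf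
  have b1 : |(1 : ℤ)| ≤ 2 ^ K.β := by simpa using one_le_pow₀ (by norm_num)
  have hpow : ∀ a ≤ l, (v.N ^ 2 + 1) ^ a ≤ 2 ^ K.β := fun a ha =>
    (pow_le_pow_right₀ (by nlinarith [sq_nonneg v.N]) ha).trans hβ
  have h0 := (Slot.X.exec_set (K := K) (v := v) (e := 1) (x := 1) rfl b1).seq
    ((Slot.Y.exec_zero _).seq ((Slot.D.exec_set (e := 1) (x := 1) rfl b1).seq
      ((Slot.cnt.exec_zero _).seq ((exec_loop (K := K) (P :=
    Slot.cnt.set (Slot.cnt.ex + .le 1 (Slot.X.ex * Slot.A.ex + Slot.D.ex * Slot.C.ex)) ⨟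
    Slot.t.set Slot.X.ex ⨟
    Slot.X.set (Slot.X.ex * (Slot.N.ex * Slot.N.ex - 1) - Slot.Y.ex * (2 * Slot.N.ex)) ⨟
    Slot.Y.set (Slot.t.ex * (2 * Slot.N.ex) + Slot.Y.ex * (Slot.N.ex * Slot.N.ex - 1)) ⨟
    Slot.D.set (Slot.D.ex * (Slot.N.ex * Slot.N.ex + 1)) ⨟ Slot.t.set 0) f (hl _ _ _ _) hlβ ?_).congr
      (by simp [hf, rot, scanCount]) rfl))))
  · exact h0
  intro a ha
  have e1 : (Slot.cnt.ex + .le 1 (Slot.X.ex * Slot.A.ex + Slot.D.ex * Slot.C.ex)).eval (K.mem (f a)) =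
      scanCount v.N (a + 1) v.A v.C := by
    rw [scanCount_succ]
    simp [hf]
  have hc := scanCount_le v.N (a + 1) v.A v.C
  refine (Slot.cnt.exec_set e1 (abs_natCast_le_of_le (by omega))).seq
    ((Slot.t.exec_set (x := (rot v.N a).1) (by simp [hf])
      ((abs_rot_fst_le _ _).trans (hpow a ha.le))).seq
    ((Slot.X.exec_set (x := (rot v.N (a + 1)).1) (by simp [hf, rot, pow_two])
      ((abs_rot_fst_le _ _).trans (hpow _ ha))).seq
    ((Slot.Y.exec_set (x := (rot v.N (a + 1)).2) (by simp [hf, rot, pow_two])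
      ((abs_rot_snd_le _ _).trans (hpow _ ha))).seq
    ((Slot.D.exec_set (x := (v.N ^ 2 + 1) ^ (a + 1)) (by simp [hf, pow_succ])
      (by rw [abs_of_nonneg (by positivity)]; exact hpow _ ha)).seq
    ((Slot.t.exec_zero _).congr rfl ?_)))))
  simp [hf, ht]

/-- The variables of a scan are set to zero. -/
def clearProg : Prog :=
  Slot.X.set 0 ⨟ Slot.Y.set 0 ⨟ Slot.D.set 0 ⨟ Slot.cnt.set 0 ⨟ Slot.A.set 0 ⨟ Slot.C.set 0

theorem exec_clearProg (v : Vars) :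
    Exec K clearProg v { v with X := 0, Y := 0, D := 0, cnt := 0, A := 0, C := 0 } :=
  (Slot.X.exec_zero _).seq ((Slot.Y.exec_zero _).seq ((Slot.D.exec_zero _).seq
    ((Slot.cnt.exec_zero _).seq ((Slot.A.exec_zero _).seq (Slot.C.exec_zero _)))))

/-- The smallest power of two above `N`. -/
def powerProg : Prog :=
  Slot.T.set 1 ⨟ .loop Slot.N.ex (Slot.J.set (Slot.J.ex + .le Slot.T.ex Slot.N.ex) ⨟
    Slot.T.set (Slot.T.ex + Slot.T.ex * .le Slot.T.ex Slot.N.ex))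

theorem two_pow_size_le {N : ℕ} (h : 1 ≤ N) : 2 ^ N.size ≤ 2 * N := by
  have h1 : 0 < N.size := Nat.size_pos.2 h
  have h2 : 2 ^ (N.size - 1) ≤ N := Nat.lt_size.1 (by omega)
  obtain ⟨s, hs⟩ : ∃ s, N.size = s + 1 := ⟨N.size - 1, by omega⟩
  rw [hs, Nat.add_sub_cancel] at h2
  rw [hs, pow_succ]
  omega

theorem size_le_self (N : ℕ) : N.size ≤ N := Nat.size_le.2 Nat.lt_two_pow_self

/-- The exponent and the power grow together until the power exceeds `N` and then stay fixed. As the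
binary length of `N` is at most `N`, that many iterations suffice. -/
theorem exec_powerProg {v : Vars} {N : ℕ} (hN : v.N = N) (h1 : 1 ≤ N) (hJ : v.J = 0)
    (hβ : 2 * N ≤ K.β) :
    Exec K powerProg v { v with T := 2 ^ N.size, J := N.size } := by
  set f : ℕ → Vars := fun s => { v with T := 2 ^ min s N.size, J := (min s N.size : ℕ) } with hf
  have hs := size_le_self N
  have hT := two_pow_size_le h1
  have b2 : ∀ s, |(2 : ℤ) ^ min s N.size| ≤ 2 ^ K.β := by
    intro s
    have : 2 ^ min s N.size ≤ K.β :=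
      (Nat.pow_le_pow_right (by norm_num) (min_le_right s N.size)).trans (hT.trans hβ)
    have := abs_natCast_le_of_le this
    push_cast at this
    exact this
  have hle : ∀ s, ((2 : ℤ) ^ min s N.size ≤ N) ↔ s < N.size := by
    intro s
    have : ((2 : ℤ) ^ min s N.size ≤ N) ↔ 2 ^ min s N.size ≤ N := by exact_mod_cast Iff.rfl
    rw [this, ← Nat.lt_size]
    omega
  refine (Slot.T.exec_set (x := 1) rfl (abs_natCast_le_of_le (x := 1) (by omega))).seq
    ((exec_loop f (c := N) (by simp [hf, hN]) (by omega) fun s _ => ?_).congr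
    (by simp [hf, hJ]) (by simp [hf, hs]))
  have eJ : (Slot.J.ex + .le Slot.T.ex Slot.N.ex).eval (K.mem (f s)) = (min (s + 1) N.size : ℕ) := by
    simp only [Expr.eval_add', Expr.eval_le', Slot.eval_ex, Slot.J_read, Slot.T_read, Slot.N_read, hf,
      hN, hle]
    split_ifs <;> omega
  refine (Slot.J.exec_set eJ (abs_natCast_le_of_le (by omega))).seq
    (Slot.T.exec_set (x := 2 ^ min (s + 1) N.size) ?_ (b2 _))
  simp only [Expr.eval_add', Expr.eval_mul', Expr.eval_le', Slot.eval_ex, Slot.J_upd, Slot.T_read,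
    Slot.N_read, hf, hN, hle]
  split_ifs with h
  · rw [min_eq_left h.le, min_eq_left (by omega), pow_succ]; ring
  · rw [min_eq_right (by omega), min_eq_right (by omega)]; ring

section

variable {n : ℕ} {B : Braid n} {k : ℕ}

/-- An entry of the table of angles. -/
def entryProg : Prog :=
  scanProg (Slot.z.ex * Slot.u.ex) ⨟ Slot.A.set (Slot.Y.ex * Slot.cx.ex) ⨟
  Slot.C.set (Slot.X.ex * Slot.sx.ex) ⨟ scanProg (2 * Slot.q.ex - 1) ⨟
  setTab Slot.z.ex (Slot.cnt.ex * Slot.T.ex / (4 * Slot.q.ex)) ⨟ clearProg ⨟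
  Slot.z.set (Slot.z.ex + 1)

theorem unitCount_mul_le (N : ℕ) {k : ℕ} : unitCount N k * k ≤ 2 * quarter N := Nat.div_mul_le_self _ _

theorem quarter_le (N : ℕ) : quarter N ≤ 2 * N := scanCount_le _ _ _ _

/-- All the numbers that are stored are bounded by $(N^2+1)^{4N}$: the products formed for the test
belong to the exponent $(z+1)u\le ku\le2q\le4N$, where $u$ is the unit count and $q$ the quarter
count. -/
theorem exec_entryProg {N J z : ℕ} {v : Vars} (hN : v.N = N) (hT : v.T = 2 ^ J) (hq : v.q = quarter N)
    (hu : v.u = unitCount N k) (hcx : v.cx = (rot N (unitCount N k)).1)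
    (hsx : v.sx = (rot N (unitCount N k)).2) (ht : v.t = 0) (hz : v.z = z) (hzk : z < k)
    (hX : v.X = 0) (hY : v.Y = 0) (hD : v.D = 0) (hcnt : v.cnt = 0) (hA : v.A = 0) (hC : v.C = 0)
    (hβ : 4 * N ≤ K.β) (hJ : 2 ^ J ≤ K.β) (hkβ : k ≤ K.β)
    (hP : ((N : ℤ) ^ 2 + 1) ^ (4 * N) ≤ 2 ^ K.β) :
    Exec K entryProg v { v with
      z := (z + 1 : ℕ)
      tab := Function.update v.tab z ((calib N k J).tab z) } := by
  have hq2 := quarter_le N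
  have hu2 : (z + 1) * unitCount N k ≤ 4 * N := by
    have h1 : (z + 1) * unitCount N k ≤ k * unitCount N k := Nat.mul_le_mul_right _ hzk
    have h2 := unitCount_mul_le N (k := k)
    rw [Nat.mul_comm] at h2
    omega
  have hzu : z * unitCount N k ≤ 4 * N := by
    refine le_trans (Nat.mul_le_mul_right _ (by omega)) hu2
  have hpow : ∀ a ≤ 4 * N, ((N : ℤ) ^ 2 + 1) ^ a ≤ 2 ^ K.β := fun a ha =>
    (pow_le_pow_right₀ (by nlinarith [sq_nonneg (N : ℤ)]) ha).trans hP
  have s1 := exec_scanProg (K := K) (v := v) (len := Slot.z.ex * Slot.u.ex) (l := z * unitCount N k)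
    (by intro x y d c; simp [hz, hu]; norm_cast) ht (by omega) (by rw [hN]; exact hpow _ hzu)
  rw [hN] at s1
  have hprod : ∀ x y : ℤ, |x| ≤ ((N : ℤ) ^ 2 + 1) ^ (z * unitCount N k) →
      |y| ≤ ((N : ℤ) ^ 2 + 1) ^ unitCount N k → |x * y| ≤ 2 ^ K.β := by
    intro x y hx hy
    refine le_trans ?_ (hpow ((z + 1) * unitCount N k) hu2)
    rw [abs_mul, Nat.add_mul, one_mul, pow_add]
    exact mul_le_mul hx hy (abs_nonneg _) (by positivity)
  refine s1.seq (Exec.seq (Slot.A.exec_set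
    (x := (rot N (z * unitCount N k)).2 * (rot N (unitCount N k)).1) (by simp [hcx])
    (hprod _ _ (abs_rot_snd_le _ _) (abs_rot_fst_le _ _))) (Exec.seq (Slot.C.exec_set
    (x := (rot N (z * unitCount N k)).1 * (rot N (unitCount N k)).2) (by simp [hsx])
    (hprod _ _ (abs_rot_fst_le _ _) (abs_rot_snd_le _ _))) ?_))
  refine Exec.seq (exec_scanProg (l := 2 * quarter N - 1)
    (by intro x y d c; simp [hq]; omega) (by simp [ht]) (by omega)
    (by simp only [Slot.C_upd, Slot.A_upd]; exact hpow _ (by omega))) ?_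
  have hval := (calib_valid N k J).tab_le z
  refine (exec_setTab (x := z) (y := (calib N k J).tab z) (by simp [hz]) ?_
    (abs_natCast_le_of_le (hval.trans hJ))).seq ((exec_clearProg _).seq
      ((Slot.z.exec_set (x := (z + 1 : ℕ)) (by simp [hz])
        (abs_natCast_le_of_le (by omega))).congr rfl ?_))
  · simp [hT, hq, calib, angleCount]
  · simp [hX, hY, hD, hcnt, hA, hC, hN]

/-- The table of angles. -/
def tableProg : Prog :=
  Slot.A.set 1 ⨟ scanProg (2 * Slot.N.ex) ⨟ Slot.q.set Slot.cnt.ex ⨟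
  Slot.u.set (2 * Slot.q.ex / kEx) ⨟ scanProg Slot.u.ex ⨟ Slot.cx.set Slot.X.ex ⨟
  Slot.sx.set Slot.Y.ex ⨟ Slot.cd.set Slot.D.ex ⨟ clearProg ⨟ Slot.z.set 1 ⨟
  .loop (kEx - 1) entryProg ⨟ Slot.z.set 0

theorem exec_tableProg (hK : K.Has B k) {N J : ℕ} {v : Vars} (hk : 1 ≤ k) (hN : v.N = N)
    (hT : v.T = 2 ^ J) (ht : v.t = 0) (hC : v.C = 0)
    (hβ : 4 * N + 1 ≤ K.β) (hJ : 2 ^ J ≤ K.β) (hkβ : k ≤ K.β)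
    (hP : ((N : ℤ) ^ 2 + 1) ^ (4 * N) ≤ 2 ^ K.β) :
    Exec K tableProg v { v with
      q := quarter N
      u := unitCount N k
      cx := (rot N (unitCount N k)).1
      sx := (rot N (unitCount N k)).2
      cd := ((N : ℤ) ^ 2 + 1) ^ unitCount N k
      X := 0
      Y := 0
      D := 0
      cnt := 0
      A := 0
      C := 0
      z := 0
      tab := fun z => if 1 ≤ z ∧ z < k then (calib N k J).tab z else v.tab z } := by
  have hq2 := quarter_le N
  have hu2 : unitCount N k ≤ 4 * N :=
    (Nat.le_mul_of_pos_right _ hk).trans ((unitCount_mul_le N).trans (by omega))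
  have hpow : ∀ a ≤ 4 * N, ((N : ℤ) ^ 2 + 1) ^ a ≤ 2 ^ K.β := fun a ha =>
    (pow_le_pow_right₀ (by nlinarith [sq_nonneg (N : ℤ)]) ha).trans hP
  have b1 : |(1 : ℤ)| ≤ 2 ^ K.β := by simpa using one_le_pow₀ (by norm_num)
  refine (Slot.A.exec_set (x := 1) rfl b1).seq (Exec.seq (exec_scanProg (l := 2 * N)
    (by intro x y d c; simp [hN]; omega) (by simp [ht]) (by omega)
    (by simp only [Slot.A_upd, hN]; exact hpow _ (by omega))) ?_)
  refine (Slot.q.exec_set (x := quarter N) (by simp [hN, hC, quarter])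
    (abs_natCast_le_of_le (by omega))).seq ((Slot.u.exec_set (x := unitCount N k)
      (by simp [hK.eval_kEx, unitCount]) (abs_natCast_le_of_le (by omega))).seq
    (Exec.seq (exec_scanProg (l := unitCount N k) (by intro x y d c; simp) (by simp [ht])
      (by omega) (by simp only [Slot.A_upd, Slot.u_upd, Slot.q_upd, hN]; exact hpow _ hu2)) ?_))
  refine (Slot.cx.exec_set (x := (rot N (unitCount N k)).1) (by simp [hN])
    ((abs_rot_fst_le _ _).trans (hpow _ hu2))).seq
    ((Slot.sx.exec_set (x := (rot N (unitCount N k)).2) (by simp [hN])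
    ((abs_rot_snd_le _ _).trans (hpow _ hu2))).seq
    ((Slot.cd.exec_set (x := ((N : ℤ) ^ 2 + 1) ^ unitCount N k) (by simp [hN])
    (by rw [abs_of_nonneg (by positivity)]; exact hpow _ hu2)).seq ((exec_clearProg _).seq
    ((Slot.z.exec_set (x := 1) rfl b1).seq ?_))))
  set f : ℕ → Vars := fun s => { v with
      q := quarter N
      u := unitCount N k
      cx := (rot N (unitCount N k)).1
      sx := (rot N (unitCount N k)).2
      cd := ((N : ℤ) ^ 2 + 1) ^ unitCount N k
      X := 0
      Y := 0
      D := 0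
      cnt := 0
      A := 0
      C := 0
      z := (s + 1 : ℕ)
      tab := fun z => if 1 ≤ z ∧ z < s + 1 then (calib N k J).tab z else v.tab z } with hf
  refine Exec.seq ((exec_loop (K := K) f (c := k - 1) ?_ (by omega) ?_).congr ?_ rfl)
    ((Slot.z.exec_zero _).congr rfl ?_)
  · simp only [Expr.eval_sub', hK.eval_kEx, Expr.eval_one]
    omega
  · intro s hs
    refine (exec_entryProg (k := k) (J := J) (z := s + 1) (v := f s) hN hT rfl rfl rfl rfl ht rfl
      (by omega) rfl rfl rfl rfl rfl rfl (by omega) hJ hkβ hP).congr rfl ?_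
    have : Function.update (f s).tab (s + 1) ((calib N k J).tab (s + 1)) = (f (s + 1)).tab := by
      funext z
      by_cases h : z = s + 1
      · rw [h, Function.update_self]
        simp [hf]
      · rw [Function.update_of_ne h]
        have : (1 ≤ z ∧ z < s + 1) ↔ (1 ≤ z ∧ z < s + 1 + 1) := by omega
        simp only [hf, this]
    rw [this]
  · simp [hf]
    funext z
    rw [if_neg (by omega)]
  · have : k - 1 + 1 = k := by omega
    simp only [hf, this, Slot.z_upd]

/-- The powers of the approximate loop value. -/
def scaleProg : Prog :=
  Slot.pnum.set 1 ⨟ Slot.pden.set 1 ⨟ .loop (nEx - 1) (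
    Slot.pnum.set (Slot.pnum.ex * (2 * Slot.cx.ex)) ⨟ Slot.pden.set (Slot.pden.ex * Slot.cd.ex))

/-- The quotient of $2\,$`cx` by `cd` approximates $d$. Its powers are kept as separate numerators
and denominators, which $W$ bounds in common. -/
theorem exec_scaleProg (hK : K.Has B k) {v : Vars} {W : ℤ} (hn : 1 ≤ n) (hnβ : n ≤ K.β)
    (hx : |v.cx| ≤ W) (hd : |v.cd| ≤ W) (h1 : 1 ≤ W) (hW : (2 * W) ^ n ≤ 2 ^ K.β) :
    Exec K scaleProg v { v with pnum := (2 * v.cx) ^ (n - 1), pden := v.cd ^ (n - 1) } := by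
  have b1 : |(1 : ℤ)| ≤ 2 ^ K.β := by simpa using one_le_pow₀ (by norm_num)
  set f : ℕ → Vars := fun s => { v with pnum := (2 * v.cx) ^ s, pden := v.cd ^ s } with hf
  refine (Slot.pnum.exec_set (x := 1) rfl b1).seq ((Slot.pden.exec_set (x := 1) rfl b1).seq
    ((exec_loop f (c := n - 1) ?_ (by omega) ?_).congr (by simp [hf]) rfl))
  · simp only [Expr.eval_sub', hK.eval_nEx, Expr.eval_one]
    omega
  · intro s hs
    have hle : (2 * W) ^ (s + 1) ≤ 2 ^ K.β :=
      (pow_le_pow_right₀ (by omega) (by omega)).trans hW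
    refine (Slot.pnum.exec_set (x := (2 * v.cx) ^ (s + 1)) (by simp [hf, pow_succ]) ?_).seq
      ((Slot.pden.exec_set (x := v.cd ^ (s + 1)) (by simp [hf, pow_succ]) ?_).congr rfl
        (by simp [hf]))
    · rw [abs_pow, abs_mul, abs_two]
      exact (pow_le_pow_left₀ (by positivity) (by omega) _).trans hle
    · rw [abs_pow]
      exact (pow_le_pow_left₀ (by positivity) (by omega) _).trans hle

end

variable {K : Ctx}

/-! ## The program -/

theorem exists_polyEx (p : MvPolynomial (Fin 3) ℕ) : ∃ e : Expr, ∀ (K : Ctx) {n : ℕ} (B : Braid n)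
    (k : ℕ) (v : Vars), K.Has B k → e.eval (K.mem v) = polyVal p B k := by
  induction p using MvPolynomial.induction_on with
  | C a =>
    refine ⟨.lit a, fun K n B k v _ => ?_⟩
    simp [polyVal, Expr.eval]
  | add p q hp hq =>
    obtain ⟨e, he⟩ := hp
    obtain ⟨f, hf⟩ := hq
    refine ⟨e + f, fun K n B k v h => ?_⟩
    rw [Expr.eval_add', he K B k v h, hf K B k v h]
    simp [polyVal]
  | mul_X p i hp =>
    obtain ⟨e, he⟩ := hp
    refine ⟨e * (![nEx, mEx, kEx] i), fun K n B k v h => ?_⟩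
    rw [Expr.eval_mul', he K B k v h]
    fin_cases i <;> simp [polyVal, h.eval_nEx, h.eval_mEx, h.eval_kEx]

/-- The bounds for the sizes of the numbers in a run. -/
structure Room (β n k m N M : ℕ) : Prop where
  one_le_N : 1 ≤ N
  one_le_n : 1 ≤ n
  three_le_k : 3 ≤ k
  one_le_M : 1 ≤ M
  N_le : 4 * N + 3 ≤ β
  k_le : k ≤ β
  n_le : n + 2 ≤ β
  m_le : m ≤ β
  M_le : M ≤ β
  pow_le : (M : ℤ) * (2 * ((N : ℤ) ^ 2 + 1) ^ (4 * N)) ^ n ≤ 2 ^ β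

theorem Room.pow_le' {β n k m N M : ℕ} (h : Room β n k m N M) :
    (2 * ((N : ℤ) ^ 2 + 1) ^ (4 * N)) ^ n ≤ 2 ^ β := by
  refine le_trans ?_ h.pow_le
  have : (1 : ℤ) ≤ M := by exact_mod_cast h.one_le_M
  exact le_mul_of_one_le_left (by positivity) this

theorem Room.base_le {β n k m N M : ℕ} (h : Room β n k m N M) :
    ((N : ℤ) ^ 2 + 1) ^ (4 * N) ≤ 2 ^ β := by
  refine le_trans ?_ h.pow_le'
  have h1 : (1 : ℤ) ≤ ((N : ℤ) ^ 2 + 1) ^ (4 * N) := one_le_pow₀ (by nlinarith [sq_nonneg (N : ℤ)])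
  refine le_trans ?_ (le_self_pow₀ (by omega) (by have := h.one_le_n; omega))
  omega

/-! ### The whole program: preparation, two batches of rounds, output -/

/-- The preparation. -/
def setupProg (eN eM : Expr) : Prog :=
  Slot.N.set eN ⨟ Slot.M.set eM ⨟ powerProg ⨟ tableProg ⨟ scaleProg

/-- The initial values of the variables. -/
def Vars.zero : Vars where
  N := 0
  M := 0
  T := 0
  J := 0
  q := 0
  u := 0
  X := 0
  Y := 0
  D := 0
  cnt := 0
  A := 0
  C := 0
  cx := 0
  sx := 0
  cd := 0
  z := 0
  t := 0
  b := 0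
  i := 0
  j := 0
  g := 0
  acc := 0
  accRe := 0
  pnum := 0
  pden := 0
  arr := 0
  tab := 0
  circ := []

theorem Vars.get_zero (c : ℕ) : Vars.zero.get c = 0 := by
  rcases Nat.lt_or_ge c 25 with hl | hl
  · interval_cases c <;> rfl
  · obtain ⟨c, rfl⟩ := Nat.exists_eq_add_of_le' hl
    simp [Vars.get, Vars.zero]

/-- The values of the variables between the rounds. -/
structure Prepared (N n k M : ℕ) (v : Vars) : Prop where
  ready : Ready (calib N k N.size) k v
  clean : Clean v
  circ : v.circ = []
  M : v.M = M
  pnum : v.pnum = (2 * (rot N (unitCount N k)).1) ^ (n - 1)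
  pden : v.pden = (((N : ℤ) ^ 2 + 1) ^ unitCount N k) ^ (n - 1)

section

variable {n : ℕ} {B : Braid n} {k : ℕ} {N M : ℕ}

theorem unitCount_le (N : ℕ) (hk : 1 ≤ k) : unitCount N k ≤ 4 * N :=
  (Nat.le_mul_of_pos_right _ hk).trans ((unitCount_mul_le N).trans (by have := quarter_le N; omega))

theorem exec_setupProg (hK : K.Has B k) (hR : Room K.β n k B.length N M) {eN eM : Expr}
    (hN : ∀ v, eN.eval (K.mem v) = N) (hM : ∀ v, eM.eval (K.mem v) = M) :
    ∃ w, Exec K (setupProg eN eM) Vars.zero w ∧ Prepared N n k M w ∧ w.acc = 0 := by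
  have hT := two_pow_size_le hR.one_le_N
  have hk := hR.three_le_k
  have hNβ := hR.N_le
  have hW : (1 : ℤ) ≤ ((N : ℤ) ^ 2 + 1) ^ (4 * N) := one_le_pow₀ (by nlinarith [sq_nonneg (N : ℤ)])
  have hpow : ((N : ℤ) ^ 2 + 1) ^ unitCount N k ≤ ((N : ℤ) ^ 2 + 1) ^ (4 * N) :=
    pow_le_pow_right₀ (by nlinarith [sq_nonneg (N : ℤ)]) (unitCount_le N (by omega))
  have s1 := Slot.N.exec_set (K := K) (hN Vars.zero) (abs_natCast_le_of_le (by omega))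
  have s2 := Slot.M.exec_set (K := K) (hM (Slot.N.upd Vars.zero N)) (abs_natCast_le_of_le hR.M_le)
  have s3 := exec_powerProg (K := K) (v := Slot.M.upd (Slot.N.upd Vars.zero N) M) (N := N) rfl
    hR.one_le_N rfl (by omega)
  have s4 := exec_tableProg (K := K) hK (N := N) (J := N.size)
    (v := { Slot.M.upd (Slot.N.upd Vars.zero N) M with T := 2 ^ N.size, J := N.size })
    (by omega) rfl rfl rfl rfl (by omega) (by omega) hR.k_le hR.base_le
  have s5 := fun (v : Vars) (hx : v.cx = (rot N (unitCount N k)).1)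
      (hd : v.cd = ((N : ℤ) ^ 2 + 1) ^ unitCount N k) =>
    exec_scaleProg (K := K) hK (v := v) (W := ((N : ℤ) ^ 2 + 1) ^ (4 * N)) hR.one_le_n
      (by have := hR.n_le; omega) (by rw [hx]; exact (abs_rot_fst_le N (unitCount N k)).trans hpow)
      (by rw [hd, abs_of_nonneg (by positivity)]; exact hpow) hW hR.pow_le'
  refine ⟨_, s1.seq (s2.seq (s3.seq (s4.seq (s5 _ rfl rfl)))), ⟨⟨rfl, rfl, ?_, ?_⟩,
    ⟨rfl, rfl, rfl, rfl, rfl, rfl, rfl, rfl⟩, rfl, rfl, ?_, ?_⟩, rfl⟩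
  · have : ¬(1 ≤ 0 ∧ 0 < k) := by omega
    exact (if_neg this :
      (if 1 ≤ 0 ∧ 0 < k then (((calib N k N.size).tab 0 : ℕ) : ℤ) else 0) = 0)
  · intro z h1 h2
    exact if_pos ⟨h1, h2⟩
  · dsimp only
  · dsimp only

/-- The law of the sum of the outcomes of some rounds. -/
def accPMF (C : Calib) (k ph : ℕ) {n : ℕ} (B : Braid n) : ℕ → PMF ℤ
  | 0 => PMF.pure 0
  | M + 1 => (accPMF C k ph B M).bind fun a =>
      (roundPMF C k ph B).map fun x => a + if x.2 then -1 else 1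

/-- The array is overwritten in each round, so the full law of the variables is complicated. Only an
invariant and the law of the accumulator are kept; the law of one round depends on nothing else. -/
theorem rexec_rounds (hK : K.Has B k) (hR : Room K.β n k B.length N M) {v : Vars}
    (hv : Prepared N n k M v) (hacc : v.acc = 0) {ph : ℕ} (hph : ph ≤ 1) :
    ∃ μ, RExec K (.loop Slot.M.ex (roundProg ph)) v μ ∧
      (∀ w ∈ μ.support, Prepared N n k M w ∧ |w.acc| ≤ M ∧ w.accRe = v.accRe) ∧
      μ.map Vars.acc = accPMF (calib N k N.size) k ph B M := by
  set C := calib N k N.size with hC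
  have hT := two_pow_size_le hR.one_le_N
  have hNβ := hR.N_le
  set κ : Vars → PMF Vars := fun w => (roundPMF C k ph B).map fun x =>
    { w with arr := place x.1 w.arr, acc := w.acc + if x.2 then -1 else 1 } with hκ
  set μ : ℕ → PMF Vars := fun i => Nat.rec (PMF.pure v) (fun _ ν => ν.bind κ) i with hμ
  have inv : ∀ i, ∀ w ∈ (μ i).support, Prepared N n k M w ∧ |w.acc| ≤ i ∧ w.accRe = v.accRe := by
    intro i
    induction i with
    | zero =>
      intro w hw
      rw [(PMF.mem_support_pure_iff _ _).1 hw]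
      exact ⟨hv, by simp [hacc], rfl⟩
    | succ i ih =>
      intro w hw
      obtain ⟨u, hu, hw⟩ := (PMF.mem_support_bind_iff _ _ _).1 hw
      obtain ⟨x, -, rfl⟩ := (PMF.mem_support_map_iff _ _ _).1 hw
      obtain ⟨h, h2, h3⟩ := ih u hu
      refine ⟨⟨⟨h.ready.J, h.ready.T, h.ready.tab_zero, h.ready.tab⟩, ⟨h.clean.z, h.clean.t,
        h.clean.b, h.clean.i, h.clean.j, h.clean.g, h.clean.A, h.clean.C⟩, h.circ, h.M, h.pnum,
        h.pden⟩, ?_, h3⟩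
      rw [abs_le] at h2 ⊢
      push_cast
      split_ifs <;> constructor <;> linarith [h2.1, h2.2]
  refine ⟨μ M, ?_, inv M, ?_⟩
  · refine rexec_loop (by simp [hv.M]) hR.M_le rfl (κ := fun _ => κ) (fun _ _ => rfl) ?_
    intro i hi w hw
    obtain ⟨h, h2, -⟩ := inv i w hw
    refine rexec_roundProg hK hR.three_le_k h.ready h.circ h.clean (by omega) hR.n_le hR.k_le hR.m_le
      hph ?_
    have := hR.M_le
    omega
  · have : ∀ i, (μ i).map Vars.acc = accPMF C k ph B i := by
      intro i
      induction i with
      | zero =>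
        change (PMF.pure v).map Vars.acc = PMF.pure 0
        rw [PMF.pure_map, hacc]
      | succ i ih =>
        rw [accPMF, ← ih, PMF.bind_map]
        change ((μ i).bind κ).map Vars.acc = _
        rw [PMF.map_bind]
        congr 1
        funext w
        rw [hκ, PMF.map_comp]
        rfl
    exact this M

/-- The program without the output. -/
def mainProg (eN eM : Expr) : Prog :=
  setupProg eN eM ⨟ .loop Slot.M.ex (roundProg 0) ⨟ Slot.accRe.set Slot.acc.ex ⨟ Slot.acc.set 0 ⨟
    .loop Slot.M.ex (roundProg 1)

theorem rexec_mainProg (hK : K.Has B k) (hR : Room K.β n k B.length N M) {eN eM : Expr}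
    (hN : ∀ v, eN.eval (K.mem v) = N) (hM : ∀ v, eM.eval (K.mem v) = M) :
    ∃ μ, RExec K (mainProg eN eM) Vars.zero μ ∧
      (∀ w ∈ μ.support, Prepared N n k M w ∧ |w.acc| ≤ M ∧ |w.accRe| ≤ M) ∧
      μ.map (fun w => (w.accRe, w.acc)) = (accPMF (calib N k N.size) k 0 B M).bind fun a =>
        (accPMF (calib N k N.size) k 1 B M).map fun a' => (a, a') := by
  classical
  obtain ⟨v, s1, hv, hacc⟩ := exec_setupProg hK hR hN hM
  obtain ⟨μ, s2, hμ, hμa⟩ := rexec_rounds hK hR hv hacc (ph := 0) (by omega)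
  set F : Vars → Vars := fun w => { w with accRe := w.acc, acc := 0 } with hF
  have hprep : ∀ w ∈ μ.support, Prepared N n k M (F w) := by
    intro w hw
    obtain ⟨h, -, -⟩ := hμ w hw
    exact ⟨⟨h.ready.J, h.ready.T, h.ready.tab_zero, h.ready.tab⟩, ⟨h.clean.z, h.clean.t,
        h.clean.b, h.clean.i, h.clean.j, h.clean.g, h.clean.A, h.clean.C⟩, h.circ, h.M, h.pnum,
        h.pden⟩
  have hex : ∀ w, ∃ ν : PMF Vars, w ∈ μ.support →
      RExec K (.loop Slot.M.ex (roundProg 1)) (F w) ν ∧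
      (∀ w' ∈ ν.support, Prepared N n k M w' ∧ |w'.acc| ≤ M ∧ w'.accRe = w.acc) ∧
      ν.map Vars.acc = accPMF (calib N k N.size) k 1 B M := by
    intro w
    by_cases hw : w ∈ μ.support
    · obtain ⟨ν, h1, h2, h3⟩ := rexec_rounds hK hR (hprep w hw) rfl (ph := 1) le_rfl
      exact ⟨ν, fun _ => ⟨h1, h2, h3⟩⟩
    · exact ⟨μ, fun h => absurd h hw⟩
  choose ν hν using hex
  refine ⟨μ.bind ν, s1.seq_rexec (s2.seq fun w hw => ?_), ?_, ?_⟩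
  · refine (Slot.accRe.exec_set (x := w.acc) (by simp) (Ctx.small ?_)).seq_rexec
      ((Slot.acc.exec_zero _).seq_rexec (hν w hw).1)
    exact (hμ w hw).2.1.trans (by exact_mod_cast hR.M_le)
  · intro w' hw'
    obtain ⟨w, hw, hw'⟩ := (PMF.mem_support_bind_iff _ _ _).1 hw'
    obtain ⟨h1, h2, h3⟩ := (hν w hw).2.1 w' hw'
    exact ⟨h1, h2, h3 ▸ (hμ w hw).2.1⟩
  · rw [PMF.map_bind, ← hμa, PMF.bind_map]
    refine bind_congr_support _ fun w hw => ?_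
    rw [Function.comp, ← (hν w hw).2.2, PMF.map_comp]
    refine bind_congr_support _ fun w' hw' => ?_
    simp only [Function.comp, ((hν w hw).2.1 w' hw').2.2]

/-- The output. -/
def outputProg : Prog :=
  .store 0 (Slot.accRe.ex * Slot.pnum.ex) ⨟ .store 1 (0 - Slot.acc.ex * Slot.pnum.ex) ⨟
    .store 2 (Slot.M.ex * Slot.pden.ex)

/-- Another content of an input cell. -/
def Ctx.withInput (K : Ctx) (c : ℕ) (x : ℤ) (hc : c ≠ 2) (hx : |x| ≤ 2 ^ K.β) : Ctx where
  inp := Function.update K.inp c x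
  m := K.m
  β := K.β
  inp_two := by rw [Function.update_of_ne hc.symm, K.inp_two]
  inp_le d := by
    by_cases h : d = c
    · rw [h, Function.update_self]; exact hx
    · rw [Function.update_of_ne h]; exact K.inp_le d

theorem Ctx.mem_withInput {c : ℕ} {x : ℤ} (hc : c ≠ 2) (hx : |x| ≤ 2 ^ K.β) (h : c < K.m + 3)
    (v : Vars) : (K.withInput c x hc hx).mem v = Function.update (K.mem v) c x := by
  funext d
  by_cases hd : d = c
  · rw [hd, Function.update_self, Ctx.mem]
    exact (if_pos h).trans (Function.update_self ..)
  · rw [Function.update_of_ne hd, Ctx.mem, Ctx.mem]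
    change (if d < K.m + 3 then Function.update K.inp c x d else _) = _
    rw [Function.update_of_ne hd]
    rfl

/-- The output overwrites input cells, which is modelled by contexts with a changed input. The cell
2 is written last because all the variables are addressed through it. -/
theorem runs_outputProg {v : Vars} (hv : K.Bd v) (h1 : |v.accRe * v.pnum| ≤ 2 ^ K.β)
    (h2 : |v.acc * v.pnum| ≤ 2 ^ K.β) :
    ∃ s : PState, Runs K.β outputProg (K.st v) (PMF.pure s) ∧ s.1 0 = v.accRe * v.pnum ∧
      s.1 1 = -(v.acc * v.pnum) ∧ s.1 2 = v.M * v.pden := by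
  have h2' : |-(v.acc * v.pnum)| ≤ 2 ^ K.β := by rwa [abs_neg]
  set K1 := K.withInput 0 (v.accRe * v.pnum) (by norm_num) h1 with hK1
  set K2 := K1.withInput 1 (-(v.acc * v.pnum)) (by norm_num) h2' with hK2
  have m1 : K1.mem v = Function.update (K.mem v) 0 (v.accRe * v.pnum) :=
    Ctx.mem_withInput _ _ (by omega) v
  have m2 : K2.mem v = Function.update (K1.mem v) 1 (-(v.acc * v.pnum)) :=
    Ctx.mem_withInput _ _ (by omega) v
  have r1 := runs_store 0 (Slot.accRe.ex * Slot.pnum.ex) (s := K.st v) hv.memLE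
  have e1 : (Function.update (K.st v).1 ((0 : Expr).eval (K.st v).1).toNat
      ((Slot.accRe.ex * Slot.pnum.ex).eval (K.st v).1), (K.st v).2) = K1.st v := by
    rw [Ctx.st, Ctx.st, m1]
    simp
  rw [e1] at r1
  have hv1 : K1.Bd v := hv
  have hv2 : K2.Bd v := hv
  have r2 := runs_store 1 (0 - Slot.acc.ex * Slot.pnum.ex) (s := K1.st v) hv1.memLE
  have e2 : (Function.update (K1.st v).1 ((1 : Expr).eval (K1.st v).1).toNat
      ((0 - Slot.acc.ex * Slot.pnum.ex).eval (K1.st v).1), (K1.st v).2) = K2.st v := by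
    rw [Ctx.st, Ctx.st, m2]
    simp
  rw [e2] at r2
  have r3 := runs_store 2 (Slot.M.ex * Slot.pden.ex) (s := K2.st v) hv2.memLE
  have e3 : (Function.update (K2.st v).1 ((2 : Expr).eval (K2.st v).1).toNat
      ((Slot.M.ex * Slot.pden.ex).eval (K2.st v).1), (K2.st v).2) =
      (Function.update (K2.mem v) 2 (v.M * v.pden), v.circ) := by
    rw [Ctx.st]
    simp
  rw [e3] at r3
  refine ⟨(Function.update (K2.mem v) 2 (v.M * v.pden), v.circ), ?_, ?_, ?_, ?_⟩
  · have r23 := runs_seq r2 (Q := .store 2 (Slot.M.ex * Slot.pden.ex))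
      (κ := fun _ => PMF.pure (Function.update (K2.mem v) 2 (v.M * v.pden), v.circ)) (by
        intro s hs
        rw [(PMF.mem_support_pure_iff _ _).1 hs]
        exact r3)
    rw [PMF.pure_bind] at r23
    have := runs_seq r1 (Q := .store 1 (0 - Slot.acc.ex * Slot.pnum.ex) ⨟
      .store 2 (Slot.M.ex * Slot.pden.ex))
      (κ := fun _ => PMF.pure (Function.update (K2.mem v) 2 (v.M * v.pden), v.circ)) (by
        intro s hs
        rw [(PMF.mem_support_pure_iff _ _).1 hs]
        exact r23)
    rw [PMF.pure_bind] at this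
    exact this
  · simp [m2, m1]
  · simp [m2, m1]
  · simp

/-- The input as a context. -/
def braidCtx {n : ℕ} (B : Braid n) (k β : ℕ) (hn : n ≤ β) (hk : k ≤ β) (hm : B.length ≤ β) : Ctx where
  inp := inputMemory B k
  m := B.length
  β := β
  inp_two := rfl
  inp_le c := by
    have key : ∀ x : ℕ, x ≤ β → (x : ℤ) ≤ 2 ^ β := fun x hx => by
      exact_mod_cast hx.trans Nat.lt_two_pow_self.le
    match c with
    | 0 => exact (abs_of_nonneg (by positivity : (0 : ℤ) ≤ n)).trans_le (key n hn)
    | 1 => exact (abs_of_nonneg (by positivity : (0 : ℤ) ≤ k)).trans_le (key k hk)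
    | 2 => exact (abs_of_nonneg (by positivity : (0 : ℤ) ≤ B.length)).trans_le (key _ hm)
    | j + 3 =>
      by_cases h : j < B.length
      · rw [inputMemory_add_three B k h, crossCode, abs_le]
        have h1 := B[j].1.2
        have h2 := key n hn
        constructor <;> split_ifs <;> omega
      · rw [inputMemory, List.getElem?_eq_none (by omega)]
        simp

/-- The output after the sums `a` and `b` of the outcomes of the rounds. -/
def outputValue (N n k M : ℕ) (a b : ℤ) : ℂ :=
  (((a * (2 * (rot N (unitCount N k)).1) ^ (n - 1) : ℤ) : ℂ) +
    ((-(b * (2 * (rot N (unitCount N k)).1) ^ (n - 1)) : ℤ) : ℂ) * Complex.I) /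
    (((M : ℤ) * (((N : ℤ) ^ 2 + 1) ^ unitCount N k) ^ (n - 1) : ℤ) : ℂ)

theorem Room.abs_mul_le {β n k m N M : ℕ} (h : Room β n k m N M) {a : ℤ} (ha : |a| ≤ M) :
    |a * (2 * (rot N (unitCount N k)).1) ^ (n - 1)| ≤ 2 ^ β := by
  have hk := h.three_le_k
  have hW : (1 : ℤ) ≤ ((N : ℤ) ^ 2 + 1) ^ (4 * N) := one_le_pow₀ (by nlinarith [sq_nonneg (N : ℤ)])
  have hpow : ((N : ℤ) ^ 2 + 1) ^ unitCount N k ≤ ((N : ℤ) ^ 2 + 1) ^ (4 * N) :=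
    pow_le_pow_right₀ (by nlinarith [sq_nonneg (N : ℤ)]) (unitCount_le N (by omega))
  refine le_trans ?_ h.pow_le
  rw [abs_mul]
  refine mul_le_mul ha ?_ (abs_nonneg _) (by positivity)
  rw [abs_pow, abs_mul, abs_two]
  have h1 := (abs_rot_fst_le N (unitCount N k)).trans hpow
  exact (pow_le_pow_left₀ (by positivity) (by omega) _).trans
    (pow_le_pow_right₀ (by omega) (by omega))

theorem run_law {β : ℕ} (hR : Room β n k B.length N M) {eN eM : Expr}
    (hN : ∀ (K : Ctx) (v : Vars), K.Has B k → eN.eval (K.mem v) = N)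
    (hM : ∀ (K : Ctx) (v : Vars), K.Has B k → eM.eval (K.mem v) = M) :
    ((mainProg eN eM ⨟ outputProg).run (initial B k)).map Config.output =
        ((accPMF (calib N k N.size) k 0 B M).bind fun a =>
          (accPMF (calib N k N.size) k 1 B M).map fun b => outputValue N n k M a b) ∧
      ∀ s ∈ ((mainProg eN eM ⨟ outputProg).run (initial B k)).support,
        s.time ≤ (mainProg eN eM ⨟ outputProg).cost.eval β * (β + 1) := by
  have hn := hR.n_le
  set K := braidCtx B k β (by omega) hR.k_le hR.m_le with hKdef
  have hK : K.Has B k := ⟨rfl⟩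
  obtain ⟨μ, r1, hμ, hlaw⟩ := rexec_mainProg (K := K) hK hR (fun v => hN K v hK) (fun v => hM K v hK)
  have hbd : K.Bd Vars.zero := fun c => by rw [Vars.get_zero]; simp
  obtain ⟨r1, hb⟩ := r1 hbd
  have hst : K.st Vars.zero = (inputMemory B k, []) := by
    have : K.mem Vars.zero = inputMemory B k := by
      funext c
      rw [Ctx.mem, Vars.get_zero]
      split_ifs with h
      · rfl
      · obtain ⟨j, rfl⟩ : ∃ j, c = j + 3 := ⟨c - 3, by omega⟩
        have : B.length ≤ j := by
          change ¬ j + 3 < B.length + 3 at h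
          omega
        rw [inputMemory, List.getElem?_eq_none this]
    rw [Ctx.st, this]
    rfl
  rw [hst] at r1
  have hout : ∀ w ∈ μ.support, ∃ s : PState, Runs β outputProg (K.st w) (PMF.pure s) ∧
      s.1 0 = w.accRe * w.pnum ∧ s.1 1 = -(w.acc * w.pnum) ∧ s.1 2 = w.M * w.pden := by
    intro w hw
    obtain ⟨h1, h2, h3⟩ := hμ w hw
    refine runs_outputProg (K := K) (hb w hw) ?_ ?_
    · rw [h1.pnum]; exact hR.abs_mul_le h3
    · rw [h1.pnum]; exact hR.abs_mul_le h2
  have hex : ∀ w, ∃ s : PState, w ∈ μ.support → (Runs β outputProg (K.st w) (PMF.pure s) ∧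
      s.1 0 = w.accRe * w.pnum ∧ s.1 1 = -(w.acc * w.pnum) ∧ s.1 2 = w.M * w.pden) := by
    intro w
    by_cases hw : w ∈ μ.support
    · obtain ⟨s, hs⟩ := hout w hw
      exact ⟨s, fun _ => hs⟩
    · exact ⟨K.st w, fun h => absurd h hw⟩
  choose S hS using hex
  obtain ⟨κ, hκ1, hκ2⟩ := exists_kernel (β := β) (P := outputProg) (μ := μ) (st := K.st)
    (κ := fun w => PMF.pure (S w)) fun w hw => (hS w hw).1
  obtain ⟨l1, l2⟩ := runs_seq r1 hκ1 0
  rw [hκ2] at l1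
  refine ⟨?_, fun s hs => (l2 s hs).trans (Nat.zero_add _).le⟩
  set out : PState → ℂ := fun s => ((s.1 0 : ℂ) + (s.1 1 : ℂ) * Complex.I) / (s.1 2 : ℂ) with hout
  have e1 : Config.output = out ∘ Config.forget := rfl
  rw [e1, ← PMF.map_comp]
  change PMF.map out (PMF.map Config.forget ((mainProg eN eM ⨟ outputProg).run
    ⟨inputMemory B k, [], 0⟩)) = _
  rw [l1, PMF.map_bind]
  have e2 : ((accPMF (calib N k N.size) k 0 B M).bind fun a =>
      (accPMF (calib N k N.size) k 1 B M).map fun b => outputValue N n k M a b) =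
      (μ.map fun w => (w.accRe, w.acc)).map fun x => outputValue N n k M x.1 x.2 := by
    rw [hlaw, PMF.map_bind]
    simp only [PMF.map_comp]
    rfl
  rw [e2, PMF.map_comp]
  refine bind_congr_support _ fun w hw => ?_
  obtain ⟨-, o1, o2, o3⟩ := hS w hw
  obtain ⟨h1, -, -⟩ := hμ w hw
  rw [PMF.pure_map]
  simp only [hout, o1, o2, o3, h1.pnum, h1.pden, h1.M, Function.comp, outputValue]

end

open scoped ENNReal

/-! ## Expectations and tail bounds -/

/-- The expectation of a nonnegative function. -/
def expect {α : Type*} (μ : PMF α) (f : α → ℝ≥0∞) : ℝ≥0∞ := ∑' x, μ x * f x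

section Expect

variable {α γ : Type*}

theorem expect_pure (a : α) (f : α → ℝ≥0∞) : expect (PMF.pure a) f = f a := by
  classical
  rw [expect, tsum_eq_single a]
  · simp [PMF.pure_apply]
  · intro x hx
    simp [PMF.pure_apply, hx]

theorem expect_bind (μ : PMF α) (κ : α → PMF γ) (f : γ → ℝ≥0∞) :
    expect (μ.bind κ) f = expect μ fun a => expect (κ a) f := by
  simp only [expect, PMF.bind_apply, ← ENNReal.tsum_mul_right, ← ENNReal.tsum_mul_left]
  rw [ENNReal.tsum_comm]
  simp only [mul_assoc]

theorem expect_map (μ : PMF α) (g : α → γ) (f : γ → ℝ≥0∞) :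
    expect (μ.map g) f = expect μ (f ∘ g) := by
  rw [PMF.map, expect_bind]
  simp only [Function.comp, expect_pure]
  rfl

theorem expect_mono (μ : PMF α) {f g : α → ℝ≥0∞} (h : ∀ a, f a ≤ g a) : expect μ f ≤ expect μ g :=
  ENNReal.tsum_le_tsum fun a => mul_le_mul_right (h a) _

theorem expect_add (μ : PMF α) (f g : α → ℝ≥0∞) :
    (expect μ fun a => f a + g a) = expect μ f + expect μ g := by
  simp only [expect, mul_add, ENNReal.tsum_add]

theorem expect_const (μ : PMF α) (c : ℝ≥0∞) : (expect μ fun _ => c) = c := by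
  rw [expect, ENNReal.tsum_mul_right, μ.tsum_coe, one_mul]

theorem expect_mul_left (μ : PMF α) (c : ℝ≥0∞) (f : α → ℝ≥0∞) :
    (expect μ fun a => c * f a) = c * expect μ f := by
  simp only [expect, ← ENNReal.tsum_mul_left, mul_left_comm]

theorem toOuterMeasure_le_expect (μ : PMF α) {s : Set α} {f : α → ℝ≥0∞} (h : ∀ a ∈ s, 1 ≤ f a) :
    μ.toOuterMeasure s ≤ expect μ f := by
  rw [PMF.toOuterMeasure_apply]
  refine ENNReal.tsum_le_tsum fun a => ?_
  by_cases ha : a ∈ s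
  · rw [Set.indicator_of_mem ha]
    exact le_mul_of_one_le_right zero_le (h a ha)
  · rw [Set.indicator_of_notMem ha]
    exact zero_le

end Expect

theorem expect_measureDist (D : List Gate) (f : Bool → ℝ≥0∞) :
    expect (measureDist D) f = ∑ b, ENNReal.ofReal (outcomeProb D b) * f b := by
  rw [expect, tsum_fintype]
  rfl

theorem expect_walkPMF (C : Calib) (k n : ℕ) (f : (Fin n → Bool) → ℝ≥0∞) :
    expect (walkPMF C k n) f = ∑ p, ENNReal.ofReal (walkProb (stepProb C k) p) * f p := by
  induction n with
  | zero =>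
    rw [walkPMF, expect_pure, Fintype.sum_unique, walkProb, Finset.univ_eq_empty, Finset.prod_empty,
      ENNReal.ofReal_one, one_mul]
    exact congrArg f (Subsingleton.elim _ _)
  | succ n ih =>
    rw [walkPMF, expect_bind, ih, sum_snoc]
    refine Finset.sum_congr rfl fun p _ => ?_
    rw [expect_map, expect_measureDist, Finset.mul_sum]
    refine Finset.sum_congr rfl fun b _ => ?_
    rw [walkProb_snoc, ENNReal.ofReal_mul (walkProb_nonneg (fun z b => stepProb_nonneg C z b) p),
      mul_assoc]
    rfl

section Rounds

variable {n : ℕ} {k : ℕ} (C : Calib) (ph : ℕ) (B : Braid n)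

/-- The probability of a path and an outcome of a round. -/
def roundWeight (k : ℕ) (x : (Fin n → Bool) × Bool) : ℝ :=
  walkProb (stepProb C k) x.1 * outcomeProb (testCircuit n k ph C B (site x.1)) x.2

theorem roundWeight_nonneg (x : (Fin n → Bool) × Bool) : 0 ≤ roundWeight C ph B k x :=
  mul_nonneg (walkProb_nonneg (fun z b => stepProb_nonneg C z b) _) (outcomeProb_nonneg _ _)

theorem expect_roundPMF (f : (Fin n → Bool) × Bool → ℝ≥0∞) :
    expect (roundPMF C k ph B) f = ∑ x, ENNReal.ofReal (roundWeight C ph B k x) * f x := by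
  rw [roundPMF, expect_bind, expect_walkPMF, Fintype.sum_prod_type]
  refine Finset.sum_congr rfl fun p _ => ?_
  rw [expect_map, expect_measureDist, Finset.mul_sum]
  refine Finset.sum_congr rfl fun b _ => ?_
  rw [roundWeight, ENNReal.ofReal_mul (walkProb_nonneg (fun z b => stepProb_nonneg C z b) p),
    mul_assoc]
  rfl

theorem sum_roundWeight : ∑ x, roundWeight C ph B k x = 1 := by
  simp only [roundWeight, Fintype.sum_prod_type, ← Finset.mul_sum, Fintype.sum_bool,
    outcomeProb_sum, mul_one]
  exact sum_walkProb (fun z => sum_stepProb C z) n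

variable {C}

theorem sum_roundWeight_mul (hk : 3 ≤ k) (hC : C.Valid) :
    ∑ x : (Fin n → Bool) × Bool, roundWeight C ph B k x * (if x.2 then -1 else 1) =
      roundMean hk C B ph := by
  rw [roundMean, Fintype.sum_prod_type]
  refine Finset.sum_congr rfl fun p _ => ?_
  rw [← outcomeProb_testCircuit_sub hk ph hC B p, Fintype.sum_bool]
  simp only [roundWeight]
  simp
  ring

/-- The rounds are independent, so each contributes one factor, bounded by `exp_moment_le`. -/
theorem expect_exp_accPMF_le (hk : 3 ≤ k) (hC : C.Valid) (M : ℕ) {t : ℝ} (ht : |t| ≤ 1) :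
    (expect (accPMF C k ph B M) fun a => ENNReal.ofReal (Real.exp (t * a))) ≤
      ENNReal.ofReal (Real.exp (M * (t * roundMean hk C B ph + t ^ 2))) := by
  induction M with
  | zero => rw [accPMF, expect_pure]; simp
  | succ M ih =>
    have h1 : (expect (roundPMF C k ph B) fun x =>
        ENNReal.ofReal (Real.exp (t * (if x.2 then -1 else 1)))) ≤
        ENNReal.ofReal (Real.exp (t * roundMean hk C B ph + t ^ 2)) := by
      rw [expect_roundPMF, ← sum_roundWeight_mul ph B hk hC]
      refine le_trans (le_of_eq ?_) (ENNReal.ofReal_le_ofReal (exp_moment_le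
        (fun x => roundWeight_nonneg C ph B x) (sum_roundWeight C ph B) (fun x => ?_) ht))
      · rw [ENNReal.ofReal_sum_of_nonneg fun x _ =>
          mul_nonneg (roundWeight_nonneg C ph B x) (Real.exp_pos _).le]
        refine Finset.sum_congr rfl fun x _ => ?_
        rw [ENNReal.ofReal_mul (roundWeight_nonneg C ph B x)]
      · split_ifs <;> simp
    rw [accPMF, expect_bind]
    have h2 : ∀ a : ℤ, (expect ((roundPMF C k ph B).map fun x => a + if x.2 then -1 else 1)
        fun a => ENNReal.ofReal (Real.exp (t * a))) ≤
        ENNReal.ofReal (Real.exp (t * roundMean hk C B ph + t ^ 2)) *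
          ENNReal.ofReal (Real.exp (t * a)) := by
      intro a
      rw [expect_map]
      have e : ((fun a : ℤ => ENNReal.ofReal (Real.exp (t * a))) ∘
          fun x : (Fin n → Bool) × Bool => a + if x.2 then -1 else 1) = fun x =>
          ENNReal.ofReal (Real.exp (t * a)) *
            ENNReal.ofReal (Real.exp (t * (if x.2 then -1 else 1))) := by
        funext x
        rw [← ENNReal.ofReal_mul (Real.exp_pos _).le, ← Real.exp_add, Function.comp]
        congr 2
        push_cast
        ring
      rw [e, expect_mul_left, mul_comm]
      gcongr
    refine (expect_mono _ h2).trans ?_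
    rw [expect_mul_left]
    refine (mul_le_mul_right ih _).trans (le_of_eq ?_)
    rw [← ENNReal.ofReal_mul (Real.exp_pos _).le, ← Real.exp_add]
    congr 2
    push_cast
    ring

/-- An upper bound for the indicator function of a large deviation. -/
def deviation (M : ℕ) (m η : ℝ) (a : ℤ) : ℝ≥0∞ :=
  ENNReal.ofReal (Real.exp (η / 2 * (a - M * (m + η)))) +
    ENNReal.ofReal (Real.exp (-(η / 2) * (a - M * (m - η))))

theorem one_le_deviation {M : ℕ} {m η : ℝ} (hη : 0 ≤ η) {a : ℤ} (h : M * η ≤ |a - M * m|) :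
    1 ≤ deviation M m η a := by
  rw [deviation]
  rcases le_abs.1 h with h | h
  · refine le_add_right ?_
    rw [← ENNReal.ofReal_one]
    refine ENNReal.ofReal_le_ofReal (Real.one_le_exp (mul_nonneg (by positivity) ?_))
    linarith
  · refine le_add_left ?_
    rw [← ENNReal.ofReal_one]
    refine ENNReal.ofReal_le_ofReal (Real.one_le_exp ?_)
    rw [neg_mul, ← mul_neg]
    refine mul_nonneg (by positivity) ?_
    linarith

/-- Markov's inequality in exponential form, with the parameters $\pm\eta/2$ for the two tails. -/
theorem expect_deviation_le (hk : 3 ≤ k) (hC : C.Valid) (M : ℕ) {η : ℝ} (h0 : 0 ≤ η) (h2 : η ≤ 2) :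
    expect (accPMF C k ph B M) (deviation M (roundMean hk C B ph) η) ≤
      2 * ENNReal.ofReal (Real.exp (-(M * η ^ 2 / 4))) := by
  set m := roundMean hk C B ph with hm
  have key : ∀ t c : ℝ, |t| ≤ 1 → M * (t * m + t ^ 2) + c = -(M * η ^ 2 / 4) →
      (expect (accPMF C k ph B M) fun a => ENNReal.ofReal (Real.exp (c + t * a))) ≤
        ENNReal.ofReal (Real.exp (-(M * η ^ 2 / 4))) := by
    intro t c ht hc
    have e : (fun a : ℤ => ENNReal.ofReal (Real.exp (c + t * a))) = fun a : ℤ =>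
        ENNReal.ofReal (Real.exp c) * ENNReal.ofReal (Real.exp (t * a)) := by
      funext a
      rw [← ENNReal.ofReal_mul (Real.exp_pos _).le, ← Real.exp_add]
    rw [e, expect_mul_left]
    refine (mul_le_mul_right (expect_exp_accPMF_le ph B hk hC M ht) _).trans (le_of_eq ?_)
    rw [← ENNReal.ofReal_mul (Real.exp_pos _).le, ← Real.exp_add, add_comm, hc]
  have e : deviation M m η = fun a : ℤ =>
      ENNReal.ofReal (Real.exp (-(η / 2 * (M * (m + η))) + η / 2 * a)) +
        ENNReal.ofReal (Real.exp (η / 2 * (M * (m - η)) + -(η / 2) * a)) := by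
    funext a
    rw [deviation]
    congr 3 <;> ring
  rw [e, expect_add, two_mul]
  refine add_le_add (key _ _ ?_ ?_) (key _ _ ?_ ?_)
  · rw [abs_of_nonneg (by positivity)]; linarith
  · ring
  · rw [abs_neg, abs_of_nonneg (by positivity)]; linarith
  · ring

end Rounds

/-! ## The error of the output -/

/-- A linear bound for the relative error of a power as long as it stays below 1: the quadratic term
is absorbed by the factor 2. -/
theorem abs_pow_sub_one_le {x δ : ℝ} (h : |x - 1| ≤ δ) (j : ℕ) (hj : 2 * j * δ ≤ 1) :
    |x ^ j - 1| ≤ 2 * j * δ := by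
  have hδ : 0 ≤ δ := (abs_nonneg _).trans h
  induction j with
  | zero => simp
  | succ j ih =>
    push_cast at hj ⊢
    have h1 := ih (by nlinarith)
    have h2 : x ^ (j + 1) - 1 = x * (x ^ j - 1) + (x - 1) := by ring
    have h3 : |x| ≤ 1 + δ := by
      have := abs_add_le (x - 1) 1
      simp only [sub_add_cancel, abs_one] at this
      linarith
    rw [h2]
    refine (abs_add_le _ _).trans ?_
    rw [abs_mul]
    have h4 : |x| * |x ^ j - 1| ≤ (1 + δ) * (2 * j * δ) :=
      mul_le_mul h3 h1 (abs_nonneg _) (by linarith)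
    nlinarith [mul_nonneg hδ hδ]

theorem one_le_dval {k : ℕ} (hk : 3 ≤ k) : 1 ≤ dval k := by
  have hk' : (3 : ℝ) ≤ k := by exact_mod_cast hk
  have h1 : Real.cos (Real.pi / 3) ≤ Real.cos (Real.pi / k) := by
    refine Real.cos_le_cos_of_nonneg_of_le_pi (by positivity) (by linarith [Real.pi_pos]) ?_
    exact div_le_div_of_nonneg_left Real.pi_pos.le (by norm_num) hk'
  rw [Real.cos_pi_div_three] at h1
  rw [dval]
  linarith

/-- The approximation of the loop value. -/
def approxD (N k : ℕ) : ℝ := 2 * Real.cos (unitCount N k * eta N)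

theorem abs_approxD_sub_le {N k : ℕ} (hN : 1 ≤ N) (hk : 3 ≤ k) : |approxD N k - dval k| ≤ 4 / N := by
  have h1 := abs_unit_sub_le hN hk
  have h2 := Real.abs_cos_sub_cos_le (unitCount N k * eta N) (Real.pi / k)
  rw [approxD, dval, ← mul_sub, abs_mul, abs_two]
  have : (4 : ℝ) / N = 2 * (2 / N) := by ring
  rw [this]
  linarith

/-- Since $d\ge1$ for $k\ge3$, the absolute error $4/N$ of $d$ is also a relative error, and
`abs_pow_sub_one_le` treats the power. -/
theorem abs_approxD_pow_sub_le {N k n : ℕ} (hk : 3 ≤ k) (hN : 8 * n ≤ N) (hn : 1 ≤ n) :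
    |approxD N k ^ (n - 1) - dval k ^ (n - 1)| ≤ 8 * n / N * dval k ^ (n - 1) := by
  have hN1 : 1 ≤ N := by omega
  have hd := one_le_dval hk
  have hd0 : 0 < dval k := by linarith
  have hN0 : (0 : ℝ) < N := by exact_mod_cast hN1
  have h1 : |approxD N k / dval k - 1| ≤ 4 / N := by
    rw [div_sub_one hd0.ne', abs_div, abs_of_pos hd0]
    exact (div_le_self (abs_nonneg _) hd).trans (abs_approxD_sub_le hN1 hk)
  have hn' : ((n - 1 : ℕ) : ℝ) ≤ n := by exact_mod_cast Nat.sub_le _ _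
  have h8 : (8 : ℝ) * n ≤ N := by exact_mod_cast hN
  have h2 : 2 * ((n - 1 : ℕ) : ℝ) * (4 / N) ≤ 8 * n / N := by
    rw [mul_div_assoc', div_le_div_iff_of_pos_right hN0]
    linarith
  have h3 := abs_pow_sub_one_le h1 (n - 1) (h2.trans (by rw [div_le_one hN0]; exact h8))
  have e : approxD N k ^ (n - 1) - dval k ^ (n - 1) =
      ((approxD N k / dval k) ^ (n - 1) - 1) * dval k ^ (n - 1) := by
    rw [div_pow, sub_mul, div_mul_cancel₀ _ (by positivity), one_mul]
  rw [e, abs_mul, abs_of_pos (by positivity : 0 < dval k ^ (n - 1))]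
  exact mul_le_mul_of_nonneg_right (h3.trans h2) (by positivity)

/-- The powers of $N^2+1$ cancel. The sign of `b` is negative because the second test measures ${\rm
Re}(i\kappa)=-{\rm Im}\,\kappa$. -/
theorem outputValue_eq {N n k M : ℕ} (hN : 1 ≤ N) (a b : ℤ) :
    outputValue N n k M a b = (approxD N k ^ (n - 1) : ℝ) *
      (((a / M : ℝ) : ℂ) - ((b / M : ℝ) : ℂ) * Complex.I) := by
  have hx : ((rot N (unitCount N k)).1 : ℂ) =
      (((N : ℂ) ^ 2 + 1) ^ unitCount N k) * ((Real.cos (unitCount N k * eta N) : ℝ) : ℂ) := by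
    have := (rot_eq hN (unitCount N k)).1
    rw [← Complex.ofReal_intCast, this]
    push_cast
    rfl
  have hD : ((N : ℂ) ^ 2 + 1) ^ unitCount N k ≠ 0 := by
    refine pow_ne_zero _ ?_
    have : ((N : ℝ) ^ 2 + 1) ≠ 0 := by positivity
    exact_mod_cast this
  rw [outputValue, approxD]
  push_cast
  rw [show ((rot (N : ℤ) (unitCount N k)).1 : ℂ) = _ from hx]
  set D := ((N : ℂ) ^ 2 + 1) ^ unitCount N k
  push_cast
  set c := Complex.cos (unitCount N k * eta N)
  rw [show 2 * (D * c) = D * (2 * c) by ring, mul_pow D]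
  rcases Nat.eq_zero_or_pos M with rfl | hM
  · simp
  · have : (M : ℂ) ≠ 0 := by exact_mod_cast hM.ne'
    have hD' := pow_ne_zero (n - 1) hD
    field_simp
    ring

open scoped ENNReal

section

variable {n k : ℕ} (B : Braid n)

theorem abs_roundMean_le (hk : 3 ≤ k) (C : Calib) (ph : ℕ) : |roundMean hk C B ph| ≤ 1 := by
  rw [roundMean]
  refine (Finset.abs_sum_le_sum_abs _ _).trans ?_
  refine (Finset.sum_le_sum fun p _ => ?_).trans_eq (sum_walkProb (fun z => sum_stepProb (k := k) C z) n)
  have hw := walkProb_nonneg (fun z b => stepProb_nonneg (k := k) C z b) p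
  rw [abs_mul, abs_of_nonneg hw]
  refine mul_le_of_le_one_right hw ((Complex.abs_re_le_norm _).trans ?_)
  rw [norm_mul, norm_pow, Complex.norm_I, one_pow, one_mul]
  exact norm_circBraid_apply_le hk C B p

/-- The budget: the means are off by $\varepsilon/16$ through the circuit, and the averages by
another $\varepsilon/16$, so the estimate $X$ is within $\varepsilon/4$ of $S$. The scale $E$ has
the relative error $8n/N\le\varepsilon/16$. With $|E|\le2D$ and the crude bound $|S|\le4$ the total
is at most $\frac34\varepsilon D$. -/
theorem norm_outputValue_sub_lt (hk : 3 ≤ k) (hn : 1 ≤ n) {N J M : ℕ} {ε : ℝ} (hε : 0 < ε)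
    (hε1 : ε ≤ 1) (hM : 0 < M) (hN : 128 * n ≤ ε * N) {δ : ℝ} (hδ : (calib N k J).Accurate k δ)
    (he : 2 * δ * n + 11 * δ * B.length ≤ ε / 16) {a b : ℤ}
    (ha : |a - M * roundMean hk (calib N k J) B 0| < M * (ε / 16))
    (hb : |b - M * roundMean hk (calib N k J) B 1| < M * (ε / 16)) :
    ‖outputValue N n k M a b - jonesTrace B k‖ < ε * dval k ^ (n - 1) := by
  have hM' : (0 : ℝ) < M := by exact_mod_cast hM
  have hn' : (1 : ℝ) ≤ n := by exact_mod_cast hn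
  have hN1 : 1 ≤ N := by
    by_contra h
    have : N = 0 := by omega
    rw [this] at hN
    simp at hN
    linarith
  have hN0 : (0 : ℝ) < N := by exact_mod_cast hN1
  have h8 : 8 * n ≤ N := by
    have : (8 : ℝ) * n ≤ N := by nlinarith
    exact_mod_cast this
  have hd0 : 0 < dval k := by linarith [one_le_dval hk]
  set D := dval k ^ (n - 1) with hD
  have hD0 : 0 < D := by positivity
  set E := approxD N k ^ (n - 1) with hE
  set S := ∑ p, (pathProb k p : ℂ) * normBraid hk B p p with hS
  set m0 := roundMean hk (calib N k J) B 0 with hm0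
  set m1 := roundMean hk (calib N k J) B 1 with hm1
  have e0 : |m0 - S.re| ≤ ε / 16 := by
    have := abs_roundMean_sub_le hk (calib_valid N k J) hδ B 0
    rw [pow_zero, one_mul] at this
    exact this.trans he
  have e1 : |m1 + S.im| ≤ ε / 16 := by
    have := abs_roundMean_sub_le hk (calib_valid N k J) hδ B 1
    rw [pow_one, Complex.I_mul_re, sub_neg_eq_add] at this
    exact this.trans he
  have b0 := abs_roundMean_le B hk (calib N k J) 0
  have b1 := abs_roundMean_le B hk (calib N k J) 1
  have ha' : |a / M - m0| < ε / 16 := by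
    rw [div_sub' hM'.ne', abs_div, abs_of_pos hM', div_lt_iff₀ hM', mul_comm (ε / 16)]
    exact ha
  have hb' : |b / M - m1| < ε / 16 := by
    rw [div_sub' hM'.ne', abs_div, abs_of_pos hM', div_lt_iff₀ hM', mul_comm (ε / 16)]
    exact hb
  set X : ℂ := ((a / M : ℝ) : ℂ) - ((b / M : ℝ) : ℂ) * Complex.I with hX
  have hXre : X.re = a / M := by simp [hX]
  have hXim : X.im = -(b / M) := by simp [hX]
  have hXS : ‖X - S‖ ≤ ε / 4 := by
    refine (Complex.norm_le_abs_re_add_abs_im _).trans ?_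
    rw [Complex.sub_re, Complex.sub_im, hXre, hXim]
    rw [abs_le] at e0 e1
    rw [abs_lt] at ha' hb'
    have h1 : |a / M - S.re| ≤ ε / 8 := by rw [abs_le]; constructor <;> linarith
    have h2 : |-(b / M) - S.im| ≤ ε / 8 := by rw [abs_le]; constructor <;> linarith
    linarith
  have hS4 : ‖S‖ ≤ 4 := by
    refine (Complex.norm_le_abs_re_add_abs_im _).trans ?_
    rw [abs_le] at e0 e1 b0 b1
    have h1 : |S.re| ≤ 2 := by rw [abs_le]; constructor <;> linarith
    have h2 : |S.im| ≤ 2 := by rw [abs_le]; constructor <;> linarith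
    linarith
  have hED : |E - D| ≤ ε / 16 * D := by
    refine (abs_approxD_pow_sub_le hk h8 hn).trans (mul_le_mul_of_nonneg_right ?_ hD0.le)
    rw [div_le_iff₀ hN0]
    linarith
  have hE2 : |E| ≤ 2 * D := by
    have := abs_add_le (E - D) D
    rw [sub_add_cancel, abs_of_pos hD0] at this
    nlinarith
  rw [outputValue_eq hN1, jonesTrace_eq_normBraid hk hn, ← hS, ← hX, ← Complex.ofReal_pow, ← hD]
  have e : (E : ℂ) * X - (D : ℂ) * S = (E : ℂ) * (X - S) + ((E - D : ℝ) : ℂ) * S := by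
    push_cast; ring
  rw [e]
  refine (norm_add_le _ _).trans_lt ?_
  rw [norm_mul, norm_mul, Complex.norm_real, Complex.norm_real, Real.norm_eq_abs, Real.norm_eq_abs]
  have h1 : |E| * ‖X - S‖ ≤ 2 * D * (ε / 4) := mul_le_mul hE2 hXS (norm_nonneg _) (by positivity)
  have h2 : |E - D| * ‖S‖ ≤ ε / 16 * D * 4 := mul_le_mul hED hS4 (norm_nonneg _) (by positivity)
  nlinarith [mul_pos hε hD0]

/-- A failure requires that one of the two sums deviates. The indicator is bounded by the sum of the
two deviation functions, so that the expectations separate. -/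
theorem failure_le (hk : 3 ≤ k) (hn : 1 ≤ n) {N M Q : ℕ} {ε : ℝ} (hε : 0 < ε) (hε1 : ε ≤ 1)
    (hM : 0 < M) (hN : 128 * n ≤ ε * N) {δ : ℝ} (hδ : (calib N k N.size).Accurate k δ)
    (he : 2 * δ * n + 11 * δ * B.length ≤ ε / 16) (hQ : (Q : ℝ) + 2 ≤ M * (ε / 16) ^ 2 / 4) :
    ((accPMF (calib N k N.size) k 0 B M).bind fun a =>
      (accPMF (calib N k N.size) k 1 B M).map fun b => outputValue N n k M a b).toOuterMeasure
      {r | ¬ ‖r - jonesTrace B k‖ < ε * dval k ^ (n - 1)} ≤ (1 / 2) ^ Q := by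
  classical
  set C := calib N k N.size with hC
  set G0 := deviation M (roundMean hk C B 0) (ε / 16) with hG0
  set G1 := deviation M (roundMean hk C B 1) (ε / 16) with hG1
  refine (toOuterMeasure_le_expect _ (f := fun r =>
    if ¬ ‖r - jonesTrace B k‖ < ε * dval k ^ (n - 1) then 1 else 0) fun r hr => ?_).trans ?_
  · exact (if_pos hr).ge
  rw [expect_bind]
  have key : ∀ a, (expect ((accPMF C k 1 B M).map fun b => outputValue N n k M a b) fun r =>
      if ¬ ‖r - jonesTrace B k‖ < ε * dval k ^ (n - 1) then 1 else 0) ≤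
      G0 a + expect (accPMF C k 1 B M) G1 := by
    intro a
    rw [expect_map]
    refine (expect_mono _ (g := fun b => G0 a + G1 b) fun b => ?_).trans ?_
    · rw [Function.comp]
      split_ifs with h
      · exact zero_le
      · by_cases ha : |a - M * roundMean hk C B 0| < M * (ε / 16)
        · by_cases hb : |b - M * roundMean hk C B 1| < M * (ε / 16)
          · exact absurd (norm_outputValue_sub_lt B hk hn hε hε1 hM hN hδ he ha hb) h
          · exact le_add_left (one_le_deviation (by positivity) (not_lt.1 hb))
        · exact le_add_right (one_le_deviation (by positivity) (not_lt.1 ha))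
    · rw [expect_add, expect_const]
  refine (expect_mono _ key).trans ?_
  rw [expect_add, expect_const]
  have hV := calib_valid N k N.size
  refine (add_le_add (expect_deviation_le 0 B hk hV M (by positivity) (by linarith))
    (expect_deviation_le 1 B hk hV M (by positivity) (by linarith))).trans ?_
  have h1 : Real.exp (-(M * (ε / 16) ^ 2 / 4)) ≤ Real.exp (-((Q : ℝ) + 2)) :=
    Real.exp_le_exp.2 (neg_le_neg hQ)
  have h2 := four_mul_exp_le Q
  have h4 : (2 : ℝ≥0∞) = ENNReal.ofReal 2 := by simp
  have h5 : ((1 : ℝ≥0∞) / 2) ^ Q = ENNReal.ofReal ((1 / 2) ^ Q) := by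
    rw [ENNReal.ofReal_pow (by norm_num), ENNReal.ofReal_div_of_pos (by norm_num)]
    simp
  rw [h5, h4, ← ENNReal.ofReal_mul (by norm_num),
    ← ENNReal.ofReal_add (by positivity) (by positivity)]
  exact ENNReal.ofReal_le_ofReal (by linarith)

end

/-! ## The choice of the parameters -/

theorem polyVal_add (p q : MvPolynomial (Fin 3) ℕ) {n : ℕ} (B : Braid n) (k : ℕ) :
    polyVal (p + q) B k = polyVal p B k + polyVal q B k := map_add _ _ _

theorem polyVal_mul (p q : MvPolynomial (Fin 3) ℕ) {n : ℕ} (B : Braid n) (k : ℕ) :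
    polyVal (p * q) B k = polyVal p B k * polyVal q B k := map_mul _ _ _

theorem polyVal_pow (p : MvPolynomial (Fin 3) ℕ) (a : ℕ) {n : ℕ} (B : Braid n) (k : ℕ) :
    polyVal (p ^ a) B k = polyVal p B k ^ a := map_pow _ _ _

theorem polyVal_C (a : ℕ) {n : ℕ} (B : Braid n) (k : ℕ) : polyVal (MvPolynomial.C a) B k = a :=
  MvPolynomial.eval_C _

theorem polyVal_X (i : Fin 3) {n : ℕ} (B : Braid n) (k : ℕ) :
    polyVal (MvPolynomial.X i) B k = ![n, B.length, k] i := MvPolynomial.eval_X _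

/-- The cost is a polynomial in $\beta$, and $\beta$ is a polynomial in the three parameters; the
composition is the time bound. -/
theorem polyVal_aeval (b : MvPolynomial (Fin 3) ℕ) (c : Polynomial ℕ) {n : ℕ} (B : Braid n) (k : ℕ) :
    polyVal (Polynomial.aeval b c) B k = c.eval (polyVal b B k) := by
  rw [polyVal, Polynomial.aeval_def, Polynomial.hom_eval₂, ← Polynomial.eval₂_id]
  congr 1
  exact Subsingleton.elim _ _

/-- From $N^2+1\le2^{2N}$ the large power in `Room` has at most $M+(1+8N^2)n$ bits; the remaining
summands serve the other fields. -/
theorem room_of_eq {n k m N M : ℕ} (hn : 1 ≤ n) (hk : 3 ≤ k) (hN : 1 ≤ N) (hM : 1 ≤ M) :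
    Room (4 * N + 3 + k + (n + 2) + m + M + (1 + 8 * N ^ 2) * n) n k m N M where
  one_le_N := hN
  one_le_n := hn
  three_le_k := hk
  one_le_M := hM
  N_le := by omega
  k_le := by omega
  n_le := by omega
  m_le := by omega
  M_le := by omega
  pow_le := by
    have h1 : N ^ 2 + 1 ≤ 2 ^ (2 * N) := by
      have h : N + 1 ≤ 2 ^ N := Nat.lt_two_pow_self
      calc N ^ 2 + 1 ≤ (N + 1) ^ 2 := by nlinarith
        _ ≤ (2 ^ N) ^ 2 := Nat.pow_le_pow_left h 2
        _ = 2 ^ (2 * N) := by rw [← pow_mul, mul_comm]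
    have h2 : M * (2 * (N ^ 2 + 1) ^ (4 * N)) ^ n ≤
        2 ^ (4 * N + 3 + k + (n + 2) + m + M + (1 + 8 * N ^ 2) * n) := by
      calc M * (2 * (N ^ 2 + 1) ^ (4 * N)) ^ n ≤ 2 ^ M * (2 * (2 ^ (2 * N)) ^ (4 * N)) ^ n := by
            gcongr
            exact Nat.lt_two_pow_self.le
        _ = 2 ^ (M + (1 + 8 * N ^ 2) * n) := by
            rw [← pow_mul, ← pow_succ', ← pow_mul, ← pow_add]
            congr 2
            ring
        _ ≤ _ := Nat.pow_le_pow_right (by norm_num) (by omega)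
    exact_mod_cast h2

theorem exists_quantum_algorithm (p q : MvPolynomial (Fin 3) ℕ) :
    ∃ (P : Prog) (T : MvPolynomial (Fin 3) ℕ),
      ∀ (n k : ℕ), 1 ≤ n → 3 ≤ k → ∀ B : Braid n,
        (∀ s ∈ (P.run (initial B k)).support, s.time ≤ polyVal T B k) ∧
        (P.run (initial B k)).toOuterMeasure
            {s | ¬ ‖s.output - jonesTrace B k‖ <
              1 / ((polyVal p B k : ℝ) + 1) * dval k ^ (n - 1)} ≤
          (1 / 2) ^ polyVal q B k := by
  let n' : MvPolynomial (Fin 3) ℕ := MvPolynomial.X 0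
  let m' : MvPolynomial (Fin 3) ℕ := MvPolynomial.X 1
  let k' : MvPolynomial (Fin 3) ℕ := MvPolynomial.X 2
  let c : ℕ → MvPolynomial (Fin 3) ℕ := fun a => MvPolynomial.C a
  -- With $\varepsilon=1/(p+1)$ and $\delta=1/s$, the error $2\delta n+11\delta m$ is exactly
  -- $\varepsilon/16$. The two summands of $N$ provide $18k^3s^2\le N$ and $128n\le\varepsilon N$,
  -- and $M(\varepsilon/16)^2/4=q+2$.
  let s' := c 16 * (p + c 1) * (c 2 * n' + c 11 * m')
  let N' := c 18 * k' ^ 3 * s' ^ 2 + c 128 * n' * (p + c 1)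
  let M' := c 1024 * (q + c 2) * (p + c 1) ^ 2
  let b' := c 4 * N' + c 3 + k' + (n' + c 2) + m' + M' + (c 1 + c 8 * N' ^ 2) * n'
  obtain ⟨exN, hN⟩ := exists_polyEx N'
  obtain ⟨exM, hM⟩ := exists_polyEx M'
  refine ⟨mainProg exN exM ⨟ outputProg,
    Polynomial.aeval b' (mainProg exN exM ⨟ outputProg).cost * (b' + c 1), fun n k hn hk B => ?_⟩
  have en : polyVal n' B k = n := polyVal_X 0 B k
  have em : polyVal m' B k = B.length := polyVal_X 1 B k
  have ek : polyVal k' B k = k := polyVal_X 2 B k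
  have ec : ∀ a, polyVal (c a) B k = a := fun a => polyVal_C a B k
  set P := polyVal p B k with hP
  set Q := polyVal q B k with hQ
  set s := polyVal s' B k with hs
  set N := polyVal N' B k with hNdef
  set M := polyVal M' B k with hMdef
  have es : s = 16 * (P + 1) * (2 * n + 11 * B.length) := by
    simp only [hs, s', polyVal_mul, polyVal_add, ec, en, em, hP]
  have eN : N = 18 * k ^ 3 * s ^ 2 + 128 * n * (P + 1) := by
    simp only [hNdef, N', polyVal_mul, polyVal_add, polyVal_pow, ec, en, ek, hP, hs]
  have eM : M = 1024 * (Q + 2) * (P + 1) ^ 2 := by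
    simp only [hMdef, M', polyVal_mul, polyVal_add, polyVal_pow, ec, hP, hQ]
  have eb : polyVal b' B k =
      4 * N + 3 + k + (n + 2) + B.length + M + (1 + 8 * N ^ 2) * n := by
    simp only [b', polyVal_mul, polyVal_add, polyVal_pow, ec, en, em, ek, hNdef, hMdef]
  have hs1 : 1 ≤ s := by
    rw [es]
    exact Nat.one_le_iff_ne_zero.2 (by positivity)
  have hN1 : 1 ≤ N := by
    rw [eN]
    exact Nat.one_le_iff_ne_zero.2 (by positivity)
  have hM1 : 1 ≤ M := by
    rw [eM]
    exact Nat.one_le_iff_ne_zero.2 (by positivity)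
  obtain ⟨h1, h2⟩ := run_law (B := B) (room_of_eq (m := B.length) hn hk hN1 hM1)
    (fun K v hK => hN K B k v hK) (fun K v hK => hM K B k v hK)
  have hP0 : (0 : ℝ) < (P : ℝ) + 1 := by positivity
  have hacc : (calib N k N.size).Accurate k (1 / s) :=
    calib_accurate hk hs1 (by rw [eN]; exact Nat.le_add_right _ _) (Nat.lt_size_self N)
  refine ⟨fun x hx => ?_, ?_⟩
  · rw [polyVal_mul, polyVal_aeval, polyVal_add b', ec, eb]
    exact h2 x hx
  · have := failure_le B hk hn (N := N) (M := M) (Q := Q) (ε := 1 / ((P : ℝ) + 1)) (by positivity)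
      (by rw [div_le_one hP0]; linarith [(Nat.cast_nonneg P : (0 : ℝ) ≤ P)]) hM1 ?_ hacc ?_ ?_
    · rw [← h1, PMF.toOuterMeasure_map_apply] at this
      exact this
    · have : (128 * n * (P + 1) : ℝ) ≤ N := by
        rw [eN]
        push_cast
        exact le_add_of_nonneg_left (by positivity)
      rw [div_mul_eq_mul_div, one_mul, le_div_iff₀ hP0]
      exact this
    · have hs0 : (0 : ℝ) < s := by exact_mod_cast hs1
      have es' : (s : ℝ) = 16 * (P + 1) * (2 * n + 11 * B.length) := by rw [es]; push_cast; ring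
      have : 2 * (1 / (s : ℝ)) * n + 11 * (1 / s) * B.length = (2 * n + 11 * B.length) / s := by ring
      rw [this, div_le_iff₀ hs0, es']
      refine le_of_eq ?_
      field_simp
    · rw [eM]
      push_cast
      refine le_of_eq ?_
      field_simp
      ring

end JonesTrace

end

theorem theorem1 (p q : MvPolynomial (Fin 3) ℕ) :
    (∃ (P : JonesTrace.Prog) (T : MvPolynomial (Fin 3) ℕ),
      ∀ (n k : ℕ), 1 ≤ n → 3 ≤ k → ∀ B : JonesTrace.Braid n,
        (∀ s ∈ (P.run (JonesTrace.initial B k)).support, s.time ≤ JonesTrace.polyVal T B k) ∧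
        (P.run (JonesTrace.initial B k)).toOuterMeasure
            {s | ¬ ‖s.output - JonesTrace.jonesTrace B k‖ <
              1 / ((JonesTrace.polyVal p B k : ℝ) + 1) * JonesTrace.dval k ^ (n - 1)} ≤
          (1 / 2) ^ JonesTrace.polyVal q B k) ∧
    (∃ M : MvPolynomial (Fin 3) ℕ,
      ∀ (n k : ℕ), 1 ≤ n → 3 ≤ k → ∀ B : JonesTrace.Braid n,
        JonesTrace.samplingFailure k B (JonesTrace.polyVal M B k) (JonesTrace.jonesTrace B k)
            (1 / ((JonesTrace.polyVal p B k : ℝ) + 1) * JonesTrace.dval k ^ (n - 1)) ≤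
          (1 / 2) ^ JonesTrace.polyVal q B k) := by
  exact ⟨JonesTrace.exists_quantum_algorithm p q, JonesTrace.exists_samplingFailure_le p q⟩
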